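/- **Setting.** Alice and Bob exchange quantum messages over a channel that may lose them, together with classical messages that are public and never lost. Each party has a finite-dimensional quantum register. The parties move in turns; whose turn it is, and whether the protocol is over, is determined by the public classical transcript. In each turn the moving party applies an instrument to its register and the quantum message, which may depend on everything classical it has seen, and it remembers the classical outcome. The public symbol sent in a turn is either an ordinary message or the declaration "the quantum message was lost"; a quantum message may be blank, which the receiver can detect. A protocol prescribes a strategy and an output for each honest party; it is over after a bounded number of consecutive turns without a declaration of a loss, and an honest party that holds a non-blank message neither declares it lost nor sends a blank one. A dishonest party uses an arbitrary strategy of the same kind, with a register of any finite dimension, and finally may measure its register and the quantum message. A *weak coin-flipping* (WCF) protocol has no inputs; both parties output a bit and never abort, and honest parties output the same uniformly random bit $c$. Its cheating probabilities are: $A_{\mathrm{WCF}}$, the maximum probability with which dishonest Alice can make honest Bob output $c=0$; and $B_{\mathrm{WCF}}$, the maximum probability with which dishonest Bob can make honest Alice output $c=1$. A *Random-OT* protocol has no inputs; honest Alice outputs two bits $(x_0,x_1)$ and honest Bob outputs $(b,x_b)$, where $x_0,x_1,b$ are independent uniformly random bits; honest parties never abort, the final state and classical record of honest Alice contain no information about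 $b$, and those of honest Bob none about $x_{\bar b}$. $A_{\mathrm{ROT}}$ is the maximum probability with which dishonest Alice can learn $b$ without Bob aborting, and $B_{\mathrm{ROT}}$ the maximum probability with which dishonest Bob can learn $x_0\oplus x_1$ without Alice aborting. An *OT* protocol has inputs $(x_0,x_1)\in\{0,1\}^2$ of Alice and $b\in\{0,1\}$ of Bob; if both are honest they never abort, Bob outputs $x_b$ and gets no information about $x_{\bar b}$, and Alice gets no information about $b$. $A_{\mathrm{OT}}$ is the maximum probability with which dishonest Alice can learn $b$ without Bob aborting, and $B_{\mathrm{OT}}$ the maximum probability with which dishonest Bob can learn $x_0\oplus x_1$ without Alice aborting; the inputs of the honest party are either uniformly random or worst-case, and we say that an OT protocol has cheating probabilities $(A_{\mathrm{OT}},B_{\mathrm{OT}})$ if both interpretations give these values. In each case the maxima are over dishonest parties that, when holding a non-blank message, neither declare it lost nor send a blank message, and the bias is $\varepsilon=\max\{A,B\}-\tfrac12$. A protocol is *loss-tolerant* (LT) if the requirements on honest parties hold for every pattern of finitely many lost quantum messages, and no dishonest party can exceed the cheating probabilities by falsely declaring messages lost or by deliberately sending blank messages. A protocol is *fair* if its two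 cheating probabilities are equal. **Theorem.** Suppose there exist an LT-WCF protocol with cheating probabilities $(A_{\mathrm{WCF}},B_{\mathrm{WCF}})$ and bias $\varepsilon_{\mathrm{WCF}}$ and an LT-Random-OT protocol with cheating probabilities $(A_{\mathrm{ROT}},B_{\mathrm{ROT}})$ and bias $\varepsilon_{\mathrm{ROT}}$. Then there exists an LT-OT protocol with cheating probabilities $$A_{\mathrm{OT}}=A_{\mathrm{WCF}}\,|A_{\mathrm{ROT}}-B_{\mathrm{ROT}}|+\min\{A_{\mathrm{ROT}},B_{\mathrm{ROT}}\},$$ $$B_{\mathrm{OT}}=B_{\mathrm{WCF}}\,|A_{\mathrm{ROT}}-B_{\mathrm{ROT}}|+\min\{A_{\mathrm{ROT}},B_{\mathrm{ROT}}\}.$$ Its bias satisfies $$\varepsilon_{\mathrm{OT}}\le|A_{\mathrm{ROT}}-B_{\mathrm{ROT}}|+\min\{A_{\mathrm{ROT}},B_{\mathrm{ROT}}\}-\tfrac12=\varepsilon_{\mathrm{ROT}},$$ and $\varepsilon_{\mathrm{OT}}<\varepsilon_{\mathrm{ROT}}$ when $\varepsilon_{\mathrm{WCF}}<\tfrac12$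 and $A_{\mathrm{ROT}}\ne B_{\mathrm{ROT}}$. Furthermore, the OT protocol is fair when the WCF protocol is fair. -/

import Mathlib

open scoped Matrix BigOperators ComplexOrder

noncomputable section

namespace QProto

/-! Two-party quantum protocols over a lossy quantum channel.

The public classical transcript is a list (latest symbol first) of elements of `Option C`: an
element `c : C` is an ordinary classical message, `none` is the declaration "the quantum message was
lost".  The quantum message register has the orthonormal basis `Option M`: the vectors `some m` span
the genuine messages, and `none` is the blank (vacuum) message, which the receiver can tell apart
from every genuine message. -/

/-- The two parties. -/
inductive Party where
  | alice
  | bob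

/-- What one party does, honest or not: a finite-dimensional private register with basis `Q` and an
initial density operator, and for each turn of that party an instrument on the private register and
the message register.  The instrument depends on the private record (the list of the party's
earlier private outcomes) and on the public transcript; its outcome `(r, c)` consists of a private
outcome, which is appended to the record, and a public symbol, which is appended to the transcript.
Each outcome has one Kraus operator, so every outcome is remembered: no classical information is
ever forgotten. -/
structure Strategy (C M : Type) [Fintype C] [Fintype M] [DecidableEq M] where
  Q : Type
  [fintypeQ : Fintype Q]
  [decEqQ : DecidableEq Q]
  R : Type
  [fintypeR : Fintype R]
  init : Matrix Q Q ℂ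
  init_posSemidef : init.PosSemidef
  init_trace : init.trace = 1
  op : List R → List (Option C) → R × Option C → Matrix (Q × Option M) (Q × Option M) ℂ
  op_complete : ∀ r τ, ∑ o, (op r τ o)ᴴ * op r τ o = 1

attribute [instance] Strategy.fintypeQ Strategy.decEqQ Strategy.fintypeR

section Basic

variable {C M : Type} [Fintype C] [Fintype M] [DecidableEq M]

/-- The party never exploits losses: whenever it holds a genuine (non-blank) quantum message, it
neither declares that the message was lost nor sends a blank message. -/
def Strategy.LossFree (S : Strategy C M) : Prop :=
  ∀ (r : List S.R) (τ : List (Option C)) (o : S.R × Option C) (q q' : S.Q) (m : M),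
    (o.2 = none → ∀ k : Option M, S.op r τ o (q', k) (q, some m) = 0) ∧
      S.op r τ o (q', none) (q, some m) = 0

end Basic

/-- An honest player: a strategy that never lies about losses, together with the output, a function
of the player's private record and the public transcript at the end of the protocol. -/
structure Player (C M Y : Type) [Fintype C] [Fintype M] [DecidableEq M] extends Strategy C M where
  honest : toStrategy.LossFree
  out : List R → List (Option C) → Y

/-- A dishonest player who wants to learn a bit: a strategy, and a final two-outcome measurement
`{eff false, eff true}` of everything it holds at the end, whose outcome is its guess. -/
structure Guesser (C M : Type) [Fintype C] [Fintype M] [DecidableEq M] extends Strategy C M where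
  eff : List R → List (Option C) → Bool → Matrix (Q × Option M) (Q × Option M) ℂ
  eff_posSemidef : ∀ r τ g, (eff r τ g).PosSemidef
  eff_sum : ∀ r τ, eff r τ false + eff r τ true = 1

section Joint

variable {C M : Type} [Fintype C] [Fintype M] [DecidableEq M]

/-- Operators on the joint space: Alice's register, the message register, Bob's register. -/
abbrev Joint (A B : Strategy C M) : Type :=
  Matrix (A.Q × Option M × B.Q) (A.Q × Option M × B.Q) ℂ

/-- An operator on Alice's register and the message register, acting on the joint space. -/
def liftA (A B : Strategy C M) (K : Matrix (A.Q × Option M) (A.Q × Option M) ℂ) : Joint A B :=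
  Matrix.of fun i j => K (i.1, i.2.1) (j.1, j.2.1) * (1 : Matrix B.Q B.Q ℂ) i.2.2 j.2.2

/-- An operator on Bob's register and the message register, acting on the joint space. -/
def liftB (A B : Strategy C M) (K : Matrix (B.Q × Option M) (B.Q × Option M) ℂ) : Joint A B :=
  Matrix.of fun i j => K (i.2.2, i.2.1) (j.2.2, j.2.1) * (1 : Matrix A.Q A.Q ℂ) i.1 j.1

/-- The joint state before the first turn; the message register starts in a fixed genuine message
`m₀`. -/
def start (A B : Strategy C M) (m₀ : M) : Joint A B :=
  Matrix.of fun i j => A.init i.1 j.1 *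
    Matrix.single (some m₀) (some m₀) (1 : ℂ) i.2.1 j.2.1 * B.init i.2.2 j.2.2

/-- The channel loses the quantum message: it is discarded and replaced by the blank message. -/
def lose (A B : Strategy C M) (ρ : Joint A B) : Joint A B :=
  Matrix.of fun i j => Matrix.single none none (1 : ℂ) i.2.1 j.2.1 *
    ∑ k : Option M, ρ (i.1, k, i.2.2) (j.1, k, j.2.2)

/-- Partial trace over Bob's private register. -/
def traceOutB (A B : Strategy C M) (ρ : Joint A B) :
    Matrix (A.Q × Option M) (A.Q × Option M) ℂ :=
  Matrix.of fun i j => ∑ q : B.Q, ρ (i.1, i.2, q) (j.1, j.2, q)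

/-- Partial trace over Alice's private register. -/
def traceOutA (A B : Strategy C M) (ρ : Joint A B) :
    Matrix (B.Q × Option M) (B.Q × Option M) ℂ :=
  Matrix.of fun i j => ∑ q : A.Q, ρ (q, i.2, i.1) (q, j.2, j.1)

/-- Run the protocol for at most `n` more turns from the given private records, transcript and
(unnormalised) joint state.  `next τ` tells from the public transcript whose turn it is, `none`
meaning that the protocol is over; `loss i` tells whether the channel loses the quantum message
sent in turn number `i`.  The result is the sum, over all branches on which the protocol is over
within `n` turns, of the quantity `f` of the final records, transcript and unnormalised state. -/
def run (next : List (Option C) → Option Party) (A B : Strategy C M) (loss : ℕ → Bool)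
    {N : Type} [AddCommMonoid N]
    (f : List A.R → List B.R → List (Option C) → Joint A B → N) :
    ℕ → List A.R → List B.R → List (Option C) → Joint A B → N
  | 0, rA, rB, τ, ρ =>
    match next τ with
    | none => f rA rB τ ρ
    | some _ => 0
  | n + 1, rA, rB, τ, ρ =>
    match next τ with
    | none => f rA rB τ ρ
    | some Party.alice => ∑ o : A.R × Option C,
        let ρ' := liftA A B (A.op rA τ o) * ρ * (liftA A B (A.op rA τ o))ᴴ
        run next A B loss f n (o.1 :: rA) rB (o.2 :: τ)
          (if loss τ.length then lose A B ρ' else ρ')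
    | some Party.bob => ∑ o : B.R × Option C,
        let ρ' := liftB A B (B.op rB τ o) * ρ * (liftB A B (B.op rB τ o))ᴴ
        run next A B loss f n rA (o.1 :: rB) (o.2 :: τ)
          (if loss τ.length then lose A B ρ' else ρ')

end Joint

/-- A two-party protocol with inputs in `XA`, `XB` and outputs in `YA`, `YB` (`Unit` as input type
means: no input).  Whose turn it is, and whether the protocol is over, is public.  The protocol has
boundedly many rounds: it is over as soon as `N` turns in a row have brought no declaration of a
loss (with transcripts read from the latest symbol on, `σ` is what follows `τ`). -/
structure Protocol (XA XB YA YB : Type) where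
  C : Type
  [fintypeC : Fintype C]
  M : Type
  [fintypeM : Fintype M]
  [decEqM : DecidableEq M]
  m₀ : M
  next : List (Option C) → Option Party
  bounded : ∃ N : ℕ, ∀ τ σ : List (Option C), σ.length = N → none ∉ σ →
    ∃ υ : List (Option C), υ <:+ σ ++ τ ∧ next υ = none
  alice : XA → Player C M YA
  bob : XB → Player C M YB

attribute [instance] Protocol.fintypeC Protocol.fintypeM Protocol.decEqM

/-- A pattern of losses on the channel: which turns lose their quantum message. -/
abbrev LossPattern : Type := ℕ → Bool

/-- The perfect channel. -/
def noLoss : LossPattern := fun _ => false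

/-- Only finitely many messages are lost. -/
def LossPattern.Finite (loss : LossPattern) : Prop := ∃ t : ℕ, ∀ i, t ≤ i → loss i = false

namespace Protocol

variable {XA XB YA YB : Type} (P : Protocol XA XB YA YB)

/-- Run Alice's strategy `A` against Bob's strategy `B` from the start, for at most `T` turns. -/
def exec (A B : Strategy P.C P.M) (loss : LossPattern) (T : ℕ) {N : Type} [AddCommMonoid N]
    (f : List A.R → List B.R → List (Option P.C) → Joint A B → N) : N :=
  run P.next A B loss f T [] [] [] (start A B P.m₀)

open Classical in
/-- Both parties honest: the probability that within `T` turns the protocol is over, Alice having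
output `yA` and Bob `yB`. -/
def outProb (xA : XA) (xB : XB) (loss : LossPattern) (T : ℕ) (yA : YA) (yB : YB) : ℝ :=
  P.exec (P.alice xA).toStrategy (P.bob xB).toStrategy loss T fun rA rB τ ρ =>
    if (P.alice xA).out rA τ = yA ∧ (P.bob xB).out rB τ = yB then ρ.trace.re else 0

open Classical in
/-- Both parties honest: the unnormalised state of all that Alice holds at the end (her private
register and the message register), on the event that her classical information is `(rA, τ)` and
that Bob's output has the property `ev`. -/
def viewA (xA : XA) (xB : XB) (loss : LossPattern) (T : ℕ) (ev : YB → Prop)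
    (rA : List (P.alice xA).R) (τ : List (Option P.C)) :
    Matrix ((P.alice xA).Q × Option P.M) ((P.alice xA).Q × Option P.M) ℂ :=
  P.exec (P.alice xA).toStrategy (P.bob xB).toStrategy loss T fun rA' rB' τ' ρ =>
    if rA' = rA ∧ τ' = τ ∧ ev ((P.bob xB).out rB' τ') then
      traceOutB (P.alice xA).toStrategy (P.bob xB).toStrategy ρ else 0

open Classical in
/-- Both parties honest: the unnormalised state of all that Bob holds at the end (his private
register and the message register), on the event that his classical information is `(rB, τ)` and
that Alice's output has the property `ev`. -/
def viewB (xA : XA) (xB : XB) (loss : LossPattern) (T : ℕ) (ev : YA → Prop)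
    (rB : List (P.bob xB).R) (τ : List (Option P.C)) :
    Matrix ((P.bob xB).Q × Option P.M) ((P.bob xB).Q × Option P.M) ℂ :=
  P.exec (P.alice xA).toStrategy (P.bob xB).toStrategy loss T fun rA' rB' τ' ρ =>
    if rB' = rB ∧ τ' = τ ∧ ev ((P.alice xA).out rA' τ') then
      traceOutA (P.alice xA).toStrategy (P.bob xB).toStrategy ρ else 0

open Classical in
/-- The probability with which dishonest Alice, playing `E`, makes honest Bob output `y` within `T`
turns. -/
def forceA (xB : XB) (y : YB) (E : Strategy P.C P.M) (T : ℕ) : ℝ :=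
  P.exec E (P.bob xB).toStrategy noLoss T fun _ rB τ ρ =>
    if (P.bob xB).out rB τ = y then ρ.trace.re else 0

open Classical in
/-- The probability with which dishonest Bob, playing `E`, makes honest Alice output `y` within `T`
turns. -/
def forceB (xA : XA) (y : YA) (E : Strategy P.C P.M) (T : ℕ) : ℝ :=
  P.exec (P.alice xA).toStrategy E noLoss T fun rA _ τ ρ =>
    if (P.alice xA).out rA τ = y then ρ.trace.re else 0

/-- The probability with which dishonest Alice, playing `E`, guesses the secret bit of honest Bob
without Bob aborting.  The secret bit is a function of Bob's output, with the value `none` if Bob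
aborts. -/
def learnA (xB : XB) (secret : YB → Option Bool) (E : Guesser P.C P.M) (T : ℕ) : ℝ :=
  P.exec E.toStrategy (P.bob xB).toStrategy noLoss T fun rA rB τ ρ =>
    match secret ((P.bob xB).out rB τ) with
    | none => 0
    | some s => (liftA E.toStrategy (P.bob xB).toStrategy (E.eff rA τ s) * ρ).trace.re

/-- The probability with which dishonest Bob, playing `E`, guesses the secret bit of honest Alice
without Alice aborting. -/
def learnB (xA : XA) (secret : YA → Option Bool) (E : Guesser P.C P.M) (T : ℕ) : ℝ :=
  P.exec (P.alice xA).toStrategy E.toStrategy noLoss T fun rA rB τ ρ =>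
    match secret ((P.alice xA).out rA τ) with
    | none => 0
    | some s => (liftB (P.alice xA).toStrategy E.toStrategy (E.eff rB τ s) * ρ).trace.re

end Protocol

/-- `p` is the maximal success probability of dishonest players of the kind `S` who do not exploit
losses, and no player of this kind does better by falsely declaring losses or by deliberately
sending blank messages.  Here `win E T` is the probability of success within `T` turns. -/
def IsLTCheatingProb {S : Type 1} (lossFree : S → Prop) (win : S → ℕ → ℝ) (p : ℝ) : Prop :=
  IsGreatest {v | ∃ E T, lossFree E ∧ v = win E T} p ∧ ∀ E T, win E T ≤ p

/-- The bias of a protocol with cheating probabilities `a` and `b`. -/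
def bias (a b : ℝ) : ℝ := max a b - 1 / 2

/-- The bit `x_b` of the pair `(x_0, x_1)`; here `0` is `false` and `1` is `true`. -/
def pick (x : Bool × Bool) (b : Bool) : Bool := if b then x.2 else x.1

/-- Weak coin-flipping protocols: no inputs, both parties output a bit and never abort. -/
abbrev WCFProtocol : Type 1 := Protocol Unit Unit Bool Bool

/-- Random oblivious transfer protocols: no inputs, Alice outputs `(x_0, x_1)`, Bob outputs
`(b, x_b)`; the output `none` means that the party aborts. -/
abbrev ROTProtocol : Type 1 := Protocol Unit Unit (Option (Bool × Bool)) (Option (Bool × Bool))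

/-- Oblivious transfer protocols: Alice inputs `(x_0, x_1)`, Bob inputs `b` and outputs a bit; the
output `none` means that the party aborts. -/
abbrev OTProtocol : Type 1 := Protocol (Bool × Bool) Bool (Option Unit) (Option Bool)

/-- Loss-tolerant weak coin-flipping protocols with cheating probabilities `(a, b)`. -/
structure IsLTWCF (P : WCFProtocol) (a b : ℝ) : Prop where
  /-- Whichever finitely many messages get lost, honest parties end up with the same uniformly
  random bit. -/
  correct : ∀ loss : LossPattern, loss.Finite → ∃ T₀, ∀ T ≥ T₀, ∀ c : Bool,
    P.outProb () () loss T c c = 1 / 2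
  /-- Dishonest Alice wants the outcome `0`. -/
  cheatA : IsLTCheatingProb Strategy.LossFree (P.forceA () false) a
  /-- Dishonest Bob wants the outcome `1`. -/
  cheatB : IsLTCheatingProb Strategy.LossFree (P.forceB () true) b

/-- Loss-tolerant random oblivious transfer protocols with cheating probabilities `(a, b)`. -/
structure IsLTROT (P : ROTProtocol) (a b : ℝ) : Prop where
  /-- Honest parties never abort, `x_0`, `x_1`, `b` are independent and uniformly random, and Bob's
  second output bit is `x_b`. -/
  correct : ∀ loss : LossPattern, loss.Finite → ∃ T₀, ∀ T ≥ T₀, ∀ (x : Bool × Bool) (b : Bool),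
    P.outProb () () loss T (some x) (some (b, pick x b)) = 1 / 8
  /-- Honest Alice gets no information about `b`. -/
  hidingA : ∀ (loss : LossPattern) (T : ℕ) (rA : List (P.alice ()).R) (τ : List (Option P.C)),
    P.viewA () () loss T (fun y => ∃ v, y = some (false, v)) rA τ =
      P.viewA () () loss T (fun y => ∃ v, y = some (true, v)) rA τ
  /-- Honest Bob, with output `(b, v)`, gets no information about the other bit of Alice. -/
  hidingB : ∀ (loss : LossPattern) (T : ℕ) (rB : List (P.bob ()).R) (τ : List (Option P.C))
    (b v : Bool), (P.bob ()).out rB τ = some (b, v) →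
    P.viewB () () loss T (fun y => ∃ x, y = some x ∧ pick x (!b) = false) rB τ =
      P.viewB () () loss T (fun y => ∃ x, y = some x ∧ pick x (!b) = true) rB τ
  /-- Dishonest Alice wants to learn `b`. -/
  cheatA : IsLTCheatingProb (fun E : Guesser P.C P.M => E.LossFree)
    (P.learnA () (fun y => y.map Prod.fst)) a
  /-- Dishonest Bob wants to learn `x_0 ⊕ x_1`. -/
  cheatB : IsLTCheatingProb (fun E : Guesser P.C P.M => E.LossFree)
    (P.learnB () (fun y => y.map fun x => xor x.1 x.2)) b

/-- Loss-tolerant oblivious transfer protocols with cheating probabilities `(a, b)`, both for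
uniformly random inputs and for worst-case inputs of the honest party. -/
structure IsLTOT (P : OTProtocol) (a b : ℝ) : Prop where
  /-- Honest parties never abort, and Bob learns `x_b` perfectly. -/
  correct : ∀ loss : LossPattern, loss.Finite → ∀ (x : Bool × Bool) (i : Bool), ∃ T₀, ∀ T ≥ T₀,
    P.outProb x i loss T (some ()) (some (pick x i)) = 1
  /-- Honest Alice gets no information about `b`. -/
  hidingA : ∀ (loss : LossPattern) (T : ℕ) (x : Bool × Bool) (rA : List (P.alice x).R)
    (τ : List (Option P.C)),
    P.viewA x false loss T (fun _ => True) rA τ = P.viewA x true loss T (fun _ => True) rA τ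
  /-- Honest Bob gets no information about the bit of Alice that he did not ask for. -/
  hidingB : ∀ (loss : LossPattern) (T : ℕ) (i : Bool) (x x' : Bool × Bool), pick x i = pick x' i →
    ∀ (rB : List (P.bob i).R) (τ : List (Option P.C)),
    P.viewB x i loss T (fun _ => True) rB τ = P.viewB x' i loss T (fun _ => True) rB τ
  /-- Dishonest Alice wants to learn `b`, chosen uniformly. -/
  cheatA : IsLTCheatingProb (fun E : Guesser P.C P.M => E.LossFree)
    (fun E T => (∑ i : Bool, P.learnA i (fun y => y.map fun _ => i) E T) / 2) a
  /-- Dishonest Alice wants to learn `b`, for the worst `b`. -/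
  cheatA_worst : IsLTCheatingProb (fun E : Guesser P.C P.M => E.LossFree)
    (fun E T => ⨅ i : Bool, P.learnA i (fun y => y.map fun _ => i) E T) a
  /-- Dishonest Bob wants to learn `x_0 ⊕ x_1`, for uniform `(x_0, x_1)`. -/
  cheatB : IsLTCheatingProb (fun E : Guesser P.C P.M => E.LossFree)
    (fun E T => (∑ x : Bool × Bool, P.learnB x (fun y => y.map fun _ => xor x.1 x.2) E T) / 4) b
  /-- Dishonest Bob wants to learn `x_0 ⊕ x_1`, for the worst `(x_0, x_1)`. -/
  cheatB_worst : IsLTCheatingProb (fun E : Guesser P.C P.M => E.LossFree)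
    (fun E T => ⨅ x : Bool × Bool, P.learnB x (fun y => y.map fun _ => xor x.1 x.2) E T) b

end QProto

end

/-! Random OT can be turned around. If Bob's output is (b, v) with v = x_b, then v ⊕ x_0 = b ∧ (x_0
⊕ x_1), and this relation is symmetric in the pairs (x_0, x_0 ⊕ x_1) and (v, b). Relabelling the
outputs therefore gives a random OT in which the parties, their secrets and their cheating
probabilities are interchanged (`Duo.IsROT.reverse`). So there is one orientation with probabilities
(max, min), good for a dishonest Alice, and one with (min, max), good for a dishonest Bob. The coin
decides which of them is run, outcome 0, the one that dishonest Alice wants, selecting the first. If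
Alice obtains 0 with weight w ≤ aW, she wins with probability at most w·max + (1 - w)·min ≤ aW·|aR -
bR| + min, and likewise for Bob with outcome 1 (`HasCheatingProb.seq`, `Selector.IsWCF.switch`). The
resulting random OT becomes an OT by a one-time pad: Bob announces the difference between his input
and his random choice, Alice announces her masked inputs. For uniform inputs a cheater could have
made up the announcement of the honest party itself; conversely, a cheating strategy for random OT
does equally well for every input. Hence the uniform and the worst-case cheating probabilities are
both those of the random OT (`Duo.IsROT.transfer`).

The work lies in the composition.

Which random OT is run has to be visible in the public transcript, so the outcome of the coin flip
is announced, first by Bob, then by Alice. Alice's announcement counts, and Bob aborts if it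
contradicts his (`Duo.IsWCF.selector`).

The two given protocols have different alphabets. Both are carried over to product alphabets, and a
cheater who uses the larger alphabets is simulated over the original ones (`HasCheatingProb.lift`).

A cheater enters the second protocol with quantum and classical memory of the first. The fresh
register of the honest player is in a product state with all of it, and the first mover, if honest,
resets the message. Given the transcript of the first protocol, the cheater thus only has another
initial state, which is no advantage (`guessProb_seq_le`). For the exact value, a cheater who fails
to get the favourable coin must still reach the second protocol. This holds since players who do not
exploit losses finish with probability one on the perfect channel (`outWeight_total`).

All comparisons of two executions, except the exchange of the parties in `run_swap`, rest on one
induction, `run_sim`: if the branches of two runs can be paired so that a relation between records,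
transcripts and states is preserved, and unpaired branches carry the zero state, then the two
expected payoffs agree. -/

set_option linter.unusedSectionVars false

noncomputable section

namespace QProto

/-! ### Executions of protocols and their comparison -/

section Run

variable {C M : Type} [Fintype C] [Fintype M] [DecidableEq M]

/-- The channel: the message is lost if `lost` is true. -/
def chan (A B : Strategy C M) (lost : Bool) (ρ : Joint A B) : Joint A B :=
  if lost then lose A B ρ else ρ

/-- One application of an operator of Alice. -/
def stepA (A B : Strategy C M) (K : Matrix (A.Q × Option M) (A.Q × Option M) ℂ) (ρ : Joint A B) :
    Joint A B := liftA A B K * ρ * (liftA A B K)ᴴ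

/-- One application of an operator of Bob. -/
def stepB (A B : Strategy C M) (K : Matrix (B.Q × Option M) (B.Q × Option M) ℂ) (ρ : Joint A B) :
    Joint A B := liftB A B K * ρ * (liftB A B K)ᴴ

variable {next : List (Option C) → Option Party} {A B : Strategy C M} {loss : ℕ → Bool}
variable {N : Type} [AddCommMonoid N] {f g : List A.R → List B.R → List (Option C) → Joint A B → N}

theorem run_over {τ} (h : next τ = none) (n rA rB ρ) :
    run next A B loss f n rA rB τ ρ = f rA rB τ ρ := by
  cases n <;> simp [run, h]

theorem run_zero_alive {τ p} (h : next τ = some p) (rA rB ρ) :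
    run next A B loss f 0 rA rB τ ρ = 0 := by
  simp [run, h]

theorem run_alice {τ} (h : next τ = some Party.alice) (n rA rB ρ) :
    run next A B loss f (n + 1) rA rB τ ρ = ∑ o : A.R × Option C,
      run next A B loss f n (o.1 :: rA) rB (o.2 :: τ)
        (chan A B (loss τ.length) (stepA A B (A.op rA τ o) ρ)) := by
  simp only [run, h]; rfl

theorem run_bob {τ} (h : next τ = some Party.bob) (n rA rB ρ) :
    run next A B loss f (n + 1) rA rB τ ρ = ∑ o : B.R × Option C,
      run next A B loss f n rA (o.1 :: rB) (o.2 :: τ)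
        (chan A B (loss τ.length) (stepB A B (B.op rB τ o) ρ)) := by
  simp only [run, h]; rfl

theorem lose_zero : lose A B 0 = 0 := by ext; simp [lose]

theorem chan_zero (l : Bool) : chan A B l 0 = 0 := by
  cases l <;> simp [chan, lose_zero]

theorem liftA_zero : liftA A B 0 = 0 := by ext; simp [liftA]
theorem liftB_zero : liftB A B 0 = 0 := by ext; simp [liftB]

theorem stepA_zero (ρ : Joint A B) : stepA A B 0 ρ = 0 := by simp [stepA, liftA_zero]
theorem stepB_zero (ρ : Joint A B) : stepB A B 0 ρ = 0 := by simp [stepB, liftB_zero]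

/-- Branches whose Kraus operator vanishes on the state can be dropped from the sum over outcomes
because of this. -/
theorem run_null (hf : ∀ rA rB τ, next τ = none → f rA rB τ 0 = 0) (n : ℕ) :
    ∀ rA rB τ, run next A B loss f n rA rB τ 0 = 0 := by
  induction n with
  | zero =>
    intro rA rB τ
    rcases h : next τ with _ | p
    · rw [run_over h, hf _ _ _ h]
    · rw [run_zero_alive h]
  | succ n ih =>
    intro rA rB τ
    rcases h : next τ with _ | _ | _
    · rw [run_over h, hf _ _ _ h]
    · rw [run_alice h]; simp [stepA, chan_zero, ih]
    · rw [run_bob h]; simp [stepB, chan_zero, ih]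

/-- Two families of operators agree up to relabelling and up to vanishing members. -/
def Matched {ι ι' O O' : Type} (K : O → Matrix ι ι ℂ) (K' : O' → Matrix ι' ι' ℂ)
    (R : O → O' → Prop) : Prop :=
  ∃ (s : Set O) (e : O → O'), Set.InjOn e s ∧ (∀ o ∉ s, K o = 0) ∧ (∀ o' ∉ e '' s, K' o' = 0) ∧
    ∀ o ∈ s, R o (e o)

theorem Matched.sum_eq {ι ι' O O' : Type} [Fintype O] [Fintype O'] {K : O → Matrix ι ι ℂ}
    {K' : O' → Matrix ι' ι' ℂ} {R : O → O' → Prop} (h : Matched K K' R) {G : O → N} {G' : O' → N}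
    (hG : ∀ o, K o = 0 → G o = 0) (hG' : ∀ o, K' o = 0 → G' o = 0)
    (hR : ∀ o o', R o o' → G o = G' o') : ∑ o, G o = ∑ o', G' o' := by
  classical
  obtain ⟨s, e, he, h1, h2, h3⟩ := h
  have : ∑ o, G o = ∑ o ∈ Finset.univ.filter (· ∈ s), G o := by
    refine (Finset.sum_subset (Finset.filter_subset _ _) fun o _ ho => ?_).symm
    exact hG _ (h1 _ (by simpa using ho))
  rw [this]
  refine Finset.sum_of_injOn e (fun a ha b hb hab => he (by simpa using ha) (by simpa using hb) hab)
    (fun _ _ => by simp) (fun o' _ ho' => ?_) fun o ho => ?_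
  · exact hG' _ (h2 _ fun ⟨o, ho, h⟩ => ho' ⟨o, by simpa using ho, h⟩)
  · exact hR _ _ (h3 _ (by simpa using ho))

theorem Matched.of_injective {ι ι' O O' : Type} {K : O → Matrix ι ι ℂ}
    {K' : O' → Matrix ι' ι' ℂ} {R : O → O' → Prop} (e : O → O') (he : Function.Injective e)
    (h : ∀ o' ∉ Set.range e, K' o' = 0) (hR : ∀ o, R o (e o)) : Matched K K' R :=
  ⟨Set.univ, e, he.injOn, by simp, by simpa using h, fun o _ => hR o⟩

/-- Induction on the number of remaining turns. The second run has `k` more turns than the first,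
for whatever it does after the first is over. The constant `T` ties the remaining turns to the
transcript length, so that `hover` may use how much time is left. Since only nonzero branches have
to be paired, the two strategies may have quite different sets of outcomes. -/
theorem run_sim {C' M' : Type} [Fintype C'] [Fintype M'] [DecidableEq M']
    {A' B' : Strategy C' M'} {next' : List (Option C') → Option Party} {loss' : ℕ → Bool}
    {f' : List A'.R → List B'.R → List (Option C') → Joint A' B' → N} (T k : ℕ)
    (Rel : List A.R → List B.R → List (Option C) → Joint A B →
      List A'.R → List B'.R → List (Option C') → Joint A' B' → Prop)
    (hf : ∀ rA rB τ, next τ = none → f rA rB τ 0 = 0)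
    (hf' : ∀ rA rB τ, next' τ = none → f' rA rB τ 0 = 0)
    (hover : ∀ n rA rB τ ρ rA' rB' τ' ρ', Rel rA rB τ ρ rA' rB' τ' ρ' → n + τ.length = T →
      next τ = none → f rA rB τ ρ = run next' A' B' loss' f' (n + k) rA' rB' τ' ρ')
    (halive : ∀ p rA rB τ ρ rA' rB' τ' ρ', Rel rA rB τ ρ rA' rB' τ' ρ' → next τ = some p →
      next' τ' = some p ∧ run next' A' B' loss' f' k rA' rB' τ' ρ' = 0)
    (hA : ∀ rA rB τ ρ rA' rB' τ' ρ', Rel rA rB τ ρ rA' rB' τ' ρ' → next τ = some Party.alice →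
      Matched (fun o => stepA A B (A.op rA τ o) ρ) (fun o => stepA A' B' (A'.op rA' τ' o) ρ')
        fun o o' =>
        Rel (o.1 :: rA) rB (o.2 :: τ) (chan A B (loss τ.length) (stepA A B (A.op rA τ o) ρ))
          (o'.1 :: rA') rB' (o'.2 :: τ')
          (chan A' B' (loss' τ'.length) (stepA A' B' (A'.op rA' τ' o') ρ')))
    (hB : ∀ rA rB τ ρ rA' rB' τ' ρ', Rel rA rB τ ρ rA' rB' τ' ρ' → next τ = some Party.bob →
      Matched (fun o => stepB A B (B.op rB τ o) ρ) (fun o => stepB A' B' (B'.op rB' τ' o) ρ')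
        fun o o' =>
        Rel rA (o.1 :: rB) (o.2 :: τ) (chan A B (loss τ.length) (stepB A B (B.op rB τ o) ρ))
          rA' (o'.1 :: rB') (o'.2 :: τ')
          (chan A' B' (loss' τ'.length) (stepB A' B' (B'.op rB' τ' o') ρ'))) (n : ℕ) :
    ∀ rA rB τ ρ rA' rB' τ' ρ', Rel rA rB τ ρ rA' rB' τ' ρ' → n + τ.length = T →
      run next A B loss f n rA rB τ ρ = run next' A' B' loss' f' (n + k) rA' rB' τ' ρ' := by
  induction n with
  | zero =>
    intro rA rB τ ρ rA' rB' τ' ρ' hR hT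
    rcases h : next τ with _ | p
    · rw [run_over h, hover _ _ _ _ _ _ _ _ _ hR hT h]
    · rw [run_zero_alive h, Nat.zero_add, (halive _ _ _ _ _ _ _ _ _ hR h).2]
  | succ n ih =>
    intro rA rB τ ρ rA' rB' τ' ρ' hR hT
    rcases h : next τ with _ | _ | _
    · rw [run_over h, hover _ _ _ _ _ _ _ _ _ hR hT h]
    · rw [run_alice h, Nat.add_right_comm, run_alice (halive _ _ _ _ _ _ _ _ _ hR h).1]
      refine (hA _ _ _ _ _ _ _ _ hR h).sum_eq ?_ ?_ fun o o' ho => ih _ _ _ _ _ _ _ _ ho ?_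
      · intro o ho; simp only [ho, chan_zero, run_null hf]
      · intro o ho; simp only [ho, chan_zero, run_null hf']
      · simp; omega
    · rw [run_bob h, Nat.add_right_comm, run_bob (halive _ _ _ _ _ _ _ _ _ hR h).1]
      refine (hB _ _ _ _ _ _ _ _ hR h).sum_eq ?_ ?_ fun o o' ho => ih _ _ _ _ _ _ _ _ ho ?_
      · intro o ho; simp only [ho, chan_zero, run_null hf]
      · intro o ho; simp only [ho, chan_zero, run_null hf']
      · simp; omega

/-- The values of `f` matter only on positive states, at reachable times, when the protocol is over. -/
theorem run_hom {N' : Type} [AddCommMonoid N'] (φ : N →+ N') (n : ℕ) :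
    ∀ rA rB τ ρ, φ (run next A B loss f n rA rB τ ρ) =
      run next A B loss (fun rA rB τ ρ => φ (f rA rB τ ρ)) n rA rB τ ρ := by
  induction n with
  | zero =>
    intro rA rB τ ρ
    rcases h : next τ with _ | p
    · rw [run_over h, run_over h]
    · rw [run_zero_alive h, run_zero_alive h, map_zero]
  | succ n ih =>
    intro rA rB τ ρ
    rcases h : next τ with _ | _ | _
    · rw [run_over h, run_over h]
    · simp only [run_alice h, map_sum, ih]
    · simp only [run_bob h, map_sum, ih]

theorem run_sum {ι : Type} [Fintype ι]
    (F : ι → List A.R → List B.R → List (Option C) → Joint A B → N) (n : ℕ) (rA rB τ ρ) :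
    run next A B loss (fun rA rB τ ρ => ∑ i, F i rA rB τ ρ) n rA rB τ ρ =
      ∑ i, run next A B loss (F i) n rA rB τ ρ := by
  -- Both sides come from a single run with values in `ι → N`: the left one by applying the sum of
  -- all evaluation maps, the terms on the right by applying one evaluation map each.
  have h := run_hom (next := next) (A := A) (B := B) (loss := loss)
    (f := fun rA rB τ ρ i => F i rA rB τ ρ) (∑ i, Pi.evalAddMonoidHom (fun _ : ι => N) i) n rA rB τ ρ
  have h' := fun i => run_hom (next := next) (A := A) (B := B) (loss := loss)
    (f := fun rA rB τ ρ i => F i rA rB τ ρ) (Pi.evalAddMonoidHom (fun _ : ι => N) i) n rA rB τ ρ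
  simp only [AddMonoidHom.finsetSum_apply, Pi.evalAddMonoidHom_apply] at h h'
  rw [← h]
  exact Finset.sum_congr rfl fun i _ => h' i

theorem run_add (n : ℕ) (rA rB τ ρ) :
    run next A B loss (fun rA rB τ ρ => f rA rB τ ρ + g rA rB τ ρ) n rA rB τ ρ =
      run next A B loss f n rA rB τ ρ + run next A B loss g n rA rB τ ρ := by
  have := run_sum (next := next) (A := A) (B := B) (loss := loss)
    (fun i : Fin 2 => if i = 0 then f else g) n rA rB τ ρ
  simpa [Fin.sum_univ_two] using this

theorem run_const_mul {f : List A.R → List B.R → List (Option C) → Joint A B → ℝ} (c : ℝ) (n : ℕ)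
    (rA rB τ ρ) : run next A B loss (fun rA rB τ ρ => c * f rA rB τ ρ) n rA rB τ ρ =
      c * run next A B loss f n rA rB τ ρ :=
  (run_hom (AddMonoidHom.mulLeft c) n rA rB τ ρ).symm

end Run

/-! ### Ampliation, tensoring with a state, and partial trace along a splitting of the index type -/

section Amp

variable {I J E : Type} [Fintype I] [Fintype J] [Fintype E] [DecidableEq E]

/-- The operator `K ⊗ 1`, with the index type split as `J × E` by `g`. -/
def amp (g : I ≃ J × E) (K : Matrix J J ℂ) : Matrix I I ℂ :=
  (Matrix.kroneckerMap (· * ·) K (1 : Matrix E E ℂ)).submatrix g g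

theorem amp_apply (g : I ≃ J × E) (K : Matrix J J ℂ) (i j : I) :
    amp g K i j = K (g i).1 (g j).1 * (1 : Matrix E E ℂ) (g i).2 (g j).2 := rfl

theorem amp_mul (g : I ≃ J × E) (K L : Matrix J J ℂ) : amp g (K * L) = amp g K * amp g L := by
  rw [amp, amp, amp, Matrix.submatrix_mul_equiv, ← Matrix.mul_kronecker_mul, one_mul]

theorem amp_conjTranspose (g : I ≃ J × E) (K : Matrix J J ℂ) : amp g Kᴴ = (amp g K)ᴴ := by
  rw [amp, amp, Matrix.conjTranspose_submatrix, Matrix.conjTranspose_kronecker,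
    Matrix.conjTranspose_one]

theorem amp_one [DecidableEq I] [DecidableEq J] (g : I ≃ J × E) : amp g 1 = 1 := by
  rw [amp, Matrix.one_kronecker_one, Matrix.submatrix_one_equiv]

theorem amp_add (g : I ≃ J × E) (K L : Matrix J J ℂ) : amp g (K + L) = amp g K + amp g L := by
  ext; simp [amp_apply, add_mul]

theorem amp_sum {O : Type} (s : Finset O) (g : I ≃ J × E) (K : O → Matrix J J ℂ) :
    amp g (∑ o ∈ s, K o) = ∑ o ∈ s, amp g (K o) := by
  ext; simp [amp_apply, Matrix.sum_apply, Finset.sum_mul]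

theorem amp_posSemidef (g : I ≃ J × E) {K : Matrix J J ℂ} (hK : K.PosSemidef) :
    (amp g K).PosSemidef := (hK.kronecker Matrix.PosSemidef.one).submatrix _

/-- The state `ρ ⊗ σ`, with the index type split as `J × E` by `g`. -/
def tens (g : I ≃ J × E) (σ : Matrix E E ℂ) (ρ : Matrix J J ℂ) : Matrix I I ℂ :=
  (Matrix.kroneckerMap (· * ·) ρ σ).submatrix g g

theorem tens_apply (g : I ≃ J × E) (σ : Matrix E E ℂ) (ρ : Matrix J J ℂ) (i j : I) :
    tens g σ ρ i j = ρ (g i).1 (g j).1 * σ (g i).2 (g j).2 := rfl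

theorem amp_conj_tens (g : I ≃ J × E) (σ : Matrix E E ℂ) (K ρ : Matrix J J ℂ) :
    amp g K * tens g σ ρ * (amp g K)ᴴ = tens g σ (K * ρ * Kᴴ) := by
  rw [← amp_conjTranspose, amp, amp, tens, tens, Matrix.submatrix_mul_equiv,
    Matrix.submatrix_mul_equiv, ← Matrix.mul_kronecker_mul, ← Matrix.mul_kronecker_mul, one_mul,
    mul_one]

theorem amp_mul_tens (g : I ≃ J × E) (σ : Matrix E E ℂ) (K ρ : Matrix J J ℂ) :
    amp g K * tens g σ ρ = tens g σ (K * ρ) := by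
  rw [amp, tens, tens, Matrix.submatrix_mul_equiv, ← Matrix.mul_kronecker_mul, one_mul]

theorem trace_submatrix_equiv (g : I ≃ J) (X : Matrix J J ℂ) :
    (X.submatrix g g).trace = X.trace := by
  simp only [Matrix.trace, Matrix.diag, Matrix.submatrix_apply]
  exact g.sum_comp fun j => X j j

theorem trace_tens (g : I ≃ J × E) (σ : Matrix E E ℂ) (ρ : Matrix J J ℂ) :
    (tens g σ ρ).trace = ρ.trace * σ.trace := by
  rw [tens, trace_submatrix_equiv, Matrix.trace_kronecker]

theorem tens_posSemidef (g : I ≃ J × E) {σ : Matrix E E ℂ} {ρ : Matrix J J ℂ} (hσ : σ.PosSemidef)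
    (hρ : ρ.PosSemidef) : (tens g σ ρ).PosSemidef := (hρ.kronecker hσ).submatrix _

/-- The partial trace over `E`, with the index type split as `J × E` by `g`. -/
def ptr (g : I ≃ J × E) (X : Matrix I I ℂ) : Matrix J J ℂ :=
  ∑ x : E, X.submatrix (fun j => g.symm (j, x)) fun j => g.symm (j, x)

/-- In block form with respect to the splitting, `K ⊗ 1` is block diagonal with equal blocks, so it
multiplies each block row of `X` by `K`. -/
theorem amp_mul_submatrix {L : Type} (g : I ≃ J × E) (K : Matrix J J ℂ) (X : Matrix I I ℂ) (x : E)
    (h : L → I) : (amp g K * X).submatrix (fun j => g.symm (j, x)) h =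
      K * X.submatrix (fun j => g.symm (j, x)) h := by
  ext i j
  simp only [Matrix.submatrix_apply, Matrix.mul_apply, amp_apply, Equiv.apply_symm_apply]
  rw [← g.symm.sum_comp, Fintype.sum_prod_type]
  refine Finset.sum_congr rfl fun y _ => ?_
  simp [Matrix.one_apply]

theorem ptr_amp_mul (g : I ≃ J × E) (K : Matrix J J ℂ) (X : Matrix I I ℂ) :
    ptr g (amp g K * X) = K * ptr g X := by
  simp only [ptr, amp_mul_submatrix, Matrix.mul_sum]

theorem ptr_conjTranspose (g : I ≃ J × E) (X : Matrix I I ℂ) : ptr g Xᴴ = (ptr g X)ᴴ := by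
  simp [ptr, Matrix.conjTranspose_sum, Matrix.conjTranspose_submatrix]

theorem ptr_amp_conj (g : I ≃ J × E) (K : Matrix J J ℂ) (X : Matrix I I ℂ) :
    ptr g (amp g K * X * (amp g K)ᴴ) = K * ptr g X * Kᴴ := by
  -- Only left multiplication has been moved out of the partial trace; right multiplication is
  -- reduced to it by taking adjoints twice.
  have : amp g K * X * (amp g K)ᴴ = (amp g K * (amp g K * X)ᴴ)ᴴ := by
    rw [Matrix.conjTranspose_mul (amp g K), Matrix.conjTranspose_conjTranspose]
  rw [this, ptr_conjTranspose, ptr_amp_mul, ptr_conjTranspose, ptr_amp_mul,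
    Matrix.conjTranspose_mul, Matrix.conjTranspose_conjTranspose]

theorem trace_ptr (g : I ≃ J × E) (X : Matrix I I ℂ) : (ptr g X).trace = X.trace := by
  simp only [ptr, Matrix.trace, Matrix.diag, Matrix.sum_apply, Matrix.submatrix_apply]
  rw [← Fintype.sum_prod_type (f := fun p : J × E => X (g.symm p) (g.symm p))]
  exact g.symm.sum_comp fun i => X i i

theorem ptr_posSemidef (g : I ≃ J × E) {X : Matrix I I ℂ} (hX : X.PosSemidef) :
    (ptr g X).PosSemidef :=
  Matrix.posSemidef_sum _ fun _ _ => hX.submatrix _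

end Amp

/-! ### Positivity and trace of the operations on joint states -/

section JointOps

variable {C M : Type} [Fintype C] [Fintype M] [DecidableEq M] {A B : Strategy C M}

/-- Alice's part of the joint space split off from Bob's register. -/
def splitA (A B : Strategy C M) : A.Q × Option M × B.Q ≃ (A.Q × Option M) × B.Q :=
  (Equiv.prodAssoc _ _ _).symm

/-- Bob's part of the joint space split off from Alice's register. -/
def splitB (A B : Strategy C M) : A.Q × Option M × B.Q ≃ (B.Q × Option M) × A.Q where
  toFun i := ((i.2.2, i.2.1), i.1)
  invFun i := (i.2, i.1.2, i.1.1)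
  left_inv _ := rfl
  right_inv _ := rfl

/-- The message register split off from the private registers. -/
def splitM (A B : Strategy C M) : A.Q × Option M × B.Q ≃ (A.Q × B.Q) × Option M where
  toFun i := ((i.1, i.2.2), i.2.1)
  invFun i := (i.1.1, i.2, i.1.2)
  left_inv _ := rfl
  right_inv _ := rfl

theorem liftA_eq_amp (K : Matrix (A.Q × Option M) (A.Q × Option M) ℂ) :
    liftA A B K = amp (splitA A B) K := rfl

theorem liftB_eq_amp (K : Matrix (B.Q × Option M) (B.Q × Option M) ℂ) :
    liftB A B K = amp (splitB A B) K := rfl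

theorem liftA_posSemidef {K : Matrix (A.Q × Option M) (A.Q × Option M) ℂ} (hK : K.PosSemidef) :
    (liftA A B K).PosSemidef := by
  rw [liftA_eq_amp]; exact amp_posSemidef _ hK

theorem posSemidef_single {ι : Type} [Fintype ι] [DecidableEq ι] (i : ι) :
    (Matrix.single i i (1 : ℂ)).PosSemidef := by
  rw [← Matrix.diagonal_single, Matrix.posSemidef_diagonal_iff]
  intro j
  by_cases h : j = i
  · subst h; simp
  · simp [h]

theorem lose_eq_tens (ρ : Joint A B) :
    lose A B ρ = tens (splitM A B) (Matrix.single none none 1) (ptr (splitM A B) ρ) := by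
  ext i j
  simp [lose, tens_apply, ptr, Matrix.sum_apply, splitM, mul_comm]

theorem start_eq_tens (m₀ : M) : start A B m₀ = tens (splitM A B)
    (Matrix.single (some m₀) (some m₀) 1) (Matrix.kroneckerMap (· * ·) A.init B.init) := by
  ext i j
  simp [start, tens_apply, splitM]
  ring

theorem lose_posSemidef {ρ : Joint A B} (h : ρ.PosSemidef) : (lose A B ρ).PosSemidef := by
  rw [lose_eq_tens]
  exact tens_posSemidef _ (posSemidef_single _) (ptr_posSemidef _ h)

theorem trace_lose (ρ : Joint A B) : (lose A B ρ).trace = ρ.trace := by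
  rw [lose_eq_tens, trace_tens, trace_ptr, Matrix.trace_single_eq_same, mul_one]

theorem start_posSemidef (m₀ : M) : (start A B m₀).PosSemidef := by
  rw [start_eq_tens]
  exact tens_posSemidef _ (posSemidef_single _) (A.init_posSemidef.kronecker B.init_posSemidef)

theorem trace_start (m₀ : M) : (start A B m₀).trace = 1 := by
  rw [start_eq_tens, trace_tens, Matrix.trace_single_eq_same, Matrix.trace_kronecker, A.init_trace,
    B.init_trace, mul_one, mul_one]

theorem chan_posSemidef (l : Bool) {ρ : Joint A B} (h : ρ.PosSemidef) :
    (chan A B l ρ).PosSemidef := by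
  cases l
  · simpa [chan] using h
  · simpa [chan] using lose_posSemidef h

theorem trace_chan (l : Bool) (ρ : Joint A B) : (chan A B l ρ).trace = ρ.trace := by
  cases l <;> simp [chan, trace_lose]

theorem stepA_posSemidef (K) {ρ : Joint A B} (h : ρ.PosSemidef) : (stepA A B K ρ).PosSemidef :=
  h.mul_mul_conjTranspose_same _

theorem stepB_posSemidef (K) {ρ : Joint A B} (h : ρ.PosSemidef) : (stepB A B K ρ).PosSemidef :=
  h.mul_mul_conjTranspose_same _

theorem sum_trace_conj {ι O : Type} [Fintype ι] [DecidableEq ι] [Fintype O] {K : O → Matrix ι ι ℂ}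
    (hK : ∑ o, (K o)ᴴ * K o = 1) (ρ : Matrix ι ι ℂ) :
    ∑ o, (K o * ρ * (K o)ᴴ).trace = ρ.trace := by
  calc ∑ o, (K o * ρ * (K o)ᴴ).trace = ∑ o, ((K o)ᴴ * K o * ρ).trace :=
        Finset.sum_congr rfl fun o _ => Matrix.trace_mul_cycle _ _ _
    _ = ρ.trace := by rw [← Matrix.trace_sum, ← Matrix.sum_mul, hK, one_mul]

theorem sum_trace_stepA (r τ) (ρ : Joint A B) :
    ∑ o, (stepA A B (A.op r τ o) ρ).trace = ρ.trace := by
  refine sum_trace_conj ?_ ρ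
  simp only [liftA_eq_amp, ← amp_conjTranspose, ← amp_mul, ← amp_sum, A.op_complete, amp_one]

theorem sum_trace_stepB (r τ) (ρ : Joint A B) :
    ∑ o, (stepB A B (B.op r τ o) ρ).trace = ρ.trace := by
  refine sum_trace_conj ?_ ρ
  simp only [liftB_eq_amp, ← amp_conjTranspose, ← amp_mul, ← amp_sum, B.op_complete, amp_one]

open scoped MatrixOrder in
theorem trace_mul_nonneg {ι : Type} [Fintype ι] {X ρ : Matrix ι ι ℂ}
    (hX : X.PosSemidef) (hρ : ρ.PosSemidef) : 0 ≤ (X * ρ).trace := by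
  classical
  obtain ⟨Y, rfl⟩ := CStarAlgebra.nonneg_iff_eq_star_mul_self.mp hX.nonneg
  rw [mul_assoc, Matrix.trace_mul_comm, Matrix.star_eq_conjTranspose]
  exact (hρ.mul_mul_conjTranspose_same Y).trace_nonneg

theorem re_trace_nonneg {ι : Type} [Fintype ι] {ρ : Matrix ι ι ℂ} (hρ : ρ.PosSemidef) :
    0 ≤ ρ.trace.re := (Complex.le_def.mp hρ.trace_nonneg).1

theorem re_trace_mul_nonneg {ι : Type} [Fintype ι] {X ρ : Matrix ι ι ℂ}
    (hX : X.PosSemidef) (hρ : ρ.PosSemidef) : 0 ≤ (X * ρ).trace.re :=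
  (Complex.le_def.mp (trace_mul_nonneg hX hρ)).1

theorem eq_zero_of_re_trace {ι : Type} [Fintype ι] {ρ : Matrix ι ι ℂ} (hρ : ρ.PosSemidef)
    (h : ρ.trace.re = 0) : ρ = 0 := by
  refine hρ.trace_eq_zero_iff.mp (Complex.ext h ?_)
  exact (Complex.le_def.mp hρ.trace_nonneg).2.symm

end JointOps

/-! ### Bounds, monotonicity and positivity of expected payoffs -/

section Bounds

variable {C M : Type} [Fintype C] [Fintype M] [DecidableEq M]
variable {next : List (Option C) → Option Party} {A B : Strategy C M} {loss : ℕ → Bool}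

/-- Every state reached from a positive state is positive, so the payoff matters only on positive
states. -/
theorem run_mem {N : Type} [AddCommMonoid N]
    {f : List A.R → List B.R → List (Option C) → Joint A B → N} (S : AddSubmonoid N)
    (hf : ∀ rA rB τ ρ, ρ.PosSemidef → f rA rB τ ρ ∈ S) (n : ℕ) :
    ∀ rA rB τ ρ, ρ.PosSemidef → run next A B loss f n rA rB τ ρ ∈ S := by
  induction n with
  | zero =>
    intro rA rB τ ρ hρ
    rcases h : next τ with _ | p
    · rw [run_over h]; exact hf _ _ _ _ hρ
    · rw [run_zero_alive h]; exact S.zero_mem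
  | succ n ih =>
    intro rA rB τ ρ hρ
    rcases h : next τ with _ | _ | _
    · rw [run_over h]; exact hf _ _ _ _ hρ
    · rw [run_alice h]
      exact S.sum_mem fun o _ => ih _ _ _ _ (chan_posSemidef _ (stepA_posSemidef _ hρ))
    · rw [run_bob h]
      exact S.sum_mem fun o _ => ih _ _ _ _ (chan_posSemidef _ (stepB_posSemidef _ hρ))

theorem run_congr {N : Type} [AddCommMonoid N] {loss' : ℕ → Bool}
    {f g : List A.R → List B.R → List (Option C) → Joint A B → N} {T : ℕ}
    (hloss : ∀ i < T, loss i = loss' i)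
    (hfg : ∀ rA rB τ ρ, ρ.PosSemidef → τ.length ≤ T → next τ = none →
      f rA rB τ ρ = g rA rB τ ρ) (n : ℕ) :
    ∀ rA rB τ ρ, ρ.PosSemidef → n + τ.length ≤ T →
      run next A B loss f n rA rB τ ρ = run next A B loss' g n rA rB τ ρ := by
  induction n with
  | zero =>
    intro rA rB τ ρ hρ hT
    rcases h : next τ with _ | p
    · rw [run_over h, run_over h]; exact hfg _ _ _ _ hρ (by omega) h
    · rw [run_zero_alive h, run_zero_alive h]
  | succ n ih =>
    intro rA rB τ ρ hρ hT
    rcases h : next τ with _ | _ | _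
    · rw [run_over h, run_over h]; exact hfg _ _ _ _ hρ (by omega) h
    · rw [run_alice h, run_alice h, hloss _ (by omega)]
      exact Finset.sum_congr rfl fun o _ =>
        ih _ _ _ _ (chan_posSemidef _ (stepA_posSemidef _ hρ)) (by simp; omega)
    · rw [run_bob h, run_bob h, hloss _ (by omega)]
      exact Finset.sum_congr rfl fun o _ =>
        ih _ _ _ _ (chan_posSemidef _ (stepB_posSemidef _ hρ)) (by simp; omega)

theorem run_le {f g : List A.R → List B.R → List (Option C) → Joint A B → ℝ} {T : ℕ}
    (hfg : ∀ rA rB τ ρ, ρ.PosSemidef → τ.length ≤ T → next τ = none →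
      f rA rB τ ρ ≤ g rA rB τ ρ) (n : ℕ) :
    ∀ rA rB τ ρ, ρ.PosSemidef → n + τ.length ≤ T →
      run next A B loss f n rA rB τ ρ ≤ run next A B loss g n rA rB τ ρ := by
  induction n with
  | zero =>
    intro rA rB τ ρ hρ hT
    rcases h : next τ with _ | p
    · rw [run_over h, run_over h]; exact hfg _ _ _ _ hρ (by omega) h
    · rw [run_zero_alive h, run_zero_alive h]
  | succ n ih =>
    intro rA rB τ ρ hρ hT
    rcases h : next τ with _ | _ | _
    · rw [run_over h, run_over h]; exact hfg _ _ _ _ hρ (by omega) h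
    · rw [run_alice h, run_alice h]
      exact Finset.sum_le_sum fun o _ =>
        ih _ _ _ _ (chan_posSemidef _ (stepA_posSemidef _ hρ)) (by simp; omega)
    · rw [run_bob h, run_bob h]
      exact Finset.sum_le_sum fun o _ =>
        ih _ _ _ _ (chan_posSemidef _ (stepB_posSemidef _ hρ)) (by simp; omega)

theorem run_nonneg {f : List A.R → List B.R → List (Option C) → Joint A B → ℝ}
    (hf : ∀ rA rB τ ρ, ρ.PosSemidef → 0 ≤ f rA rB τ ρ) (n rA rB τ ρ) (hρ : ρ.PosSemidef) :
    0 ≤ run next A B loss f n rA rB τ ρ :=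
  run_mem (AddSubmonoid.nonneg ℝ) hf n _ _ _ _ hρ

/-- A larger number of turns only adds branches that finish later, and these contribute nonnegative
amounts. -/
theorem run_mono_turns {f : List A.R → List B.R → List (Option C) → Joint A B → ℝ}
    (hf : ∀ rA rB τ ρ, ρ.PosSemidef → 0 ≤ f rA rB τ ρ) {n m : ℕ} (hnm : n ≤ m) :
    ∀ rA rB τ ρ, ρ.PosSemidef →
      run next A B loss f n rA rB τ ρ ≤ run next A B loss f m rA rB τ ρ := by
  induction n generalizing m with
  | zero =>
    intro rA rB τ ρ hρ
    rcases h : next τ with _ | p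
    · rw [run_over h, run_over h]
    · rw [run_zero_alive h]; exact run_nonneg hf _ _ _ _ _ hρ
  | succ n ih =>
    intro rA rB τ ρ hρ
    obtain ⟨m, rfl⟩ : ∃ k, m = k + 1 := ⟨m - 1, by omega⟩
    rcases h : next τ with _ | _ | _
    · rw [run_over h, run_over h]
    · rw [run_alice h, run_alice h]
      exact Finset.sum_le_sum fun o _ =>
        ih (by omega) _ _ _ _ (chan_posSemidef _ (stepA_posSemidef _ hρ))
    · rw [run_bob h, run_bob h]
      exact Finset.sum_le_sum fun o _ =>
        ih (by omega) _ _ _ _ (chan_posSemidef _ (stepB_posSemidef _ hρ))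

theorem run_trace_le (n : ℕ) : ∀ rA rB τ (ρ : Joint A B), ρ.PosSemidef →
    run next A B loss (fun _ _ _ ρ => ρ.trace.re) n rA rB τ ρ ≤ ρ.trace.re := by
  induction n with
  | zero =>
    intro rA rB τ ρ hρ
    rcases h : next τ with _ | p
    · rw [run_over h]
    · rw [run_zero_alive h]; exact re_trace_nonneg hρ
  | succ n ih =>
    intro rA rB τ ρ hρ
    rcases h : next τ with _ | _ | _
    · rw [run_over h]
    · rw [run_alice h, ← sum_trace_stepA rA τ ρ, Complex.re_sum]
      refine Finset.sum_le_sum fun o _ =>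
        (ih _ _ _ _ (chan_posSemidef _ (stepA_posSemidef _ hρ))).trans_eq (by rw [trace_chan])
    · rw [run_bob h, ← sum_trace_stepB rB τ ρ, Complex.re_sum]
      refine Finset.sum_le_sum fun o _ =>
        (ih _ _ _ _ (chan_posSemidef _ (stepB_posSemidef _ hρ))).trans_eq (by rw [trace_chan])

theorem run_eq_zero_of_alive {N : Type} [AddCommMonoid N]
    {f : List A.R → List B.R → List (Option C) → Joint A B → N} (n : ℕ) :
    ∀ rA rB τ ρ, (∀ σ : List (Option C), σ.length ≤ n → next (σ ++ τ) ≠ none) →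
      run next A B loss f n rA rB τ ρ = 0 := by
  induction n with
  | zero =>
    intro rA rB τ ρ h
    obtain ⟨p, hp⟩ := Option.ne_none_iff_exists'.mp (h [] (by simp))
    exact run_zero_alive hp _ _ _
  | succ n ih =>
    intro rA rB τ ρ h
    have h' : ∀ s, ∀ σ : List (Option C), σ.length ≤ n → next (σ ++ s :: τ) ≠ none := fun s σ hσ => by
      simpa using h (σ ++ [s]) (by simpa using hσ)
    rcases hp : next τ with _ | _ | _
    · exact absurd hp (by simpa using h [] (by simp))
    · rw [run_alice hp]; exact Finset.sum_eq_zero fun o _ => ih _ _ _ _ (h' _)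
    · rw [run_bob hp]; exact Finset.sum_eq_zero fun o _ => ih _ _ _ _ (h' _)

end Bounds

/-! ### Interchanging the parties, so that dishonest players need to be treated in the role of Alice
only -/

section Swap

variable {C M : Type} [Fintype C] [Fintype M] [DecidableEq M]

/-- The other party. -/
def Party.swap : Party → Party
  | .alice => .bob
  | .bob => .alice

/-- The same order of turns with the parties interchanged. -/
def swapNext (next : List (Option C) → Option Party) (τ : List (Option C)) : Option Party :=
  (next τ).map Party.swap

theorem swapNext_swapNext (next : List (Option C) → Option Party) :
    swapNext (swapNext next) = next := by
  funext τ
  rcases h : next τ with _ | _ | _ <;> simp [swapNext, h, Party.swap]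

theorem swapNext_eq_none {next : List (Option C) → Option Party} {τ} :
    swapNext next τ = none ↔ next τ = none := by simp [swapNext]

/-- The joint space with the parties interchanged. -/
def swapIndex (A B : Strategy C M) : B.Q × Option M × A.Q ≃ A.Q × Option M × B.Q where
  toFun i := (i.2.2, i.2.1, i.1)
  invFun i := (i.2.2, i.2.1, i.1)
  left_inv _ := rfl
  right_inv _ := rfl

/-- The joint state with the parties interchanged. -/
def swapJoint {A B : Strategy C M} (ρ : Joint A B) : Joint B A :=
  ρ.submatrix (swapIndex A B) (swapIndex A B)

variable {A B : Strategy C M}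

theorem swapJoint_conj (K ρ : Joint A B) :
    swapJoint (K * ρ * Kᴴ) = swapJoint K * swapJoint ρ * (swapJoint K)ᴴ := by
  simp only [swapJoint, Matrix.conjTranspose_submatrix, Matrix.submatrix_mul_equiv]

theorem swapJoint_stepA (K) (ρ : Joint A B) :
    swapJoint (stepA A B K ρ) = stepB B A K (swapJoint ρ) := swapJoint_conj _ _

theorem swapJoint_stepB (K) (ρ : Joint A B) :
    swapJoint (stepB A B K ρ) = stepA B A K (swapJoint ρ) := swapJoint_conj _ _

theorem swapJoint_chan (l : Bool) (ρ : Joint A B) :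
    swapJoint (chan A B l ρ) = chan B A l (swapJoint ρ) := by
  cases l <;> rfl

theorem swapJoint_start (m₀ : M) : swapJoint (start A B m₀) = start B A m₀ := by
  ext i j
  simp [swapJoint, start, swapIndex]
  ring

theorem trace_swapJoint (ρ : Joint A B) : (swapJoint ρ).trace = ρ.trace :=
  trace_submatrix_equiv _ _

theorem run_swap {next : List (Option C) → Option Party} {loss : ℕ → Bool} {N : Type}
    [AddCommMonoid N] {f : List B.R → List A.R → List (Option C) → Joint B A → N} (n : ℕ) :
    ∀ rA rB τ (ρ : Joint A B), run (swapNext next) B A loss f n rB rA τ (swapJoint ρ) =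
      run next A B loss (fun rA rB τ ρ => f rB rA τ (swapJoint ρ)) n rA rB τ ρ := by
  induction n with
  | zero =>
    intro rA rB τ ρ
    rcases h : next τ with _ | p
    · rw [run_over h, run_over (by simp [swapNext, h])]
    · rw [run_zero_alive h, run_zero_alive (p := p.swap) (by simp [swapNext, h])]
  | succ n ih =>
    intro rA rB τ ρ
    rcases h : next τ with _ | _ | _
    · rw [run_over h, run_over (by simp [swapNext, h])]
    · rw [run_alice h, run_bob (by simp [swapNext, h, Party.swap])]
      simp only [← ih, swapJoint_chan, swapJoint_stepA]
    · rw [run_bob h, run_alice (by simp [swapNext, h, Party.swap])]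
      simp only [← ih, swapJoint_chan, swapJoint_stepB]

end Swap

/-! ### Cheating probabilities for learning a bit -/

section Cheating

variable {C M : Type} [Fintype C] [Fintype M] [DecidableEq M]

/-- The contribution of a final state to the probability that the dishonest player `E` guesses the
secret bit `s`, where `none` means that the honest player has aborted. -/
def guessPayoff (E : Guesser C M) (B : Strategy C M) (s : Option Bool) (r : List E.R)
    (τ : List (Option C)) (ρ : Joint E.toStrategy B) : ℝ :=
  match s with
  | none => 0
  | some s => (liftA E.toStrategy B (E.eff r τ s) * ρ).trace.re

theorem guessPayoff_zero {E : Guesser C M} {B : Strategy C M} (s r τ) :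
    guessPayoff E B s r τ 0 = 0 := by
  cases s <;> simp [guessPayoff]

/-- The probability that the dishonest player `E` guesses the secret bit of the honest player `B`.
The dishonest player has the role of Alice. -/
def guessProb (next : List (Option C) → Option Party) (B : Strategy C M) (m₀ : M)
    (secret : List B.R → List (Option C) → Option Bool) (E : Guesser C M) (T : ℕ) : ℝ :=
  run next E.toStrategy B noLoss (fun rA rB τ ρ => guessPayoff E B (secret rB τ) rA τ ρ) T [] [] []
    (start E.toStrategy B m₀)

/-- `a` is the cheating probability of a dishonest player, in the role of Alice, who wants to learn
the secret bit of the honest player `B`. -/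
def HasCheatingProb (next : List (Option C) → Option Party) (B : Strategy C M) (m₀ : M)
    (secret : List B.R → List (Option C) → Option Bool) (a : ℝ) : Prop :=
  IsLTCheatingProb (fun E : Guesser C M => E.LossFree) (guessProb next B m₀ secret) a

theorem eff_le_trace (E : Guesser C M) {B : Strategy C M} (r τ g) {ρ : Joint E.toStrategy B}
    (hρ : ρ.PosSemidef) : (liftA E.toStrategy B (E.eff r τ g) * ρ).trace.re ≤ ρ.trace.re := by
  have h : ∀ g, 0 ≤ (liftA E.toStrategy B (E.eff r τ g) * ρ).trace.re := fun g =>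
    re_trace_mul_nonneg (liftA_posSemidef (E.eff_posSemidef r τ g)) hρ
  have hsum : (liftA E.toStrategy B (E.eff r τ false) * ρ).trace.re +
      (liftA E.toStrategy B (E.eff r τ true) * ρ).trace.re = ρ.trace.re := by
    rw [← Complex.add_re, ← Matrix.trace_add, ← Matrix.add_mul, liftA_eq_amp, liftA_eq_amp,
      ← amp_add, E.eff_sum, amp_one, one_mul]
  have h1 := h false
  have h2 := h true
  cases g <;> linarith

theorem eff_nonneg (E : Guesser C M) {B : Strategy C M} (r τ g) {ρ : Joint E.toStrategy B}
    (hρ : ρ.PosSemidef) : 0 ≤ (liftA E.toStrategy B (E.eff r τ g) * ρ).trace.re :=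
  re_trace_mul_nonneg (liftA_posSemidef (E.eff_posSemidef r τ g)) hρ

theorem guessPayoff_nonneg (E : Guesser C M) {B : Strategy C M} (s r τ) {ρ : Joint E.toStrategy B}
    (hρ : ρ.PosSemidef) : 0 ≤ guessPayoff E B s r τ ρ := by
  cases s
  · exact le_rfl
  · exact eff_nonneg E _ _ _ hρ

theorem guessPayoff_le (E : Guesser C M) {B : Strategy C M} (s r τ) {ρ : Joint E.toStrategy B}
    (hρ : ρ.PosSemidef) : guessPayoff E B s r τ ρ ≤ ρ.trace.re := by
  cases s
  · exact re_trace_nonneg hρ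
  · exact eff_le_trace E _ _ _ hρ

theorem guessProb_mono {next} {B : Strategy C M} {m₀ secret} (E : Guesser C M) {T T' : ℕ}
    (h : T ≤ T') : guessProb next B m₀ secret E T ≤ guessProb next B m₀ secret E T' := by
  exact run_mono_turns (fun rA rB τ ρ hρ => guessPayoff_nonneg E _ _ _ hρ) h _ _ _ _
    (start_posSemidef _)

theorem guessProb_nonneg {next} {B : Strategy C M} {m₀ secret} (E : Guesser C M) (T : ℕ) :
    0 ≤ guessProb next B m₀ secret E T := by
  exact run_nonneg (fun rA rB τ ρ hρ => guessPayoff_nonneg E _ _ _ hρ) _ _ _ _ _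
    (start_posSemidef _)

theorem guessProb_le_one {next} {B : Strategy C M} {m₀ secret} (E : Guesser C M) (T : ℕ) :
    guessProb next B m₀ secret E T ≤ 1 := by
  refine (run_le (T := T) (g := fun _ _ _ ρ => ρ.trace.re) (fun rA rB τ ρ hρ _ _ =>
    guessPayoff_le E _ _ _ hρ) T _ _ _ _ (start_posSemidef _) (by simp)).trans
    ((run_trace_le _ _ _ _ _ (start_posSemidef _)).trans ?_)
  simp [trace_start]

theorem HasCheatingProb.nonneg {next} {B : Strategy C M} {m₀ secret a}
    (h : HasCheatingProb next B m₀ secret a) : 0 ≤ a := by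
  obtain ⟨E, T, -, rfl⟩ := h.1.1
  exact guessProb_nonneg E T

theorem HasCheatingProb.le_one {next} {B : Strategy C M} {m₀ secret a}
    (h : HasCheatingProb next B m₀ secret a) : a ≤ 1 := by
  obtain ⟨E, T, -, rfl⟩ := h.1.1
  exact guessProb_le_one E T

/-- The optimum is attained at all sufficiently late times. -/
theorem HasCheatingProb.attained {next} {B : Strategy C M} {m₀ secret a}
    (h : HasCheatingProb next B m₀ secret a) :
    ∃ (E : Guesser C M) (T₀ : ℕ), E.LossFree ∧ ∀ T ≥ T₀, guessProb next B m₀ secret E T = a := by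
  obtain ⟨E, T₀, hE, hT⟩ := h.1.1
  exact ⟨E, T₀, hE, fun T hT' => le_antisymm (h.2 E T) (hT.le.trans (guessProb_mono E hT'))⟩

theorem hasCheatingProb_of {next} {B : Strategy C M} {m₀ secret a}
    (hle : ∀ E T, guessProb next B m₀ secret E T ≤ a)
    (hge : ∃ (E : Guesser C M) (T : ℕ), E.LossFree ∧ a ≤ guessProb next B m₀ secret E T) :
    HasCheatingProb next B m₀ secret a := by
  obtain ⟨E, T, hE, h⟩ := hge
  refine ⟨⟨⟨E, T, hE, le_antisymm h (hle E T)⟩, ?_⟩, hle⟩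
  rintro _ ⟨E, T, -, rfl⟩
  exact hle E T

end Cheating

/-! ### Kraus families relabelled and padded with zeros -/

section ExtendOp

variable {O O' ι : Type}

/-- The family `K` relabelled by `inj`, with zero operators for the other labels. -/
def extendOp (inj : O → O') (K : O → Matrix ι ι ℂ) : O' → Matrix ι ι ℂ := Function.extend inj K 0

theorem extendOp_apply {inj : O → O'} (h : Function.Injective inj) (K : O → Matrix ι ι ℂ) (o : O) :
    extendOp inj K (inj o) = K o := h.extend_apply _ _ _

theorem extendOp_zero {inj : O → O'} (K : O → Matrix ι ι ℂ) {o' : O'} (h : o' ∉ Set.range inj) :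
    extendOp inj K o' = 0 := Function.extend_apply' _ _ _ h

theorem extendOp_cases {inj : O → O'} (h : Function.Injective inj) (K : O → Matrix ι ι ℂ) (o' : O') :
    extendOp inj K o' = 0 ∨ ∃ o, inj o = o' ∧ extendOp inj K o' = K o := by
  by_cases ho : o' ∈ Set.range inj
  · obtain ⟨o, rfl⟩ := ho
    exact Or.inr ⟨o, rfl, extendOp_apply h K o⟩
  · exact Or.inl (extendOp_zero K ho)

theorem sum_extendOp [Fintype O] [Fintype O'] [Fintype ι] {inj : O → O'}
    (h : Function.Injective inj) (K : O → Matrix ι ι ℂ) :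
    ∑ o', (extendOp inj K o')ᴴ * extendOp inj K o' = ∑ o, (K o)ᴴ * K o := by
  refine (Fintype.sum_of_injective inj h _ _ (fun o' ho => ?_) fun o => ?_).symm
  · rw [extendOp_zero K ho, mul_zero]
  · rw [extendOp_apply h]

end ExtendOp

/-! ### Operators transported along an inclusion of bases -/

section Emb

variable {I I' : Type} [Fintype I] [Fintype I'] [DecidableEq I] [DecidableEq I']

/-- The operator `K` transported along an inclusion of the basis. -/
def emb (G : I → I') (K : Matrix I I ℂ) : Matrix I' I' ℂ :=
  (1 : Matrix I' I' ℂ).submatrix id G * K * ((1 : Matrix I' I' ℂ).submatrix id G)ᴴ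

variable {G : I → I'}

theorem inclusion_isometry (hG : Function.Injective G) :
    ((1 : Matrix I' I' ℂ).submatrix id G)ᴴ * (1 : Matrix I' I' ℂ).submatrix id G = 1 := by
  ext i j
  simp [Matrix.mul_apply, Matrix.one_apply, hG.eq_iff, eq_comm]

theorem mul_inclusion (X : Matrix I' I' ℂ) :
    X * (1 : Matrix I' I' ℂ).submatrix id G = X.submatrix id G := by
  ext i j
  simp [Matrix.mul_apply, Matrix.one_apply]

theorem emb_mul (hG : Function.Injective G) (K L : Matrix I I ℂ) :
    emb G (K * L) = emb G K * emb G L := by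
  have h := inclusion_isometry hG
  set J := (1 : Matrix I' I' ℂ).submatrix id G
  have h' : J * K * Jᴴ * (J * L * Jᴴ) = J * K * (Jᴴ * J) * L * Jᴴ := by
    simp only [Matrix.mul_assoc]
  rw [emb, emb, emb, h', h, Matrix.mul_one, Matrix.mul_assoc J K L]

theorem emb_conjTranspose (K : Matrix I I ℂ) : emb G Kᴴ = (emb G K)ᴴ := by
  simp only [emb, Matrix.conjTranspose_mul, Matrix.conjTranspose_conjTranspose, Matrix.mul_assoc]

theorem emb_zero : emb G 0 = 0 := by simp [emb]

theorem emb_add (K L : Matrix I I ℂ) : emb G (K + L) = emb G K + emb G L := by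
  simp [emb, Matrix.mul_add, Matrix.add_mul]

theorem emb_sum {O : Type} (s : Finset O) (K : O → Matrix I I ℂ) :
    emb G (∑ o ∈ s, K o) = ∑ o ∈ s, emb G (K o) := by
  simp [emb, Matrix.mul_sum, Matrix.sum_mul]

theorem emb_posSemidef {K : Matrix I I ℂ} (h : K.PosSemidef) : (emb G K).PosSemidef :=
  h.mul_mul_conjTranspose_same _

theorem emb_apply (hG : Function.Injective G) (K : Matrix I I ℂ) (i j : I) :
    emb G K (G i) (G j) = K i j := by
  simp [emb, Matrix.mul_apply, Matrix.one_apply, hG.eq_iff]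

theorem emb_apply_left (K : Matrix I I ℂ) {i : I'} (hi : i ∉ Set.range G) (j : I') :
    emb G K i j = 0 := by
  have : ∀ x, i ≠ G x := fun x h => hi ⟨x, h.symm⟩
  simp [emb, Matrix.mul_apply, Matrix.one_apply, this]

theorem emb_apply_right (K : Matrix I I ℂ) (i : I') {j : I'} (hj : j ∉ Set.range G) :
    emb G K i j = 0 := by
  have : ∀ x, G x ≠ j := fun x h => hj ⟨x, h⟩
  simp [emb, Matrix.mul_apply, Matrix.one_apply, this]

theorem eq_emb (hG : Function.Injective G) {X : Matrix I' I' ℂ} {K : Matrix I I ℂ}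
    (h : ∀ i j, X (G i) (G j) = K i j) (hl : ∀ i ∉ Set.range G, ∀ j, X i j = 0)
    (hr : ∀ i, ∀ j ∉ Set.range G, X i j = 0) : X = emb G K := by
  ext i j
  by_cases hi : i ∈ Set.range G
  · by_cases hj : j ∈ Set.range G
    · obtain ⟨i, rfl⟩ := hi
      obtain ⟨j, rfl⟩ := hj
      rw [h, emb_apply hG]
    · rw [hr _ _ hj, emb_apply_right _ _ hj]
  · rw [hl _ hi, emb_apply_left _ hi]

theorem mul_inclusion_eq (hG : Function.Injective G) {X : Matrix I' I' ℂ} {K : Matrix I I ℂ}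
    (h : ∀ i j, X (G i) (G j) = K i j) (hl : ∀ i ∉ Set.range G, ∀ j, X i (G j) = 0) :
    X * (1 : Matrix I' I' ℂ).submatrix id G = (1 : Matrix I' I' ℂ).submatrix id G * K := by
  rw [mul_inclusion]
  ext i j
  by_cases hi : i ∈ Set.range G
  · obtain ⟨i, rfl⟩ := hi
    simp [Matrix.mul_apply, Matrix.one_apply, hG.eq_iff, h]
  · have : ∀ x, i ≠ G x := fun x h => hi ⟨x, h.symm⟩
    simp [Matrix.mul_apply, this, hl _ hi]

/-- The hypotheses say that `X` maps the span of the image of `G` into itself and acts there as `K`;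
what `X` does elsewhere is irrelevant for states supported on that subspace. -/
theorem conj_emb (hG : Function.Injective G) {X : Matrix I' I' ℂ} {K : Matrix I I ℂ}
    (h : ∀ i j, X (G i) (G j) = K i j) (hl : ∀ i ∉ Set.range G, ∀ j, X i (G j) = 0)
    (ρ : Matrix I I ℂ) : X * emb G ρ * Xᴴ = emb G (K * ρ * Kᴴ) := by
  have h := mul_inclusion_eq hG h hl
  have h' := congrArg Matrix.conjTranspose h
  simp only [Matrix.conjTranspose_mul] at h'
  rw [emb, emb, ← Matrix.mul_assoc, ← Matrix.mul_assoc, h, Matrix.mul_assoc _ _ Xᴴ, h']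
  simp only [Matrix.mul_assoc]

theorem trace_mul_emb (X : Matrix I' I' ℂ) (ρ : Matrix I I ℂ) :
    (X * emb G ρ).trace = (X.submatrix G G * ρ).trace := by
  rw [emb, ← Matrix.mul_assoc, Matrix.trace_mul_comm, ← Matrix.mul_assoc, ← Matrix.mul_assoc,
    Matrix.mul_assoc _ X, mul_inclusion]
  congr 2
  ext i j
  simp [Matrix.mul_apply, Matrix.one_apply]

theorem trace_emb (hG : Function.Injective G) (ρ : Matrix I I ℂ) :
    (emb G ρ).trace = ρ.trace := by
  have := trace_mul_emb (G := G) 1 ρ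
  rwa [one_mul, Matrix.submatrix_one _ hG, one_mul] at this

/-- `emb` as a homomorphism. -/
def embHom (G : I → I') : Matrix I I ℂ →+ Matrix I' I' ℂ where
  toFun := emb G
  map_zero' := emb_zero
  map_add' := emb_add

/-- A Kraus family that leaves a subspace invariant stays complete when it is compressed to that
subspace. Without the invariance, part of the norm would be lost in the compression. -/
theorem sum_conj_submatrix {O : Type} [Fintype O] (hG : Function.Injective G)
    {X : O → Matrix I' I' ℂ} (hl : ∀ o, ∀ i ∉ Set.range G, ∀ j, X o i (G j) = 0)
    (hX : ∑ o, (X o)ᴴ * X o = 1) :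
    ∑ o, ((X o).submatrix G G)ᴴ * (X o).submatrix G G = 1 := by
  have key : ∀ o, ((X o).submatrix G G)ᴴ * (X o).submatrix G G = ((X o)ᴴ * X o).submatrix G G := by
    intro o
    ext i j
    simp only [Matrix.mul_apply, Matrix.submatrix_apply, Matrix.conjTranspose_apply]
    refine Fintype.sum_of_injective G hG _ _ (fun k hk => ?_) fun k => rfl
    rw [hl o k hk j, mul_zero]
  simp only [key]
  rw [← Matrix.submatrix_one _ hG, ← hX]
  ext i j
  simp [Matrix.sum_apply]

end Emb

/-! ### Carrying strategies over to larger alphabets -/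

/-- Larger alphabets `C'`, `M'` of public symbols and quantum messages: a symbol `c` is encoded as
`enc c`, and `M'` consists of copies of `M`. -/
structure Extension (C M C' M' : Type) where
  F : Type
  [fintypeF : Fintype F]
  [decEqF : DecidableEq F]
  f₀ : F
  fib : M' ≃ M × F
  dec : C' → C
  enc : C → C'
  dec_enc : ∀ c, dec (enc c) = c

attribute [instance] Extension.fintypeF Extension.decEqF

section

variable {C M C' M' : Type} [Fintype C] [Fintype M] [DecidableEq M] [Fintype C'] [Fintype M']
  [DecidableEq M'] (X : Extension C M C' M')

namespace Extension

theorem enc_injective : Function.Injective X.enc := Function.LeftInverse.injective X.dec_enc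

/-- A message over the large alphabet as a message over the small one, and its copy. -/
def split : Option M' → Option M × X.F
  | none => (none, X.f₀)
  | some m => (some (X.fib m).1, (X.fib m).2)

theorem split_injective : Function.Injective X.split := by
  rintro (_ | m) (_ | m') h
  · rfl
  · simp [split] at h
  · simp [split] at h
  · simp only [split, Prod.mk.injEq, Option.some.injEq] at h
    exact congrArg some (X.fib.injective (Prod.ext h.1 h.2))

/-- Splitting the message next to a private register. -/
def splitReg (Q : Type) (i : Q × Option M') : (Q × Option M) × X.F :=
  ((i.1, (X.split i.2).1), (X.split i.2).2)

theorem splitReg_injective (Q : Type) : Function.Injective (X.splitReg Q) := by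
  rintro ⟨q, m⟩ ⟨q', m'⟩ h
  simp only [splitReg, Prod.mk.injEq] at h
  exact Prod.ext h.1.1 (X.split_injective (Prod.ext h.1.2 h.2))

/-- There is only one blank message, which is given the label `f₀`; hence the vectors missed by the
splitting are the blanks with any other label. -/
theorem not_range_splitReg {Q : Type} {i : (Q × Option M) × X.F}
    (h : i ∉ Set.range (X.splitReg Q)) : i.1.2 = none ∧ i.2 ≠ X.f₀ := by
  obtain ⟨⟨q, m⟩, f⟩ := i
  rcases m with _ | m
  · refine ⟨rfl, fun hf => h ⟨(q, none), ?_⟩⟩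
    simp only at hf
    simp [splitReg, split, hf]
  · exact absurd ⟨(q, some (X.fib.symm (m, f))), by simp [splitReg, split]⟩ h

/-- An operator acting on messages over the large alphabet, the copy being left alone. -/
def liftOp {Q : Type} (K : Matrix (Q × Option M) (Q × Option M) ℂ) :
    Matrix (Q × Option M') (Q × Option M') ℂ :=
  (Matrix.kroneckerMap (· * ·) K (1 : Matrix X.F X.F ℂ)).submatrix (X.splitReg Q) (X.splitReg Q)

theorem liftOp_apply {Q : Type} (K : Matrix (Q × Option M) (Q × Option M) ℂ) (i j) :
    X.liftOp K i j = K (i.1, (X.split i.2).1) (j.1, (X.split j.2).1) *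
      (1 : Matrix X.F X.F ℂ) (X.split i.2).2 (X.split j.2).2 := rfl

theorem liftOp_mk {Q : Type} (K : Matrix (Q × Option M) (Q × Option M) ℂ) (q m q' m') :
    X.liftOp K (q, m) (q', m') = K (q, (X.split m).1) (q', (X.split m').1) *
      (1 : Matrix X.F X.F ℂ) (X.split m).2 (X.split m').2 := rfl

/-- The missing vectors cannot be reached: a genuine message is never turned into a blank, and the
blank has the label `f₀`, which is left alone. So loss-freeness is what makes `K ⊗ 1` act on the
messages of the large alphabet, and it is used here for the completeness of the lifted instrument.
-/
theorem kron_splitReg_eq_zero {Q : Type} {K : Matrix (Q × Option M) (Q × Option M) ℂ}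
    (hK : ∀ q q' m, K (q', none) (q, some m) = 0) {i : (Q × Option M) × X.F}
    (hi : i ∉ Set.range (X.splitReg Q)) (j) :
    Matrix.kroneckerMap (· * ·) K (1 : Matrix X.F X.F ℂ) i (X.splitReg Q j) = 0 := by
  obtain ⟨h1, h2⟩ := X.not_range_splitReg hi
  obtain ⟨⟨q, m⟩, f⟩ := i
  simp only at h1 h2
  subst h1
  obtain ⟨q', _ | m'⟩ := j
  · simp [splitReg, split, h2]
  · simp [splitReg, split, hK]

end Extension

variable {X}

/-- The symbol outcomes of the small protocol among those of the large one. -/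
def encOutcome (X : Extension C M C' M') {R : Type} (o : R × Option C) : R × Option C' :=
  (o.1, o.2.map X.enc)

theorem encOutcome_injective {R : Type} :
    Function.Injective (encOutcome X : R × Option C → R × Option C') := by
  rintro ⟨r, s⟩ ⟨r', s'⟩ h
  simp only [encOutcome, Prod.mk.injEq] at h
  exact Prod.ext h.1 (Option.map_injective X.enc_injective h.2)

/-- The operators of a strategy carried over to larger alphabets. -/
def Strategy.liftedOp (S : Strategy C M) (X : Extension C M C' M') (r : List S.R)
    (τ : List (Option C')) : S.R × Option C' → Matrix (S.Q × Option M') (S.Q × Option M') ℂ :=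
  extendOp (encOutcome X) fun o => X.liftOp (S.op r (τ.map (Option.map X.dec)) o)

/-- A strategy carried over to larger alphabets. -/
abbrev Strategy.lift (S : Strategy C M) (X : Extension C M C' M') (hS : S.LossFree) :
    Strategy C' M' where
  Q := S.Q
  R := S.R
  init := S.init
  init_posSemidef := S.init_posSemidef
  init_trace := S.init_trace
  op := S.liftedOp X
  op_complete r τ := by
    rw [Strategy.liftedOp, sum_extendOp encOutcome_injective]
    refine sum_conj_submatrix (X := fun o => Matrix.kroneckerMap (· * ·)
      (S.op r (τ.map (Option.map X.dec)) o) (1 : Matrix X.F X.F ℂ)) (X.splitReg_injective _)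
      (fun o i hi j => X.kron_splitReg_eq_zero (fun q q' m => (hS _ _ _ _ _ _).2) hi j) ?_
    simp only [Matrix.conjTranspose_kronecker, ← Matrix.mul_kronecker_mul, Matrix.conjTranspose_one,
      one_mul]
    have h1 : (1 : Matrix ((S.Q × Option M) × X.F) ((S.Q × Option M) × X.F) ℂ) =
      Matrix.kroneckerMap (· * ·) 1 1 := Matrix.one_kronecker_one.symm
    rw [h1, ← S.op_complete r (τ.map (Option.map X.dec))]
    ext i j
    simp [Matrix.sum_apply, Finset.sum_mul]

theorem Strategy.lift_lossFree {S : Strategy C M} (hS : S.LossFree) : (S.lift X hS).LossFree := by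
  intro r τ o q q' m
  simp only [Strategy.liftedOp]
  rcases extendOp_cases (encOutcome_injective (X := X))
    (fun o => X.liftOp (S.op r (τ.map (Option.map X.dec)) o)) o with h | ⟨o, rfl, h⟩
  · simp [h]
  · have := hS r (τ.map (Option.map X.dec)) o q q' (X.fib m).1
    simp only [h, Extension.liftOp_apply]
    refine ⟨fun ho k => ?_, ?_⟩
    · rw [Extension.split, this.1 (by simpa [encOutcome] using ho), zero_mul]
    · rw [Extension.split, Extension.split, this.2, zero_mul]

/-- The order of turns carried over to larger alphabets. -/
def liftNext (X : Extension C M C' M') (next : List (Option C) → Option Party)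
    (τ : List (Option C')) : Option Party := next (τ.map (Option.map X.dec))

/-- The inclusion of the small message space as the distinguished copy. -/
def Extension.incl (X : Extension C M C' M') : Option M → Option M' :=
  Option.map fun m => X.fib.symm (m, X.f₀)

theorem Extension.split_incl (m : Option M) : X.split (X.incl m) = (m, X.f₀) := by
  cases m <;> simp [incl, split]

theorem Extension.incl_injective : Function.Injective X.incl := fun m m' h => by
  have := congrArg X.split h
  simp only [split_incl, Prod.mk.injEq, and_true] at this
  exact this

theorem Extension.mem_range_incl {m : Option M'} : m ∈ Set.range X.incl ↔ (X.split m).2 = X.f₀ := by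
  constructor
  · rintro ⟨m, rfl⟩; rw [split_incl]
  · intro h
    refine ⟨(X.split m).1, X.split_injective ?_⟩
    rw [split_incl, ← h]

/-- The inclusion of joint spaces. -/
def Extension.inclJoint (X : Extension C M C' M') (QA QB : Type) (i : QA × Option M × QB) :
    QA × Option M' × QB := (i.1, X.incl i.2.1, i.2.2)

theorem Extension.inclJoint_injective (QA QB : Type) :
    Function.Injective (X.inclJoint QA QB) := by
  rintro ⟨a, m, b⟩ ⟨a', m', b'⟩ h
  simp only [inclJoint, Prod.mk.injEq] at h
  simp only [Prod.mk.injEq]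
  exact ⟨h.1, X.incl_injective h.2.1, h.2.2⟩

theorem Extension.not_range_inclJoint {QA QB : Type} {i : QA × Option M' × QB}
    (h : i ∉ Set.range (X.inclJoint QA QB)) : (X.split i.2.1).2 ≠ X.f₀ := fun hf => by
  obtain ⟨m, hm⟩ := X.mem_range_incl.mpr hf
  exact h ⟨(i.1, m, i.2.2), by simp [inclJoint, hm]⟩

section

variable {A B : Strategy C M} {hA : A.LossFree} {hB : B.LossFree}

/-- The lifted operators leave the label of the message alone, so states supported on the copy with
label `f₀` stay there. -/
theorem stepA_lift (K : Matrix (A.Q × Option M) (A.Q × Option M) ℂ) (ρ : Joint A B) :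
    stepA (A.lift X hA) (B.lift X hB) (X.liftOp K) (emb (X.inclJoint A.Q B.Q) ρ) =
      emb (X.inclJoint A.Q B.Q) (stepA A B K ρ) := by
  refine conj_emb (X.inclJoint_injective _ _) (fun i j => ?_) (fun i hi j => ?_) ρ
  · change X.liftOp K (i.1, X.incl i.2.1) (j.1, X.incl j.2.1) * (1 : Matrix B.Q B.Q ℂ) i.2.2 j.2.2 =
      K (i.1, i.2.1) (j.1, j.2.1) * (1 : Matrix B.Q B.Q ℂ) i.2.2 j.2.2
    rw [Extension.liftOp_mk, X.split_incl, X.split_incl, Matrix.one_apply_eq, mul_one]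
  · have := X.not_range_inclJoint hi
    change X.liftOp K (i.1, i.2.1) (j.1, X.incl j.2.1) * (1 : Matrix B.Q B.Q ℂ) i.2.2 j.2.2 = 0
    rw [Extension.liftOp_mk, X.split_incl, Matrix.one_apply_ne this, mul_zero, zero_mul]

theorem stepB_lift (K : Matrix (B.Q × Option M) (B.Q × Option M) ℂ) (ρ : Joint A B) :
    stepB (A.lift X hA) (B.lift X hB) (X.liftOp K) (emb (X.inclJoint A.Q B.Q) ρ) =
      emb (X.inclJoint A.Q B.Q) (stepB A B K ρ) := by
  refine conj_emb (X.inclJoint_injective _ _) (fun i j => ?_) (fun i hi j => ?_) ρ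
  · change X.liftOp K (i.2.2, X.incl i.2.1) (j.2.2, X.incl j.2.1) * (1 : Matrix A.Q A.Q ℂ) i.1 j.1 =
      K (i.2.2, i.2.1) (j.2.2, j.2.1) * (1 : Matrix A.Q A.Q ℂ) i.1 j.1
    rw [Extension.liftOp_mk, X.split_incl, X.split_incl, Matrix.one_apply_eq, mul_one]
  · have := X.not_range_inclJoint hi
    change X.liftOp K (i.2.2, i.2.1) (j.2.2, X.incl j.2.1) * (1 : Matrix A.Q A.Q ℂ) i.1 j.1 = 0
    rw [Extension.liftOp_mk, X.split_incl, Matrix.one_apply_ne this, mul_zero, zero_mul]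

theorem sum_incl {g : Option M' → ℂ} (h : ∀ m, m ∉ Set.range X.incl → g m = 0) :
    ∑ m, g m = ∑ m, g (X.incl m) :=
  (Fintype.sum_of_injective X.incl X.incl_injective _ _ h fun _ => rfl).symm

theorem lose_lift (ρ : Joint A B) :
    lose (A.lift X hA) (B.lift X hB) (emb (X.inclJoint A.Q B.Q) ρ) =
      emb (X.inclJoint A.Q B.Q) (lose A B ρ) := by
  have hr : ∀ {i : A.Q × Option M' × B.Q}, i ∉ Set.range (X.inclJoint A.Q B.Q) → none ≠ i.2.1 := by
    intro i hi h
    apply X.not_range_inclJoint hi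
    rw [← h]; rfl
  have hn : ∀ m : Option M, (none = X.incl m) ↔ none = m := by
    intro m; cases m <;> simp [Extension.incl]
  refine eq_emb (X.inclJoint_injective _ _) (fun i j => ?_) (fun i hi j => ?_) fun i j hj => ?_
  · have : ∑ k : Option M', emb (X.inclJoint A.Q B.Q) ρ (i.1, k, i.2.2) (j.1, k, j.2.2) =
        ∑ k : Option M, ρ (i.1, k, i.2.2) (j.1, k, j.2.2) := by
      rw [sum_incl (X := X)]
      · exact Finset.sum_congr rfl fun k _ =>
          emb_apply (X.inclJoint_injective A.Q B.Q) ρ (i.1, k, i.2.2) (j.1, k, j.2.2)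
      · intro m hm
        refine emb_apply_left _ (fun ⟨x, hx⟩ => hm ⟨x.2.1, ?_⟩) _
        exact congrArg (fun y => y.2.1) hx
    simp only [lose, Matrix.of_apply, Matrix.single_apply, Extension.inclJoint, hn]
    exact congrArg _ this
  · simp only [lose, Matrix.of_apply, Matrix.single_apply, hr hi, false_and, if_false, zero_mul]
  · simp only [lose, Matrix.of_apply, Matrix.single_apply, hr hj, and_false, if_false, zero_mul]

theorem chan_lift (l : Bool) (ρ : Joint A B) :
    chan (A.lift X hA) (B.lift X hB) l (emb (X.inclJoint A.Q B.Q) ρ) =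
      emb (X.inclJoint A.Q B.Q) (chan A B l ρ) := by
  cases l
  · rfl
  · exact lose_lift ρ

theorem start_lift (m₀ : M) :
    start (A.lift X hA) (B.lift X hB) (X.fib.symm (m₀, X.f₀)) =
      emb (X.inclJoint A.Q B.Q) (start A B m₀) := by
  have hi : ∀ m : Option M, (some (X.fib.symm (m₀, X.f₀)) = X.incl m) ↔ some m₀ = m := by
    intro m
    rw [show some (X.fib.symm (m₀, X.f₀)) = X.incl (some m₀) from rfl, X.incl_injective.eq_iff]
  have hr : ∀ {i : A.Q × Option M' × B.Q}, i ∉ Set.range (X.inclJoint A.Q B.Q) →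
      some (X.fib.symm (m₀, X.f₀)) ≠ i.2.1 := by
    intro i hi h
    apply X.not_range_inclJoint hi
    rw [← h]; simp [Extension.split]
  refine eq_emb (X.inclJoint_injective _ _) (fun i j => ?_) (fun i hi j => ?_) fun i j hj => ?_
  · simp only [start, Matrix.of_apply, Matrix.single_apply, Extension.inclJoint, hi]
  · simp only [start, Matrix.of_apply, Matrix.single_apply, hr hi, false_and, if_false, zero_mul,
      mul_zero]
  · simp only [start, Matrix.of_apply, Matrix.single_apply, hr hj, and_false, if_false, zero_mul,
      mul_zero]

theorem map_dec_map_enc (X : Extension C M C' M') (τ : List (Option C)) :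
    (τ.map (Option.map X.enc)).map (Option.map X.dec) = τ := by
  have : Option.map X.dec ∘ Option.map X.enc = id := by
    funext s; cases s <;> simp [X.dec_enc]
  rw [List.map_map, this, List.map_id]

/-- A lost message becomes the blank, which belongs to the copy `f₀` as well. Between two lifted
strategies the comparison therefore holds for every pattern of losses. -/
theorem run_lift {next : List (Option C) → Option Party} {loss : ℕ → Bool} {N : Type}
    [AddCommMonoid N] {f : List A.R → List B.R → List (Option C') →
      Joint (A.lift X hA) (B.lift X hB) → N}
    (hf : ∀ rA rB τ, f rA rB τ 0 = 0) (n : ℕ) (rA rB τ) (ρ : Joint A B) :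
    run (liftNext X next) (A.lift X hA) (B.lift X hB) loss f n rA rB (τ.map (Option.map X.enc))
      (emb (X.inclJoint A.Q B.Q) ρ) =
    run next A B loss (fun rA rB τ ρ => f rA rB (τ.map (Option.map X.enc))
      (emb (X.inclJoint A.Q B.Q) ρ)) n rA rB τ ρ := by
  symm
  refine run_sim (A := A) (B := B) (A' := A.lift X hA) (B' := B.lift X hB)
    (n + τ.length) 0 (fun rA rB τ ρ rA' rB' τ' ρ' => rA' = rA ∧ rB' = rB ∧
    τ' = τ.map (Option.map X.enc) ∧ ρ' = emb (X.inclJoint A.Q B.Q) ρ) ?_ ?_ ?_ ?_ ?_ ?_ n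
    _ _ _ _ _ _ _ _ ⟨rfl, rfl, rfl, rfl⟩ rfl
  · intros; rw [emb_zero, hf]
  · intros; apply hf
  · rintro n rA rB τ ρ _ _ _ _ ⟨rfl, rfl, rfl, rfl⟩ - h
    rw [run_over (by rwa [liftNext, map_dec_map_enc])]
  · rintro p rA rB τ ρ _ _ _ _ ⟨rfl, rfl, rfl, rfl⟩ h
    have : liftNext X next (τ.map (Option.map X.enc)) = some p := by rwa [liftNext, map_dec_map_enc]
    exact ⟨this, run_zero_alive this _ _ _⟩
  · rintro rA rB τ ρ rA' rB' _ _ ⟨rfl, rfl, rfl, rfl⟩ h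
    refine Matched.of_injective (encOutcome X) encOutcome_injective (fun o' ho => ?_) fun o => ?_
    · simp only [Strategy.liftedOp, extendOp_zero _ ho]
      exact stepA_zero _
    · refine ⟨rfl, rfl, by simp [encOutcome], ?_⟩
      have : (A.lift X hA).op rA' (τ.map (Option.map X.enc)) (encOutcome X o) =
          X.liftOp (A.op rA' τ o) := by
        simp only [Strategy.liftedOp, extendOp_apply encOutcome_injective, map_dec_map_enc]
      rw [this, stepA_lift, chan_lift, List.length_map]
  · rintro rA rB τ ρ rA' rB' _ _ ⟨rfl, rfl, rfl, rfl⟩ h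
    refine Matched.of_injective (encOutcome X) encOutcome_injective (fun o' ho => ?_) fun o => ?_
    · simp only [Strategy.liftedOp, extendOp_zero _ ho]
      exact stepB_zero _
    · refine ⟨rfl, rfl, by simp [encOutcome], ?_⟩
      have : (B.lift X hB).op rB' (τ.map (Option.map X.enc)) (encOutcome X o) =
          X.liftOp (B.op rB' τ o) := by
        simp only [Strategy.liftedOp, extendOp_apply encOutcome_injective, map_dec_map_enc]
      rw [this, stepB_lift, chan_lift, List.length_map]

end

end

/-! ### Simulating a dishonest player who uses the larger alphabets -/

section

variable {C M C' M' : Type} [Fintype C] [Fintype M] [DecidableEq M] [Fintype C'] [Fintype M']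
  [DecidableEq M'] (X : Extension C M C' M')

/-- The splitting of a message, the copy being kept in the private register. -/
def Extension.store (Q : Type) (i : Q × Option M') : (Q × X.F) × Option M :=
  ((i.1, (X.split i.2).2), (X.split i.2).1)

theorem Extension.store_injective (Q : Type) : Function.Injective (X.store Q) := by
  rintro ⟨q, m⟩ ⟨q', m'⟩ h
  simp only [store, Prod.mk.injEq] at h
  exact Prod.ext h.1.1 (X.split_injective (Prod.ext h.2 h.1.2))

theorem Extension.not_range_store {Q : Type} {i : (Q × X.F) × Option M}
    (h : i ∉ Set.range (X.store Q)) : i.2 = none ∧ i.1.2 ≠ X.f₀ :=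
  X.not_range_splitReg (i := ((i.1.1, i.2), i.1.2)) fun ⟨j, hj⟩ => h ⟨j, by
    simp only [splitReg, Prod.mk.injEq] at hj
    exact Prod.ext (Prod.ext hj.1.1 hj.2) hj.1.2⟩

/-- The transcript over the large alphabet, from the record of the party of the role of Alice, who
remembers the symbols sent by her. -/
def recoverTranscript (next : List (Option C) → Option Party) {R : Type} :
    List (Option (R × Option C')) → List (Option C) → List (Option C')
  | _, [] => []
  | r, c :: τ =>
    match next τ, r with
    | some Party.alice, some (_, s) :: r' => s :: recoverTranscript next r' τ
    | _, r => c.map X.enc :: recoverTranscript next r τ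

/-- The outcomes over the large alphabet as outcomes over the small one. -/
def decOutcome {R : Type} (o : R × Option C') : R × Option C := (o.1, o.2.map X.dec)

theorem decOutcome_encOutcome {R : Type} (o : R × Option C) :
    decOutcome X (encOutcome X o) = o := by
  obtain ⟨r, _ | s⟩ := o <;> simp [decOutcome, encOutcome, X.dec_enc]

/-- The outcomes of a simulated strategy. -/
def simOutcome {R : Type} : (R × Option C') ⊕ Unit → Option (R × Option C') × Option C
  | .inl o => (some o, o.2.map X.dec)
  | .inr _ => (none, none)

theorem simOutcome_injective {R : Type} :
    Function.Injective (simOutcome X : (R × Option C') ⊕ Unit → _) := by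
  rintro (o | _) (o' | _) h <;> simp_all [simOutcome]

/-- The operators of a strategy over the large alphabets, on messages over the small ones. -/
def Strategy.simOp (E : Strategy C' M') (r : List E.R) (τ : List (Option C')) :
    (E.R × Option C') ⊕ Unit → Matrix ((E.Q × X.F) × Option M) ((E.Q × X.F) × Option M) ℂ :=
  Sum.elim (fun o => emb (X.store E.Q) (E.op r τ o)) fun _ => 1 - emb (X.store E.Q) 1

/-- `1 - emb G 1` is the projection onto the complement of the image of `G`. It serves as its own
Kraus operator for the additional outcome of a simulated move, and it is positive, as needed for the
effects of the simulated guess. -/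
theorem sub_emb_one {I I' : Type} [Fintype I] [Fintype I'] [DecidableEq I] [DecidableEq I']
    {G : I → I'} (hG : Function.Injective G) :
    (1 - emb G (1 : Matrix I I ℂ))ᴴ * (1 - emb G 1) = 1 - emb G 1 := by
  have h1 : (emb G (1 : Matrix I I ℂ))ᴴ = emb G 1 := by
    rw [← emb_conjTranspose, Matrix.conjTranspose_one]
  have h2 : emb G (1 : Matrix I I ℂ) * emb G 1 = emb G 1 := by rw [← emb_mul hG, one_mul]
  rw [Matrix.conjTranspose_sub, Matrix.conjTranspose_one, h1, sub_mul, one_mul, mul_sub, mul_one, h2]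
  simp

/-- The operators of the simulation of a strategy over the large alphabets. -/
def Strategy.simulatedOp (E : Strategy C' M') (next : List (Option C) → Option Party)
    (r : List (Option (E.R × Option C'))) (τ : List (Option C)) :
    Option (E.R × Option C') × Option C →
      Matrix ((E.Q × X.F) × Option M) ((E.Q × X.F) × Option M) ℂ :=
  extendOp (simOutcome X)
    (E.simOp X (r.reduceOption.map Prod.fst) (recoverTranscript X next r τ))

/-- A strategy over the large alphabets simulated over the small ones. -/
abbrev Strategy.simulate (E : Strategy C' M') (next : List (Option C) → Option Party) :
    Strategy C M where
  Q := E.Q × X.F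
  R := Option (E.R × Option C')
  init := Matrix.kroneckerMap (· * ·) E.init (Matrix.single X.f₀ X.f₀ 1)
  init_posSemidef := E.init_posSemidef.kronecker (posSemidef_single _)
  init_trace := by rw [Matrix.trace_kronecker, E.init_trace, Matrix.trace_single_eq_same, one_mul]
  op := E.simulatedOp X next
  op_complete r τ := by
    rw [Strategy.simulatedOp, sum_extendOp (simOutcome_injective X), Fintype.sum_sum_type]
    simp only [Strategy.simOp, Sum.elim_inl, Sum.elim_inr, ← emb_conjTranspose,
      ← emb_mul (X.store_injective E.Q), ← emb_sum, E.op_complete]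
    rw [Fintype.univ_punit, Finset.sum_singleton, sub_emb_one (X.store_injective E.Q)]
    simp

/-- A guesser over the large alphabets simulated over the small ones. -/
abbrev Guesser.simulate (E : Guesser C' M') (next : List (Option C) → Option Party) :
    Guesser C M where
  toStrategy := E.toStrategy.simulate X next
  eff r τ g := emb (X.store E.Q)
    (E.eff (r.reduceOption.map Prod.fst) (recoverTranscript X next r τ) g) +
      -- The complement of the image of `store` is never populated; it is assigned to the guess
      -- `true` only to make the two effects add up to one.
      if g then 1 - emb (X.store E.Q) 1 else 0
  eff_posSemidef r τ g := by
    refine (emb_posSemidef (E.eff_posSemidef _ _ _)).add ?_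
    split
    · rw [← sub_emb_one (X.store_injective E.Q)]
      exact Matrix.posSemidef_conjTranspose_mul_self _
    · exact Matrix.PosSemidef.zero
  eff_sum r τ := by
    simp only [Bool.false_eq_true, if_false, if_true, add_zero]
    rw [← add_assoc, ← emb_add, E.eff_sum, add_sub_cancel]

/-- The inclusion of joint spaces for a simulated strategy. -/
def Extension.storeJoint (QA QB : Type) (i : QA × Option M' × QB) :
    (QA × X.F) × Option M × QB := ((i.1, (X.split i.2.1).2), (X.split i.2.1).1, i.2.2)

variable {X}

theorem Extension.storeJoint_injective (QA QB : Type) :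
    Function.Injective (X.storeJoint QA QB) := by
  rintro ⟨a, m, b⟩ ⟨a', m', b'⟩ h
  simp only [storeJoint, Prod.mk.injEq] at h
  simp only [Prod.mk.injEq]
  exact ⟨h.1.1, X.split_injective (Prod.ext h.2.1 h.1.2), h.2.2⟩

theorem Extension.not_range_storeJoint {QA QB : Type} {i : (QA × X.F) × Option M × QB}
    (h : i ∉ Set.range (X.storeJoint QA QB)) : i.2.1 = none ∧ i.1.2 ≠ X.f₀ :=
  X.not_range_store (i := (i.1, i.2.1)) fun ⟨j, hj⟩ => h ⟨(j.1, j.2, i.2.2), by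
    simp only [store, Prod.mk.injEq] at hj
    exact Prod.ext hj.1 (Prod.ext hj.2 rfl)⟩

theorem Extension.not_range_store_of {QA QB : Type} {i : (QA × X.F) × Option M × QB}
    (h : i ∉ Set.range (X.storeJoint QA QB)) : (i.1, i.2.1) ∉ Set.range (X.store QA) :=
  fun ⟨j, hj⟩ => h ⟨(j.1, j.2, i.2.2), by
    simp only [store, Prod.mk.injEq] at hj
    exact Prod.ext hj.1 (Prod.ext hj.2 rfl)⟩

variable {E : Strategy C' M'} {B : Strategy C M} {hB : B.LossFree}
  {next : List (Option C) → Option Party}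

theorem stepA_simulate (K : Matrix (E.Q × Option M') (E.Q × Option M') ℂ)
    (ρ : Joint E (B.lift X hB)) :
    stepA (E.simulate X next) B (emb (X.store E.Q) K) (emb (X.storeJoint E.Q B.Q) ρ) =
      emb (X.storeJoint E.Q B.Q) (stepA E (B.lift X hB) K ρ) := by
  refine conj_emb (X.storeJoint_injective _ _) (fun i j => ?_) (fun i hi j => ?_) ρ
  · change emb (X.store E.Q) K (X.store E.Q (i.1, i.2.1)) (X.store E.Q (j.1, j.2.1)) *
      (1 : Matrix B.Q B.Q ℂ) i.2.2 j.2.2 = _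
    rw [emb_apply (X.store_injective _)]
    rfl
  · change emb (X.store E.Q) K (i.1, i.2.1) (X.store E.Q (j.1, j.2.1)) *
      (1 : Matrix B.Q B.Q ℂ) i.2.2 j.2.2 = _
    rw [emb_apply_left _ (X.not_range_store_of hi), zero_mul]

/-- The simulation never leaves the image of the larger space, so the padding outcome has weight
zero; in particular the declaration of a loss attached to it is never made. -/
theorem stepA_simulate_compl (ρ : Joint E (B.lift X hB)) :
    stepA (E.simulate X next) B (1 - emb (X.store E.Q) 1) (emb (X.storeJoint E.Q B.Q) ρ) = 0 := by
  have := conj_emb (X.storeJoint_injective E.Q B.Q)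
    (X := liftA (E.simulate X next) B (1 - emb (X.store E.Q) 1)) (K := 0) (fun i j => ?_)
    (fun i hi j => ?_) ρ
  · rw [zero_mul, zero_mul, emb_zero] at this
    exact this
  · change ((1 : Matrix ((E.Q × X.F) × Option M) ((E.Q × X.F) × Option M) ℂ)
      (X.store E.Q (i.1, i.2.1)) (X.store E.Q (j.1, j.2.1)) -
      emb (X.store E.Q) 1 (X.store E.Q (i.1, i.2.1)) (X.store E.Q (j.1, j.2.1))) *
      (1 : Matrix B.Q B.Q ℂ) i.2.2 j.2.2 = 0
    rw [emb_apply (X.store_injective _)]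
    simp only [Matrix.one_apply, (X.store_injective _).eq_iff, sub_self, zero_mul]
  · change ((1 : Matrix ((E.Q × X.F) × Option M) ((E.Q × X.F) × Option M) ℂ)
      (i.1, i.2.1) (X.store E.Q (j.1, j.2.1)) -
      emb (X.store E.Q) 1 (i.1, i.2.1) (X.store E.Q (j.1, j.2.1))) *
      (1 : Matrix B.Q B.Q ℂ) i.2.2 j.2.2 = 0
    have h := X.not_range_store_of hi
    rw [emb_apply_left _ h, Matrix.one_apply_ne fun h' => h ⟨_, h'.symm⟩, sub_self, zero_mul]

/-- The honest player ignores the label, so the cheater may keep it in its own register while the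
honest player holds the message. The hypothesis on `K` excludes that a genuine message with a label
other than `f₀` becomes a blank. -/
theorem stepB_simulate (K : Matrix (B.Q × Option M) (B.Q × Option M) ℂ)
    (hK : ∀ q q' m, K (q', none) (q, some m) = 0) (ρ : Joint E (B.lift X hB)) :
    stepB (E.simulate X next) B K (emb (X.storeJoint E.Q B.Q) ρ) =
      emb (X.storeJoint E.Q B.Q) (stepB E (B.lift X hB) (X.liftOp K) ρ) := by
  refine conj_emb (X.storeJoint_injective _ _) (fun i j => ?_) (fun i hi j => ?_) ρ
  · change K (i.2.2, (X.split i.2.1).1) (j.2.2, (X.split j.2.1).1) *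
      (1 : Matrix (E.Q × X.F) (E.Q × X.F) ℂ) (i.1, (X.split i.2.1).2) (j.1, (X.split j.2.1).2) =
      X.liftOp K (i.2.2, i.2.1) (j.2.2, j.2.1) * (1 : Matrix E.Q E.Q ℂ) i.1 j.1
    rw [Extension.liftOp_mk]
    simp only [Matrix.one_apply, Prod.mk.injEq]
    by_cases h1 : i.1 = j.1 <;> by_cases h2 : (X.split i.2.1).2 = (X.split j.2.1).2 <;>
      simp [h1, h2]
  · change K (i.2.2, i.2.1) (j.2.2, (X.split j.2.1).1) *
      (1 : Matrix (E.Q × X.F) (E.Q × X.F) ℂ) i.1 (j.1, (X.split j.2.1).2) = 0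
    obtain ⟨h1, h2⟩ := X.not_range_storeJoint hi
    obtain ⟨a, _ | m, b⟩ := j
    · rw [Matrix.one_apply_ne, mul_zero]
      intro h
      apply h2
      rw [h]
      rfl
    · rw [h1]
      simp only [Extension.split, hK, zero_mul]

theorem start_simulate (m₀ : M) :
    start (E.simulate X next) B m₀ =
      emb (X.storeJoint E.Q B.Q) (start E (B.lift X hB) (X.fib.symm (m₀, X.f₀))) := by
  have hs : ∀ m : Option M', some (X.fib.symm (m₀, X.f₀)) = m ↔
      X.f₀ = (X.split m).2 ∧ some m₀ = (X.split m).1 := by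
    intro m
    rw [← X.split_injective.eq_iff]
    simp [Extension.split, Prod.ext_iff, and_comm]
  refine eq_emb (X.storeJoint_injective _ _) (fun i j => ?_) (fun i hi j => ?_) fun i j hj => ?_
  · simp only [start, Matrix.of_apply, Matrix.single_apply, Extension.storeJoint, hs,
      Matrix.kroneckerMap_apply]
    by_cases h1 : X.f₀ = (X.split i.2.1).2
    · by_cases h2 : X.f₀ = (X.split j.2.1).2
      · simp [← h1, ← h2]
      · simp [← h1, h2]
    · simp [h1]
  · obtain ⟨h1, h2⟩ := X.not_range_storeJoint hi
    simp [start, Matrix.single_apply, h1]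
  · obtain ⟨h1, h2⟩ := X.not_range_storeJoint hj
    simp [start, Matrix.single_apply, h1]

/-- The cheater recovers the transcript over the large alphabet by remembering its own symbols and
encoding those of the honest player, who utters encoded symbols only. The perfect channel matters: a
loss would erase the label over the large alphabet but not the stored one. -/
theorem run_simulate {N : Type} [AddCommMonoid N]
    {f : List (Option (E.R × Option C')) → List B.R → List (Option C) →
      Joint (E.simulate X next) B → N}
    {f' : List E.R → List B.R → List (Option C') → Joint E (B.lift X hB) → N}
    (hf' : ∀ rA rB τ, f' rA rB τ 0 = 0) (hf : ∀ rA rB τ, f rA rB τ 0 = 0)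
    (hff : ∀ rA rB τ ρ, (recoverTranscript X next rA τ).map (Option.map X.dec) = τ → f' (rA.reduceOption.map Prod.fst) rB (recoverTranscript X next rA τ) ρ =
      f rA rB τ (emb (X.storeJoint E.Q B.Q) ρ)) (n : ℕ) (ρ : Joint E (B.lift X hB)) :
    run (liftNext X next) E (B.lift X hB) noLoss f' n [] [] [] ρ =
      run next (E.simulate X next) B noLoss f n [] [] [] (emb (X.storeJoint E.Q B.Q) ρ) := by
  refine run_sim (A := E) (B := B.lift X hB) (A' := E.simulate X next) (B' := B) n 0
    (fun rA rB τ ρ rA' rB' τ' ρ' => rA = rA'.reduceOption.map Prod.fst ∧ rB = rB' ∧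
      τ = recoverTranscript X next rA' τ' ∧ τ' = τ.map (Option.map X.dec) ∧
      ρ' = emb (X.storeJoint E.Q B.Q) ρ) ?_ ?_ ?_ ?_ ?_ ?_ n
    _ _ _ _ _ _ _ _ ⟨rfl, rfl, rfl, rfl, rfl⟩ rfl
  · intros; apply hf'
  · intros; apply hf
  · rintro n rA rB τ ρ rA' rB' τ' ρ' ⟨h1, h2, h3, h4, h5⟩ - h
    rw [run_over (by rwa [h4]), h5, ← hff _ _ _ _ (by rw [← h3, ← h4]), h1, h2, h3]
  · rintro p rA rB τ ρ rA' rB' τ' ρ' ⟨h1, h2, h3, h4, h5⟩ h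
    have : next τ' = some p := by rwa [h4]
    exact ⟨this, run_zero_alive this _ _ _⟩
  · rintro rA rB τ ρ rA' rB' τ' ρ' ⟨h1, h2, h3, h4, h5⟩ h
    have hn : next τ' = some Party.alice := by rwa [h4]
    have hop : ∀ o, (E.simulate X next).op rA' τ' (simOutcome X o) = E.simOp X rA τ o := fun o => by
      simp only [Strategy.simulatedOp, extendOp_apply (simOutcome_injective X), h1, h3]
    refine Matched.of_injective (fun o => simOutcome X (Sum.inl o))
      ((simOutcome_injective X).comp Sum.inl_injective) (fun o' ho => ?_) fun o => ?_
    · by_cases ho' : o' = simOutcome X (Sum.inr ())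
      · rw [ho', hop, h5]
        exact stepA_simulate_compl ρ
      · simp only [Strategy.simulatedOp]
        rw [extendOp_zero, stepA_zero]
        rintro ⟨o | o, rfl⟩
        · exact ho ⟨o, rfl⟩
        · exact ho' rfl
    · rw [hop, h5]
      refine ⟨by simp [simOutcome, h1], h2, ?_, by simp [simOutcome, h4], ?_⟩
      · simp [simOutcome, recoverTranscript, hn, h3]
      · exact stepA_simulate _ _
  · rintro rA rB τ ρ rA' rB' τ' ρ' ⟨h1, h2, h3, h4, h5⟩ h
    have hn : next τ' = some Party.bob := by rwa [h4]
    subst h2 h5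
    -- Outcomes of the lifted honest player whose symbol is not an encoding have a vanishing
    -- operator; on the others decoding is injective.
    refine ⟨Set.range (encOutcome X), decOutcome X, ?_, ?_, ?_, ?_⟩
    · rintro _ ⟨o, rfl⟩ _ ⟨o', rfl⟩ hoo
      rw [decOutcome_encOutcome, decOutcome_encOutcome] at hoo
      rw [hoo]
    · intro o ho
      simp only [Strategy.liftedOp, extendOp_zero _ ho]
      exact stepB_zero _
    · intro o ho
      exact absurd ⟨encOutcome X o, ⟨_, rfl⟩, decOutcome_encOutcome X o⟩ ho
    · rintro _ ⟨o, rfl⟩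
      have hop : (B.lift X hB).op rB τ (encOutcome X o) = X.liftOp (B.op rB τ' o) := by
        simp only [Strategy.liftedOp, extendOp_apply encOutcome_injective, h4]
      rw [decOutcome_encOutcome, hop]
      refine ⟨h1, rfl, ?_, ?_, ?_⟩
      · rw [h3]
        simp [encOutcome, recoverTranscript, hn]
      · rw [h4]
        obtain ⟨r, _ | s⟩ := o <;> simp [encOutcome, X.dec_enc]
      · exact stepB_simulate _ (fun q q' m => (hB _ _ _ _ _ _).2) _

theorem liftA_simulate_eff (E : Guesser C' M') (r τ g)
    (ρ : Joint E.toStrategy (B.lift X hB)) :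
    (liftA (E.toStrategy.simulate X next) B ((E.simulate X next).eff r τ g) *
      emb (X.storeJoint E.Q B.Q) ρ).trace =
    (liftA E.toStrategy (B.lift X hB) (E.eff (r.reduceOption.map Prod.fst)
      (recoverTranscript X next r τ) g) * ρ).trace := by
  rw [trace_mul_emb]
  congr 2
  ext i j
  change (emb (X.store E.Q) _ (X.store E.Q (i.1, i.2.1)) (X.store E.Q (j.1, j.2.1)) +
    (if g then 1 - emb (X.store E.Q) 1 else 0) (X.store E.Q (i.1, i.2.1))
      (X.store E.Q (j.1, j.2.1))) * (1 : Matrix B.Q B.Q ℂ) i.2.2 j.2.2 = _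
  rw [emb_apply (X.store_injective _)]
  have : (if g then 1 - emb (X.store E.Q) 1 else 0 :
      Matrix ((E.Q × X.F) × Option M) ((E.Q × X.F) × Option M) ℂ) (X.store E.Q (i.1, i.2.1))
      (X.store E.Q (j.1, j.2.1)) = 0 := by
    cases g
    · rfl
    · simp only [if_true, Matrix.sub_apply]
      rw [emb_apply (X.store_injective _)]
      simp only [Matrix.one_apply, (X.store_injective _).eq_iff, sub_self]
  rw [this, add_zero]
  rfl

/-- The simulated player does exactly as well over the small alphabets; this supplies the upper
bound for the lifted protocol. The simulation need not be loss-free, because the bound on cheating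
probabilities covers all players. -/
theorem guessProb_lift_le {m₀ : M} {secret : List B.R → List (Option C) → Option Bool}
    (E : Guesser C' M') (T : ℕ) :
    guessProb (liftNext X next) (B.lift X hB) (X.fib.symm (m₀, X.f₀))
      (fun r τ => secret r (τ.map (Option.map X.dec))) E T =
    guessProb next B m₀ secret (E.simulate X next) T := by
  unfold guessProb
  rw [show start (E.simulate X next).toStrategy B m₀ = _ from start_simulate (hB := hB) m₀]
  refine run_simulate (E := E.toStrategy) ?_ ?_ ?_ T _
  · intros; exact guessPayoff_zero _ _ _
  · intros; exact guessPayoff_zero (E := E.simulate X next) _ _ _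
  · intro rA rB τ ρ h
    simp only [h]
    cases secret rB τ
    · rfl
    · exact congrArg Complex.re (liftA_simulate_eff E _ _ _ _).symm

/-- A guesser carried over to larger alphabets. -/
abbrev Guesser.lift (E : Guesser C M) (X : Extension C M C' M') (hE : E.LossFree) :
    Guesser C' M' where
  toStrategy := E.toStrategy.lift X hE
  eff r τ g := X.liftOp (E.eff r (τ.map (Option.map X.dec)) g)
  eff_posSemidef r τ g :=
    ((E.eff_posSemidef _ _ _).kronecker Matrix.PosSemidef.one).submatrix _
  eff_sum r τ := by
    ext i j
    rw [Matrix.add_apply, Extension.liftOp_apply, Extension.liftOp_apply, ← add_mul,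
      ← Matrix.add_apply, E.eff_sum]
    simp only [Matrix.one_apply, mul_ite, mul_one, mul_zero]
    rw [← ite_and]
    refine if_congr ?_ rfl rfl
    rw [← (X.splitReg_injective _).eq_iff]
    simp [Extension.splitReg, and_comm]

/-- The upper bound comes from simulation; the value is attained by the lift of an optimal loss-free
player, which exists because that player is loss-free. -/
theorem HasCheatingProb.lift {m₀ : M} {secret : List B.R → List (Option C) → Option Bool} {a : ℝ}
    (h : HasCheatingProb next B m₀ secret a) (X : Extension C M C' M') (hB : B.LossFree) :
    HasCheatingProb (liftNext X next) (B.lift X hB) (X.fib.symm (m₀, X.f₀))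
      (fun r τ => secret r (τ.map (Option.map X.dec))) a := by
  refine hasCheatingProb_of (fun E T => ?_) ?_
  · rw [guessProb_lift_le]
    exact h.2 _ _
  · obtain ⟨E, T, hE, hT⟩ := h.1.1
    refine ⟨E.lift X hE, T, Strategy.lift_lossFree hE, ?_⟩
    rw [hT]
    unfold guessProb
    refine le_of_eq (Eq.symm ?_)
    rw [show start (E.lift X hE).toStrategy (B.lift X hB) (X.fib.symm (m₀, X.f₀)) = _ from
      start_lift (hA := hE) m₀]
    refine (run_lift (A := E.toStrategy) (hA := hE) ?_ T [] [] [] _).trans ?_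
    · intros; exact guessPayoff_zero (E := E.lift X hE) _ _ _
    · congr 1
      funext rA rB τ ρ
      simp only [map_dec_map_enc]
      cases secret rB τ
      · rfl
      · refine congrArg Complex.re ?_
        refine (trace_mul_emb _ _).trans ?_
        congr 2
        ext i j
        change X.liftOp (E.eff rA ((τ.map (Option.map X.enc)).map (Option.map X.dec)) _)
          (i.1, X.incl i.2.1) (j.1, X.incl j.2.1) * (1 : Matrix B.Q B.Q ℂ) i.2.2 j.2.2 = _
        rw [Extension.liftOp_mk, X.split_incl, X.split_incl, Matrix.one_apply_eq, mul_one,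
          map_dec_map_enc]
        rfl

end

/-! ### Probabilities of events and conditional views of honest players -/

section Views

variable {C M : Type} [Fintype C] [Fintype M] [DecidableEq M]

open Classical in
/-- The probability of an event that concerns the final classical information of two players. -/
def outWeight (next : List (Option C) → Option Party) (A B : Strategy C M) (m₀ : M)
    (loss : LossPattern) (T : ℕ) (P : List A.R → List B.R → List (Option C) → Prop) : ℝ :=
  run next A B loss (fun rA rB τ ρ => if P rA rB τ then ρ.trace.re else 0) T [] [] []
    (start A B m₀)

open Classical in
/-- The unnormalised final state of the player `A`, on the event that the classical information of
`A` is `(rA, τ)` and that of `B` satisfies `P`. -/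
def viewOf (next : List (Option C) → Option Party) (A B : Strategy C M) (m₀ : M)
    (loss : LossPattern) (T : ℕ) (P : List B.R → List (Option C) → Prop) (rA : List A.R)
    (τ : List (Option C)) : Matrix (A.Q × Option M) (A.Q × Option M) ℂ :=
  run next A B loss (fun rA' rB' τ' ρ => if rA' = rA ∧ τ' = τ ∧ P rB' τ' then traceOutB A B ρ else 0)
    T [] [] [] (start A B m₀)

variable {next : List (Option C) → Option Party} {A B : Strategy C M} {m₀ : M}
  {loss : LossPattern} {T : ℕ}

theorem traceOutB_eq_ptr (ρ : Joint A B) : traceOutB A B ρ = ptr (splitA A B) ρ := by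
  ext i j
  simp [traceOutB, ptr, Matrix.sum_apply, splitA]

theorem traceOutB_zero : traceOutB A B 0 = 0 := by ext; simp [traceOutB]

theorem run_swap_start {N : Type} [AddCommMonoid N]
    {f : List B.R → List A.R → List (Option C) → Joint B A → N} :
    run (swapNext next) B A loss f T [] [] [] (start B A m₀) =
      run next A B loss (fun rA rB τ ρ => f rB rA τ (swapJoint ρ)) T [] [] [] (start A B m₀) := by
  rw [← run_swap, swapJoint_start]

theorem outWeight_swap {P : List A.R → List B.R → List (Option C) → Prop} :
    outWeight (swapNext next) B A m₀ loss T (fun rB rA τ => P rA rB τ) =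
      outWeight next A B m₀ loss T P := by
  unfold outWeight
  rw [run_swap_start]
  simp only [trace_swapJoint]

theorem outWeight_congr {P Q : List A.R → List B.R → List (Option C) → Prop}
    (h : ∀ rA rB τ, P rA rB τ ↔ Q rA rB τ) :
    outWeight next A B m₀ loss T P = outWeight next A B m₀ loss T Q := by
  congr 1
  funext rA rB τ
  exact propext (h _ _ _)

theorem outWeight_nonneg {P : List A.R → List B.R → List (Option C) → Prop} :
    0 ≤ outWeight next A B m₀ loss T P :=
  run_nonneg (fun _ _ _ _ hρ => by split; exacts [re_trace_nonneg hρ, le_rfl]) _ _ _ _ _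
    (start_posSemidef _)

theorem outWeight_mono_turns {P : List A.R → List B.R → List (Option C) → Prop} {T' : ℕ}
    (h : T ≤ T') : outWeight next A B m₀ loss T P ≤ outWeight next A B m₀ loss T' P :=
  run_mono_turns (fun _ _ _ _ hρ => by split; exacts [re_trace_nonneg hρ, le_rfl]) h _ _ _ _
    (start_posSemidef _)

theorem outWeight_le_one {P : List A.R → List B.R → List (Option C) → Prop} :
    outWeight next A B m₀ loss T P ≤ 1 := by
  refine (run_le (T := T) (g := fun _ _ _ ρ => ρ.trace.re) (fun rA rB τ ρ hρ _ _ => ?_) T _ _ _ _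
    (start_posSemidef _) (by simp)).trans ((run_trace_le _ _ _ _ _ (start_posSemidef _)).trans ?_)
  · split
    exacts [le_rfl, re_trace_nonneg hρ]
  · simp [trace_start]

/-- Losses after turn `T` have no effect within `T` turns. This reduces arbitrary patterns of
losses, for which hiding is required, to finite ones, the only ones that correctness speaks about.
-/
theorem outWeight_truncate {P : List A.R → List B.R → List (Option C) → Prop} :
    outWeight next A B m₀ loss T P =
      outWeight next A B m₀ (fun i => if i < T then loss i else false) T P :=
  run_congr (T := T) (fun i hi => by simp [hi]) (fun _ _ _ _ _ _ _ => rfl) T _ _ _ _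
    (start_posSemidef _) (by simp)

theorem truncate_finite : LossPattern.Finite (fun i => if i < T then loss i else false) :=
  ⟨T, fun i hi => by simp [Nat.not_lt.mpr hi]⟩

/-- If the disjoint events `P i` have total probability 1, then nothing else happens. -/
theorem outWeight_eq_zero {ι : Type} [Fintype ι]
    {P : ι → List A.R → List B.R → List (Option C) → Prop}
    (hdisj : ∀ rA rB τ i j, P i rA rB τ → P j rA rB τ → i = j)
    (h : ∀ loss : LossPattern, loss.Finite → ∃ T₀, ∀ T ≥ T₀,
      ∑ i, outWeight next A B m₀ loss T (P i) = 1) (loss : LossPattern) (T : ℕ) :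
    outWeight next A B m₀ loss T (fun rA rB τ => ∀ i, ¬ P i rA rB τ) = 0 := by
  classical
  refine le_antisymm ?_ outWeight_nonneg
  rw [outWeight_truncate]
  obtain ⟨T₀, hT₀⟩ := h _ (truncate_finite (loss := loss) (T := T))
  refine (outWeight_mono_turns (le_max_left T T₀)).trans ?_
  have h1 := hT₀ (max T T₀) (le_max_right _ _)
  have h2 := outWeight_le_one (next := next) (A := A) (B := B) (m₀ := m₀)
    (loss := fun i => if i < T then loss i else false) (T := max T T₀) (P := fun _ _ _ => True)
  have h3 : outWeight next A B m₀ (fun i => if i < T then loss i else false) (max T T₀)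
      (fun _ _ _ => True) = ∑ i, outWeight next A B m₀ (fun i => if i < T then loss i else false)
      (max T T₀) (P i) + outWeight next A B m₀ (fun i => if i < T then loss i else false) (max T T₀)
      (fun rA rB τ => ∀ i, ¬ P i rA rB τ) := by
    unfold outWeight
    rw [← run_sum, ← run_add]
    congr 1
    funext rA rB τ ρ
    by_cases hP : ∃ i, P i rA rB τ
    · obtain ⟨i, hi⟩ := hP
      rw [if_pos trivial, if_neg (fun h : ∀ i, ¬ P i rA rB τ => h i hi), add_zero,
        Finset.sum_eq_single i]
      · rw [if_pos hi]
      · intro j _ hj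
        exact if_neg fun h => hj (hdisj _ _ _ _ _ h hi)
      · simp
    · push Not at hP
      simp [hP]
  linarith

/-- A view on an event contained in `Bad` is a positive operator whose trace is at most the weight
of `Bad`, hence zero. So views do not see what happens on a null event, such as inconsistent
outputs. -/
theorem viewOf_congr {Bad : List A.R → List B.R → List (Option C) → Prop}
    (h : outWeight next A B m₀ loss T Bad = 0) {P Q : List B.R → List (Option C) → Prop}
    {rA : List A.R} {τ : List (Option C)} (hPQ : ∀ rB, ¬ Bad rA rB τ → (P rB τ ↔ Q rB τ)) :
    viewOf next A B m₀ loss T P rA τ = viewOf next A B m₀ loss T Q rA τ := by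
  classical
  have key : ∀ P : List B.R → List (Option C) → Prop, (∀ rB, P rB τ → Bad rA rB τ) →
      viewOf next A B m₀ loss T P rA τ = 0 := by
    intro P hP
    have hpsd : (viewOf next A B m₀ loss T P rA τ).PosSemidef := by
      refine run_mem (S := (⟨⟨{X | X.PosSemidef}, fun ha hb => Matrix.PosSemidef.add ha hb⟩,
        Matrix.PosSemidef.zero⟩ : AddSubmonoid (Matrix (A.Q × Option M) (A.Q × Option M) ℂ)))
        (fun rA rB τ ρ hρ => ?_) _ _ _ _ _ (start_posSemidef _)
      split
      · change (traceOutB A B ρ).PosSemidef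
        rw [traceOutB_eq_ptr]
        exact ptr_posSemidef _ hρ
      · exact Matrix.PosSemidef.zero
    refine eq_zero_of_re_trace hpsd (le_antisymm ?_ (re_trace_nonneg hpsd))
    rw [← h]
    have := run_hom (next := next) (A := A) (B := B) (loss := loss)
      (f := fun rA' rB' τ' ρ => if rA' = rA ∧ τ' = τ ∧ P rB' τ' then traceOutB A B ρ else 0)
      ((Complex.reAddGroupHom : ℂ →+ ℝ).comp
        (Matrix.traceAddMonoidHom (A.Q × Option M) ℂ)) T [] [] [] (start A B m₀)
    refine this.le.trans (run_le (T := T) (fun rA' rB' τ' ρ hρ _ _ => ?_) T _ _ _ _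
      (start_posSemidef _) (by simp))
    by_cases hc : rA' = rA ∧ τ' = τ ∧ P rB' τ'
    · obtain ⟨rfl, rfl, hc⟩ := hc
      rw [if_pos ⟨rfl, rfl, hc⟩, if_pos (hP _ hc), traceOutB_eq_ptr]
      change (ptr (splitA A B) ρ).trace.re ≤ _
      rw [trace_ptr]
    · rw [if_neg hc, map_zero]
      split
      exacts [re_trace_nonneg hρ, le_rfl]
  -- The event `P` is cut into `P ∧ Q` and `P ∧ ¬Q`; the latter lies in `Bad`.
  have split : ∀ P Q : List B.R → List (Option C) → Prop,
      (∀ rB, ¬ Bad rA rB τ → (P rB τ → Q rB τ)) → viewOf next A B m₀ loss T P rA τ =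
        viewOf next A B m₀ loss T (fun rB τ => P rB τ ∧ Q rB τ) rA τ := by
    intro P Q hPQ
    have h0 := key (fun rB τ => P rB τ ∧ ¬ Q rB τ) fun rB ⟨h1, h2⟩ => by
      by_contra hb
      exact h2 (hPQ rB hb h1)
    rw [← add_zero (viewOf next A B m₀ loss T (fun rB τ => P rB τ ∧ Q rB τ) rA τ), ← h0]
    unfold viewOf
    rw [← run_add]
    congr 1
    funext rA' rB' τ' ρ
    by_cases h3 : P rB' τ' <;> by_cases h4 : Q rB' τ' <;> simp [h3, h4]
  rw [split P Q fun rB hb => (hPQ rB hb).mp, split Q P fun rB hb => (hPQ rB hb).mpr]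
  simp only [and_comm]

end Views

/-! ### Random OT with fixed alphabets, and its reversal -/

section Duo

/-- A protocol without inputs, with given alphabets. -/
structure Duo (C M : Type) [Fintype C] [Fintype M] [DecidableEq M] (YA YB : Type) where
  m₀ : M
  next : List (Option C) → Option Party
  bounded : ∃ N : ℕ, ∀ τ σ : List (Option C), σ.length = N → none ∉ σ →
    ∃ υ : List (Option C), υ <:+ σ ++ τ ∧ next υ = none
  A : Player C M YA
  B : Player C M YB

variable {C M : Type} [Fintype C] [Fintype M] [DecidableEq M] {YA YB : Type}

/-- Random oblivious transfer with given alphabets. -/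
structure Duo.IsROT (D : Duo C M (Option (Bool × Bool)) (Option (Bool × Bool))) (a b : ℝ) :
    Prop where
  correct : ∀ loss : LossPattern, loss.Finite → ∃ T₀, ∀ T ≥ T₀, ∀ (x : Bool × Bool) (i : Bool),
    outWeight D.next D.A.toStrategy D.B.toStrategy D.m₀ loss T
      (fun rA rB τ => D.A.out rA τ = some x ∧ D.B.out rB τ = some (i, pick x i)) = 1 / 8
  hidingA : ∀ (loss : LossPattern) (T : ℕ) (rA : List D.A.R) (τ : List (Option C)),
    viewOf D.next D.A.toStrategy D.B.toStrategy D.m₀ loss T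
      (fun rB τ => ∃ v, D.B.out rB τ = some (false, v)) rA τ =
    viewOf D.next D.A.toStrategy D.B.toStrategy D.m₀ loss T
      (fun rB τ => ∃ v, D.B.out rB τ = some (true, v)) rA τ
  hidingB : ∀ (loss : LossPattern) (T : ℕ) (rB : List D.B.R) (τ : List (Option C)) (i v : Bool),
    D.B.out rB τ = some (i, v) →
    viewOf (swapNext D.next) D.B.toStrategy D.A.toStrategy D.m₀ loss T
      (fun rA τ => ∃ x, D.A.out rA τ = some x ∧ pick x (!i) = false) rB τ =
    viewOf (swapNext D.next) D.B.toStrategy D.A.toStrategy D.m₀ loss T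
      (fun rA τ => ∃ x, D.A.out rA τ = some x ∧ pick x (!i) = true) rB τ
  cheatA : HasCheatingProb D.next D.B.toStrategy D.m₀ (fun r τ => (D.B.out r τ).map Prod.fst) a
  cheatB : HasCheatingProb (swapNext D.next) D.A.toStrategy D.m₀
    (fun r τ => (D.A.out r τ).map fun x => xor x.1 x.2) b

/-- The outputs of random oblivious transfer match. -/
def Consistent (yA yB : Option (Bool × Bool)) : Prop :=
  ∃ x i, yA = some x ∧ yB = some (i, pick x i)

/-- The eight consistent pairs of outputs have probability 1/8 each and exhaust the total
probability. -/
theorem Duo.IsROT.outWeight_eq_zero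
    {D : Duo C M (Option (Bool × Bool)) (Option (Bool × Bool))} {a b : ℝ} (h : D.IsROT a b)
    (loss : LossPattern) (T : ℕ) : outWeight D.next D.A.toStrategy D.B.toStrategy D.m₀ loss T
      (fun rA rB τ => ¬ Consistent (D.A.out rA τ) (D.B.out rB τ)) = 0 := by
  have := QProto.outWeight_eq_zero (ι := (Bool × Bool) × Bool) (next := D.next)
    (A := D.A.toStrategy) (B := D.B.toStrategy) (m₀ := D.m₀)
    (P := fun i rA rB τ => D.A.out rA τ = some i.1 ∧ D.B.out rB τ = some (i.2, pick i.1 i.2)) ?_ ?_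
    loss T
  · rw [← this]
    refine outWeight_congr fun rA rB τ => ?_
    simp only [Consistent, Prod.forall, not_exists]
  · rintro rA rB τ ⟨x, i⟩ ⟨y, j⟩ ⟨h1, h2⟩ ⟨h3, h4⟩
    rw [h1, Option.some.injEq] at h3
    rw [h2, Option.some.injEq] at h4
    exact Prod.ext h3 (congrArg Prod.fst h4)
  · intro loss hl
    obtain ⟨T₀, hT⟩ := h.correct loss hl
    refine ⟨T₀, fun T hT' => ?_⟩
    simp only [hT T hT']
    simp

/-- Random oblivious transfer in the opposite direction. -/
def Duo.reverse (D : Duo C M (Option (Bool × Bool)) (Option (Bool × Bool))) :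
    Duo C M (Option (Bool × Bool)) (Option (Bool × Bool)) where
  m₀ := D.m₀
  next := swapNext D.next
  bounded := by simpa only [swapNext_eq_none] using D.bounded
  A := { D.B with out := fun r τ => (D.B.out r τ).map fun y => (y.2, xor y.2 y.1) }
  B := { D.A with out := fun r τ => (D.A.out r τ).map fun x => (xor x.1 x.2, x.1) }

/-- The relation v ⊕ x_0 = b ∧ (x_0 ⊕ x_1) is symmetric in the pairs (x_0, x_0 ⊕ x_1) and (v, b).
The old choice bit b is the XOR of the new pair (v, v ⊕ b), and the old XOR x_0 ⊕ x_1 is the new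
choice bit, so each secret becomes the other one. -/
theorem Duo.IsROT.reverse {D : Duo C M (Option (Bool × Bool)) (Option (Bool × Bool))} {a b : ℝ}
    (h : D.IsROT a b) : D.reverse.IsROT b a where
  correct loss hl := by
    obtain ⟨T₀, hT⟩ := h.correct loss hl
    refine ⟨T₀, fun T hT' x i => ?_⟩
    -- The old outputs that produce the new ones: x_0 is the bit received by the new Bob, x_0 ⊕ x_1
    -- is his choice `i`, and the old choice bit is the XOR of the new pair.
    rw [← hT T hT' (pick x i, xor (pick x i) i) (xor x.1 x.2)]
    refine (outWeight_swap (next := D.next) (A := D.A.toStrategy) (B := D.B.toStrategy)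
      (P := fun rA rB τ => (D.B.out rB τ).map (fun y => (y.2, xor y.2 y.1)) = some x ∧
        (D.A.out rA τ).map (fun x => (xor x.1 x.2, x.1)) = some (i, pick x i))).trans ?_
    refine outWeight_congr fun rA rB τ => ?_
    rcases D.A.out rA τ with _ | ⟨x0, x1⟩ <;> rcases D.B.out rB τ with _ | ⟨j, v⟩ <;> try simp
    obtain ⟨y0, y1⟩ := x
    revert x0 x1 j v y0 y1 i
    decide
  hidingA loss T rB τ := by
    have hz := h.outWeight_eq_zero loss T
    rw [← outWeight_swap] at hz
    change viewOf (swapNext D.next) D.B.toStrategy D.A.toStrategy D.m₀ loss T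
      (fun rA τ => ∃ v, (D.A.out rA τ).map (fun x => (xor x.1 x.2, x.1)) = some (false, v)) rB τ =
      viewOf (swapNext D.next) D.B.toStrategy D.A.toStrategy D.m₀ loss T
      (fun rA τ => ∃ v, (D.A.out rA τ).map (fun x => (xor x.1 x.2, x.1)) = some (true, v)) rB τ
    rcases hB : D.B.out rB τ with _ | ⟨i, v⟩
    · refine viewOf_congr hz fun rA hc => ?_
      rw [hB] at hc
      exact absurd (fun ⟨_, _, _, h⟩ => by cases h) hc
    -- To the holder of (i, v) with v = x_i, the XOR x_0 ⊕ x_1 equals β exactly when the unknown bit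
    -- is v ⊕ β. So hiding the other bit hides the new choice.
    · have key : ∀ β, viewOf (swapNext D.next) D.B.toStrategy D.A.toStrategy D.m₀ loss T
          (fun rA τ => ∃ v, (D.A.out rA τ).map (fun x => (xor x.1 x.2, x.1)) = some (β, v)) rB τ =
          viewOf (swapNext D.next) D.B.toStrategy D.A.toStrategy D.m₀ loss T
          (fun rA τ => ∃ x, D.A.out rA τ = some x ∧ pick x (!i) = xor v β) rB τ := by
        intro β
        refine viewOf_congr hz fun rA hc => ?_
        obtain ⟨x, j, h1, h2⟩ := not_not.mp hc
        rw [hB] at h2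
        simp only [Option.some.injEq, Prod.mk.injEq] at h2
        obtain ⟨rfl, rfl⟩ := h2
        simp only [h1, Option.map_some, Option.some.injEq, exists_eq_left', Prod.mk.injEq,
          exists_and_left, exists_eq', and_true]
        obtain ⟨x0, x1⟩ := x
        clear h1 hB hc
        revert x0 x1 i β
        decide
      rw [key, key]
      have := h.hidingB loss T rB τ i v hB
      cases v
      · exact this
      · exact this.symm
  hidingB loss T rA τ i' v' hA := by
    have hz := h.outWeight_eq_zero loss T
    change viewOf (swapNext (swapNext D.next)) D.A.toStrategy D.B.toStrategy D.m₀ loss T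
      (fun rB τ => ∃ x, (D.B.out rB τ).map (fun y => (y.2, xor y.2 y.1)) = some x ∧
        pick x (!i') = false) rA τ =
      viewOf (swapNext (swapNext D.next)) D.A.toStrategy D.B.toStrategy D.m₀ loss T
      (fun rB τ => ∃ x, (D.B.out rB τ).map (fun y => (y.2, xor y.2 y.1)) = some x ∧
        pick x (!i') = true) rA τ
    rw [swapNext_swapNext]
    -- The bit of the new pair that was not chosen is x_0 ⊕ b, and the new Bob knows x_0 = v'. So it
    -- is hidden because b is.
    have key : ∀ γ, viewOf D.next D.A.toStrategy D.B.toStrategy D.m₀ loss T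
        (fun rB τ => ∃ x, (D.B.out rB τ).map (fun y => (y.2, xor y.2 y.1)) = some x ∧
          pick x (!i') = γ) rA τ = viewOf D.next D.A.toStrategy D.B.toStrategy D.m₀ loss T
        (fun rB τ => ∃ w, D.B.out rB τ = some (xor v' γ, w)) rA τ := by
      intro γ
      refine viewOf_congr hz fun rB hc => ?_
      obtain ⟨x, j, h1, h2⟩ := not_not.mp hc
      change (D.A.out rA τ).map (fun x => (xor x.1 x.2, x.1)) = some (i', v') at hA
      simp only [h1, Option.map_some, Option.some.injEq, Prod.mk.injEq] at hA
      simp only [h2, Option.map_some, Option.some.injEq, exists_eq_left', Prod.mk.injEq,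
        exists_and_left, exists_eq', and_true]
      obtain ⟨x0, x1⟩ := x
      obtain ⟨rfl, rfl⟩ := hA
      clear h1 h2 hc
      revert x0 x1 j γ
      decide
    rw [key, key]
    have := h.hidingA loss T rA τ
    cases v'
    · exact this
    · exact this.symm
  cheatA := by
    have : (fun r τ => (D.reverse.B.out r τ).map Prod.fst) =
        fun r τ => (D.A.out r τ).map fun x => xor x.1 x.2 := by
      funext r τ
      simp only [Duo.reverse, Option.map_map]
      rfl
    rw [this]
    exact h.cheatB
  cheatB := by
    have : (fun r τ => (D.reverse.A.out r τ).map fun x => xor x.1 x.2) =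
        fun r τ => (D.B.out r τ).map Prod.fst := by
      funext r τ
      simp only [Duo.reverse, Option.map_map]
      refine congrArg (fun g => Option.map g _) ?_
      funext y
      simp
    rw [this]
    change HasCheatingProb (swapNext (swapNext D.next)) _ _ _ _
    rw [swapNext_swapNext]
    exact h.cheatA

end Duo

/-! ### Equal views give equal results of whatever is computed from them -/

section Transfer

variable {C M : Type} [Fintype C] [Fintype M] [DecidableEq M]
  {next : List (Option C) → Option Party} {A B : Strategy C M} {m₀ : M}
  {loss : LossPattern} {T : ℕ}

open Classical in
/-- What is computed from the final views of `A` is the same for two events with the same views. -/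
theorem viewOf_transfer {N : Type} [AddCommMonoid N]
    (φ : Matrix (A.Q × Option M) (A.Q × Option M) ℂ →+ N)
    {key : List A.R → List (Option C) → Prop}
    (hkey : ∀ r τ r' τ', key r τ → key r' τ' → r = r' ∧ τ = τ')
    {P Q : List B.R → List (Option C) → Prop}
    (h : ∀ rA τ, key rA τ → viewOf next A B m₀ loss T P rA τ = viewOf next A B m₀ loss T Q rA τ) :
    run next A B loss (fun rA rB τ ρ => if key rA τ ∧ P rB τ then φ (traceOutB A B ρ) else 0)
      T [] [] [] (start A B m₀) =
    run next A B loss (fun rA rB τ ρ => if key rA τ ∧ Q rB τ then φ (traceOutB A B ρ) else 0)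
      T [] [] [] (start A B m₀) := by
  by_cases hk : ∃ r τ, key r τ
  · obtain ⟨r, τ, hr⟩ := hk
    have key' : ∀ P : List B.R → List (Option C) → Prop,
        run next A B loss (fun rA rB τ ρ => if key rA τ ∧ P rB τ then φ (traceOutB A B ρ) else 0)
          T [] [] [] (start A B m₀) = φ (viewOf next A B m₀ loss T P r τ) := by
      intro P
      unfold viewOf
      rw [run_hom φ]
      congr 1
      funext rA rB τ' ρ
      by_cases h1 : key rA τ'
      · obtain ⟨rfl, rfl⟩ := hkey _ _ _ _ h1 hr
        by_cases h2 : P rB τ' <;> simp [h1, h2]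
      · rw [if_neg fun h => h1 h.1, if_neg, map_zero]
        rintro ⟨rfl, rfl, -⟩
        exact h1 hr
    rw [key', key', h _ _ hr]
  · push Not at hk
    congr 1
    funext rA rB τ ρ
    rw [if_neg fun h => hk _ _ h.1, if_neg fun h => hk _ _ h.1]

end Transfer

/-! ### The given definitions in terms of weights, views and guessing probabilities -/

section Conversion

variable {XA XB YA YB : Type} (P : Protocol XA XB YA YB)

theorem Protocol.outProb_eq (xA : XA) (xB : XB) (loss T yA yB) :
    P.outProb xA xB loss T yA yB = outWeight P.next (P.alice xA).toStrategy (P.bob xB).toStrategy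
      P.m₀ loss T fun rA rB τ => (P.alice xA).out rA τ = yA ∧ (P.bob xB).out rB τ = yB := by
  unfold Protocol.outProb outWeight Protocol.exec
  congr 1
  funext rA rB τ ρ
  congr

theorem Protocol.viewA_eq (xA : XA) (xB : XB) (loss T ev rA τ) :
    P.viewA xA xB loss T ev rA τ = viewOf P.next (P.alice xA).toStrategy (P.bob xB).toStrategy
      P.m₀ loss T (fun rB τ => ev ((P.bob xB).out rB τ)) rA τ := by
  unfold Protocol.viewA viewOf Protocol.exec
  congr 1

theorem Protocol.viewB_eq (xA : XA) (xB : XB) (loss T ev rB τ) :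
    P.viewB xA xB loss T ev rB τ = viewOf (swapNext P.next) (P.bob xB).toStrategy
      (P.alice xA).toStrategy P.m₀ loss T (fun rA τ => ev ((P.alice xA).out rA τ)) rB τ := by
  unfold Protocol.viewB viewOf Protocol.exec
  rw [run_swap_start]
  rfl

theorem Protocol.learnA_eq (xB : XB) (secret : YB → Option Bool) :
    P.learnA xB secret = guessProb P.next (P.bob xB).toStrategy P.m₀
      fun r τ => secret ((P.bob xB).out r τ) := by
  funext E T
  unfold Protocol.learnA guessProb Protocol.exec
  congr 1

theorem trace_liftA_swapJoint {C M : Type} [Fintype C] [Fintype M] [DecidableEq M]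
    {A E : Strategy C M} (K) (ρ : Joint A E) :
    (liftA E A K * swapJoint ρ).trace = (liftB A E K * ρ).trace := by
  rw [← trace_swapJoint (liftB A E K * ρ)]
  have : swapJoint (liftB A E K) = liftA E A K := rfl
  rw [← this, swapJoint, swapJoint, swapJoint, Matrix.submatrix_mul_equiv]

theorem Protocol.learnB_eq (xA : XA) (secret : YA → Option Bool) :
    P.learnB xA secret = guessProb (swapNext P.next) (P.alice xA).toStrategy P.m₀
      fun r τ => secret ((P.alice xA).out r τ) := by
  funext E T
  unfold Protocol.learnB guessProb Protocol.exec
  rw [run_swap_start]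
  congr 1
  funext rA rB τ ρ
  beta_reduce
  rcases secret ((P.alice xA).out rA τ) with _ | s
  · rfl
  · exact congrArg Complex.re (trace_liftA_swapJoint _ _).symm

theorem Protocol.forceA_eq (xB : XB) (y : YB) (E : Strategy P.C P.M) (T : ℕ) :
    P.forceA xB y E T = outWeight P.next E (P.bob xB).toStrategy P.m₀ noLoss T
      fun _ rB τ => (P.bob xB).out rB τ = y := by
  unfold Protocol.forceA outWeight Protocol.exec
  congr 1

theorem Protocol.forceB_eq (xA : XA) (y : YA) (E : Strategy P.C P.M) (T : ℕ) :
    P.forceB xA y E T = outWeight (swapNext P.next) E (P.alice xA).toStrategy P.m₀ noLoss T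
      fun _ rA τ => (P.alice xA).out rA τ = y := by
  rw [outWeight_swap (P := fun rA _ τ => (P.alice xA).out rA τ = y)]
  unfold Protocol.forceB outWeight Protocol.exec
  congr 1

/-- A protocol without inputs. -/
abbrev Protocol.duo {YA YB : Type} (P : Protocol Unit Unit YA YB) : Duo P.C P.M YA YB where
  m₀ := P.m₀
  next := P.next
  bounded := P.bounded
  A := P.alice ()
  B := P.bob ()

theorem IsLTROT.isROT {R : ROTProtocol} {a b : ℝ} (h : IsLTROT R a b) : R.duo.IsROT a b where
  correct loss hl := by
    obtain ⟨T₀, hT⟩ := h.correct loss hl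
    refine ⟨T₀, fun T hT' x i => ?_⟩
    rw [← hT T hT' x i, Protocol.outProb_eq]
  hidingA loss T rA τ := by
    have := h.hidingA loss T rA τ
    rwa [Protocol.viewA_eq, Protocol.viewA_eq] at this
  hidingB loss T rB τ i v hv := by
    have := h.hidingB loss T rB τ i v hv
    rwa [Protocol.viewB_eq, Protocol.viewB_eq] at this
  cheatA := by
    have := h.cheatA
    rwa [Protocol.learnA_eq] at this
  cheatB := by
    have := h.cheatB
    rwa [Protocol.learnB_eq] at this

end Conversion

/-! ### Forcing an outcome as a form of guessing -/

section Force

variable {C M : Type} [Fintype C] [Fintype M] [DecidableEq M]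
  {next : List (Option C) → Option Party} {B : Strategy C M} {m₀ : M}

/-- A dishonest player who always guesses `true`. -/
abbrev Strategy.guessTrue (E : Strategy C M) : Guesser C M where
  toStrategy := E
  eff _ _ g := if g then 1 else 0
  eff_posSemidef _ _ g := by
    cases g
    · exact Matrix.PosSemidef.zero
    · exact Matrix.PosSemidef.one
  eff_sum _ _ := by simp

/-- Forcing the event `ev` as guessing a bit that is only defined when `ev` occurs. -/
def forceSecret {R : Type} (ev : List R → List (Option C) → Bool) (r : List R)
    (τ : List (Option C)) : Option Bool := if ev r τ then some true else none

theorem guessProb_guessTrue (ev : List B.R → List (Option C) → Bool) (E : Strategy C M) (T : ℕ) :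
    guessProb next B m₀ (forceSecret ev) E.guessTrue T =
      outWeight next E B m₀ noLoss T (fun _ rB τ => ev rB τ = true) := by
  unfold guessProb outWeight
  congr 1
  funext rA rB τ ρ
  unfold forceSecret
  by_cases h : ev rB τ = true
  · rw [if_pos h, if_pos h]
    simp only [guessPayoff, if_true, liftA_eq_amp, amp_one, one_mul]
  · rw [if_neg h, if_neg h]
    rfl

theorem guessProb_forceSecret_le (ev : List B.R → List (Option C) → Bool) (E : Guesser C M)
    (T : ℕ) : guessProb next B m₀ (forceSecret ev) E T ≤
      outWeight next E.toStrategy B m₀ noLoss T (fun _ rB τ => ev rB τ = true) := by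
  refine run_le (T := T) (fun rA rB τ ρ hρ _ _ => ?_) T _ _ _ _ (start_posSemidef _) (by simp)
  unfold forceSecret
  by_cases h : ev rB τ = true
  · rw [if_pos h, if_pos h]
    exact eff_le_trace E _ _ _ hρ
  · rw [if_neg h, if_neg h]
    exact le_rfl

/-- The secret is defined only when `ev` occurs, and then it is `true`; so always guessing `true` is
optimal and wins exactly on `ev`. In this form the change of alphabets for guessing also applies to
coin flipping. -/
theorem hasCheatingProb_force {ev : List B.R → List (Option C) → Bool} {a : ℝ}
    (h : IsLTCheatingProb Strategy.LossFree (fun E T =>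
      outWeight next E B m₀ noLoss T (fun _ rB τ => ev rB τ = true)) a) :
    HasCheatingProb next B m₀ (forceSecret ev) a := by
  refine hasCheatingProb_of (fun E T => (guessProb_forceSecret_le ev E T).trans (h.2 _ _)) ?_
  obtain ⟨E, T, hE, hT⟩ := h.1.1
  exact ⟨E.guessTrue, T, hE, by rw [guessProb_guessTrue]; exact hT.le⟩

end Force

/-! ### Coin flipping and random OT over larger alphabets -/

section DuoLift

variable {C M : Type} [Fintype C] [Fintype M] [DecidableEq M]
variable {C' M' : Type} [Fintype C'] [Fintype M'] [DecidableEq M'] {YA YB : Type}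

/-- Weak coin flipping with given alphabets. -/
structure Duo.IsWCF (D : Duo C M Bool Bool) (a b : ℝ) : Prop where
  correct : ∀ loss : LossPattern, loss.Finite → ∃ T₀, ∀ T ≥ T₀, ∀ c : Bool,
    outWeight D.next D.A.toStrategy D.B.toStrategy D.m₀ loss T
      (fun rA rB τ => D.A.out rA τ = c ∧ D.B.out rB τ = c) = 1 / 2
  cheatA : HasCheatingProb D.next D.B.toStrategy D.m₀ (forceSecret fun r τ => !D.B.out r τ) a
  cheatB : HasCheatingProb (swapNext D.next) D.A.toStrategy D.m₀ (forceSecret D.A.out) b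

theorem IsLTWCF.isWCF {W : WCFProtocol} {a b : ℝ} (h : IsLTWCF W a b) : W.duo.IsWCF a b where
  correct loss hl := by
    obtain ⟨T₀, hT⟩ := h.correct loss hl
    refine ⟨T₀, fun T hT' c => ?_⟩
    rw [← hT T hT' c, Protocol.outProb_eq]
  cheatA := by
    refine hasCheatingProb_force ?_
    convert h.cheatA using 2
    funext T
    rw [Protocol.forceA_eq]
    exact outWeight_congr fun _ _ _ => by simp
  cheatB := by
    refine hasCheatingProb_force ?_
    convert h.cheatB using 2
    funext T
    rw [Protocol.forceB_eq]

/-- A player carried over to larger alphabets. -/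
abbrev Player.lift {Y : Type} (S : Player C M Y) (X : Extension C M C' M') : Player C' M' Y where
  toStrategy := S.toStrategy.lift X S.honest
  honest := Strategy.lift_lossFree S.honest
  out r τ := S.out r (τ.map (Option.map X.dec))

/-- A protocol without inputs carried over to larger alphabets. -/
abbrev Duo.lift (D : Duo C M YA YB) (X : Extension C M C' M') : Duo C' M' YA YB where
  m₀ := X.fib.symm (D.m₀, X.f₀)
  next := liftNext X D.next
  bounded := by
    obtain ⟨N, hN⟩ := D.bounded
    refine ⟨N, fun τ σ hσ hn => ?_⟩
    obtain ⟨υ, ⟨t, ht⟩, hυ'⟩ := hN (τ.map (Option.map X.dec)) (σ.map (Option.map X.dec))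
      (by simpa using hσ) (by
        rw [List.mem_map]
        rintro ⟨s, hs, h⟩
        rw [Option.map_eq_none_iff] at h
        exact hn (h ▸ hs))
    rw [← List.map_append] at ht
    obtain ⟨t', υ', h1, -, h3⟩ := List.map_eq_append_iff.mp ht.symm
    exact ⟨υ', ⟨t', h1.symm⟩, by rw [liftNext, h3, hυ']⟩
  A := D.A.lift X
  B := D.B.lift X

variable {next : List (Option C) → Option Party} {A B : Strategy C M} {m₀ : M}
  {loss : LossPattern} {T : ℕ} (X : Extension C M C' M') (hA : A.LossFree) (hB : B.LossFree)

theorem outWeight_lift (P : List A.R → List B.R → List (Option C) → Prop) :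
    outWeight (liftNext X next) (A.lift X hA) (B.lift X hB) (X.fib.symm (m₀, X.f₀)) loss T
      (fun rA rB τ => P rA rB (τ.map (Option.map X.dec))) = outWeight next A B m₀ loss T P := by
  unfold outWeight
  rw [start_lift]
  refine (run_lift (by simp) T [] [] [] (start A B m₀)).trans ?_
  congr 1
  funext rA rB τ ρ
  beta_reduce
  rw [map_dec_map_enc, trace_emb (X.inclJoint_injective _ _)]

/-- The inclusion of the part of the joint space held by one player. -/
def Extension.inclReg (Q : Type) (i : Q × Option M) : Q × Option M' := (i.1, X.incl i.2)

theorem Extension.inclReg_injective (Q : Type) : Function.Injective (X.inclReg Q) := by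
  rintro ⟨a, m⟩ ⟨a', m'⟩ h
  simp only [inclReg, Prod.mk.injEq] at h
  simp only [Prod.mk.injEq]
  exact ⟨h.1, X.incl_injective h.2⟩

theorem traceOutB_emb (ρ : Joint A B) :
    traceOutB (A.lift X hA) (B.lift X hB) (emb (X.inclJoint A.Q B.Q) ρ) =
      emb (X.inclReg A.Q) (traceOutB A B ρ) := by
  have hr : ∀ {i : A.Q × Option M'} (q : B.Q), i ∉ Set.range (X.inclReg A.Q) →
      (i.1, i.2, q) ∉ Set.range (X.inclJoint A.Q B.Q) := by
    rintro i q hi ⟨j, hj⟩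
    refine hi ⟨(j.1, j.2.1), ?_⟩
    simp only [Extension.inclJoint, Prod.mk.injEq] at hj
    exact Prod.ext hj.1 hj.2.1
  refine eq_emb (X.inclReg_injective _) (fun i j => ?_) (fun i hi j => ?_) fun i j hj => ?_
  · exact Finset.sum_congr rfl fun q _ => emb_apply (X.inclJoint_injective _ _) ρ
      (i.1, i.2, q) (j.1, j.2, q)
  · exact Finset.sum_eq_zero fun q _ => emb_apply_left _ (hr q hi) _
  · exact Finset.sum_eq_zero fun q _ => emb_apply_right _ _ (hr q hj)

/-- The lifted view is the image of the original view under the inclusion of the copy `f₀` when `τ'`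
is the encoding of a transcript, and zero otherwise. -/
theorem viewOf_lift {P Q : List B.R → List (Option C) → Prop} {rA : List A.R}
    {τ' : List (Option C')} (h : viewOf next A B m₀ loss T P rA (τ'.map (Option.map X.dec)) =
      viewOf next A B m₀ loss T Q rA (τ'.map (Option.map X.dec))) :
    viewOf (liftNext X next) (A.lift X hA) (B.lift X hB) (X.fib.symm (m₀, X.f₀)) loss T
      (fun rB τ => P rB (τ.map (Option.map X.dec))) rA τ' =
    viewOf (liftNext X next) (A.lift X hA) (B.lift X hB) (X.fib.symm (m₀, X.f₀)) loss T
      (fun rB τ => Q rB (τ.map (Option.map X.dec))) rA τ' := by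
  classical
  have key : ∀ P : List B.R → List (Option C) → Prop,
      viewOf (liftNext X next) (A.lift X hA) (B.lift X hB) (X.fib.symm (m₀, X.f₀)) loss T
        (fun rB τ => P rB (τ.map (Option.map X.dec))) rA τ' =
      run next A B loss (fun rA' rB τ ρ => if (rA' = rA ∧ τ.map (Option.map X.enc) = τ') ∧ P rB τ
        then embHom (X.inclReg A.Q) (traceOutB A B ρ) else 0) T [] [] [] (start A B m₀) := by
    intro P
    unfold viewOf
    rw [start_lift]
    refine (run_lift ?_ T [] [] [] (start A B m₀)).trans ?_
    · intros
      rw [traceOutB_zero, ite_self]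
    · congr 1
      funext rA' rB τ ρ
      beta_reduce
      rw [map_dec_map_enc, traceOutB_emb]
      exact if_congr and_assoc.symm rfl rfl
  rw [key, key]
  have := viewOf_transfer (next := next) (B := B) (m₀ := m₀) (loss := loss) (T := T) (P := P)
    (Q := Q) (embHom (X.inclReg A.Q))
    (key := fun rA' τ => rA' = rA ∧ τ.map (Option.map X.enc) = τ') ?_ ?_
  · convert this
  · rintro r τ r' τ'' ⟨rfl, rfl⟩ ⟨rfl, hτ⟩
    exact ⟨rfl, List.map_injective_iff.mpr (Option.map_injective X.enc_injective) hτ.symm⟩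
  · rintro rA τ ⟨rfl, rfl⟩
    rwa [map_dec_map_enc] at h

theorem Duo.IsROT.lift {D : Duo C M (Option (Bool × Bool)) (Option (Bool × Bool))} {a b : ℝ}
    (h : D.IsROT a b) : (D.lift X).IsROT a b where
  correct loss hl := by
    obtain ⟨T₀, hT⟩ := h.correct loss hl
    refine ⟨T₀, fun T hT' x i => ?_⟩
    rw [← hT T hT' x i, ← outWeight_lift X D.A.honest D.B.honest]
  hidingA loss T rA τ := viewOf_lift X D.A.honest D.B.honest (h.hidingA _ _ _ _)
  hidingB loss T rB τ i v hv :=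
    viewOf_lift X D.B.honest D.A.honest (next := swapNext D.next)
      (P := fun rA τ => ∃ x, D.A.out rA τ = some x ∧ pick x (!i) = false)
      (Q := fun rA τ => ∃ x, D.A.out rA τ = some x ∧ pick x (!i) = true)
      (h.hidingB loss T rB _ i v hv)
  cheatA := h.cheatA.lift X D.B.honest
  cheatB := h.cheatB.lift X D.A.honest

theorem Duo.IsWCF.lift {D : Duo C M Bool Bool} {a b : ℝ} (h : D.IsWCF a b) :
    (D.lift X).IsWCF a b where
  correct loss hl := by
    obtain ⟨T₀, hT⟩ := h.correct loss hl
    refine ⟨T₀, fun T hT' c => ?_⟩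
    rw [← hT T hT' c, ← outWeight_lift X D.A.honest D.B.honest]
  cheatA := h.cheatA.lift X D.B.honest
  cheatB := h.cheatB.lift X D.A.honest

end DuoLift

/-! ### Operators acting on a part of the private register -/

section Slot

variable {Q Q₀ E M : Type} [Fintype Q] [Fintype Q₀] [Fintype E] [DecidableEq E] [Fintype M]

/-- A splitting of the private register, next to the message register. -/
def slotEquiv (M : Type) (g : Q ≃ Q₀ × E) : Q × Option M ≃ (Q₀ × Option M) × E where
  toFun i := (((g i.1).1, i.2), (g i.1).2)
  invFun i := (g.symm (i.1.1, i.2), i.1.2)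
  left_inv i := by simp
  right_inv i := by simp

/-- An operator acting on a part of the private register and the message. -/
def slot (g : Q ≃ Q₀ × E) (K : Matrix (Q₀ × Option M) (Q₀ × Option M) ℂ) :
    Matrix (Q × Option M) (Q × Option M) ℂ := amp (slotEquiv M g) K

theorem slot_apply (g : Q ≃ Q₀ × E) (K : Matrix (Q₀ × Option M) (Q₀ × Option M) ℂ) (i j) :
    slot g K i j = K ((g i.1).1, i.2) ((g j.1).1, j.2) * (1 : Matrix E E ℂ) (g i.1).2 (g j.1).2 :=
  rfl

theorem sum_slot [DecidableEq Q] [DecidableEq Q₀] [DecidableEq M] {O : Type} [Fintype O]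
    (g : Q ≃ Q₀ × E) {K : O → Matrix (Q₀ × Option M) (Q₀ × Option M) ℂ}
    (hK : ∑ o, (K o)ᴴ * K o = 1) : ∑ o, (slot g (K o))ᴴ * slot g (K o) = 1 := by
  simp only [slot, ← amp_conjTranspose, ← amp_mul, ← amp_sum, hK, amp_one]

end Slot

/-! ### Strategies that act like others on a part of their registers -/

section Cover

variable {C M : Type} [Fintype C] [Fintype M] [DecidableEq M]

/-- A splitting of the joint space, from splittings of the private registers. -/
def jointEquiv {A B A' B' : Strategy C M} {EA EB : Type} (gA : A'.Q ≃ A.Q × EA)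
    (gB : B'.Q ≃ B.Q × EB) : A'.Q × Option M × B'.Q ≃ (A.Q × Option M × B.Q) × (EA × EB) where
  toFun i := (((gA i.1).1, i.2.1, (gB i.2.2).1), ((gA i.1).2, (gB i.2.2).2))
  invFun i := (gA.symm (i.1.1, i.2.1), i.1.2.1, gB.symm (i.1.2.2, i.2.2))
  left_inv i := by simp
  right_inv i := by simp

variable {A B A' B' : Strategy C M} {EA EB : Type} [Fintype EA] [DecidableEq EA] [Fintype EB]
  [DecidableEq EB] (gA : A'.Q ≃ A.Q × EA) (gB : B'.Q ≃ B.Q × EB)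

theorem liftA_slot (K : Matrix (A.Q × Option M) (A.Q × Option M) ℂ) :
    liftA A' B' (slot gA K) = amp (jointEquiv gA gB) (liftA A B K) := by
  ext i j
  have h : (1 : Matrix B'.Q B'.Q ℂ) i.2.2 j.2.2 = (1 : Matrix B.Q B.Q ℂ) (gB i.2.2).1 (gB j.2.2).1 *
      (1 : Matrix EB EB ℂ) (gB i.2.2).2 (gB j.2.2).2 := by
    simp only [Matrix.one_apply, ← ite_and, mul_ite, mul_one, mul_zero]
    refine if_congr ?_ rfl rfl
    rw [← gB.injective.eq_iff, Prod.ext_iff, and_comm]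
  change K _ _ * (1 : Matrix EA EA ℂ) (gA i.1).2 (gA j.1).2 * (1 : Matrix B'.Q B'.Q ℂ) i.2.2 j.2.2 =
    K _ _ * (1 : Matrix B.Q B.Q ℂ) (gB i.2.2).1 (gB j.2.2).1 *
      (1 : Matrix (EA × EB) (EA × EB) ℂ) ((gA i.1).2, (gB i.2.2).2) ((gA j.1).2, (gB j.2.2).2)
  rw [h]
  by_cases h1 : (gA i.1).2 = (gA j.1).2 <;> by_cases h2 : (gB i.2.2).2 = (gB j.2.2).2 <;>
    simp [h1, h2, Matrix.one_apply, slotEquiv, jointEquiv]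

theorem liftB_slot (K : Matrix (B.Q × Option M) (B.Q × Option M) ℂ) :
    liftB A' B' (slot gB K) = amp (jointEquiv gA gB) (liftB A B K) := by
  ext i j
  have h : (1 : Matrix A'.Q A'.Q ℂ) i.1 j.1 = (1 : Matrix A.Q A.Q ℂ) (gA i.1).1 (gA j.1).1 *
      (1 : Matrix EA EA ℂ) (gA i.1).2 (gA j.1).2 := by
    simp only [Matrix.one_apply, ← ite_and, mul_ite, mul_one, mul_zero]
    refine if_congr ?_ rfl rfl
    rw [← gA.injective.eq_iff, Prod.ext_iff, and_comm]
  change K _ _ * (1 : Matrix EB EB ℂ) (gB i.2.2).2 (gB j.2.2).2 * (1 : Matrix A'.Q A'.Q ℂ) i.1 j.1 =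
    K _ _ * (1 : Matrix A.Q A.Q ℂ) (gA i.1).1 (gA j.1).1 *
      (1 : Matrix (EA × EB) (EA × EB) ℂ) ((gA i.1).2, (gB i.2.2).2) ((gA j.1).2, (gB j.2.2).2)
  rw [h]
  by_cases h1 : (gA i.1).2 = (gA j.1).2 <;> by_cases h2 : (gB i.2.2).2 = (gB j.2.2).2 <;>
    simp [h1, h2, Matrix.one_apply, slotEquiv, jointEquiv]

theorem stepA_slot_tens (σ) (K : Matrix (A.Q × Option M) (A.Q × Option M) ℂ) (ρ : Joint A B) :
    stepA A' B' (slot gA K) (tens (jointEquiv gA gB) σ ρ) =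
      tens (jointEquiv gA gB) σ (stepA A B K ρ) := by
  rw [stepA, liftA_slot gA gB, amp_conj_tens]; rfl

theorem stepB_slot_tens (σ) (K : Matrix (B.Q × Option M) (B.Q × Option M) ℂ) (ρ : Joint A B) :
    stepB A' B' (slot gB K) (tens (jointEquiv gA gB) σ ρ) =
      tens (jointEquiv gA gB) σ (stepB A B K ρ) := by
  rw [stepB, liftB_slot gA gB, amp_conj_tens]; rfl

theorem chan_tens (σ) (l : Bool) (ρ : Joint A B) :
    chan A' B' l (tens (jointEquiv gA gB) σ ρ) = tens (jointEquiv gA gB) σ (chan A B l ρ) := by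
  cases l
  · rfl
  · ext i j
    simp only [chan, if_true, lose, Matrix.of_apply, tens_apply, jointEquiv, Equiv.coe_fn_mk,
      ← Finset.sum_mul, mul_assoc]

theorem ptr_stepA_slot (K : Matrix (A.Q × Option M) (A.Q × Option M) ℂ) (ρ : Joint A' B') :
    ptr (jointEquiv gA gB) (stepA A' B' (slot gA K) ρ) =
      stepA A B K (ptr (jointEquiv gA gB) ρ) := by
  rw [stepA, liftA_slot gA gB, ptr_amp_conj]; rfl

theorem ptr_stepB_slot (K : Matrix (B.Q × Option M) (B.Q × Option M) ℂ) (ρ : Joint A' B') :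
    ptr (jointEquiv gA gB) (stepB A' B' (slot gB K) ρ) =
      stepB A B K (ptr (jointEquiv gA gB) ρ) := by
  rw [stepB, liftB_slot gA gB, ptr_amp_conj]; rfl

theorem ptr_chan (l : Bool) (ρ : Joint A' B') :
    ptr (jointEquiv gA gB) (chan A' B' l ρ) = chan A B l (ptr (jointEquiv gA gB) ρ) := by
  cases l
  · rfl
  · ext i j
    simp only [chan, if_true, lose, Matrix.of_apply, ptr, jointEquiv, Equiv.coe_fn_symm_mk,
      Matrix.sum_apply, Matrix.submatrix_apply, ← Finset.mul_sum]
    rw [Finset.sum_comm]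

/-- A relation between states of two pairs of strategies that is preserved when the same operators
act on both. -/
structure StableRel (rel : Joint A B → Joint A' B' → Prop) : Prop where
  stepA : ∀ K ρ ρ', rel ρ ρ' → rel (stepA A B K ρ) (QProto.stepA A' B' (slot gA K) ρ')
  stepB : ∀ K ρ ρ', rel ρ ρ' → rel (stepB A B K ρ) (QProto.stepB A' B' (slot gB K) ρ')
  chan : ∀ l ρ ρ', rel ρ ρ' → rel (chan A B l ρ) (QProto.chan A' B' l ρ')

/-- For the case that the unused registers are in a fixed state, in a product with the rest. -/
theorem stableRel_tens (σ : Matrix (EA × EB) (EA × EB) ℂ) :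
    StableRel gA gB fun ρ ρ' => ρ' = tens (jointEquiv gA gB) σ ρ where
  stepA := by rintro K ρ _ rfl; exact stepA_slot_tens gA gB σ K ρ
  stepB := by rintro K ρ _ rfl; exact stepB_slot_tens gA gB σ K ρ
  chan := by rintro K ρ _ rfl; exact chan_tens gA gB σ K ρ

/-- For the case that the unused registers may be entangled with the active ones, as happens when a
cheater enters the second protocol. -/
theorem stableRel_ptr : StableRel gA gB fun ρ ρ' => ρ = ptr (jointEquiv gA gB) ρ' where
  stepA := by rintro K _ ρ' rfl; exact (ptr_stepA_slot gA gB K ρ').symm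
  stepB := by rintro K _ ρ' rfl; exact (ptr_stepB_slot gA gB K ρ').symm
  chan := by rintro K _ ρ' rfl; exact (ptr_chan gA gB K ρ').symm

/-- After the transcript `base`, the strategy `S'` acts like `S` on a part of its register. -/
def Covers (S S' : Strategy C M) {E : Type} [Fintype E] [DecidableEq E] (g : S'.Q ≃ S.Q × E)
    (rec : List S.R → List S'.R) (base : List (Option C)) (P : List S.R → List (Option C) → Prop) :
    Prop := ∀ r τ, P r τ → ∃ inj : S.R × Option C → S'.R × Option C, Function.Injective inj ∧
    S'.op (rec r) (τ ++ base) = extendOp inj (fun o => slot g (S.op r τ o)) ∧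
    ∀ o, rec (o.1 :: r) = (inj o).1 :: rec r ∧ (inj o).2 = o.2

variable {gA gB}

/-- An instance of `run_sim`: both players of the second run imitate those of the first on parts of
their registers, after an earlier transcript `base`. The turn number is shifted by `base.length`,
hence the condition on the losses. The invariant `inv` records where the imitation is valid. -/
theorem run_cover {N : Type} [AddCommMonoid N] {next next' : List (Option C) → Option Party}
    {loss loss' : ℕ → Bool} {f : List A.R → List B.R → List (Option C) → Joint A B → N}
    {f' : List A'.R → List B'.R → List (Option C) → Joint A' B' → N}
    {recA : List A.R → List A'.R} {recB : List B.R → List B'.R} {base : List (Option C)}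
    {PA : List A.R → List (Option C) → Prop} {PB : List B.R → List (Option C) → Prop}
    (hA : Covers A A' gA recA base PA) (hB : Covers B B' gB recB base PB)
    {rel : Joint A B → Joint A' B' → Prop} (hrel : StableRel gA gB rel) (T k : ℕ)
    (inv : List A.R → List B.R → List (Option C) → Prop)
    (hinv : ∀ rA rB τ p, inv rA rB τ → next τ = some p → next' (τ ++ base) = some p ∧
      (p = .alice → PA rA τ ∧ ∀ r s, inv (r :: rA) rB (s :: τ)) ∧
      (p = .bob → PB rB τ ∧ ∀ r s, inv rA (r :: rB) (s :: τ)))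
    (hloss : ∀ i, loss' (i + base.length) = loss i)
    (hf : ∀ rA rB τ, next τ = none → f rA rB τ 0 = 0)
    (hf' : ∀ rA rB τ, next' τ = none → f' rA rB τ 0 = 0)
    (hzero : ∀ rA rB τ p ρ', inv rA rB τ → next τ = some p →
      run next' A' B' loss' f' k (recA rA) (recB rB) (τ ++ base) ρ' = 0)
    (hover : ∀ n rA rB τ ρ ρ', inv rA rB τ → rel ρ ρ' → n + τ.length = T → next τ = none →
      f rA rB τ ρ = run next' A' B' loss' f' (n + k) (recA rA) (recB rB) (τ ++ base) ρ')
    (n : ℕ) (rA rB τ) (ρ ρ') (hτ : inv rA rB τ) (hρ : rel ρ ρ') (hT : n + τ.length = T) :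
    run next A B loss f n rA rB τ ρ =
      run next' A' B' loss' f' (n + k) (recA rA) (recB rB) (τ ++ base) ρ' := by
  refine run_sim (A := A) (B := B) (A' := A') (B' := B') T k
    (fun rA rB τ ρ rA' rB' τ' ρ' => rA' = recA rA ∧ rB' = recB rB ∧ τ' = τ ++ base ∧ inv rA rB τ ∧
      rel ρ ρ') hf hf' ?_ ?_ ?_ ?_ n _ _ _ _ _ _ _ _ ⟨rfl, rfl, rfl, hτ, hρ⟩ hT
  · rintro n rA rB τ ρ _ _ _ ρ' ⟨rfl, rfl, rfl, hi, hr⟩ hT h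
    exact hover _ _ _ _ _ _ hi hr hT h
  · rintro p rA rB τ ρ _ _ _ ρ' ⟨rfl, rfl, rfl, hi, hr⟩ h
    exact ⟨(hinv _ _ _ _ hi h).1, hzero _ _ _ _ _ hi h⟩
  · rintro rA rB τ ρ _ _ _ ρ' ⟨rfl, rfl, rfl, hi, hr⟩ h
    obtain ⟨hP, hs⟩ := (hinv _ _ _ _ hi h).2.1 rfl
    obtain ⟨inj, hinj, hop, hrec⟩ := hA rA τ hP
    refine Matched.of_injective inj hinj (fun o' ho => ?_) fun o => ?_
    · rw [hop, extendOp_zero _ ho, stepA_zero]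
    · refine ⟨(hrec o).1.symm, rfl, by rw [(hrec o).2]; rfl, hs _ _, ?_⟩
      rw [hop, extendOp_apply hinj, List.length_append, hloss]
      exact hrel.chan _ _ _ (hrel.stepA _ _ _ hr)
  · rintro rA rB τ ρ _ _ _ ρ' ⟨rfl, rfl, rfl, hi, hr⟩ h
    obtain ⟨hP, hs⟩ := (hinv _ _ _ _ hi h).2.2 rfl
    obtain ⟨inj, hinj, hop, hrec⟩ := hB rB τ hP
    refine Matched.of_injective inj hinj (fun o' ho => ?_) fun o => ?_
    · rw [hop, extendOp_zero _ ho, stepB_zero]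
    · refine ⟨rfl, (hrec o).1.symm, by rw [(hrec o).2]; rfl, hs _ _, ?_⟩
      rw [hop, extendOp_apply hinj, List.length_append, hloss]
      exact hrel.chan _ _ _ (hrel.stepB _ _ _ hr)

/-- If every continuation of length `m` ends the protocol at its last symbol at the latest,
additional turns are never used. -/
theorem run_stable {N : Type} [AddCommMonoid N] {next : List (Option C) → Option Party}
    {loss : ℕ → Bool} {f : List A.R → List B.R → List (Option C) → Joint A B → N} (m n : ℕ) :
    ∀ rA rB τ ρ, (∀ σ : List (Option C), σ.length = m → next (σ ++ τ) = none) →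
      run next A B loss f (n + m) rA rB τ ρ = run next A B loss f m rA rB τ ρ := by
  induction m with
  | zero =>
    intro rA rB τ ρ h
    have : next τ = none := h [] rfl
    rw [run_over this, run_over this]
  | succ m ih =>
    intro rA rB τ ρ h
    have h' : ∀ s, ∀ σ : List (Option C), σ.length = m → next (σ ++ s :: τ) = none :=
      fun s σ hσ => by simpa using h (σ ++ [s]) (by simpa using hσ)
    rw [← Nat.add_assoc]
    rcases hp : next τ with _ | _ | _
    · rw [run_over hp, run_over hp]
    · rw [run_alice hp, run_alice hp]
      exact Finset.sum_congr rfl fun o _ => ih _ _ _ _ (h' _)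
    · rw [run_bob hp, run_bob hp]
      exact Finset.sum_congr rfl fun o _ => ih _ _ _ _ (h' _)

end Cover

/-! ### Splitting a transcript where the first protocol ends -/

section Cut

variable {S : Type} {next : List S → Option Party}

/-- The transcript split at the first moment when the first protocol was over: what was said after
that, and what was said before. -/
def cut (next : List S → Option Party) : List S → Option (List S × List S)
  | [] => if (next []).isNone then some ([], []) else none
  | s :: τ =>
    match cut next τ with
    | some (a, b) => some (s :: a, b)
    | none => if (next (s :: τ)).isNone then some ([], s :: τ) else none

/-- The first protocol was not over before. -/
def Proper (next : List S → Option Party) (τ : List S) : Prop :=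
  ∀ υ, υ <:+ τ → υ ≠ τ → next υ ≠ none

theorem proper_nil : Proper next ([] : List S) := fun _ h h' =>
  absurd (List.suffix_nil.mp h) h'

theorem Proper.cons {τ : List S} (h : Proper next τ) (h' : next τ ≠ none) (s : S) :
    Proper next (s :: τ) := fun υ hυ hne => by
  rcases List.suffix_cons_iff.mp hυ with rfl | hυ
  · exact absurd rfl hne
  · by_cases hυτ : υ = τ
    · rwa [hυτ]
    · exact h υ hυ hυτ

theorem cut_eq_none_iff {τ : List S} : cut next τ = none ↔ ∀ υ, υ <:+ τ → next υ ≠ none := by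
  induction τ with
  | nil => simp [cut, List.suffix_nil]
  | cons s τ ih =>
    rw [cut]
    rcases h : cut next τ with _ | ⟨a, b⟩
    · simp only [List.suffix_cons_iff, forall_eq_or_imp]
      simp
      exact fun _ => ih.mp h
    · simp only [reduceCtorEq, false_iff]
      intro h'
      rw [ih.mpr fun υ hυ => h' υ (hυ.trans (List.suffix_cons _ _))] at h
      cases h

theorem cut_spec {τ a b : List S} (h : cut next τ = some (a, b)) :
    τ = a ++ b ∧ next b = none ∧ Proper next b := by
  induction τ generalizing a with
  | nil =>
    rw [cut] at h
    split at h
    · cases h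
      exact ⟨rfl, by simp_all, proper_nil⟩
    · cases h
  | cons s τ ih =>
    rw [cut] at h
    rcases h' : cut next τ with _ | ⟨a', b'⟩
    · rw [h'] at h
      simp only at h
      split at h
      · cases h
        have := cut_eq_none_iff.mp h'
        refine ⟨rfl, by simp_all, Proper.cons (fun υ hυ _ => this υ hυ) ?_ s⟩
        exact this τ (List.suffix_refl _)
      · cases h
    · rw [h'] at h
      cases h
      obtain ⟨h1, h2⟩ := ih h'
      exact ⟨by rw [h1]; rfl, h2⟩

theorem Proper.cut_eq_none {τ : List S} (h : Proper next τ) (h' : next τ ≠ none) :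
    cut next τ = none := cut_eq_none_iff.mpr fun υ hυ => by
  by_cases hυτ : υ = τ
  · rwa [hυτ]
  · exact h υ hυ hυτ

theorem Proper.cut_eq_some {b : List S} (h : Proper next b) (h' : next b = none) (a : List S) :
    cut next (a ++ b) = some (a, b) := by
  induction a with
  | nil =>
    cases b with
    | nil => simp [cut, h']
    | cons s τ =>
      have : cut next τ = none := cut_eq_none_iff.mpr fun υ hυ => h υ
        (hυ.trans (List.suffix_cons _ _)) fun he => by
          have := hυ.length_le
          rw [he] at this
          simp at this
      simp [cut, this, h']
  | cons s a ih => simp [cut, ih]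

/-- A protocol that is still running at `τ` needs at least one of the symbols of `σ` to end. -/
theorem Proper.length_lt_of_cut {τ σ a b : List S} (h : Proper next τ) (h' : next τ ≠ none)
    (hc : cut next (σ ++ τ) = some (a, b)) : a.length < σ.length := by
  obtain ⟨h1, h2, -⟩ := cut_spec hc
  by_contra hlt
  have hb : b <:+ τ := by
    refine List.suffix_of_suffix_length_le (l₃ := σ ++ τ) ⟨a, h1.symm⟩ ⟨σ, rfl⟩ ?_
    have := congrArg List.length h1
    simp at this
    omega
  by_cases hbτ : b = τ
  · exact h' (hbτ ▸ h2)
  · exact h b hb hbτ h2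

end Cut

/-! ### Protocols followed by two classical announcements -/

section Say

variable {C M : Type} [Fintype C] [Fintype M] [DecidableEq M]

/-- The order of turns when, after the end of a protocol, first `p` and then `q` makes an
announcement. -/
def nextSay (next : List (Option C) → Option Party) (p q : Party) (τ : List (Option C)) :
    Option Party :=
  match cut next τ with
  | none => next τ
  | some ([], _) => some p
  | some ([_], _) => some q
  | some (_ :: _ :: _, _) => none

theorem cut_swapNext (next : List (Option C) → Option Party) : cut (swapNext next) = cut next := by
  have h : ∀ τ, (swapNext next τ).isNone = (next τ).isNone := fun τ => by
    rcases h : next τ <;> simp [swapNext, h]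
  funext τ
  induction τ with
  | nil => simp only [cut, h]
  | cons s τ ih => simp only [cut, h, ih]

theorem swapNext_nextSay (next : List (Option C) → Option Party) (p q : Party) :
    swapNext (nextSay next p q) = nextSay (swapNext next) p.swap q.swap := by
  funext τ
  rw [nextSay, cut_swapNext, swapNext, nextSay]
  rcases cut next τ with _ | ⟨_ | ⟨_, _ | _⟩, _⟩ <;> rfl

variable {next : List (Option C) → Option Party} {p q : Party}

theorem nextSay_of_cut_none {τ : List (Option C)} (h : cut next τ = none) :
    nextSay next p q τ = next τ := by rw [nextSay, h]

theorem cut_cons_of_cut {τ a b : List (Option C)} (h : cut next τ = some (a, b)) {s : Option C} :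
    cut next (s :: τ) = some (s :: a, b) := by rw [cut, h]

theorem nextSay_first {b : List (Option C)} (h : cut next b = some ([], b)) :
    nextSay next p q b = some p := by rw [nextSay, h]

theorem nextSay_second {b : List (Option C)} (h : cut next b = some ([], b)) {s : Option C} :
    nextSay next p q (s :: b) = some q := by rw [nextSay, cut_cons_of_cut h]

theorem nextSay_over {b : List (Option C)} (h : cut next b = some ([], b)) {s s' : Option C} :
    nextSay next p q (s' :: s :: b) = none := by
  rw [nextSay, cut_cons_of_cut (cut_cons_of_cut h)]

theorem nextSay_ne_none {τ : List (Option C)} (h : ∀ a b, cut next τ = some (a, b) → a.length < 2) :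
    nextSay next p q τ ≠ none := by
  rw [nextSay]
  rcases hc : cut next τ with _ | ⟨_ | ⟨_, _ | _⟩, _⟩
  · exact cut_eq_none_iff.mp hc _ (List.suffix_refl _)
  · simp
  · simp
  · have := h _ _ hc
    simp at this

theorem nextSay_bounded (hb : ∃ N : ℕ, ∀ τ σ : List (Option C), σ.length = N → none ∉ σ →
      ∃ υ : List (Option C), υ <:+ σ ++ τ ∧ next υ = none) :
    ∃ N : ℕ, ∀ τ σ : List (Option C), σ.length = N → none ∉ σ →
      ∃ υ : List (Option C), υ <:+ σ ++ τ ∧ nextSay next p q υ = none := by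
  obtain ⟨N, hN⟩ := hb
  refine ⟨N + 2, fun τ σ hσ hn => ?_⟩
  obtain ⟨s, s', σ, rfl⟩ : ∃ s s' σ', σ = s :: s' :: σ' := by
    rcases σ with _ | ⟨s, _ | ⟨s', σ'⟩⟩ <;> simp_all
  obtain ⟨υ, hυ, hυ'⟩ := hN τ σ (by simpa using hσ) fun h => hn (by simp [h])
  rcases hc : cut next (s :: s' :: (σ ++ τ)) with _ | ⟨a, b⟩
  · exact absurd hυ' (cut_eq_none_iff.mp hc υ (hυ.trans ⟨[s, s'], rfl⟩))
  · obtain ⟨h1, h2, h3⟩ := cut_spec hc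
    refine ⟨s :: s' :: (σ ++ τ), List.suffix_refl _, ?_⟩
    have hlen : 2 ≤ a.length := by
      by_contra hlt
      have hs : υ <:+ b := by
        refine List.suffix_of_suffix_length_le (l₃ := s :: s' :: (σ ++ τ))
          (hυ.trans ⟨[s, s'], rfl⟩) ⟨a, h1.symm⟩ ?_
        have := congrArg List.length h1
        have := hυ.length_le
        simp at *
        omega
      by_cases hυb : υ = b
      · have := congrArg List.length h1
        have := hυ.length_le
        subst hυb
        simp at *
        omega
      · exact h3 υ hs hυb hυ'
    rw [nextSay, hc]
    rcases a with _ | ⟨_, _ | _⟩ <;> simp_all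

/-- The operators of a strategy that finally makes the announcement `msg`. -/
def Strategy.sayOp (S : Strategy C M) (next : List (Option C) → Option Party)
    (msg : List S.R → List (Option C) → List (Option C) → C) (r : List (Option S.R))
    (τ : List (Option C)) :
    Option S.R × Option C → Matrix (S.Q × Option M) (S.Q × Option M) ℂ :=
  match cut next τ with
  | none => extendOp (fun o : S.R × Option C => (some o.1, o.2)) (S.op r.reduceOption τ)
  | some (a, b) => extendOp (fun _ : Unit => (none, some (msg r.reduceOption a b))) fun _ => 1

theorem some_pair_injective {R S : Type} :
    Function.Injective fun o : R × S => ((some o.1, o.2) : Option R × S) := by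
  rintro ⟨r, s⟩ ⟨r', s'⟩ h
  simpa using h

/-- A strategy followed by the announcement `msg`. -/
abbrev Strategy.say (S : Strategy C M) (next : List (Option C) → Option Party)
    (msg : List S.R → List (Option C) → List (Option C) → C) : Strategy C M where
  Q := S.Q
  R := Option S.R
  init := S.init
  init_posSemidef := S.init_posSemidef
  init_trace := S.init_trace
  op := S.sayOp next msg
  op_complete r τ := by
    unfold Strategy.sayOp
    rcases cut next τ with _ | ⟨a, b⟩
    · rw [sum_extendOp some_pair_injective, S.op_complete]
    · rw [sum_extendOp (Function.injective_of_subsingleton _)]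
      simp

theorem Strategy.LossFree.say {S : Strategy C M} (hS : S.LossFree)
    (next : List (Option C) → Option Party)
    (msg : List S.R → List (Option C) → List (Option C) → C) : (S.say next msg).LossFree := by
  intro r τ o q q' m
  rcases hc : cut next τ with _ | ⟨a, b⟩
  · simp only [Strategy.sayOp, hc]
    rcases extendOp_cases some_pair_injective (S.op r.reduceOption τ) o with h | ⟨o, rfl, h⟩
    · simp [h]
    · rw [h]
      exact hS _ _ _ _ _ _
  · simp only [Strategy.sayOp, hc]
    rcases extendOp_cases (Function.injective_of_subsingleton
      (fun _ : Unit => ((none, some (msg r.reduceOption a b)) : Option S.R × Option C)))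
      (fun _ => (1 : Matrix (S.Q × Option M) (S.Q × Option M) ℂ)) o with h | ⟨-, rfl, h⟩
    · simp [h]
    · simp [h, Matrix.one_apply]

/-- The trivial splitting of a register. -/
abbrev unitEquiv (Q : Type) : Q ≃ Q × Unit := (Equiv.prodUnique Q Unit).symm

theorem slot_unit {Q : Type} [Fintype Q] (K : Matrix (Q × Option M) (Q × Option M) ℂ) :
    slot (unitEquiv Q) K = K := by
  ext i j
  simp [slot_apply]

theorem reduceOption_map_some {α : Type} (l : List α) : (l.map some).reduceOption = l := by
  induction l with
  | nil => rfl
  | cons a l ih => rw [List.map_cons, List.reduceOption_cons_of_some, ih]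

theorem Covers.refl (S : Strategy C M) (P : List S.R → List (Option C) → Prop) :
    Covers S S (unitEquiv S.Q) id [] P := fun r τ _ =>
  ⟨id, Function.injective_id, by
    funext o
    have := extendOp_apply (ι := S.Q × Option M) Function.injective_id
      (fun o => slot (unitEquiv S.Q) (S.op r τ o)) o
    rw [id_eq, slot_unit] at this
    rw [List.append_nil, id_eq, this], fun _ => ⟨rfl, rfl⟩⟩

theorem Covers.say (S : Strategy C M) (msg : List S.R → List (Option C) → List (Option C) → C) :
    Covers S (S.say next msg) (unitEquiv S.Q) (List.map some) [] (fun _ τ => cut next τ = none) :=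
  fun r τ hτ => ⟨_, some_pair_injective, by
    simp only [List.append_nil, Strategy.sayOp, hτ, reduceOption_map_some, slot_unit],
    fun _ => ⟨rfl, rfl⟩⟩

theorem tens_unit {A B : Strategy C M} (ρ : Joint A B) :
    tens (jointEquiv (A := A) (B := B) (A' := A) (B' := B) (unitEquiv A.Q) (unitEquiv B.Q)) 1 ρ =
      ρ := by
  ext i j
  rw [tens_apply, Subsingleton.elim (jointEquiv _ _ i).2 (jointEquiv _ _ j).2, Matrix.one_apply_eq,
    mul_one]
  rfl

variable {A B A' B' : Strategy C M} {EA EB : Type} [Fintype EA] [DecidableEq EA] [Fintype EB]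
  [DecidableEq EB] {gA : A'.Q ≃ A.Q × EA} {gB : B'.Q ≃ B.Q × EB}
  {N : Type} [AddCommMonoid N] {loss : ℕ → Bool}

/-- The two turns added to `T` are exactly those of the announcements; until then the covered
players behave as in the protocol without announcements. -/
theorem run_nextSay {f : List A.R → List B.R → List (Option C) → Joint A B → N}
    {f' : List A'.R → List B'.R → List (Option C) → Joint A' B' → N}
    {recA : List A.R → List A'.R} {recB : List B.R → List B'.R}
    (hA : Covers A A' gA recA [] (fun _ τ => cut next τ = none))
    (hB : Covers B B' gB recB [] (fun _ τ => cut next τ = none))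
    {rel : Joint A B → Joint A' B' → Prop} (hrel : StableRel gA gB rel)
    (hf : ∀ rA rB τ, next τ = none → f rA rB τ 0 = 0) (hf' : ∀ rA rB τ, f' rA rB τ 0 = 0)
    (hover : ∀ rA rB b ρ ρ', cut next b = some ([], b) → rel ρ ρ' →
      f rA rB b ρ = run (nextSay next p q) A' B' loss f' 2 (recA rA) (recB rB) b ρ')
    (T : ℕ) (ρ ρ') (hρ : rel ρ ρ') :
    run (nextSay next p q) A' B' loss f' (T + 2) (recA []) (recB []) [] ρ' =
      run next A B loss f T [] [] [] ρ := by
  refine (run_cover hA hB hrel T 2 (fun _ _ τ => Proper next τ) ?_ (fun i => rfl) hf (fun _ _ _ _ => hf' _ _ _)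
    ?_ ?_ T [] [] [] ρ ρ' proper_nil hρ rfl).symm
  · intro rA rB τ p hτ h
    have hc := hτ.cut_eq_none (by simp [h])
    have hs := hτ.cons (by simp [h])
    exact ⟨by rw [List.append_nil, nextSay_of_cut_none hc, h], fun _ => ⟨hc, fun _ s => hs s⟩,
      fun _ => ⟨hc, fun _ s => hs s⟩⟩
  -- If the protocol is still running when only the two additional turns are left, at least one of
  -- them is needed to end it, and both announcements cannot follow.
  · intro rA rB τ p ρ' hτ h
    refine run_eq_zero_of_alive _ _ _ _ _ fun σ hσ => nextSay_ne_none fun a b hc => ?_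
    rw [List.append_nil] at hc
    have := hτ.length_lt_of_cut (by simp [h]) hc
    omega
  · intro n rA rB τ ρ ρ' hτ hr _ h
    rw [List.append_nil, run_stable 2 n]
    · exact hover _ _ _ _ _ (hτ.cut_eq_some h []) hr
    · intro σ hσ
      rw [nextSay, hτ.cut_eq_some h σ]
      match σ, hσ with
      | [_, _], _ => rfl

theorem run_nextSay_eq_zero {f' : List A'.R → List B'.R → List (Option C) → Joint A' B' → N}
    {T : ℕ} (hT : T < 2) (rA rB ρ) : run (nextSay next p q) A' B' loss f' T rA rB [] ρ = 0 := by
  refine run_eq_zero_of_alive _ _ _ _ _ fun σ hσ => nextSay_ne_none fun a b hc => ?_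
  have := congrArg List.length (cut_spec hc).1
  simp at this
  omega

theorem liftA_one : liftA A B 1 = 1 := by rw [liftA_eq_amp, amp_one]
theorem liftB_one : liftB A B 1 = 1 := by rw [liftB_eq_amp, amp_one]
theorem stepA_one (ρ : Joint A B) : stepA A B 1 ρ = ρ := by simp [stepA, liftA_one]
theorem stepB_one (ρ : Joint A B) : stepB A B 1 ρ = ρ := by simp [stepB, liftB_one]

theorem run_say_alice {n' : List (Option C) → Option Party}
    {msg : List A.R → List (Option C) → List (Option C) → C}
    {f : List (Option A.R) → List B.R → List (Option C) → Joint (A.say next msg) B → N}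
    (hf : ∀ rA rB τ, f rA rB τ 0 = 0) {τ a b : List (Option C)} (hτ : n' τ = some Party.alice)
    (hc : cut next τ = some (a, b)) (n : ℕ) (rA rB ρ) :
    run n' (A.say next msg) B loss f (n + 1) rA rB τ ρ =
      run n' (A.say next msg) B loss f n (none :: rA) rB (some (msg rA.reduceOption a b) :: τ)
        (chan (A.say next msg) B (loss τ.length) ρ) := by
  rw [run_alice hτ]
  simp only [Strategy.sayOp, hc]
  rw [Fintype.sum_eq_single (none, some (msg rA.reduceOption a b))]
  · rw [show ((none, some (msg rA.reduceOption a b)) : Option A.R × Option C) =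
      (fun _ : Unit => (none, some (msg rA.reduceOption a b))) () from rfl,
      extendOp_apply (Function.injective_of_subsingleton _) _ (), stepA_one]
  · intro o ho
    rw [extendOp_zero, stepA_zero, chan_zero, run_null fun _ _ _ _ => hf _ _ _]
    rintro ⟨_, rfl⟩
    exact ho rfl

theorem run_say_bob {n' : List (Option C) → Option Party}
    {msg : List B.R → List (Option C) → List (Option C) → C}
    {f : List A.R → List (Option B.R) → List (Option C) → Joint A (B.say next msg) → N}
    (hf : ∀ rA rB τ, f rA rB τ 0 = 0) {τ a b : List (Option C)} (hτ : n' τ = some Party.bob)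
    (hc : cut next τ = some (a, b)) (n : ℕ) (rA rB ρ) :
    run n' A (B.say next msg) loss f (n + 1) rA rB τ ρ =
      run n' A (B.say next msg) loss f n rA (none :: rB) (some (msg rB.reduceOption a b) :: τ)
        (chan A (B.say next msg) (loss τ.length) ρ) := by
  rw [run_bob hτ]
  simp only [Strategy.sayOp, hc]
  rw [Fintype.sum_eq_single (none, some (msg rB.reduceOption a b))]
  · rw [show ((none, some (msg rB.reduceOption a b)) : Option B.R × Option C) =
      (fun _ : Unit => (none, some (msg rB.reduceOption a b))) () from rfl,
      extendOp_apply (Function.injective_of_subsingleton _) _ (), stepB_one]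
  · intro o ho
    rw [extendOp_zero, stepB_zero, chan_zero, run_null fun _ _ _ _ => hf _ _ _]
    rintro ⟨_, rfl⟩
    exact ho rfl

/-- Both players make an announcement, Bob first. -/
theorem run_say_say {msgA : List A.R → List (Option C) → List (Option C) → C}
    {msgB : List B.R → List (Option C) → List (Option C) → C}
    {f : List (Option A.R) → List (Option B.R) → List (Option C) →
      Joint (A.say next msgA) (B.say next msgB) → N}
    (hf : ∀ rA rB τ, f rA rB τ 0 = 0) (T : ℕ) (ρ : Joint A B) :
    run (nextSay next .bob .alice) (A.say next msgA) (B.say next msgB) loss f (T + 2) [] [] [] ρ =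
      run next A B loss (fun rA rB b ρ =>
        f (none :: rA.map some) (none :: rB.map some)
          (some (msgA rA [some (msgB rB [] b)] b) :: some (msgB rB [] b) :: b)
          (chan A B (loss (b.length + 1)) (chan A B (loss b.length) ρ))) T [] [] [] ρ := by
  refine run_nextSay (A' := A.say next msgA) (B' := B.say next msgB) (Covers.say A msgA)
    (Covers.say B msgB) (rel := fun ρ ρ' => ρ' = ρ) ?_ ?_ hf ?_ T ρ ρ rfl
  · have := stableRel_tens (A := A) (B := B) (A' := A.say next msgA) (B' := B.say next msgB)
      (unitEquiv A.Q) (unitEquiv B.Q) 1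
    convert this using 4 with ρ ρ'
    exact (tens_unit ρ).symm
  · intros
    rw [chan_zero, chan_zero, hf]
  · rintro rA rB b ρ _ hc rfl
    rw [run_say_bob hf (nextSay_first hc) hc, run_say_alice hf
      (nextSay_second hc) (cut_cons_of_cut hc), run_over
      (nextSay_over hc), reduceOption_map_some,
      reduceOption_map_some]
    rfl

/-- Both players make an announcement, Alice first. -/
theorem run_say_say' {msgA : List A.R → List (Option C) → List (Option C) → C}
    {msgB : List B.R → List (Option C) → List (Option C) → C}
    {f : List (Option A.R) → List (Option B.R) → List (Option C) →
      Joint (A.say next msgA) (B.say next msgB) → N}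
    (hf : ∀ rA rB τ, f rA rB τ 0 = 0) (T : ℕ) (ρ : Joint A B) :
    run (nextSay next .alice .bob) (A.say next msgA) (B.say next msgB) loss f (T + 2) [] [] [] ρ =
      run next A B loss (fun rA rB b ρ =>
        f (none :: rA.map some) (none :: rB.map some)
          (some (msgB rB [some (msgA rA [] b)] b) :: some (msgA rA [] b) :: b)
          (chan A B (loss (b.length + 1)) (chan A B (loss b.length) ρ))) T [] [] [] ρ := by
  refine run_nextSay (A' := A.say next msgA) (B' := B.say next msgB) (Covers.say A msgA)
    (Covers.say B msgB) (rel := fun ρ ρ' => ρ' = ρ) ?_ ?_ hf ?_ T ρ ρ rfl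
  · have := stableRel_tens (A := A) (B := B) (A' := A.say next msgA) (B' := B.say next msgB)
      (unitEquiv A.Q) (unitEquiv B.Q) 1
    convert this using 4 with ρ ρ'
    exact (tens_unit ρ).symm
  · intros
    rw [chan_zero, chan_zero, hf]
  · rintro rA rB b ρ _ hc rfl
    rw [run_say_alice hf (nextSay_first hc) hc, run_say_bob hf
      (nextSay_second hc) (cut_cons_of_cut hc), run_over
      (nextSay_over hc), reduceOption_map_some,
      reduceOption_map_some]
    rfl

/-- A dishonest Alice meets an honest Bob who makes the first announcement. -/
theorem run_cheat_say {msg : List B.R → List (Option C) → List (Option C) → C}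
    {f : List A.R → List (Option B.R) → List (Option C) → Joint A (B.say next msg) → N}
    (hf : ∀ rA rB τ, f rA rB τ 0 = 0) (T : ℕ) (ρ : Joint A B) :
    run (nextSay next .bob .alice) A (B.say next msg) noLoss f (T + 2) [] [] [] ρ =
      run next A B noLoss (fun rA rB b ρ => ∑ o,
        f (o.1 :: rA) (none :: rB.map some) (o.2 :: some (msg rB [] b) :: b)
          (stepA A B (A.op rA (some (msg rB [] b) :: b) o) ρ)) T [] [] [] ρ := by
  refine run_nextSay (A' := A) (B' := B.say next msg) (Covers.refl A _)
    (Covers.say B msg) (rel := fun ρ ρ' => ρ' = ρ) ?_ ?_ hf ?_ T ρ ρ rfl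
  · have := stableRel_tens (A := A) (B := B) (A' := A) (B' := B.say next msg)
      (unitEquiv A.Q) (unitEquiv B.Q) 1
    convert this using 4 with ρ ρ'
    exact (tens_unit ρ).symm
  · intros
    exact Finset.sum_eq_zero fun o _ => by rw [stepA, mul_zero, zero_mul, hf]
  · rintro rA rB b ρ _ hc rfl
    rw [run_say_bob hf (nextSay_first hc) hc, run_alice
      (nextSay_second hc), reduceOption_map_some]
    refine Finset.sum_congr rfl fun o _ => ?_
    rw [run_over (nextSay_over hc)]
    rfl

/-- A dishonest Alice makes the first announcement and meets an honest Bob. -/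
theorem run_cheat_say' {msg : List B.R → List (Option C) → List (Option C) → C}
    {f : List A.R → List (Option B.R) → List (Option C) → Joint A (B.say next msg) → N}
    (hf : ∀ rA rB τ, f rA rB τ 0 = 0) (T : ℕ) (ρ : Joint A B) :
    run (nextSay next .alice .bob) A (B.say next msg) noLoss f (T + 2) [] [] [] ρ =
      run next A B noLoss (fun rA rB b ρ => ∑ o,
        f (o.1 :: rA) (none :: rB.map some) (some (msg rB [o.2] b) :: o.2 :: b)
          (stepA A B (A.op rA b o) ρ)) T [] [] [] ρ := by
  refine run_nextSay (A' := A) (B' := B.say next msg) (Covers.refl A _)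
    (Covers.say B msg) (rel := fun ρ ρ' => ρ' = ρ) ?_ ?_ hf ?_ T ρ ρ rfl
  · have := stableRel_tens (A := A) (B := B) (A' := A) (B' := B.say next msg)
      (unitEquiv A.Q) (unitEquiv B.Q) 1
    convert this using 4 with ρ ρ'
    exact (tens_unit ρ).symm
  · intros
    exact Finset.sum_eq_zero fun o _ => by rw [stepA, mul_zero, zero_mul, hf]
  · rintro rA rB b ρ _ hc rfl
    rw [run_alice (nextSay_first hc)]
    refine Finset.sum_congr rfl fun o _ => ?_
    rw [run_say_bob hf (nextSay_second hc) (cut_cons_of_cut hc), run_over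
      (nextSay_over hc), reduceOption_map_some]
    rfl

end Say

/-! ### Players who do not exploit losses finish on the perfect channel -/

section Total

variable {C M : Type} [Fintype C] [Fintype M] [DecidableEq M] {A B : Strategy C M}
  {next : List (Option C) → Option Party} {m₀ : M}

/-- The message is not blank. -/
def Genuine (ρ : Joint A B) : Prop := ∀ i j, i.2.1 = none → ρ i j = 0

theorem Genuine.conj {X ρ : Joint A B} (hρ : Genuine ρ)
    (hX : ∀ i j, i.2.1 = none → j.2.1 ≠ none → X i j = 0) : Genuine (X * ρ * Xᴴ) := by
  intro i j hi
  rw [Matrix.mul_apply]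
  refine Finset.sum_eq_zero fun l _ => ?_
  rw [Matrix.mul_apply, Finset.sum_eq_zero fun k _ => ?_, zero_mul]
  by_cases hk : k.2.1 = none
  · rw [hρ k l hk, mul_zero]
  · rw [hX i k hi hk, zero_mul]

theorem Genuine.conj_eq_zero {X ρ : Joint A B} (hρ : Genuine ρ)
    (hX : ∀ i j, j.2.1 ≠ none → X i j = 0) : X * ρ * Xᴴ = 0 := by
  have : X * ρ = 0 := by
    ext i l
    rw [Matrix.mul_apply]
    refine Finset.sum_eq_zero fun k _ => ?_
    by_cases hk : k.2.1 = none
    · rw [hρ k l hk, mul_zero]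
    · rw [hX i k hk, zero_mul]
  rw [this, zero_mul]

theorem Strategy.LossFree.op_none {S : Strategy C M} (hS : S.LossFree) (r τ o q') {i}
    (hi : i.2 ≠ none) : S.op r τ o (q', none) i = 0 := by
  obtain ⟨q, _ | m⟩ := i
  · exact absurd rfl hi
  · exact (hS r τ o q q' m).2

theorem Strategy.LossFree.op_declare {S : Strategy C M} (hS : S.LossFree) (r τ) {o} (ho : o.2 = none)
    (i') {i} (hi : i.2 ≠ none) : S.op r τ o i' i = 0 := by
  obtain ⟨q, _ | m⟩ := i
  · exact absurd rfl hi
  · exact (hS r τ o q i'.1 m).1 ho i'.2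

/-- On the perfect channel the message stays genuine as long as nobody sends a blank, and with a
genuine message nobody declares a loss. So all branches of nonzero weight consist of ordinary
symbols, and the bound on such turns applies. -/
theorem run_total (hA : A.LossFree) (hB : B.LossFree) (n : ℕ) : ∀ rA rB τ (ρ : Joint A B),
    Genuine ρ → Proper next τ → (∀ σ : List (Option C), σ.length = n → none ∉ σ →
      ∃ υ : List (Option C), υ <:+ σ ++ τ ∧ next υ = none) →
    run next A B noLoss (fun _ _ _ ρ => ρ.trace.re) n rA rB τ ρ = ρ.trace.re := by
  induction n with
  | zero =>
    intro rA rB τ ρ hρ hτ h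
    obtain ⟨υ, h1, h2⟩ := h [] rfl (by simp)
    by_cases hυ : υ = τ
    · rw [run_over (hυ ▸ h2)]
    · exact absurd h2 (hτ υ h1 hυ)
  | succ n ih =>
    intro rA rB τ ρ hρ hτ h
    have h' : ∀ c, ∀ σ : List (Option C), σ.length = n → none ∉ σ →
        ∃ υ : List (Option C), υ <:+ σ ++ some c :: τ ∧ next υ = none := fun c σ hσ hn => by
      simpa using h (σ ++ [some c]) (by simpa using hσ) (by simpa using hn)
    rcases hp : next τ with _ | _ | _
    · rw [run_over hp]
    · rw [run_alice hp, ← sum_trace_stepA rA τ ρ, Complex.re_sum]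
      refine Finset.sum_congr rfl fun o _ => ?_
      change run next A B noLoss _ n _ _ _ (stepA A B (A.op rA τ o) ρ) = _
      rcases ho : o.2 with _ | c
      -- The branch in which a loss is declared carries the zero state, and is therefore not needed
      -- for the bound on the number of turns.
      · have : stepA A B (A.op rA τ o) ρ = 0 := hρ.conj_eq_zero fun i j hj => by
          change A.op rA τ o _ _ * _ = 0
          rw [hA.op_declare _ _ ho _ (by exact hj), zero_mul]
        rw [this, run_null (by simp)]
        simp
      · refine ih _ _ _ _ (hρ.conj fun i j hi hj => ?_) (hτ.cons (by simp [hp]) _) (h' c)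
        change A.op rA τ o (i.1, i.2.1) (j.1, j.2.1) * _ = 0
        rw [hi, hA.op_none _ _ _ _ (by exact hj), zero_mul]
    · rw [run_bob hp, ← sum_trace_stepB rB τ ρ, Complex.re_sum]
      refine Finset.sum_congr rfl fun o _ => ?_
      change run next A B noLoss _ n _ _ _ (stepB A B (B.op rB τ o) ρ) = _
      rcases ho : o.2 with _ | c
      · have : stepB A B (B.op rB τ o) ρ = 0 := hρ.conj_eq_zero fun i j hj => by
          change B.op rB τ o _ _ * _ = 0
          rw [hB.op_declare _ _ ho _ (by exact hj), zero_mul]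
        rw [this, run_null (by simp)]
        simp
      · refine ih _ _ _ _ (hρ.conj fun i j hi hj => ?_) (hτ.cons (by simp [hp]) _) (h' c)
        change B.op rB τ o (i.2.2, i.2.1) (j.2.2, j.2.1) * _ = 0
        rw [hi, hB.op_none _ _ _ _ (by exact hj), zero_mul]

theorem outWeight_total (hA : A.LossFree) (hB : B.LossFree)
    (hb : ∃ N : ℕ, ∀ τ σ : List (Option C), σ.length = N → none ∉ σ →
      ∃ υ : List (Option C), υ <:+ σ ++ τ ∧ next υ = none) :
    ∃ N, ∀ T ≥ N, outWeight next A B m₀ noLoss T (fun _ _ _ => True) = 1 := by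
  obtain ⟨N, hN⟩ := hb
  refine ⟨N, fun T hT => le_antisymm outWeight_le_one ?_⟩
  refine le_trans ?_ (outWeight_mono_turns hT)
  have := run_total (next := next) hA hB N [] [] [] (start A B m₀) (fun i j hi => by
    simp [start, hi]) proper_nil (hN [])
  rw [trace_start, Complex.one_re] at this
  rw [← this]
  unfold outWeight
  simp

theorem HasCheatingProb.force_le {S : Strategy C M} {ev : List S.R → List (Option C) → Bool} {a : ℝ}
    (h : HasCheatingProb next S m₀ (forceSecret ev) a) (E : Strategy C M) (T : ℕ) :
    outWeight next E S m₀ noLoss T (fun _ r τ => ev r τ = true) ≤ a := by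
  rw [← guessProb_guessTrue]
  exact h.2 _ _

theorem HasCheatingProb.force_attained {S : Strategy C M} {ev : List S.R → List (Option C) → Bool}
    {a : ℝ} (h : HasCheatingProb next S m₀ (forceSecret ev) a) :
    ∃ E : Strategy C M, E.LossFree ∧ ∃ T₀, ∀ T ≥ T₀,
      outWeight next E S m₀ noLoss T (fun _ r τ => ev r τ = true) = a := by
  obtain ⟨E, T₀, hE, hT⟩ := h.attained
  exact ⟨E.toStrategy, hE, T₀, fun T hT' => le_antisymm (h.force_le _ _)
    ((hT T hT').symm.le.trans (guessProb_forceSecret_le ev E T))⟩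

theorem outWeight_add_not (P : List A.R → List B.R → List (Option C) → Prop) (loss T) :
    outWeight next A B m₀ loss T P + outWeight next A B m₀ loss T (fun rA rB τ => ¬ P rA rB τ) =
      outWeight next A B m₀ loss T (fun _ _ _ => True) := by
  unfold outWeight
  rw [← run_add]
  congr 1
  funext rA rB τ ρ
  by_cases h : P rA rB τ <;> simp [h]

end Total

/-! ### Public selection of a bit by weak coin flipping -/

section Selector

variable {C M : Type} [Fintype C] [Fintype M] [DecidableEq M]

/-- The best that a dishonest player, in the role of Alice, can do about a selection of a bit with
the honest player `S`, where `c₀` is the bit that the dishonest player prefers. -/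
structure SelectionCheat (next : List (Option C) → Option Party) (S : Strategy C M) (m₀ : M)
    (ok sel : List (Option C) → Bool) (c₀ : Bool) (p : ℝ) : Prop where
  le : ∀ (E : Strategy C M) (T : ℕ),
    outWeight next E S m₀ noLoss T (fun _ _ τ => ok τ = true ∧ sel τ = c₀) ≤ p
  attained : ∃ E : Strategy C M, E.LossFree ∧ ∃ T₀, ∀ T ≥ T₀,
    outWeight next E S m₀ noLoss T (fun _ _ τ => ok τ = true ∧ sel τ = c₀) = p ∧
    outWeight next E S m₀ noLoss T (fun _ _ τ => ok τ = true ∧ sel τ = !c₀) = 1 - p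

/-- The selection of a bit by a protocol whose transcript contains the bit; Bob has to check the
transcript. -/
structure Selector (C M : Type) [Fintype C] [Fintype M] [DecidableEq M] where
  m₀ : M
  next : List (Option C) → Option Party
  bounded : ∃ N : ℕ, ∀ τ σ : List (Option C), σ.length = N → none ∉ σ →
    ∃ υ : List (Option C), υ <:+ σ ++ τ ∧ next υ = none
  A : Strategy C M
  B : Strategy C M
  honestA : A.LossFree
  honestB : B.LossFree
  ok : List (Option C) → Bool
  sel : List (Option C) → Bool

/-- Correctness and cheating probabilities of a selector. -/
structure Selector.IsWCF (S : Selector C M) (a b : ℝ) : Prop where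
  correct : ∀ loss : LossPattern, loss.Finite → ∃ T₀, ∀ T ≥ T₀,
    outWeight S.next S.A S.B S.m₀ loss T (fun _ _ τ => S.ok τ = true) = 1
  cheatA : SelectionCheat S.next S.B S.m₀ S.ok S.sel false a
  cheatB : SelectionCheat (swapNext S.next) S.A S.m₀ (fun _ => true) S.sel true b

/-- Pairs of bits as public symbols. -/
structure BitCode (C : Type) where
  wr : Bool × Bool → C
  rd : C → Bool × Bool
  rd_wr : ∀ y, rd (wr y) = y

namespace BitCode

variable (X : BitCode C)

/-- The pair of bits announced by a symbol. -/
def bits (s : Option C) : Bool × Bool := (s.map X.rd).getD (false, false)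

theorem bits_wr (y : Bool × Bool) : X.bits (some (X.wr y)) = y := by simp [bits, X.rd_wr]

/-- The bit announced last. -/
def last : List (Option C) → Bool
  | s :: _ => (X.bits s).1
  | [] => false

/-- The last two announced bits agree. -/
def agree : List (Option C) → Bool
  | s :: s' :: _ => (X.bits s).1 == (X.bits s').1
  | _ => false

end BitCode

variable (X : BitCode C) (D : Duo C M Bool Bool)

/-- Weak coin flipping followed by announcements of the outcome. -/
abbrev Duo.selector : Selector C M where
  m₀ := D.m₀
  next := nextSay D.next .bob .alice
  bounded := nextSay_bounded D.bounded
  A := D.A.toStrategy.say D.next fun r _ b => X.wr (D.A.out r b, false)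
  B := D.B.toStrategy.say D.next fun r _ b => X.wr (D.B.out r b, false)
  honestA := D.A.honest.say _ _
  honestB := D.B.honest.say _ _
  ok := X.agree
  sel := X.last

variable {D}

/-- Bob announces his outcome before Alice does and accepts only the same bit from her. So if the
bit 0 is selected and accepted, his own outcome was 0, which she could force with probability at
most `a`. Her last move only splits the weight. -/
theorem Duo.IsWCF.selection_le {a b : ℝ} (h : D.IsWCF a b) (E : Strategy C M) (T : ℕ) :
    outWeight (D.selector X).next E (D.selector X).B D.m₀ noLoss T
      (fun _ _ τ => X.agree τ = true ∧ X.last τ = false) ≤ a := by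
  classical
  refine le_trans ?_ (h.cheatA.force_le E T)
  refine (outWeight_mono_turns (show T ≤ T + 2 by omega)).trans ?_
  refine (run_cheat_say (A := E) (B := D.B.toStrategy) (by simp) T (start E _ D.m₀)).le.trans ?_
  refine run_le (T := T) (fun rA rB τ ρ hρ _ _ => ?_) T _ _ _ _ (start_posSemidef _) (by simp)
  simp only [BitCode.agree, BitCode.last, X.bits_wr, beq_iff_eq]
  by_cases hout : D.B.out rB τ = false
  · simp only [hout, Bool.not_false, if_true, and_self]
    have := congrArg Complex.re
      (sum_trace_stepA rA (some (X.wr (D.B.out rB τ, false)) :: τ) ρ)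
    rw [Complex.re_sum] at this
    rw [← this]
    refine Finset.sum_le_sum fun o _ => ?_
    rw [hout]
    split
    · exact le_rfl
    · exact re_trace_nonneg (stepA_posSemidef _ hρ)
  · rw [if_neg (by simpa using hout)]
    refine Finset.sum_nonpos fun o _ => ?_
    rw [if_neg fun h => hout (h.1.symm.trans h.2)]

/-- A dishonest Alice who repeats Bob's announcement is always accepted, so the selected bit is his
outcome. -/
theorem Duo.IsWCF.selection_eq {E : Strategy C M} (c : Bool) (T : ℕ) :
    outWeight (D.selector X).next (E.say D.next fun _ a _ => X.wr (X.last a, false)) (D.selector X).B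
      D.m₀ noLoss (T + 2) (fun _ _ τ => X.agree τ = true ∧ X.last τ = c) =
    outWeight D.next E D.B.toStrategy D.m₀ noLoss T (fun _ r τ => D.B.out r τ = c) := by
  refine (run_say_say (A := E) (B := D.B.toStrategy) (by simp) T (start E _ D.m₀)).trans ?_
  unfold outWeight
  congr 1
  funext rA rB τ ρ
  rw [trace_chan, trace_chan]
  simp only [BitCode.agree, BitCode.last, X.bits_wr, beq_self_eq_true, true_and]
  congr

theorem Strategy.say_swapNext (S : Strategy C M) (next : List (Option C) → Option Party)
    (msg : List S.R → List (Option C) → List (Option C) → C) :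
    S.say (swapNext next) msg = S.say next msg := by
  have : S.sayOp (swapNext next) msg = S.sayOp next msg := by
    funext r τ o
    simp only [Strategy.sayOp, cut_swapNext]
  simp only [Strategy.say, this]

/-- An honest player who speaks last determines the selected bit by its own outcome, whatever the
cheater has announced before; no check is required. -/
theorem selection_le_of_second {next : List (Option C) → Option Party} {S : Strategy C M} {m₀ : M}
    {out : List S.R → List (Option C) → Bool} (E : Strategy C M) (c : Bool) (T : ℕ) :
    outWeight (nextSay next .alice .bob) E (S.say next fun r _ b => X.wr (out r b, false)) m₀ noLoss
      T (fun _ _ τ => true = true ∧ X.last τ = c) ≤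
    outWeight next E S m₀ noLoss T (fun _ r τ => out r τ = c) := by
  classical
  refine (outWeight_mono_turns (show T ≤ T + 2 by omega)).trans ?_
  refine (run_cheat_say' (A := E) (B := S) (by simp) T (start E _ m₀)).le.trans ?_
  refine run_le (T := T) (fun rA rB τ ρ hρ _ _ => ?_) T _ _ _ _ (start_posSemidef _) (by simp)
  simp only [BitCode.last, X.bits_wr, true_and]
  by_cases hout : out rB τ = c
  · simp only [hout, if_true]
    have := congrArg Complex.re (sum_trace_stepA rA τ ρ)
    rw [Complex.re_sum] at this
    exact this.le
  · simp only [hout, if_false, Finset.sum_const_zero, le_refl]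

theorem selection_eq_of_second {next : List (Option C) → Option Party} {S : Strategy C M} {m₀ : M}
    {out : List S.R → List (Option C) → Bool} {E : Strategy C M} (c : Bool) (T : ℕ) :
    outWeight (nextSay next .alice .bob) (E.say next fun _ _ _ => X.wr (false, false))
      (S.say next fun r _ b => X.wr (out r b, false)) m₀ noLoss (T + 2)
      (fun _ _ τ => true = true ∧ X.last τ = c) =
    outWeight next E S m₀ noLoss T (fun _ r τ => out r τ = c) := by
  refine (run_say_say' (A := E) (B := S) (by simp) T (start E _ m₀)).trans ?_
  unfold outWeight
  congr 1
  funext rA rB τ ρ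
  rw [trace_chan, trace_chan]
  simp only [BitCode.last, X.bits_wr, true_and]
  congr

/-- Besides the optimal probability of the preferred bit, the cheater has to obtain the other bit
with all the remaining probability. This follows since an optimal loss-free cheater finishes the
coin flip with probability one and then makes a harmless announcement. -/
theorem Duo.IsWCF.selector {a b : ℝ} (h : D.IsWCF a b) : (D.selector X).IsWCF a b where
  correct loss hl := by
    obtain ⟨T₀, hT⟩ := h.correct loss hl
    refine ⟨T₀ + 2, fun T hT' => ?_⟩
    obtain ⟨T, rfl⟩ : ∃ t, T = t + 2 := ⟨T - 2, by omega⟩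
    have h1 := hT T (by omega)
    have h2 : ∑ c : Bool, outWeight D.next D.A.toStrategy D.B.toStrategy D.m₀ loss T
        (fun rA rB τ => D.A.out rA τ = c ∧ D.B.out rB τ = c) = 1 := by
      simp only [h1]
      norm_num
    rw [← h2]
    refine (run_say_say (A := D.A.toStrategy) (B := D.B.toStrategy) (by simp) T
      (start _ _ D.m₀)).trans ?_
    unfold outWeight
    rw [← run_sum]
    congr 1
    funext rA rB τ ρ
    rw [trace_chan, trace_chan]
    simp only [BitCode.agree, X.bits_wr, beq_iff_eq, Fintype.sum_bool]
    by_cases h3 : D.A.out rA τ = true <;> by_cases h4 : D.B.out rB τ = true <;>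
      simp_all only [Bool.not_eq_true, Bool.true_eq_false, Bool.false_eq_true, and_self, and_true,
        and_false, if_true, if_false, add_zero, zero_add]
  cheatA := by
    refine ⟨h.selection_le X, ?_⟩
    obtain ⟨E, hE, T₁, hT₁⟩ := h.cheatA.force_attained
    -- After `T₂` turns the coin flip is over with certainty, so the complementary outcome has
    -- weight exactly `1 - a`.
    obtain ⟨T₂, hT₂⟩ := outWeight_total (m₀ := D.m₀) hE D.B.honest D.bounded
    refine ⟨_, hE.say D.next fun _ a _ => X.wr (X.last a, false), max T₁ T₂ + 2, fun T hT => ?_⟩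
    obtain ⟨T, rfl⟩ : ∃ t, T = t + 2 := ⟨T - 2, by omega⟩
    have h1 := hT₁ T (by omega)
    have h2 := hT₂ T (by omega)
    rw [selection_eq, selection_eq]
    simp only [Bool.not_eq_true'] at h1
    refine ⟨h1, ?_⟩
    have h3 := outWeight_add_not (next := D.next) (A := E) (B := D.B.toStrategy) (m₀ := D.m₀)
      (fun _ r τ => D.B.out r τ = false) noLoss T
    simp only [Bool.not_eq_false] at h3
    rw [Bool.not_false]
    linarith
  cheatB := by
    have hn : swapNext (D.selector X).next = nextSay (swapNext D.next) .alice .bob :=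
      swapNext_nextSay _ _ _
    have hA : (D.selector X).A = D.A.toStrategy.say (swapNext D.next)
      fun r _ b => X.wr (D.A.out r b, false) := (Strategy.say_swapNext _ _ _).symm
    rw [hn, hA]
    refine ⟨fun E T => (selection_le_of_second X E true T).trans (h.cheatB.force_le E T), ?_⟩
    obtain ⟨E, hE, T₁, hT₁⟩ := h.cheatB.force_attained
    obtain ⟨T₂, hT₂⟩ := outWeight_total (m₀ := D.m₀) (next := swapNext D.next) hE D.A.honest
      (by simpa only [swapNext_eq_none] using D.bounded)
    refine ⟨_, hE.say (swapNext D.next) fun _ _ _ => X.wr (false, false), max T₁ T₂ + 2,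
      fun T hT => ?_⟩
    obtain ⟨T, rfl⟩ : ∃ t, T = t + 2 := ⟨T - 2, by omega⟩
    have h1 := hT₁ T (by omega)
    have h2 := hT₂ T (by omega)
    rw [show (D.selector X).m₀ = D.m₀ from rfl, selection_eq_of_second, selection_eq_of_second]
    refine ⟨h1, ?_⟩
    have h3 := outWeight_add_not (next := swapNext D.next) (A := E) (B := D.A.toStrategy)
      (m₀ := D.m₀) (fun _ r τ => D.A.out r τ = true) noLoss T
    simp only [Bool.not_eq_true] at h3
    rw [Bool.not_true]
    linarith

end Selector

/-! ### Replacing the message by a fixed one -/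

section Reset

variable {C M : Type} [Fintype C] [Fintype M] [DecidableEq M] {A B : Strategy C M}

/-- The Kraus operators of the operation that replaces the message by `m₀`. -/
def resetOp (Q : Type) [DecidableEq Q] (m₀ : M) (k : Option M) :
    Matrix (Q × Option M) (Q × Option M) ℂ :=
  Matrix.of fun i j => (1 : Matrix Q Q ℂ) i.1 j.1 *
    Matrix.single (some m₀) k (1 : ℂ) i.2 j.2

theorem sum_resetOp (Q : Type) [Fintype Q] [DecidableEq Q] (m₀ : M) :
    ∑ k, (resetOp Q m₀ k)ᴴ * resetOp Q m₀ k = 1 := by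
  ext i j
  obtain ⟨q, m⟩ := i
  obtain ⟨q', m'⟩ := j
  rw [Matrix.sum_apply]
  simp only [Matrix.mul_apply, Matrix.conjTranspose_apply, resetOp, Matrix.of_apply,
    Fintype.sum_prod_type, Matrix.single_apply, Matrix.one_apply]
  by_cases hq : q' = q <;> by_cases hm : m' = m <;>
    simp [hq, hm, ite_and, eq_comm (a := q), eq_comm (a := m)]

/-- The joint state after the message has been replaced by `m₀`, given that it was `k`. -/
def resetJoint (m₀ : M) (k : Option M) (ρ : Joint A B) : Joint A B :=
  Matrix.of fun i j => Matrix.single (some m₀) (some m₀) (1 : ℂ) i.2.1 j.2.1 *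
    ρ (i.1, k, i.2.2) (j.1, k, j.2.2)

theorem stepA_reset (m₀ : M) (k : Option M) (ρ : Joint A B) :
    stepA A B (resetOp A.Q m₀ k) ρ = resetJoint m₀ k ρ := by
  have h : ∀ i j : A.Q × Option M × B.Q, liftA A B (resetOp A.Q m₀ k) i j =
      if j = (i.1, k, i.2.2) then (if i.2.1 = some m₀ then 1 else 0) else 0 := by
    rintro ⟨a, m, b⟩ ⟨a', m', b'⟩
    simp only [liftA, resetOp, Matrix.of_apply, Matrix.one_apply, Matrix.single_apply,
      Prod.mk.injEq]
    by_cases h1 : a = a' <;> by_cases h2 : b = b' <;> by_cases h3 : k = m' <;>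
      by_cases h4 : some m₀ = m <;> simp_all [eq_comm]
  ext i j
  rw [stepA, Matrix.mul_apply]
  simp only [Matrix.mul_apply, Matrix.conjTranspose_apply, h, ite_mul, zero_mul, one_mul,
    Finset.sum_ite_eq', Finset.mem_univ, if_true, apply_ite star, star_one,
    star_zero, mul_ite, mul_one, mul_zero, resetJoint, Matrix.of_apply, Matrix.single_apply]
  by_cases h1 : i.2.1 = some m₀ <;> by_cases h2 : j.2.1 = some m₀ <;>
    simp [h1, h2, eq_comm (a := some m₀)]

theorem stepB_reset (m₀ : M) (k : Option M) (ρ : Joint A B) :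
    stepB A B (resetOp B.Q m₀ k) ρ = resetJoint m₀ k ρ := by
  have h1 := congrArg swapJoint (stepA_reset (A := B) (B := A) m₀ k (swapJoint ρ))
  rw [swapJoint_stepA] at h1
  exact h1

end Reset

/-! ### A protocol followed by one of two others -/

section Seq

variable {C M : Type} [Fintype C] [Fintype M] [DecidableEq M]

/-- The order of turns when a first protocol is followed by one of two protocols. -/
def nextSeq (next₁ : List (Option C) → Option Party)
    (next₂ : Bool → List (Option C) → Option Party) (sel : List (Option C) → Bool)
    (τ : List (Option C)) : Option Party :=
  match cut next₁ τ with
  | none => next₁ τ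
  | some (a, b) => next₂ (sel b) a

theorem swapNext_nextSeq (next₁ : List (Option C) → Option Party)
    (next₂ : Bool → List (Option C) → Option Party) (sel : List (Option C) → Bool) :
    swapNext (nextSeq next₁ next₂ sel) =
      nextSeq (swapNext next₁) (fun c => swapNext (next₂ c)) sel := by
  funext τ
  rw [nextSeq, cut_swapNext, swapNext, nextSeq]
  rcases cut next₁ τ with _ | ⟨a, b⟩ <;> rfl

/-- The register of the first protocol split off. -/
def seqEquiv (Q₁ : Type) (Q₂ : Bool → Type) :
    Q₁ × Q₂ false × Q₂ true ≃ Q₁ × (Q₂ false × Q₂ true) := Equiv.refl _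

/-- The register of the protocol `c` split off. -/
def seqEquiv₂ (Q₁ : Type) (Q₂ : Bool → Type) :
    ∀ c, Q₁ × Q₂ false × Q₂ true ≃ Q₂ c × (Q₁ × Q₂ (!c))
  | false => ⟨fun i => (i.2.1, (i.1, i.2.2)), fun i => (i.2.1, (i.1, i.2.2)), fun _ => rfl,
      fun _ => rfl⟩
  | true => ⟨fun i => (i.2.2, (i.1, i.2.1)), fun i => (i.2.1, (i.2.2, i.1)), fun _ => rfl,
      fun _ => rfl⟩

/-- The private outcomes in a sequence of protocols. -/
abbrev SeqRecord (M R₁ : Type) (R₂ : Bool → Type) : Type := R₁ ⊕ (Σ c, R₂ c × Option (Option M))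

/-- The record of the first protocol. -/
def firstRecord {M R₁ : Type} {R₂ : Bool → Type} (r : List (SeqRecord M R₁ R₂)) : List R₁ :=
  r.filterMap Sum.getLeft?

/-- The part of a private outcome that belongs to the protocol `c`. -/
def secondOutcome {M R₁ : Type} {R₂ : Bool → Type} (c : Bool) : SeqRecord M R₁ R₂ → Option (R₂ c)
  | .inl _ => none
  | .inr ⟨c', r, _⟩ => if h : c' = c then some (h ▸ r) else none

/-- The record of the protocol `c`. -/
def secondRecord {M R₁ : Type} {R₂ : Bool → Type} (c : Bool) (r : List (SeqRecord M R₁ R₂)) :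
    List (R₂ c) := r.filterMap (secondOutcome c)

/-- The record in the protocol `c` together with the outcome `κ` of resetting the message at the
first turn. -/
def seqRecord {M R₁ : Type} {R₂ : Bool → Type} (c : Bool) (κ : Option (Option M)) :
    List (R₂ c) → List (SeqRecord M R₁ R₂)
  | [] => []
  | [r] => [.inr ⟨c, r, κ⟩]
  | r :: r' :: l => .inr ⟨c, r, none⟩ :: seqRecord c κ (r' :: l)

theorem seqRecord_cons {M R₁ : Type} {R₂ : Bool → Type} {c : Bool} {κ : Option (Option M)} {r : R₂ c}
    {l : List (R₂ c)} (h : l ≠ [] ∨ κ = none) :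
    (seqRecord c κ (r :: l) : List (SeqRecord M R₁ R₂)) =
      .inr ⟨c, r, none⟩ :: seqRecord c κ l := by
  rcases l with _ | ⟨r', l⟩
  · obtain rfl : κ = none := h.resolve_left (by simp)
    rfl
  · rfl

theorem firstRecord_seqRecord {M R₁ : Type} {R₂ : Bool → Type} (c : Bool) (κ : Option (Option M))
    (l : List (R₂ c)) (r₁ : List R₁) :
    firstRecord (seqRecord c κ l ++ r₁.map .inl : List (SeqRecord M R₁ R₂)) = r₁ := by
  have h : ∀ l : List (R₂ c), (seqRecord c κ l : List (SeqRecord M R₁ R₂)).filterMap Sum.getLeft? = []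
    := by
    intro l
    induction l with
    | nil => rfl
    | cons r l ih =>
      rcases l with _ | ⟨r', l⟩
      · rfl
      · rw [seqRecord, List.filterMap_cons]
        exact ih
  rw [firstRecord, List.filterMap_append, h, List.nil_append, List.filterMap_map]
  exact List.filterMap_some

theorem secondRecord_seqRecord {M R₁ : Type} {R₂ : Bool → Type} (c : Bool) (κ : Option (Option M))
    (l : List (R₂ c)) (r₁ : List R₁) :
    secondRecord c (seqRecord c κ l ++ r₁.map .inl : List (SeqRecord M R₁ R₂)) = l := by
  have h : ∀ l : List (R₂ c),
      (seqRecord c κ l : List (SeqRecord M R₁ R₂)).filterMap (secondOutcome c) = l := by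
    intro l
    induction l with
    | nil => rfl
    | cons r l ih =>
      rcases l with _ | ⟨r', l⟩
      · simp [seqRecord, secondOutcome]
      · rw [seqRecord, List.filterMap_cons, ih]
        simp [secondOutcome]
  have h1 : (r₁.map .inl : List (SeqRecord M R₁ R₂)).filterMap (secondOutcome c) = [] := by
    induction r₁ with
    | nil => rfl
    | cons r l ih => rw [List.map_cons, List.filterMap_cons]; exact ih
  rw [secondRecord, List.filterMap_append, h, h1, List.append_nil]

theorem firstRecord_map {M R₁ : Type} {R₂ : Bool → Type} (r₁ : List R₁) :
    firstRecord (r₁.map .inl : List (SeqRecord M R₁ R₂)) = r₁ :=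
  firstRecord_seqRecord false none [] r₁

theorem secondRecord_map {M R₁ : Type} {R₂ : Bool → Type} (c : Bool) (r₁ : List R₁) :
    secondRecord c (r₁.map .inl : List (SeqRecord M R₁ R₂)) = [] :=
  secondRecord_seqRecord c none [] r₁

/-- The outcomes of the first protocol. -/
def seqInl (C : Type) {M R₁ : Type} {R₂ : Bool → Type} (o : R₁ × Option C) :
    SeqRecord M R₁ R₂ × Option C := (.inl o.1, o.2)

/-- The outcomes of the protocol `c`. -/
def seqInr (C : Type) {M R₁ : Type} {R₂ : Bool → Type} (c : Bool) (o : R₂ c × Option C) :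
    SeqRecord M R₁ R₂ × Option C := (.inr ⟨c, o.1, none⟩, o.2)

/-- The outcomes of the first turn of the protocol `c`. -/
def seqFirst (C : Type) {M R₁ : Type} {R₂ : Bool → Type} (c : Bool)
    (o : Option M × (R₂ c × Option C)) :
    SeqRecord M R₁ R₂ × Option C := (.inr ⟨c, o.2.1, some o.1⟩, o.2.2)

theorem seqInl_injective {M R₁ : Type} {R₂ : Bool → Type} :
    Function.Injective (seqInl C : R₁ × Option C → SeqRecord M R₁ R₂ × Option C) := by
  rintro ⟨r, s⟩ ⟨r', s'⟩ h
  simpa [seqInl] using h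

theorem seqInr_injective {M R₁ : Type} {R₂ : Bool → Type} (c : Bool) :
    Function.Injective (seqInr C c : R₂ c × Option C → SeqRecord M R₁ R₂ × Option C) := by
  rintro ⟨r, s⟩ ⟨r', s'⟩ h
  simpa [seqInr] using h

theorem seqFirst_injective {M R₁ : Type} {R₂ : Bool → Type} (c : Bool) :
    Function.Injective (seqFirst C c :
      Option M × (R₂ c × Option C) → SeqRecord M R₁ R₂ × Option C) := by
  rintro ⟨k, r, s⟩ ⟨k', r', s'⟩ h
  simp only [seqFirst, Prod.mk.injEq, Sum.inr.injEq, Sigma.mk.injEq, heq_eq_eq, true_and,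
    Option.some.injEq] at h
  simp [h]

variable (S₁ : Strategy C M) (S₂ : Bool → Strategy C M) (next₁ : List (Option C) → Option Party)
  (sel : List (Option C) → Bool) (m₂ : Bool → M)

/-- The operators of a strategy in the protocol `c`, after a first protocol; the first move of the
protocol resets the message. -/
def Strategy.seqOp₂ (c : Bool) (r : List (S₂ c).R) (a : List (Option C)) :
    SeqRecord M S₁.R (fun c => (S₂ c).R) × Option C →
      Matrix ((S₁.Q × (S₂ false).Q × (S₂ true).Q) × Option M)
        ((S₁.Q × (S₂ false).Q × (S₂ true).Q) × Option M) ℂ :=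
  if a = [] then
    extendOp (seqFirst C c) fun o => slot (seqEquiv₂ S₁.Q (fun c => (S₂ c).Q) c)
      ((S₂ c).op r a o.2) * resetOp _ (m₂ c) o.1
  else extendOp (seqInr C c) fun o => slot (seqEquiv₂ S₁.Q (fun c => (S₂ c).Q) c) ((S₂ c).op r a o)

/-- The operators of a strategy in a sequence of protocols. -/
def Strategy.seqOp (r : List (SeqRecord M S₁.R (fun c => (S₂ c).R))) (τ : List (Option C)) :
    SeqRecord M S₁.R (fun c => (S₂ c).R) × Option C →
      Matrix ((S₁.Q × (S₂ false).Q × (S₂ true).Q) × Option M)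
        ((S₁.Q × (S₂ false).Q × (S₂ true).Q) × Option M) ℂ :=
  match cut next₁ τ with
  | none => extendOp (seqInl C) fun o => slot (seqEquiv S₁.Q fun c => (S₂ c).Q)
      (S₁.op (firstRecord r) τ o)
  | some (a, b) => S₁.seqOp₂ S₂ m₂ (sel b) (secondRecord (sel b) r) a

theorem Strategy.seqOp_first {r : List (SeqRecord M S₁.R (fun c => (S₂ c).R))}
    {τ : List (Option C)} (h : cut next₁ τ = none) : S₁.seqOp S₂ next₁ sel m₂ r τ =
      extendOp (seqInl C) fun o => slot (seqEquiv S₁.Q fun c => (S₂ c).Q)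
        (S₁.op (firstRecord r) τ o) := by
  simp only [Strategy.seqOp, h]

theorem Strategy.seqOp_second {r : List (SeqRecord M S₁.R (fun c => (S₂ c).R))}
    {τ a b : List (Option C)} (h : cut next₁ τ = some (a, b)) : S₁.seqOp S₂ next₁ sel m₂ r τ =
      S₁.seqOp₂ S₂ m₂ (sel b) (secondRecord (sel b) r) a := by
  simp only [Strategy.seqOp, h]

theorem sum_mul_conj {O O' ι : Type} [Fintype O] [Fintype O'] [Fintype ι] [DecidableEq ι]
    {K : O → Matrix ι ι ℂ} {V : O' → Matrix ι ι ℂ} (hK : ∑ o, (K o)ᴴ * K o = 1)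
    (hV : ∑ o, (V o)ᴴ * V o = 1) : ∑ o : O' × O, (K o.2 * V o.1)ᴴ * (K o.2 * V o.1) = 1 := by
  rw [Fintype.sum_prod_type, ← hV]
  refine Finset.sum_congr rfl fun k _ => ?_
  have : ∀ o, (K o * V k)ᴴ * (K o * V k) = (V k)ᴴ * ((K o)ᴴ * K o) * V k := fun o => by
    rw [Matrix.conjTranspose_mul]
    simp only [Matrix.mul_assoc]
  simp only [this]
  rw [← Finset.sum_mul, ← Finset.mul_sum, hK, mul_one]

theorem Strategy.seqOp_complete (r : List (SeqRecord M S₁.R (fun c => (S₂ c).R)))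
    (τ : List (Option C)) :
    ∑ o, (S₁.seqOp S₂ next₁ sel m₂ r τ o)ᴴ * S₁.seqOp S₂ next₁ sel m₂ r τ o = 1 := by
  rcases h : cut next₁ τ with _ | ⟨a, b⟩
  · rw [Strategy.seqOp_first _ _ _ _ _ h, sum_extendOp seqInl_injective]
    exact sum_slot (K := S₁.op (firstRecord r) τ) (seqEquiv S₁.Q fun c => (S₂ c).Q)
      (S₁.op_complete _ _)
  · rw [Strategy.seqOp_second _ _ _ _ _ h, Strategy.seqOp₂]
    have hs := sum_slot (K := (S₂ (sel b)).op (secondRecord (sel b) r) a)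
      (seqEquiv₂ S₁.Q (fun c => (S₂ c).Q) (sel b)) ((S₂ (sel b)).op_complete _ _)
    split
    · rw [sum_extendOp (seqFirst_injective _)]
      exact sum_mul_conj (K := fun o => slot (seqEquiv₂ S₁.Q (fun c => (S₂ c).Q) (sel b))
        ((S₂ (sel b)).op (secondRecord (sel b) r) a o)) (V := fun k => resetOp
        (S₁.Q × (S₂ false).Q × (S₂ true).Q) (m₂ (sel b)) k) hs (sum_resetOp _ _)
    · rw [sum_extendOp (seqInr_injective _)]
      exact hs

/-- A strategy for a first protocol, followed by a strategy for one of two protocols. -/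
abbrev Strategy.seq : Strategy C M where
  Q := S₁.Q × (S₂ false).Q × (S₂ true).Q
  R := SeqRecord M S₁.R fun c => (S₂ c).R
  init := Matrix.kroneckerMap (· * ·) S₁.init
    (Matrix.kroneckerMap (· * ·) (S₂ false).init (S₂ true).init)
  init_posSemidef := S₁.init_posSemidef.kronecker
    ((S₂ false).init_posSemidef.kronecker (S₂ true).init_posSemidef)
  init_trace := by
    simp only [Matrix.trace_kronecker, Strategy.init_trace, mul_one]
  op := S₁.seqOp S₂ next₁ sel m₂
  op_complete := S₁.seqOp_complete S₂ next₁ sel m₂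

/-- After the reset the message is genuine, whatever it was before, so only the action of `K` on
genuine messages counts. -/
theorem LossFree_mul_resetOp {Q : Type} [Fintype Q] [DecidableEq Q] {K : Matrix (Q × Option M)
    (Q × Option M) ℂ} {m₀ : M} {k : Option M} {i : Q × Option M}
    (hK : ∀ q m, K i (q, some m) = 0) (j) : (K * resetOp Q m₀ k) i j = 0 := by
  rw [Matrix.mul_apply]
  refine Finset.sum_eq_zero fun l _ => ?_
  obtain ⟨q, _ | m⟩ := l
  · simp [resetOp]
  · rw [hK, zero_mul]

theorem Strategy.LossFree.slot {Q : Type} [Fintype Q] [DecidableEq Q] {S : Strategy C M}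
    (hS : S.LossFree) {E : Type} [Fintype E] [DecidableEq E] (g : Q ≃ S.Q × E) (r τ o) (q q' : Q)
    (m : M) : (o.2 = none → ∀ k, slot g (S.op r τ o) (q', k) (q, some m) = 0) ∧
      slot g (S.op r τ o) (q', none) (q, some m) = 0 := by
  have := hS r τ o (g q).1 (g q').1 m
  refine ⟨fun ho k => ?_, ?_⟩
  · rw [slot_apply, this.1 ho, zero_mul]
  · rw [slot_apply, this.2, zero_mul]

variable {S₁ S₂ next₁ sel m₂}

theorem Strategy.LossFree.seq (h₁ : S₁.LossFree) (h₂ : ∀ c, (S₂ c).LossFree) :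
    (S₁.seq S₂ next₁ sel m₂).LossFree := by
  intro r τ o q q' m
  change (o.2 = none → ∀ k, S₁.seqOp S₂ next₁ sel m₂ r τ o (q', k) (q, some m) = 0) ∧
    S₁.seqOp S₂ next₁ sel m₂ r τ o (q', none) (q, some m) = 0
  rcases h : cut next₁ τ with _ | ⟨a, b⟩
  · rw [Strategy.seqOp_first _ _ _ _ _ h]
    rcases extendOp_cases (seqInl_injective (M := M) (R₂ := fun c => (S₂ c).R))
      (fun o => QProto.slot (seqEquiv S₁.Q fun c => (S₂ c).Q) (S₁.op (firstRecord r) τ o)) o with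
      h | ⟨o, rfl, h⟩
    · simp [h]
    · rw [h]
      exact h₁.slot _ _ _ _ _ _ _
  · rw [Strategy.seqOp_second _ _ _ _ _ h, Strategy.seqOp₂]
    split
    · rcases extendOp_cases (seqFirst_injective (R₁ := S₁.R) (R₂ := fun c => (S₂ c).R) (sel b))
        (fun o => QProto.slot (seqEquiv₂ S₁.Q (fun c => (S₂ c).Q) (sel b))
          ((S₂ (sel b)).op (secondRecord (sel b) r) a o.2) * resetOp _ (m₂ (sel b)) o.1) o with
        h | ⟨o, rfl, h⟩
      · simp [h]
      · rw [h]
        refine ⟨fun ho k => LossFree_mul_resetOp (fun q m => ?_) _,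
          LossFree_mul_resetOp (fun q m => ?_) _⟩
        · exact ((h₂ _).slot _ _ _ _ _ _ _).1 ho k
        · exact ((h₂ _).slot _ _ _ _ _ _ _).2
    · rcases extendOp_cases (seqInr_injective (M := M) (R₁ := S₁.R) (R₂ := fun c => (S₂ c).R) (sel b))
        (fun o => QProto.slot (seqEquiv₂ S₁.Q (fun c => (S₂ c).Q) (sel b))
          ((S₂ (sel b)).op (secondRecord (sel b) r) a o)) o with h | ⟨o, rfl, h⟩
      · simp [h]
      · rw [h]
        exact (h₂ _).slot _ _ _ _ _ _ _

theorem Covers.seq_first : Covers S₁ (S₁.seq S₂ next₁ sel m₂) (seqEquiv S₁.Q fun c => (S₂ c).Q)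
    (List.map .inl) [] (fun _ τ => cut next₁ τ = none) :=
  fun r τ hτ => ⟨_, seqInl_injective, by
    change S₁.seqOp S₂ next₁ sel m₂ _ _ = _
    rw [List.append_nil, Strategy.seqOp_first _ _ _ _ _ hτ, firstRecord_map], fun _ => ⟨rfl, rfl⟩⟩

/-- From its second turn on, the selected protocol is run without resets. If the player made its
first move, the oldest entry of its record in this protocol also contains the outcome `κ` of the
reset; this is the reason for the condition on the record. -/
theorem Covers.seq_second {b : List (Option C)} (hb : cut next₁ b = some ([], b))
    (r₁ : List S₁.R) (κ : Option (Option M)) : Covers (S₂ (sel b)) (S₁.seq S₂ next₁ sel m₂)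
      (seqEquiv₂ S₁.Q (fun c => (S₂ c).Q) (sel b)) (fun r => seqRecord (sel b) κ r ++ r₁.map .inl) b
      (fun r τ => τ ≠ [] ∧ (r ≠ [] ∨ κ = none)) :=
  fun r τ hτ => ⟨_, seqInr_injective (sel b), by
    change S₁.seqOp S₂ next₁ sel m₂ _ _ = _
    obtain ⟨-, h1, h2⟩ := cut_spec hb
    rw [Strategy.seqOp_second _ _ _ _ _ (h2.cut_eq_some h1 τ), secondRecord_seqRecord,
      Strategy.seqOp₂, if_neg hτ.1], fun o => ⟨by
      beta_reduce
      rw [seqRecord_cons hτ.2]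
      rfl, rfl⟩⟩

end Seq

/-! ### Execution of a sequence of protocols -/

section SeqRun

variable {C M : Type} [Fintype C] [Fintype M] [DecidableEq M]
  {next₁ : List (Option C) → Option Party} {next₂ : Bool → List (Option C) → Option Party}
  {sel : List (Option C) → Bool} {m₁ : M} {m₂ : Bool → M} {loss : ℕ → Bool}
  {N : Type} [AddCommMonoid N]

theorem tens_zero {I J E : Type} [Fintype I] [Fintype J] [Fintype E] (g : I ≃ J × E)
    (σ : Matrix E E ℂ) : tens g σ 0 = 0 := by ext; simp [tens_apply]

theorem zero_tens {I J E : Type} [Fintype I] [Fintype J] [Fintype E] (g : I ≃ J × E)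
    (ρ : Matrix J J ℂ) : tens g 0 ρ = 0 := by ext; simp [tens_apply]

theorem run_zero_payoff {next : List (Option C) → Option Party} {A B : Strategy C M} (n rA rB τ ρ) :
    run next A B loss (fun _ _ _ _ => (0 : N)) n rA rB τ ρ = 0 := by
  have := run_sum (next := next) (A := A) (B := B) (loss := loss)
    (fun (_ : Empty) _ _ _ _ => (0 : N)) n rA rB τ ρ
  simpa using this

theorem stepA_mul {A B : Strategy C M} (K L) (ρ : Joint A B) :
    stepA A B (K * L) ρ = stepA A B K (stepA A B L ρ) := by
  rw [stepA, stepA, stepA, liftA_eq_amp, amp_mul, Matrix.conjTranspose_mul]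
  simp only [Matrix.mul_assoc]
  rfl

theorem stepB_mul {A B : Strategy C M} (K L) (ρ : Joint A B) :
    stepB A B (K * L) ρ = stepB A B K (stepB A B L ρ) := by
  rw [stepB, stepB, stepB, liftB_eq_amp, amp_mul, Matrix.conjTranspose_mul]
  simp only [Matrix.mul_assoc]
  rfl

theorem nextSeq_second {b : List (Option C)} (hb : cut next₁ b = some ([], b))
    (a : List (Option C)) : nextSeq next₁ next₂ sel (a ++ b) = next₂ (sel b) a := by
  obtain ⟨-, h1, h2⟩ := cut_spec hb
  rw [nextSeq, h2.cut_eq_some h1 a]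

/-- The first phase of a sequence of protocols. -/
theorem run_seq_first {A B A' B' : Strategy C M} {EA EB : Type} [Fintype EA] [DecidableEq EA]
    [Fintype EB] [DecidableEq EB] {gA : A'.Q ≃ A.Q × EA} {gB : B'.Q ≃ B.Q × EB}
    {f : List A.R → List B.R → List (Option C) → Joint A B → N}
    {f' : List A'.R → List B'.R → List (Option C) → Joint A' B' → N}
    {recA : List A.R → List A'.R} {recB : List B.R → List B'.R}
    (hA : Covers A A' gA recA [] (fun _ τ => cut next₁ τ = none))
    (hB : Covers B B' gB recB [] (fun _ τ => cut next₁ τ = none)) (σ) (T : ℕ)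
    (hf : ∀ rA rB τ, f rA rB τ 0 = 0) (hf' : ∀ rA rB τ, f' rA rB τ 0 = 0)
    (hover : ∀ rA rB b ρ, cut next₁ b = some ([], b) → f rA rB b ρ =
      run (nextSeq next₁ next₂ sel) A' B' loss f' (T - b.length) (recA rA) (recB rB) b
        (tens (jointEquiv gA gB) σ ρ)) (ρ) :
    run (nextSeq next₁ next₂ sel) A' B' loss f' T (recA []) (recB []) []
      (tens (jointEquiv gA gB) σ ρ) = run next₁ A B loss f T [] [] [] ρ := by
  have hn : ∀ {τ}, cut next₁ τ = none → nextSeq next₁ next₂ sel τ = next₁ τ := fun h => by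
    rw [nextSeq, h]
  refine (run_cover (k := 0) hA hB (stableRel_tens gA gB σ) T (fun _ _ τ => Proper next₁ τ) ?_
    (fun i => rfl) (fun _ _ _ _ => hf _ _ _) (fun _ _ _ _ => hf' _ _ _) ?_ ?_ T [] [] [] ρ _
    proper_nil rfl rfl).symm
  · intro rA rB τ p hτ h
    have hc := hτ.cut_eq_none (by simp [h])
    have hs := hτ.cons (by simp [h])
    exact ⟨by rw [List.append_nil, hn hc, h], fun _ => ⟨hc, fun _ s => hs s⟩,
      fun _ => ⟨hc, fun _ s => hs s⟩⟩
  · intro rA rB τ p ρ' hτ h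
    have hc := hτ.cut_eq_none (by simp [h])
    exact run_zero_alive (p := p) (by rw [List.append_nil, hn hc, h]) _ _ _
  · rintro n rA rB τ ρ _ hτ rfl hT h
    rw [hover _ _ _ _ (show cut next₁ τ = some ([], τ) from hτ.cut_eq_some h []), ← hT,
      Nat.add_sub_cancel, List.append_nil, Nat.add_zero]

variable {A₁ B₁ : Strategy C M} {A₂ B₂ : Bool → Strategy C M}

/-- The first turn of the second protocol. -/
theorem sum_seqOp₂_first {S₁ : Strategy C M} {S₂ : Bool → Strategy C M} {c : Bool}
    {G : SeqRecord M S₁.R (fun c => (S₂ c).R) × Option C → N}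
    (hG : ∀ o, S₁.seqOp₂ S₂ m₂ c [] [] o = 0 → G o = 0) :
    ∑ o, G o = ∑ k, ∑ o, G (seqFirst C c (k, o)) := by
  rw [← Fintype.sum_prod_type (f := fun p : Option M × ((S₂ c).R × Option C) =>
    G (seqFirst C c p))]
  refine (Fintype.sum_of_injective _ (seqFirst_injective c) _ _ (fun o ho => ?_)
    fun o => rfl).symm
  refine hG o ?_
  rw [Strategy.seqOp₂, if_pos rfl]
  exact extendOp_zero _ ho

theorem seqOp₂_first {S₁ : Strategy C M} {S₂ : Bool → Strategy C M} {c : Bool}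
    (k : Option M) (o : (S₂ c).R × Option C) :
    S₁.seqOp₂ S₂ m₂ c [] [] (seqFirst C (R₂ := fun c => (S₂ c).R) c (k, o)) =
      slot (seqEquiv₂ S₁.Q (fun c => (S₂ c).Q) c) ((S₂ c).op [] [] o) * resetOp _ (m₂ c) k := by
  rw [Strategy.seqOp₂, if_pos rfl]
  exact extendOp_apply (seqFirst_injective (R₁ := S₁.R) (R₂ := fun c => (S₂ c).R) c) _ (k, o)

theorem seqOp_start {S₁ : Strategy C M} {S₂ : Bool → Strategy C M} {b : List (Option C)}
    (hb : cut next₁ b = some ([], b)) (r : List S₁.R) :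
    S₁.seqOp S₂ next₁ sel m₂ (r.map .inl) b = S₁.seqOp₂ S₂ m₂ (sel b) [] [] := by
  rw [Strategy.seqOp_second _ _ _ _ _ hb, secondRecord_map]

/-- The initial state of the registers of the second protocols. -/
def seqInit (A₂ B₂ : Bool → Strategy C M) :
    Matrix (((A₂ false).Q × (A₂ true).Q) × ((B₂ false).Q × (B₂ true).Q))
      (((A₂ false).Q × (A₂ true).Q) × ((B₂ false).Q × (B₂ true).Q)) ℂ :=
  Matrix.kroneckerMap (· * ·)
    (Matrix.kroneckerMap (· * ·) (A₂ false).init (A₂ true).init)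
    (Matrix.kroneckerMap (· * ·) (B₂ false).init (B₂ true).init)

theorem start_seq (m₁ : M) :
    start (A₁.seq A₂ next₁ sel m₂) (B₁.seq B₂ next₁ sel m₂) m₁ =
      tens (jointEquiv (A' := A₁.seq A₂ next₁ sel m₂) (B' := B₁.seq B₂ next₁ sel m₂)
        (seqEquiv A₁.Q fun c => (A₂ c).Q) (seqEquiv B₁.Q fun c => (B₂ c).Q)) (seqInit A₂ B₂)
        (start A₁ B₁ m₁) := by
  ext i j
  simp only [start, tens_apply, Matrix.of_apply, seqInit, Matrix.kroneckerMap_apply, jointEquiv,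
    seqEquiv, Equiv.coe_fn_mk, Equiv.refl_apply]
  ring

/-- The final state of the registers that are not used in the protocol `c`, if the message was
`k`. -/
def seqEnv (A₂ B₂ : Bool → Strategy C M) (c : Bool) (k : Option M) (ρ : Joint A₁ B₁) :
    Matrix ((A₁.Q × (A₂ !c).Q) × (B₁.Q × (B₂ !c).Q)) ((A₁.Q × (A₂ !c).Q) × (B₁.Q × (B₂ !c).Q)) ℂ :=
  Matrix.of fun i j => ρ (i.1.1, k, i.2.1) (j.1.1, k, j.2.1) * (A₂ !c).init i.1.2 j.1.2 *
    (B₂ !c).init i.2.2 j.2.2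

/-- Once the old message has been measured and replaced, the registers of the selected protocol are
in its initial state, in a product with everything else. The rest is kept as a fixed state on which
the second protocol does not act. -/
theorem resetJoint_seq (c : Bool) (k : Option M) (ρ : Joint A₁ B₁) :
    resetJoint (m₂ c) k (tens (jointEquiv (A' := A₁.seq A₂ next₁ sel m₂)
      (B' := B₁.seq B₂ next₁ sel m₂) (seqEquiv A₁.Q fun c => (A₂ c).Q)
      (seqEquiv B₁.Q fun c => (B₂ c).Q)) (seqInit A₂ B₂) ρ) =
    tens (jointEquiv (A := A₂ c) (B := B₂ c) (A' := A₁.seq A₂ next₁ sel m₂)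
      (B' := B₁.seq B₂ next₁ sel m₂) (seqEquiv₂ A₁.Q (fun c => (A₂ c).Q) c)
      (seqEquiv₂ B₁.Q (fun c => (B₂ c).Q) c)) (seqEnv A₂ B₂ c k ρ)
      (start (A₂ c) (B₂ c) (m₂ c)) := by
  have h1 : (A₂ !false).init = (A₂ true).init := rfl
  have h2 : (A₂ !true).init = (A₂ false).init := rfl
  have h3 : (B₂ !false).init = (B₂ true).init := rfl
  have h4 : (B₂ !true).init = (B₂ false).init := rfl
  cases c <;> ext i j <;>
  simp only [resetJoint, start, tens_apply, Matrix.of_apply, seqInit, seqEnv, h1, h2, h3, h4,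
    Matrix.kroneckerMap_apply, jointEquiv, seqEquiv, seqEquiv₂, Equiv.coe_fn_mk,
    Equiv.refl_apply] <;>
  ring

/-- The first mover's record of resetting the message. -/
def resetRecord (s : Option Party) (p : Party) (k : Option M) : Option (Option M) :=
  match s, p with
  | some .alice, .alice => some k
  | some .bob, .bob => some k
  | _, _ => none

/-- The second phase of a sequence of protocols, after the first turn. -/
theorem run_seq_tail {f : List (A₁.seq A₂ next₁ sel m₂).R → List (B₁.seq B₂ next₁ sel m₂).R →
      List (Option C) → Joint (A₁.seq A₂ next₁ sel m₂) (B₁.seq B₂ next₁ sel m₂) → N}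
    (hf : ∀ rA rB τ, f rA rB τ 0 = 0) {b : List (Option C)} (hb : cut next₁ b = some ([], b))
    (κA κB : Option (Option M)) (σ) (rA₁ : List A₁.R) (rB₁ : List B₁.R) (n : ℕ) (rA rB τ ρ)
    (hτ : τ ≠ []) (hA : rA ≠ [] ∨ κA = none) (hB : rB ≠ [] ∨ κB = none) :
    run (nextSeq next₁ next₂ sel) (A₁.seq A₂ next₁ sel m₂) (B₁.seq B₂ next₁ sel m₂) loss f n
      (seqRecord (sel b) κA rA ++ rA₁.map .inl) (seqRecord (sel b) κB rB ++ rB₁.map .inl) (τ ++ b)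
      (tens (jointEquiv (A := A₂ (sel b)) (B := B₂ (sel b)) (A' := A₁.seq A₂ next₁ sel m₂)
        (B' := B₁.seq B₂ next₁ sel m₂) (seqEquiv₂ A₁.Q (fun c => (A₂ c).Q) (sel b))
        (seqEquiv₂ B₁.Q (fun c => (B₂ c).Q) (sel b))) σ ρ) =
    run (next₂ (sel b)) (A₂ (sel b)) (B₂ (sel b)) (fun i => loss (i + b.length))
      (fun rA rB a ρ => f (seqRecord (sel b) κA rA ++ rA₁.map .inl)
        (seqRecord (sel b) κB rB ++ rB₁.map .inl) (a ++ b)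
        (tens (jointEquiv (A := A₂ (sel b)) (B := B₂ (sel b)) (A' := A₁.seq A₂ next₁ sel m₂)
        (B' := B₁.seq B₂ next₁ sel m₂) (seqEquiv₂ A₁.Q (fun c => (A₂ c).Q) (sel b))
        (seqEquiv₂ B₁.Q (fun c => (B₂ c).Q) (sel b))) σ ρ)) n rA rB τ ρ := by
  refine (run_cover (k := 0) (Covers.seq_second hb rA₁ κA) (Covers.seq_second hb rB₁ κB)
    (stableRel_tens _ _ σ) (n + τ.length)
    (fun rA rB τ => τ ≠ [] ∧ (rA ≠ [] ∨ κA = none) ∧ (rB ≠ [] ∨ κB = none)) ?_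
    (fun i => rfl) ?_ (fun _ _ _ _ => hf _ _ _) ?_ ?_ n rA rB τ ρ _ ⟨hτ, hA, hB⟩ rfl rfl).symm
  · rintro rA rB τ p ⟨h1, h2, h3⟩ h
    exact ⟨by rw [nextSeq_second hb, h], fun _ => ⟨⟨h1, h2⟩, fun r s => by simp [h3]⟩,
      fun _ => ⟨⟨h1, h3⟩, fun r s => by simp [h2]⟩⟩
  · intros
    rw [tens_zero, hf]
  · intro rA rB τ p ρ' _ h
    exact run_zero_alive (p := p) (by rw [nextSeq_second hb, h]) _ _ _
  · rintro n rA rB τ ρ _ _ rfl _ h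
    rw [run_over (by rw [nextSeq_second hb, h])]

/-- Whichever player moves first resets the message; its outcome `k` is summed over and appears in
the record of that player only. The protocols must not be over at the start, since otherwise no
reset takes place. -/
theorem run_seq_second {f : List (A₁.seq A₂ next₁ sel m₂).R → List (B₁.seq B₂ next₁ sel m₂).R →
      List (Option C) → Joint (A₁.seq A₂ next₁ sel m₂) (B₁.seq B₂ next₁ sel m₂) → N}
    (hf : ∀ rA rB τ, f rA rB τ 0 = 0) (hne : ∀ c, next₂ c [] ≠ none) {b : List (Option C)}
    (hb : cut next₁ b = some ([], b)) (rA₁ : List A₁.R) (rB₁ : List B₁.R) (n : ℕ) (ρ) :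
    run (nextSeq next₁ next₂ sel) (A₁.seq A₂ next₁ sel m₂) (B₁.seq B₂ next₁ sel m₂) loss f n
      (rA₁.map .inl) (rB₁.map .inl) b (tens (jointEquiv (A' := A₁.seq A₂ next₁ sel m₂)
      (B' := B₁.seq B₂ next₁ sel m₂) (seqEquiv A₁.Q fun c => (A₂ c).Q)
      (seqEquiv B₁.Q fun c => (B₂ c).Q)) (seqInit A₂ B₂) ρ) =
    ∑ k, run (next₂ (sel b)) (A₂ (sel b)) (B₂ (sel b)) (fun i => loss (i + b.length))
      (fun rA rB a ρ' => f
        (seqRecord (sel b) (resetRecord (next₂ (sel b) []) .alice k) rA ++ rA₁.map .inl)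
        (seqRecord (sel b) (resetRecord (next₂ (sel b) []) .bob k) rB ++ rB₁.map .inl) (a ++ b)
        (tens (jointEquiv (A := A₂ (sel b)) (B := B₂ (sel b)) (A' := A₁.seq A₂ next₁ sel m₂)
        (B' := B₁.seq B₂ next₁ sel m₂) (seqEquiv₂ A₁.Q (fun c => (A₂ c).Q) (sel b))
        (seqEquiv₂ B₁.Q (fun c => (B₂ c).Q) (sel b))) (seqEnv A₂ B₂ (sel b) k ρ) ρ')) n [] [] []
        (start (A₂ (sel b)) (B₂ (sel b)) (m₂ (sel b))) := by
  have hnext : nextSeq next₁ next₂ sel b = next₂ (sel b) [] := nextSeq_second hb []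
  rcases n with _ | n
  · obtain ⟨p, hp⟩ := Option.ne_none_iff_exists'.mp (hne (sel b))
    rw [run_zero_alive (hnext.trans hp)]
    exact (Finset.sum_eq_zero fun k _ => run_zero_alive hp _ _ _).symm
  rcases hp : next₂ (sel b) [] with _ | _ | _
  · exact absurd hp (hne _)
  · rw [run_alice (hnext.trans hp)]
    have hop : ∀ o, A₁.seqOp A₂ next₁ sel m₂ (rA₁.map .inl) b o =
        A₁.seqOp₂ A₂ m₂ (sel b) [] [] o := fun o => congrFun (seqOp_start hb rA₁) o
    simp only [hop]
    rw [sum_seqOp₂_first (m₂ := m₂) (c := sel b) fun o ho => by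
      rw [ho, stepA_zero, chan_zero, run_null fun _ _ _ _ => hf _ _ _]]
    refine Finset.sum_congr rfl fun k _ => ?_
    rw [run_alice hp]
    refine Finset.sum_congr rfl fun o _ => ?_
    rw [seqOp₂_first, stepA_mul, stepA_reset, resetJoint_seq, stepA_slot_tens, chan_tens]
    have := run_seq_tail (next₂ := next₂) (loss := loss) hf hb (resetRecord (some .alice) .alice k)
      (resetRecord (some .alice) .bob k) (seqEnv A₂ B₂ (sel b) k ρ) rA₁ rB₁ n [o.1] [] [o.2]
      (chan _ _ (loss b.length) (stepA _ _ ((A₂ (sel b)).op [] [] o)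
        (start (A₂ (sel b)) (B₂ (sel b)) (m₂ (sel b))))) (by simp) (by simp) (Or.inr rfl)
    refine Eq.trans this ?_
    simp only [List.length_nil, Nat.zero_add]
  · rw [run_bob (hnext.trans hp)]
    have hop : ∀ o, B₁.seqOp B₂ next₁ sel m₂ (rB₁.map .inl) b o =
        B₁.seqOp₂ B₂ m₂ (sel b) [] [] o := fun o => congrFun (seqOp_start hb rB₁) o
    simp only [hop]
    rw [sum_seqOp₂_first (m₂ := m₂) (c := sel b) fun o ho => by
      rw [ho, stepB_zero, chan_zero, run_null fun _ _ _ _ => hf _ _ _]]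
    refine Finset.sum_congr rfl fun k _ => ?_
    rw [run_bob hp]
    refine Finset.sum_congr rfl fun o _ => ?_
    rw [seqOp₂_first, stepB_mul, stepB_reset, resetJoint_seq, stepB_slot_tens, chan_tens]
    have := run_seq_tail (next₂ := next₂) (loss := loss) hf hb (resetRecord (some .bob) .alice k)
      (resetRecord (some .bob) .bob k) (seqEnv A₂ B₂ (sel b) k ρ) rA₁ rB₁ n [] [o.1] [o.2]
      (chan _ _ (loss b.length) (stepB _ _ ((B₂ (sel b)).op [] [] o)
        (start (A₂ (sel b)) (B₂ (sel b)) (m₂ (sel b))))) (by simp) (Or.inr rfl) (by simp)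
    refine Eq.trans this ?_
    simp only [List.length_nil, Nat.zero_add]

/-- Two sequences of strategies against each other. -/
theorem run_seq {f : List (A₁.seq A₂ next₁ sel m₂).R → List (B₁.seq B₂ next₁ sel m₂).R →
      List (Option C) → Joint (A₁.seq A₂ next₁ sel m₂) (B₁.seq B₂ next₁ sel m₂) → N}
    (hf : ∀ rA rB τ, f rA rB τ 0 = 0) (hne : ∀ c, next₂ c [] ≠ none) (T : ℕ) :
    run (nextSeq next₁ next₂ sel) (A₁.seq A₂ next₁ sel m₂) (B₁.seq B₂ next₁ sel m₂) loss f T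
      [] [] [] (start _ _ m₁) =
    run next₁ A₁ B₁ loss (fun rA₁ rB₁ b ρ =>
      ∑ k, run (next₂ (sel b)) (A₂ (sel b)) (B₂ (sel b)) (fun i => loss (i + b.length))
      (fun rA rB a ρ' => f
        (seqRecord (sel b) (resetRecord (next₂ (sel b) []) .alice k) rA ++ rA₁.map .inl)
        (seqRecord (sel b) (resetRecord (next₂ (sel b) []) .bob k) rB ++ rB₁.map .inl) (a ++ b)
        (tens (jointEquiv (A := A₂ (sel b)) (B := B₂ (sel b)) (A' := A₁.seq A₂ next₁ sel m₂)
        (B' := B₁.seq B₂ next₁ sel m₂) (seqEquiv₂ A₁.Q (fun c => (A₂ c).Q) (sel b))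
        (seqEquiv₂ B₁.Q (fun c => (B₂ c).Q) (sel b))) (seqEnv A₂ B₂ (sel b) k ρ) ρ'))
        (T - b.length) [] [] [] (start (A₂ (sel b)) (B₂ (sel b)) (m₂ (sel b))))
      T [] [] [] (start A₁ B₁ m₁) := by
  rw [start_seq]
  refine run_seq_first (A' := A₁.seq A₂ next₁ sel m₂) (B' := B₁.seq B₂ next₁ sel m₂)
    Covers.seq_first Covers.seq_first (seqInit A₂ B₂) T ?_ hf ?_ _
  · intro rA₁ rB₁ b
    refine Finset.sum_eq_zero fun k _ => ?_
    have h0 : seqEnv A₂ B₂ (sel b) k (0 : Joint A₁ B₁) = 0 := by ext; simp [seqEnv]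
    simp only [h0, zero_tens, hf]
    exact run_zero_payoff _ _ _ _ _
  · intro rA₁ rB₁ b ρ hb
    rw [run_seq_second hf hne hb]

end SeqRun

/-! ### Transcripts that end exactly when the protocol is over -/

section Restrict

variable {C M : Type} [Fintype C] [Fintype M] [DecidableEq M] {A B : Strategy C M}
  {next : List (Option C) → Option Party} {loss : ℕ → Bool} {N : Type} [AddCommMonoid N]

open Classical in
/-- Only transcripts that end as soon as the protocol is over contribute. -/
theorem run_restrict {f : List A.R → List B.R → List (Option C) → Joint A B → N} (n : ℕ) :
    ∀ rA rB τ ρ, Proper next τ → run next A B loss f n rA rB τ ρ = run next A B loss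
      (fun rA rB b ρ => if cut next b = some ([], b) then f rA rB b ρ else 0) n rA rB τ ρ := by
  induction n with
  | zero =>
    intro rA rB τ ρ hτ
    rcases h : next τ with _ | p
    · rw [run_over h, run_over h, if_pos (show cut next τ = some ([], τ) from hτ.cut_eq_some h [])]
    · rw [run_zero_alive h, run_zero_alive h]
  | succ n ih =>
    intro rA rB τ ρ hτ
    rcases h : next τ with _ | _ | _
    · rw [run_over h, run_over h, if_pos (show cut next τ = some ([], τ) from hτ.cut_eq_some h [])]
    · rw [run_alice h, run_alice h]
      exact Finset.sum_congr rfl fun o _ => ih _ _ _ _ (hτ.cons (by simp [h]) _)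
    · rw [run_bob h, run_bob h]
      exact Finset.sum_congr rfl fun o _ => ih _ _ _ _ (hτ.cons (by simp [h]) _)

end Restrict

/-! ### Payoffs of measurements on a part of the register -/

section Payoff

variable {C M : Type} [Fintype C] [Fintype M] [DecidableEq M] {A B A' B' : Strategy C M}
  {EA EB : Type} [Fintype EA] [DecidableEq EA] [Fintype EB] [DecidableEq EB]
  (gA : A'.Q ≃ A.Q × EA) (gB : B'.Q ≃ B.Q × EB)

theorem trace_slot_mul_tens (σ : Matrix (EA × EB) (EA × EB) ℂ) (K) (ρ : Joint A B) :
    (liftA A' B' (slot gA K) * tens (jointEquiv gA gB) σ ρ).trace =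
      (liftA A B K * ρ).trace * σ.trace := by
  rw [liftA_slot gA gB, amp_mul_tens, trace_tens]

theorem trace_slot_mul (K) (ρ' : Joint A' B') :
    (liftA A' B' (slot gA K) * ρ').trace = (liftA A B K * ptr (jointEquiv gA gB) ρ').trace := by
  rw [liftA_slot gA gB, ← trace_ptr (jointEquiv gA gB), ptr_amp_mul]

end Payoff

/-! ### Prepared initial states do not help a cheater -/

section Prepared

variable {C M : Type} [Fintype C] [Fintype M] [DecidableEq M] {B : Strategy C M}
  {next : List (Option C) → Option Party}

/-- A dishonest player that acts like another one on a part of its register. -/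
theorem run_guess_cover {E E' : Guesser C M} {X : Type} [Fintype X] [DecidableEq X]
    {g : E'.Q ≃ E.Q × X} {rec : List E.R → List E'.R} {P : List (Option C) → Prop}
    (hP : ∀ s τ, P τ → P (s :: τ)) (hE : Covers E.toStrategy E'.toStrategy g rec [] fun _ τ => P τ)
    (heff : ∀ r τ s, P τ → E'.eff (rec r) τ s = slot g (E.eff r τ s))
    (secret : List B.R → List (Option C) → Option Bool) (σ : Matrix (X × Unit) (X × Unit) ℂ) (t : ℝ)
    (hσ : σ.trace = t) (n : ℕ) (rA rB τ ρ) (hτ : P τ) :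
    t * run next E.toStrategy B noLoss (fun rA rB τ ρ => guessPayoff E B (secret rB τ) rA τ ρ)
      n rA rB τ ρ =
    run next E'.toStrategy B noLoss (fun rA rB τ ρ => guessPayoff E' B (secret rB τ) rA τ ρ)
      n (rec rA) rB τ (tens (jointEquiv g (unitEquiv B.Q)) σ ρ) := by
  rw [← run_const_mul]
  have := run_cover (k := 0) (loss := noLoss) (loss' := noLoss) (next := next) (next' := next)
    (f := fun rA rB τ ρ => t * guessPayoff E B (secret rB τ) rA τ ρ)
    (f' := fun rA rB τ ρ => guessPayoff E' B (secret rB τ) rA τ ρ)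
    hE (Covers.refl B fun _ _ => True) (stableRel_tens _ _ σ) (n + τ.length)
    (fun _ _ τ => P τ) ?_ (fun i => rfl) ?_ ?_ ?_ ?_ n rA rB τ ρ _ hτ rfl rfl
  · simpa using this
  · intro rA rB τ p h hp
    exact ⟨by rw [List.append_nil, hp], fun _ => ⟨h, fun _ _ => hP _ _ h⟩,
      fun _ => ⟨trivial, fun _ _ => hP _ _ h⟩⟩
  · intros
    rw [guessPayoff_zero, mul_zero]
  · intros
    rw [guessPayoff_zero]
  · intro rA rB τ p ρ' _ h
    exact run_zero_alive (p := p) (by rw [List.append_nil, h]) _ _ _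
  · rintro n rA rB τ ρ _ hτ rfl - h
    rw [List.append_nil, run_over h, id_eq]
    rcases secret rB τ with _ | s
    · exact mul_zero _
    · simp only [guessPayoff]
      rw [heff _ _ _ hτ, trace_slot_mul_tens, hσ, mul_comm, Complex.re_mul_ofReal]

/-- A dishonest player with another initial state. -/
abbrev Guesser.withInit (E : Guesser C M) (ω : Matrix E.Q E.Q ℂ) (h : ω.PosSemidef)
    (h' : ω.trace = 1) : Guesser C M where
  toStrategy := { E.toStrategy with init := ω, init_posSemidef := h, init_trace := h' }
  eff := E.eff
  eff_posSemidef := E.eff_posSemidef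
  eff_sum := E.eff_sum

theorem normalize {ι : Type} [Fintype ι] {ω : Matrix ι ι ℂ} (h : ω.PosSemidef)
    (h0 : ω.trace.re ≠ 0) : (((ω.trace.re⁻¹ : ℝ) : ℂ) • ω).PosSemidef ∧
      (((ω.trace.re⁻¹ : ℝ) : ℂ) • ω).trace = 1 := by
  refine ⟨h.smul ?_, ?_⟩
  · exact_mod_cast inv_nonneg.mpr (re_trace_nonneg h)
  · have : ω.trace = (ω.trace.re : ℂ) :=
      Complex.ext rfl (Complex.le_def.mp h.trace_nonneg).2.symm
    rw [Matrix.trace_smul, smul_eq_mul, Complex.ofReal_inv]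
    nth_rewrite 2 [this]
    exact inv_mul_cancel₀ (by exact_mod_cast h0)

variable {m₀ : M} {secret : List B.R → List (Option C) → Option Bool} {a : ℝ}

/-- The joint state when Alice's register is in the state `ω`. -/
def startWith (E B : Strategy C M) (m₀ : M) (ω : Matrix E.Q E.Q ℂ) : Joint E B :=
  Matrix.of fun i j => ω i.1 j.1 * Matrix.single (some m₀) (some m₀) (1 : ℂ) i.2.1 j.2.1 *
    B.init i.2.2 j.2.2

/-- A cheater may choose its initial state, so the bound applies to the normalisation of `ω`, and
the payoff is homogeneous in `ω`. This is the situation of a second protocol opened by the honest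
player, who has reset the message. -/
theorem HasCheatingProb.le_of_startWith (h : HasCheatingProb next B m₀ secret a) (E : Guesser C M)
    {ω : Matrix E.Q E.Q ℂ} (hω : ω.PosSemidef) (n : ℕ) :
    run next E.toStrategy B noLoss (fun rA rB τ ρ => guessPayoff E B (secret rB τ) rA τ ρ) n [] [] []
      (startWith E.toStrategy B m₀ ω) ≤ a * ω.trace.re := by
  by_cases h0 : ω.trace.re = 0
  · have h1 : startWith E.toStrategy B m₀ ω = 0 := by
      ext
      simp [startWith, eq_zero_of_re_trace hω h0]
    rw [h0, h1, run_null fun _ _ _ _ => guessPayoff_zero _ _ _, mul_zero]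
  · obtain ⟨h1, h2⟩ := normalize hω h0
    have h3 := run_guess_cover (next := next) (E := E) (E' := E.withInit _ h1 h2)
      (g := unitEquiv E.Q) (rec := id) (P := fun _ => True) (fun _ _ _ => trivial)
      (Covers.refl E.toStrategy _) (fun _ _ _ _ => (slot_unit _).symm) secret
      (((ω.trace.re⁻¹ : ℝ) : ℂ) • 1) ω.trace.re⁻¹ (by simp) n [] [] []
      (startWith E.toStrategy B m₀ ω) trivial
    have h4 : tens (jointEquiv (A := E.toStrategy) (B := B)
        (A' := (E.withInit _ h1 h2).toStrategy) (B' := B) (unitEquiv E.Q) (unitEquiv B.Q))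
        (((ω.trace.re⁻¹ : ℝ) : ℂ) • 1) (startWith E.toStrategy B m₀ ω) =
        start (E.withInit _ h1 h2).toStrategy B m₀ := by
      ext i j
      simp only [tens_apply, startWith, start, Matrix.of_apply, jointEquiv, Equiv.coe_fn_mk,
        Matrix.smul_apply, Subsingleton.elim _ ((), ()), Matrix.one_apply_eq]
      simp
      ring
    rw [h4] at h3
    have h5 := h.2 (E.withInit _ h1 h2) n
    have h6 : guessProb next B m₀ secret (E.withInit _ h1 h2) n = _ := h3.symm
    rw [h6, inv_mul_le_iff₀ (lt_of_le_of_ne (re_trace_nonneg hω) (Ne.symm h0))] at h5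
    linarith

/-- The exchange of the register and the message with an ancilla. -/
def exchange (Q M : Type) [DecidableEq Q] [DecidableEq M] : Matrix ((Q × (Q × Option M)) × Option M)
    ((Q × (Q × Option M)) × Option M) ℂ :=
  Matrix.of fun i j => (1 : Matrix _ _ ℂ) ((i.1.2.1, (i.1.1, i.2)), i.1.2.2) j

theorem exchange_conj {Q M : Type} [Fintype Q] [DecidableEq Q] [Fintype M] [DecidableEq M] :
    (exchange Q M)ᴴ * exchange Q M = 1 := by
  ext ⟨⟨q, q', m'⟩, m⟩ j
  rw [Matrix.mul_apply, Finset.sum_eq_single ((q', (q, m)), m')]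
  · simp [exchange, Matrix.conjTranspose_apply]
  · rintro ⟨⟨p, p', k'⟩, k⟩ - h
    rw [Matrix.conjTranspose_apply, exchange, Matrix.of_apply, Matrix.one_apply_ne, star_zero,
      zero_mul]
    intro h'
    refine h ?_
    simp only [Prod.mk.injEq] at h' ⊢
    tauto
  · simp

/-- A dishonest player who takes its first move with a prepared state of its register and the
message. -/
abbrev Guesser.prepare (E : Guesser C M) (ω : Matrix (E.Q × Option M) (E.Q × Option M) ℂ)
    (h : ω.PosSemidef) (h' : ω.trace = 1) : Guesser C M where
  Q := E.Q × (E.Q × Option M)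
  R := E.R
  init := Matrix.kroneckerMap (· * ·) E.init ω
  init_posSemidef := E.init_posSemidef.kronecker h
  init_trace := by rw [Matrix.trace_kronecker, E.init_trace, h', one_mul]
  op r τ o := slot (Equiv.refl _) (E.op r τ o) * if τ = [] then exchange E.Q M else 1
  op_complete r τ := by
    have h := sum_slot (K := E.op r τ) (Equiv.refl (E.Q × (E.Q × Option M))) (E.op_complete r τ)
    split
    · simp only [Matrix.conjTranspose_mul, Matrix.mul_assoc]
      simp only [← Matrix.mul_assoc (slot _ _)ᴴ, ← Finset.mul_sum, ← Finset.sum_mul]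
      rw [h, one_mul, exchange_conj]
    · simpa using h
  eff r τ s := slot (Equiv.refl _) (E.eff r τ s)
  eff_posSemidef r τ s := amp_posSemidef _ (E.eff_posSemidef r τ s)
  eff_sum r τ := by rw [slot, slot, ← amp_add, E.eff_sum, amp_one]

theorem stepA_exchange {E : Guesser C M} {ω : Matrix (E.Q × Option M) (E.Q × Option M) ℂ} {t : ℂ}
    {h : (t • ω).PosSemidef} {h' : (t • ω).trace = 1} :
    stepA (E.prepare (t • ω) h h').toStrategy B (exchange E.Q M)
      (start (E.prepare (t • ω) h h').toStrategy B m₀) =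
    tens (jointEquiv (A := E.toStrategy) (B := B) (A' := (E.prepare (t • ω) h h').toStrategy)
      (B' := B) (Equiv.refl _) (unitEquiv B.Q)) (Matrix.of fun i j => t *
          E.init i.1.1 j.1.1 * Matrix.single (some m₀) (some m₀) (1 : ℂ) i.1.2 j.1.2)
      (tens (splitA E.toStrategy B) B.init ω) := by
  have hl : ∀ i j : (E.Q × (E.Q × Option M)) × Option M × B.Q,
      liftA (E.prepare (t • ω) h h').toStrategy B (exchange E.Q M) i j =
      if j = ((i.1.2.1, (i.1.1, i.2.1)), i.1.2.2, i.2.2) then 1 else 0 := by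
    rintro ⟨⟨q, q', m'⟩, m, b⟩ ⟨⟨p, p', k'⟩, k, d⟩
    simp only [liftA, exchange, Matrix.of_apply, Matrix.one_apply, ← ite_and, mul_ite, mul_one,
      mul_zero]
    refine if_congr ?_ rfl rfl
    simp only [Prod.mk.injEq]
    tauto
  ext ⟨⟨q, q', m'⟩, m, b⟩ ⟨⟨p, p', k'⟩, k, d⟩
  rw [stepA, Matrix.mul_apply]
  simp only [Matrix.mul_apply, Matrix.conjTranspose_apply, hl, ite_mul, zero_mul, one_mul,
    Finset.sum_ite_eq', Finset.mem_univ, if_true, apply_ite star, star_one,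
    star_zero, mul_ite, mul_one, mul_zero]
  simp only [start, tens_apply, jointEquiv, splitA, Matrix.of_apply, Matrix.kroneckerMap_apply,
    Matrix.smul_apply, smul_eq_mul, Equiv.coe_fn_mk, Equiv.refl_apply, Equiv.prodAssoc_symm_apply,
    Equiv.prodUnique_symm_apply]
  ring

/-- Here the cheater opens the protocol, so the message need not be `m₀` and may be entangled with
its register. A cheater in the real protocol achieves the same: it keeps a copy of the normalised
`ω` in an ancilla and exchanges it for its register and the message just before its first move. -/
theorem HasCheatingProb.le_of_first (h : HasCheatingProb next B m₀ secret a) (E : Guesser C M)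
    (hn : next [] = some .alice) {ω : Matrix (E.Q × Option M) (E.Q × Option M) ℂ}
    (hω : ω.PosSemidef) (n : ℕ) :
    run next E.toStrategy B noLoss (fun rA rB τ ρ => guessPayoff E B (secret rB τ) rA τ ρ) n [] [] []
      (tens (splitA E.toStrategy B) B.init ω) ≤ a * ω.trace.re := by
  by_cases h0 : ω.trace.re = 0
  · have h1 : tens (splitA E.toStrategy B) B.init ω = 0 := by
      rw [eq_zero_of_re_trace hω h0, tens_zero]
    rw [h0, h1, run_null fun _ _ _ _ => guessPayoff_zero _ _ _, mul_zero]
  rcases n with _ | n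
  · rw [run_zero_alive hn]
    exact mul_nonneg h.nonneg (re_trace_nonneg hω)
  obtain ⟨h1, h2⟩ := normalize hω h0
  have h3 := h.2 (E.prepare _ h1 h2) (n + 1)
  have h4 : ∀ o, stepA (E.prepare _ h1 h2).toStrategy B ((E.prepare _ h1 h2).op [] [] o)
      (start (E.prepare _ h1 h2).toStrategy B m₀) =
      tens (jointEquiv (A := E.toStrategy) (B := B) (A' := (E.prepare _ h1 h2).toStrategy) (B' := B)
        (Equiv.refl _) (unitEquiv B.Q)) (Matrix.of fun i j => ((ω.trace.re⁻¹ : ℝ) : ℂ) *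
          E.init i.1.1 j.1.1 * Matrix.single (some m₀) (some m₀) (1 : ℂ) i.1.2 j.1.2)
        (stepA E.toStrategy B (E.op [] [] o) (tens (splitA E.toStrategy B) B.init ω)) := by
    intro o
    rw [← stepA_slot_tens, ← stepA_exchange, ← stepA_mul]
    rfl
  -- After the first turn the prepared player acts like `E` on its active register. The ancilla then
  -- holds the discarded initial register and message, in a state whose trace is the normalising
  -- factor `ω.trace.re⁻¹`.
  have h5 := fun o : E.R × Option C => run_guess_cover (next := next) (B := B) (E := E)
    (E' := E.prepare _ h1 h2) (g := Equiv.refl _) (rec := id) (P := fun τ => τ ≠ [])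
    (fun _ _ _ => by simp) (fun r τ hτ => ⟨id, Function.injective_id, by
      funext o
      have := extendOp_apply (ι := (E.Q × (E.Q × Option M)) × Option M) Function.injective_id
        (fun o => slot (Equiv.refl (E.Q × (E.Q × Option M))) (E.op r τ o)) o
      refine Eq.trans ?_ this.symm
      simp only [List.append_nil, id_eq, if_neg hτ, mul_one], fun _ => ⟨rfl, rfl⟩⟩)
    (fun _ _ _ _ => rfl) secret (Matrix.of fun i j => ((ω.trace.re⁻¹ : ℝ) : ℂ) *
          E.init i.1.1 j.1.1 * Matrix.single (some m₀) (some m₀) (1 : ℂ) i.1.2 j.1.2) ω.trace.re⁻¹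
    (by
      simp only [Matrix.trace, Matrix.diag, Matrix.of_apply, Fintype.sum_prod_type,
        Finset.univ_unique, Finset.sum_singleton, ← Finset.mul_sum, ← Finset.sum_mul]
      have e1 : ∑ q, E.init q q = 1 := E.init_trace
      have e2 : ∑ m, Matrix.single (some m₀) (some m₀) (1 : ℂ) m m = 1 :=
        Matrix.trace_single_eq_same (some m₀) (1 : ℂ)
      rw [e1, e2, mul_one, mul_one]) n [o.1] [] [o.2]
    (stepA E.toStrategy B (E.op [] [] o) (tens (splitA E.toStrategy B) B.init ω)) (by simp)
  have h6 : guessProb next B m₀ secret (E.prepare _ h1 h2) (n + 1) = ω.trace.re⁻¹ *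
      run next E.toStrategy B noLoss (fun rA rB τ ρ => guessPayoff E B (secret rB τ) rA τ ρ) (n + 1)
        [] [] [] (tens (splitA E.toStrategy B) B.init ω) := by
    unfold guessProb
    rw [run_alice hn, run_alice hn, Finset.mul_sum]
    refine Finset.sum_congr rfl fun o _ => ?_
    refine Eq.trans ?_ (h5 o).symm
    exact congrArg _ (h4 o)
  rw [h6, inv_mul_le_iff₀ (lt_of_le_of_ne (re_trace_nonneg hω) (Ne.symm h0))] at h3
  linarith

end Prepared

/-! ### Upper bound for a cheater in a sequence of protocols -/

section SeqCheat

variable {C M : Type} [Fintype C] [Fintype M] [DecidableEq M]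
  {next₁ : List (Option C) → Option Party} {next₂ : Bool → List (Option C) → Option Party}
  {ok sel : List (Option C) → Bool} {m₁ : M} {m₂ : Bool → M}

/-- The secret of an honest player in a sequence of protocols, if it does not abort. -/
def seqSecret {Y R₁ : Type} {R₂ : Bool → Type} (next₁ : List (Option C) → Option Party)
    (ok sel : List (Option C) → Bool) (secret : ∀ c, List (R₂ c) → List (Option C) → Option Y)
    (r : List (SeqRecord M R₁ R₂)) (τ : List (Option C)) : Option Y :=
  match cut next₁ τ with
  | none => none
  | some (a, b) => if ok b then secret (sel b) (secondRecord (sel b) r) a else none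

theorem seqSecret_second {Y R₁ : Type} {R₂ : Bool → Type}
    {secret : ∀ c, List (R₂ c) → List (Option C) → Option Y} {b : List (Option C)}
    (hb : cut next₁ b = some ([], b)) (r : List (SeqRecord M R₁ R₂)) (a : List (Option C)) :
    seqSecret next₁ ok sel secret r (a ++ b) =
      if ok b then secret (sel b) (secondRecord (sel b) r) a else none := by
  obtain ⟨-, h1, h2⟩ := cut_spec hb
  rw [seqSecret, h2.cut_eq_some h1 a]

/-- What a dishonest player does after the transcript `b`. -/
abbrev Guesser.shift (E : Guesser C M) (r₀ : List E.R) (b : List (Option C)) : Guesser C M where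
  toStrategy := { E.toStrategy with
    op := fun r τ => E.op (r ++ r₀) (τ ++ b)
    op_complete := fun r τ => E.op_complete (r ++ r₀) (τ ++ b) }
  eff r τ := E.eff (r ++ r₀) (τ ++ b)
  eff_posSemidef r τ := E.eff_posSemidef (r ++ r₀) (τ ++ b)
  eff_sum r τ := E.eff_sum (r ++ r₀) (τ ++ b)

theorem Covers.shift (E : Guesser C M) (r₀ : List E.R) (b : List (Option C)) (P) :
    Covers (E.shift r₀ b).toStrategy E.toStrategy (unitEquiv E.Q) (fun r => r ++ r₀) b P :=
  fun r τ _ => ⟨id, Function.injective_id, by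
    funext o
    have := extendOp_apply (ι := E.Q × Option M) Function.injective_id
      (fun o => QProto.slot (unitEquiv E.Q) (E.op (r ++ r₀) (τ ++ b) o)) o
    rw [id_eq, slot_unit] at this
    exact this.symm, fun _ => ⟨rfl, rfl⟩⟩

variable {B₁ : Strategy C M} {B₂ : Bool → Strategy C M}
  {secret : ∀ c, List (B₂ c).R → List (Option C) → Option Bool}

/-- The payoff of a dishonest player against an honest player in a sequence of protocols. -/
def seqPayoff (E : Guesser C M) (B₁ : Strategy C M) (B₂ : Bool → Strategy C M)
    (next₁ : List (Option C) → Option Party) (ok sel : List (Option C) → Bool) (m₂ : Bool → M)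
    (secret : ∀ c, List (B₂ c).R → List (Option C) → Option Bool) (rA : List E.R)
    (rB : List (B₁.seq B₂ next₁ sel m₂).R) (τ : List (Option C))
    (ρ : Joint E.toStrategy (B₁.seq B₂ next₁ sel m₂)) : ℝ :=
  guessPayoff E (B₁.seq B₂ next₁ sel m₂) (seqSecret next₁ ok sel secret rB τ) rA τ ρ

theorem run_seqPayoff_null (E : Guesser C M) (next) (n rA rB τ) :
    run next E.toStrategy (B₁.seq B₂ next₁ sel m₂) noLoss
      (seqPayoff E B₁ B₂ next₁ ok sel m₂ secret) n rA rB τ 0 = 0 :=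
  run_null (fun _ _ _ _ => guessPayoff_zero _ _ _) _ _ _ _

theorem run_eq_zero_of_suffix {A B : Strategy C M} {next : List (Option C) → Option Party}
    {loss : ℕ → Bool} {N : Type} [AddCommMonoid N]
    {f : List A.R → List B.R → List (Option C) → Joint A B → N} {b : List (Option C)}
    (h : ∀ rA rB a ρ, f rA rB (a ++ b) ρ = 0) (n : ℕ) : ∀ rA rB a ρ,
      run next A B loss f n rA rB (a ++ b) ρ = 0 := by
  induction n with
  | zero =>
    intro rA rB a ρ
    rcases hp : next (a ++ b) with _ | p
    · rw [run_over hp, h]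
    · rw [run_zero_alive hp]
  | succ n ih =>
    intro rA rB a ρ
    rcases hp : next (a ++ b) with _ | _ | _
    · rw [run_over hp, h]
    · rw [run_alice hp]
      exact Finset.sum_eq_zero fun o _ => ih _ _ (o.2 :: a) _
    · rw [run_bob hp]
      exact Finset.sum_eq_zero fun o _ => ih _ _ (o.2 :: a) _

/-- The register of the honest player split when the protocol `c` is run. -/
abbrev secondEquiv (E : Guesser C M) (B₁ : Strategy C M) (B₂ : Bool → Strategy C M)
    (next₁ : List (Option C) → Option Party) (sel : List (Option C) → Bool) (m₂ : Bool → M)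
    (r₀ : List E.R) (b : List (Option C)) :=
  jointEquiv (A := (E.shift r₀ b).toStrategy) (B := B₂ (sel b)) (A' := E.toStrategy)
    (B' := B₁.seq B₂ next₁ sel m₂) (unitEquiv E.Q) (seqEquiv₂ B₁.Q (fun c => (B₂ c).Q) (sel b))

/-- Only the cheater and one register of the honest player take part in the second protocol, so all
other registers can be traced out even if they are entangled with the cheater. The first turn is
excluded when it belongs to the honest player, because it contains the reset. -/
theorem run_second_cheat (E : Guesser C M) {b : List (Option C)} (hb : cut next₁ b = some ([], b))
    (hok : ok b = true) (r₀ : List E.R) (r₁ : List B₁.R) (κ : Option (Option M)) (n : ℕ)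
    (rA rB τ ρ) (hτ : τ ≠ [] ∨ next₂ (sel b) [] = some .alice) (hr : rB ≠ [] ∨ κ = none) :
    run (nextSeq next₁ next₂ sel) E.toStrategy (B₁.seq B₂ next₁ sel m₂) noLoss
      (seqPayoff E B₁ B₂ next₁ ok sel m₂ secret) n (rA ++ r₀)
      (seqRecord (sel b) κ rB ++ r₁.map .inl) (τ ++ b) ρ =
    run (next₂ (sel b)) (E.shift r₀ b).toStrategy (B₂ (sel b)) noLoss
      (fun rA rB τ ρ => guessPayoff (E.shift r₀ b) (B₂ (sel b)) (secret (sel b) rB τ) rA τ ρ) n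
      rA rB τ (ptr (secondEquiv E B₁ B₂ next₁ sel m₂ r₀ b) ρ) := by
  refine (run_cover (k := 0) (PA := fun _ _ => True) (Covers.shift E r₀ b _)
    (Covers.seq_second hb r₁ κ) (stableRel_ptr _ _) (n + τ.length)
    (fun _ rB τ => (τ ≠ [] ∨ next₂ (sel b) [] = some .alice) ∧ (rB ≠ [] ∨ κ = none)) ?_
    (fun i => rfl) (fun _ _ _ _ => guessPayoff_zero _ _ _)
    (fun _ _ _ _ => guessPayoff_zero _ _ _) ?_ ?_ n rA rB τ _ ρ ⟨hτ, hr⟩ rfl rfl).symm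
  · rintro rA rB τ p ⟨h1, h2⟩ h
    refine ⟨by rw [nextSeq_second hb, h], fun _ => ⟨trivial, fun _ _ => ⟨by simp, h2⟩⟩, ?_⟩
    rintro rfl
    refine ⟨⟨?_, h2⟩, fun _ _ => by simp⟩
    rintro rfl
    rcases h1 with h1 | h1
    · exact h1 rfl
    · rw [h1] at h
      cases h
  · intro rA rB τ p ρ' _ h
    exact run_zero_alive (p := p) (by rw [nextSeq_second hb, h]) _ _ _
  · rintro n rA rB τ _ ρ' _ rfl _ h
    rw [run_over (by rw [nextSeq_second hb, h])]
    rw [seqSecret_second hb, if_pos hok, secondRecord_seqRecord]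
    rcases secret (sel b) rB τ with _ | s
    · rfl
    · simp only [guessPayoff]
      rw [← trace_slot_mul (A := (E.shift r₀ b).toStrategy) (unitEquiv E.Q), slot_unit]

/-- The state of the unused registers of an honest player in the first protocol. -/
def cheatInit (B₂ : Bool → Strategy C M) :
    Matrix (Unit × ((B₂ false).Q × (B₂ true).Q)) (Unit × ((B₂ false).Q × (B₂ true).Q)) ℂ :=
  Matrix.of fun i j => (B₂ false).init i.2.1 j.2.1 * (B₂ true).init i.2.2 j.2.2

/-- The register of the honest player split when the first protocol is run. -/
abbrev firstEquiv (E : Guesser C M) (B₁ : Strategy C M) (B₂ : Bool → Strategy C M)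
    (next₁ : List (Option C) → Option Party) (sel : List (Option C) → Bool) (m₂ : Bool → M) :=
  jointEquiv (A := E.toStrategy) (B := B₁) (A' := E.toStrategy)
    (B' := B₁.seq B₂ next₁ sel m₂) (unitEquiv E.Q) (seqEquiv B₁.Q (fun c => (B₂ c).Q))

theorem start_cheat (E : Guesser C M) : start E.toStrategy (B₁.seq B₂ next₁ sel m₂) m₁ =
    tens (firstEquiv E B₁ B₂ next₁ sel m₂) (cheatInit B₂) (start E.toStrategy B₁ m₁) := by
  ext i j
  simp only [start, tens_apply, Matrix.of_apply, cheatInit, Matrix.kroneckerMap_apply, jointEquiv,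
    seqEquiv, Equiv.coe_fn_mk, Equiv.refl_apply, Equiv.prodUnique_symm_apply]
  ring

/-- The register of the honest player for the selected protocol has not been touched; it is still in
its initial state, in a product with the reduced state of the cheater. -/
theorem ptr_cheat (E : Guesser C M) (r₀ : List E.R) (b : List (Option C))
    (ρ : Joint E.toStrategy B₁) :
    ptr (secondEquiv E B₁ B₂ next₁ sel m₂ r₀ b)
      (tens (firstEquiv E B₁ B₂ next₁ sel m₂) (cheatInit B₂) ρ) =
    tens (splitA (E.shift r₀ b).toStrategy (B₂ (sel b))) (B₂ (sel b)).init
      (traceOutB E.toStrategy B₁ ρ) := by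
  have e : ∀ c, ∑ q, (B₂ c).init q q = 1 := fun c => (B₂ c).init_trace
  have h1 : (B₂ !false).init = (B₂ true).init := rfl
  have h2 : (B₂ !true).init = (B₂ false).init := rfl
  unfold secondEquiv
  generalize sel b = c
  cases c <;> ext i j <;>
  simp only [ptr, Matrix.sum_apply, Matrix.submatrix_apply, tens_apply, jointEquiv,
    Equiv.coe_fn_symm_mk, Equiv.coe_fn_mk, seqEquiv, seqEquiv₂, Equiv.refl_apply, cheatInit,
    Matrix.of_apply, Fintype.sum_prod_type, Finset.univ_unique, Finset.sum_singleton, splitA,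
    traceOutB, Equiv.prodUnique_symm_apply, Equiv.prodAssoc_symm_apply]
  · rw [Finset.sum_mul]
    refine Finset.sum_congr rfl fun x _ => ?_
    rw [← Finset.mul_sum, ← Finset.mul_sum]
    refine (congrArg (fun z => ρ (i.1, i.2.1, x) (j.1, j.2.1, x) *
      ((B₂ false).init i.2.2 j.2.2 * z)) (e true)).trans ?_
    rw [mul_one]
  · rw [Finset.sum_mul]
    refine Finset.sum_congr rfl fun x _ => ?_
    rw [← Finset.mul_sum, ← Finset.sum_mul]
    refine (congrArg (fun z => ρ (i.1, i.2.1, x) (j.1, j.2.1, x) *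
      (z * (B₂ true).init i.2.2 j.2.2)) (e false)).trans ?_
    rw [one_mul]

theorem ptr_resetJoint {A B A' B' : Strategy C M} {EA EB : Type} [Fintype EA] [DecidableEq EA]
    [Fintype EB] [DecidableEq EB] (gA : A'.Q ≃ A.Q × EA) (gB : B'.Q ≃ B.Q × EB) (m₀ : M)
    (k : Option M) (ρ : Joint A' B') : ptr (jointEquiv gA gB) (resetJoint m₀ k ρ) =
      resetJoint m₀ k (ptr (jointEquiv gA gB) ρ) := by
  ext i j
  simp only [ptr, resetJoint, Matrix.of_apply, Matrix.sum_apply, Matrix.submatrix_apply, jointEquiv,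
    Equiv.coe_fn_symm_mk, Finset.mul_sum]

theorem resetJoint_tens {E B : Strategy C M} (m₀ : M) (k : Option M)
    (ω : Matrix (E.Q × Option M) (E.Q × Option M) ℂ) :
    resetJoint m₀ k (tens (splitA E B) B.init ω) =
      startWith E B m₀ (ω.submatrix (fun q => (q, k)) fun q => (q, k)) := by
  ext i j
  simp only [resetJoint, startWith, tens_apply, splitA, Matrix.of_apply, Matrix.submatrix_apply,
    Equiv.prodAssoc_symm_apply]
  ring

theorem sum_trace_block {Q K : Type} [Fintype Q] [Fintype K] (ω : Matrix (Q × K) (Q × K) ℂ) :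
    ∑ k, (ω.submatrix (fun q => (q, k)) fun q => (q, k)).trace = ω.trace := by
  simp only [Matrix.trace, Matrix.diag, Matrix.submatrix_apply]
  rw [Finset.sum_comm, Fintype.sum_prod_type]

/-- The second phase against a dishonest player. -/
theorem run_second_le {a : Bool → ℝ}
    (h : ∀ c, HasCheatingProb (next₂ c) (B₂ c) (m₂ c) (secret c) (a c))
    (hne : ∀ c, next₂ c [] ≠ none) (E : Guesser C M) {b : List (Option C)}
    (hb : cut next₁ b = some ([], b)) (hok : ok b = true) (r₀ : List E.R) (r₁ : List B₁.R) (n : ℕ)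
    {ρ : Joint E.toStrategy B₁} (hρ : ρ.PosSemidef) :
    run (nextSeq next₁ next₂ sel) E.toStrategy (B₁.seq B₂ next₁ sel m₂) noLoss
      (seqPayoff E B₁ B₂ next₁ ok sel m₂ secret) n r₀ (r₁.map .inl) b
      (tens (firstEquiv E B₁ B₂ next₁ sel m₂) (cheatInit B₂) ρ) ≤ a (sel b) * ρ.trace.re := by
  have hω : (traceOutB E.toStrategy B₁ ρ).PosSemidef := by
    rw [traceOutB_eq_ptr]
    exact ptr_posSemidef _ hρ
  have ht : (traceOutB E.toStrategy B₁ ρ).trace = ρ.trace := by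
    rw [traceOutB_eq_ptr, trace_ptr]
  rcases hp : next₂ (sel b) [] with _ | _ | _
  · exact absurd hp (hne _)
  -- The cheater opens the second protocol, with its register and the message in an arbitrary joint
  -- state.
  · have h1 := run_second_cheat (m₂ := m₂) (secret := secret) E hb hok r₀ r₁ none n [] [] []
      (tens (firstEquiv E B₁ B₂ next₁ sel m₂) (cheatInit B₂) ρ) (.inr hp) (.inr rfl)
    refine h1.le.trans ?_
    rw [ptr_cheat, ← ht]
    exact (h (sel b)).le_of_first (E.shift r₀ b) hp hω n
  -- The honest player opens the second protocol. Its reset finds the message `k` and leaves the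
  -- cheater with the corresponding diagonal block of its state; the traces of the blocks add up to
  -- the total weight.
  · have hn : nextSeq next₁ next₂ sel b = some .bob := (nextSeq_second hb []).trans hp
    rcases n with _ | n
    · rw [run_zero_alive hn]
      exact mul_nonneg (h _).nonneg (re_trace_nonneg hρ)
    have h1 : run (nextSeq next₁ next₂ sel) E.toStrategy (B₁.seq B₂ next₁ sel m₂) noLoss
        (seqPayoff E B₁ B₂ next₁ ok sel m₂ secret) (n + 1) r₀ (r₁.map .inl) b
        (tens (firstEquiv E B₁ B₂ next₁ sel m₂) (cheatInit B₂) ρ) =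
        ∑ k, run (next₂ (sel b)) (E.shift r₀ b).toStrategy (B₂ (sel b)) noLoss
          (fun rA rB τ ρ => guessPayoff (E.shift r₀ b) (B₂ (sel b)) (secret (sel b) rB τ) rA τ ρ)
          (n + 1) [] [] [] (startWith (E.shift r₀ b).toStrategy (B₂ (sel b)) (m₂ (sel b))
            ((traceOutB E.toStrategy B₁ ρ).submatrix (fun q => (q, k)) fun q => (q, k))) := by
      rw [run_bob hn]
      have hop : ∀ o, B₁.seqOp B₂ next₁ sel m₂ (r₁.map .inl) b o =
          B₁.seqOp₂ B₂ m₂ (sel b) [] [] o := fun o => congrFun (seqOp_start hb r₁) o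
      simp only [hop]
      rw [sum_seqOp₂_first (m₂ := m₂) (c := sel b) fun o ho => by
        rw [ho, stepB_zero, chan_zero, run_seqPayoff_null]]
      refine Finset.sum_congr rfl fun k _ => ?_
      rw [run_bob hp]
      refine Finset.sum_congr rfl fun o _ => ?_
      rw [seqOp₂_first, stepB_mul, stepB_reset]
      have := run_second_cheat (next₂ := next₂) (secret := secret) E hb hok r₀ r₁ (some k) n []
        [o.1] [o.2] (stepB E.toStrategy (B₁.seq B₂ next₁ sel m₂)
          (slot (seqEquiv₂ B₁.Q (fun c => (B₂ c).Q) (sel b)) ((B₂ (sel b)).op [] [] o))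
          (resetJoint (m₂ (sel b)) k (tens (firstEquiv E B₁ B₂ next₁ sel m₂) (cheatInit B₂) ρ)))
        (.inl (by simp)) (.inl (by simp))
      refine Eq.trans this ?_
      rw [ptr_stepB_slot, ptr_resetJoint, ptr_cheat, resetJoint_tens]
      rfl
    rw [h1, ← ht, ← sum_trace_block, Complex.re_sum, Finset.mul_sum]
    exact Finset.sum_le_sum fun k _ => (h (sel b)).le_of_startWith (E.shift r₀ b)
      (hω.submatrix _) (n + 1)

-- For each finished transcript `b` of the first protocol, the continuation is worth at most `a (sel
-- b)` times the weight of `b`, and nothing if the honest player rejects `b`. Classical and quantum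
-- memory of the cheater is included in the conditional state.
open Classical in
theorem guessProb_seq_le {a : Bool → ℝ}
    (h : ∀ c, HasCheatingProb (next₂ c) (B₂ c) (m₂ c) (secret c) (a c))
    (hne : ∀ c, next₂ c [] ≠ none) (E : Guesser C M) (T : ℕ) :
    guessProb (nextSeq next₁ next₂ sel) (B₁.seq B₂ next₁ sel m₂) m₁
      (seqSecret next₁ ok sel secret) E T ≤
    ∑ c, a c * outWeight next₁ E.toStrategy B₁ m₁ noLoss T
      (fun _ _ b => ok b = true ∧ sel b = c) := by
  have h1 : guessProb (nextSeq next₁ next₂ sel) (B₁.seq B₂ next₁ sel m₂) m₁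
      (seqSecret next₁ ok sel secret) E T = run next₁ E.toStrategy B₁ noLoss
      (fun rA rB b ρ => if cut next₁ b = some ([], b) then
        run (nextSeq next₁ next₂ sel) E.toStrategy (B₁.seq B₂ next₁ sel m₂) noLoss
          (seqPayoff E B₁ B₂ next₁ ok sel m₂ secret) (T - b.length) rA (rB.map .inl) b
          (tens (firstEquiv E B₁ B₂ next₁ sel m₂) (cheatInit B₂) ρ) else 0) T [] [] []
        (start E.toStrategy B₁ m₁) := by
    unfold guessProb
    rw [start_cheat]
    refine run_seq_first (next₁ := next₁) (next₂ := next₂) (sel := sel) (A := E.toStrategy) (B := B₁)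
      (A' := E.toStrategy) (B' := B₁.seq B₂ next₁ sel m₂) (recA := id) (recB := List.map .inl)
      (gA := unitEquiv E.Q) (gB := seqEquiv B₁.Q fun c => (B₂ c).Q)
      (f' := seqPayoff E B₁ B₂ next₁ ok sel m₂ secret)
      (Covers.refl E.toStrategy _) Covers.seq_first (cheatInit B₂) T ?_ ?_ ?_ _
    · intro rA rB b
      rw [tens_zero, run_seqPayoff_null, ite_self]
    · intro rA rB b
      exact guessPayoff_zero _ _ _
    · intro rA rB b ρ hb
      rw [if_pos hb]
      rfl
  rw [h1]
  unfold outWeight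
  simp only [← run_const_mul]
  rw [← run_sum]
  refine run_le (T := T) (fun rA rB b ρ hρ _ _ => ?_) T _ _ _ _ (start_posSemidef _) (by simp)
  have h0 : ∀ inst : ∀ c, Decidable (ok b = true ∧ sel b = c),
      0 ≤ ∑ c, a c * @ite _ _ (inst c) ρ.trace.re 0 := fun inst =>
    Finset.sum_nonneg fun c _ => mul_nonneg (h c).nonneg (by
      split
      exacts [re_trace_nonneg hρ, le_rfl])
  by_cases hb : cut next₁ b = some ([], b)
  · rw [if_pos hb]
    by_cases hok : ok b = true
    · refine (run_second_le h hne E hb hok rA rB (T - b.length) hρ).trans (le_of_eq ?_)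
      rw [Finset.sum_eq_single (sel b)]
      · rw [if_pos ⟨hok, rfl⟩]
      · intro c _ hc
        rw [if_neg fun h => hc h.2.symm, mul_zero]
      · simp
    · refine le_of_eq_of_le ?_ (h0 _)
      refine run_eq_zero_of_suffix (fun rA rB a ρ => ?_) _ _ _ [] _
      rw [seqPayoff, seqSecret_second hb, if_neg hok]
      rfl
  · rw [if_neg hb]
    exact h0 _

end SeqCheat

/-! ### Exact cheating probabilities for a sequence of protocols -/

section SeqAttained

variable {C M : Type} [Fintype C] [Fintype M] [DecidableEq M]
  {next₁ : List (Option C) → Option Party} {next₂ : Bool → List (Option C) → Option Party}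
  {ok sel : List (Option C) → Bool} {m₁ : M} {m₂ : Bool → M}

/-- The final measurement of a dishonest player in a sequence of protocols. -/
def Guesser.seqEff (E₁ : Strategy C M) (E₂ : Bool → Guesser C M)
    (next₁ : List (Option C) → Option Party) (sel : List (Option C) → Bool)
    (r : List (SeqRecord M E₁.R fun c => (E₂ c).R)) (τ : List (Option C)) (s : Bool) :
    Matrix ((E₁.Q × (E₂ false).Q × (E₂ true).Q) × Option M)
      ((E₁.Q × (E₂ false).Q × (E₂ true).Q) × Option M) ℂ :=
  match cut next₁ τ with
  | none => if s then 1 else 0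
  | some (a, b) => slot (seqEquiv₂ E₁.Q (fun c => (E₂ c).Q) (sel b))
      ((E₂ (sel b)).eff (secondRecord (sel b) r) a s)

theorem Guesser.seqEff_second {E₁ : Strategy C M} {E₂ : Bool → Guesser C M} {b : List (Option C)}
    (hb : cut next₁ b = some ([], b)) (r a s) : Guesser.seqEff E₁ E₂ next₁ sel r (a ++ b) s =
      slot (seqEquiv₂ E₁.Q (fun c => (E₂ c).Q) (sel b))
        ((E₂ (sel b)).eff (secondRecord (sel b) r) a s) := by
  obtain ⟨-, h1, h2⟩ := cut_spec hb
  simp only [Guesser.seqEff, h2.cut_eq_some h1 a]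

/-- A dishonest player in a sequence of protocols. -/
abbrev Guesser.seq (E₁ : Strategy C M) (E₂ : Bool → Guesser C M)
    (next₁ : List (Option C) → Option Party) (sel : List (Option C) → Bool) (m₂ : Bool → M) :
    Guesser C M where
  toStrategy := E₁.seq (fun c => (E₂ c).toStrategy) next₁ sel m₂
  eff := Guesser.seqEff E₁ E₂ next₁ sel
  eff_posSemidef r τ s := by
    unfold Guesser.seqEff
    rcases cut next₁ τ with _ | ⟨a, b⟩
    · cases s
      · exact Matrix.PosSemidef.zero
      · exact Matrix.PosSemidef.one
    · exact amp_posSemidef _ ((E₂ (sel b)).eff_posSemidef _ _ _)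
  eff_sum r τ := by
    unfold Guesser.seqEff
    rcases cut next₁ τ with _ | ⟨a, b⟩
    · simp
    · simp only [slot]
      rw [← amp_add, (E₂ (sel b)).eff_sum, amp_one]

theorem seqEnv_posSemidef {A₁ B₁ : Strategy C M} {A₂ B₂ : Bool → Strategy C M} (c : Bool)
    (k : Option M) {ρ : Joint A₁ B₁} (hρ : ρ.PosSemidef) : (seqEnv A₂ B₂ c k ρ).PosSemidef := by
  have h1 := ((hρ.submatrix fun p : A₁.Q × B₁.Q => (p.1, k, p.2)).kronecker
    ((A₂ !c).init_posSemidef.kronecker (B₂ !c).init_posSemidef)).submatrix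
    fun i : (A₁.Q × (A₂ !c).Q) × (B₁.Q × (B₂ !c).Q) => ((i.1.1, i.2.1), (i.1.2, i.2.2))
  refine (congrArg Matrix.PosSemidef ?_).mp h1
  ext i j
  simp only [seqEnv, Matrix.of_apply, Matrix.submatrix_apply, Matrix.kroneckerMap_apply]
  ring

theorem sum_trace_seqEnv {A₁ B₁ : Strategy C M} {A₂ B₂ : Bool → Strategy C M} (c : Bool)
    (ρ : Joint A₁ B₁) : ∑ k, (seqEnv A₂ B₂ c k ρ).trace = ρ.trace := by
  have e1 : ∑ q, (A₂ !c).init q q = 1 := (A₂ !c).init_trace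
  have e2 : ∑ q, (B₂ !c).init q q = 1 := (B₂ !c).init_trace
  simp only [Matrix.trace, Matrix.diag, seqEnv, Matrix.of_apply, Fintype.sum_prod_type,
    ← Finset.mul_sum, ← Finset.sum_mul, e1, e2, mul_one]
  rw [Finset.sum_comm]

theorem trace_eq_re {ι : Type} [Fintype ι] {ρ : Matrix ι ι ℂ} (hρ : ρ.PosSemidef) :
    ρ.trace = (ρ.trace.re : ℂ) := Complex.ext rfl (Complex.le_def.mp hρ.trace_nonneg).2.symm

variable {B₁ : Strategy C M} {B₂ : Bool → Strategy C M}
  {secret : ∀ c, List (B₂ c).R → List (Option C) → Option Bool}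

-- This cheater uses fresh registers in the second protocol, so the payoff factorises into the
-- weight of the transcript `b` and the success probability in the protocol selected by `b`, with
-- the turns that are left.
open Classical in
theorem guessProb_seq (hne : ∀ c, next₂ c [] ≠ none) (E₁ : Strategy C M) (E₂ : Bool → Guesser C M)
    (T : ℕ) : guessProb (nextSeq next₁ next₂ sel) (B₁.seq B₂ next₁ sel m₂) m₁
      (seqSecret next₁ ok sel secret) (Guesser.seq E₁ E₂ next₁ sel m₂) T =
    run next₁ E₁ B₁ noLoss (fun _ _ b ρ => if ok b = true then ρ.trace.re *
      guessProb (next₂ (sel b)) (B₂ (sel b)) (m₂ (sel b)) (secret (sel b)) (E₂ (sel b))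
        (T - b.length) else 0) T [] [] [] (start E₁ B₁ m₁) := by
  unfold guessProb
  rw [run_seq (A₁ := E₁) (A₂ := fun c => (E₂ c).toStrategy) (loss := noLoss)
    (fun _ _ _ => guessPayoff_zero _ _ _) hne, run_restrict _ _ _ _ _ proper_nil]
  conv_rhs => rw [run_restrict _ _ _ _ _ proper_nil]
  refine run_congr (T := T) (fun _ _ => rfl) (fun rA rB b ρ hρ _ _ => ?_) T _ _ _ _
    (start_posSemidef _) (by simp)
  by_cases hb : cut next₁ b = some ([], b)
  swap
  · rw [if_neg hb, if_neg hb]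
  rw [if_pos hb, if_pos hb]
  by_cases hok : ok b = true
  swap
  · rw [if_neg hok]
    refine Finset.sum_eq_zero fun k _ => ?_
    simp only [seqSecret_second hb, if_neg hok]
    exact run_zero_payoff _ _ _ _ _
  rw [if_pos hok, ← sum_trace_seqEnv (A₂ := fun c => (E₂ c).toStrategy) (B₂ := B₂) (sel b) ρ,
    Complex.re_sum, Finset.sum_mul]
  refine Finset.sum_congr rfl fun k _ => ?_
  rw [← run_const_mul]
  congr 1
  funext rA' rB' a ρ'
  rw [seqSecret_second hb, if_pos hok, secondRecord_seqRecord]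
  rcases secret (sel b) rB' a with _ | s
  · exact (mul_zero _).symm
  · simp only [guessPayoff]
    rw [Guesser.seqEff_second hb, secondRecord_seqRecord, trace_slot_mul_tens]
    have h5 := trace_eq_re (seqEnv_posSemidef (A₁ := E₁) (B₁ := B₁)
      (A₂ := fun c => (E₂ c).toStrategy) (B₂ := B₂) (sel b) k hρ)
    generalize (seqEnv (fun c => (E₂ c).toStrategy) B₂ (sel b) k ρ).trace = z at h5 ⊢
    rw [h5, mul_comm, Complex.re_ofReal_mul, Complex.ofReal_re]

/-- If w and w' are the weights of the preferred and of the other bit, then w ≤ p and w + w' ≤ 1.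
Since `a (!c₀)` is nonnegative and at most `a c₀`, the sum `a c₀ * w + a (!c₀) * w'` is largest for
w = p, w' = 1 - p. A cheater who is optimal in all three protocols attains this. -/
theorem HasCheatingProb.seq {a : Bool → ℝ} {c₀ : Bool} {p : ℝ}
    (h₁ : SelectionCheat next₁ B₁ m₁ ok sel c₀ p)
    (h₂ : ∀ c, HasCheatingProb (next₂ c) (B₂ c) (m₂ c) (secret c) (a c))
    (hne : ∀ c, next₂ c [] ≠ none) (ha : a (!c₀) ≤ a c₀) :
    HasCheatingProb (nextSeq next₁ next₂ sel) (B₁.seq B₂ next₁ sel m₂) m₁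
      (seqSecret next₁ ok sel secret) (a (!c₀) + (a c₀ - a (!c₀)) * p) := by
  classical
  have hsum : ∀ F : Bool → ℝ, ∑ c, F c = F c₀ + F (!c₀) := fun F => by
    cases c₀ <;> simp [add_comm]
  refine hasCheatingProb_of (fun E T => ?_) ?_
  · refine (guessProb_seq_le h₂ hne E T).trans ?_
    rw [hsum]
    have h3 := h₁.le E.toStrategy T
    have h4 : outWeight next₁ E.toStrategy B₁ m₁ noLoss T (fun _ _ b => ok b = true ∧ sel b = c₀) +
        outWeight next₁ E.toStrategy B₁ m₁ noLoss T (fun _ _ b => ok b = true ∧ sel b = !c₀) ≤ 1 := by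
      refine le_trans (le_of_eq ?_) (outWeight_le_one (P := fun _ _ b => ok b = true)
        (next := next₁) (A := E.toStrategy) (B := B₁) (m₀ := m₁) (loss := noLoss) (T := T))
      unfold outWeight
      rw [← run_add]
      congr 1
      funext rA rB b ρ
      by_cases h5 : ok b = true <;> by_cases h6 : sel b = c₀
      · simp [h5, h6]
      · have : sel b = !c₀ := by revert h6; cases sel b <;> cases c₀ <;> simp
        simp [h5, this]
      · simp [h5]
      · simp [h5]
    have h5 := (h₂ (!c₀)).nonneg
    nlinarith
  · obtain ⟨E₁, hE₁, T₁, hT₁⟩ := h₁.attained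
    choose E₂ T₂ hE₂ hT₂ using fun c => (h₂ c).attained
    -- Transcripts of the first protocol of length at most `T₁` leave at least `T₂ (sel b)` turns
    -- for either continuation.
    refine ⟨Guesser.seq E₁ E₂ next₁ sel m₂, T₁ + (T₂ false + T₂ true), hE₁.seq hE₂, ?_⟩
    rw [guessProb_seq hne]
    refine le_trans (le_of_eq ?_) (run_mono_turns (n := T₁) (fun rA rB b ρ hρ => ?_) (by omega)
      _ _ _ _ (start_posSemidef _))
    · obtain ⟨h3, h4⟩ := hT₁ T₁ le_rfl
      have h5 : a (!c₀) + (a c₀ - a (!c₀)) * p = ∑ c, a c * outWeight next₁ E₁ B₁ m₁ noLoss T₁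
          (fun _ _ b => ok b = true ∧ sel b = c) := by
        rw [hsum, h3, h4]
        ring
      rw [h5]
      unfold outWeight
      simp only [← run_const_mul]
      rw [← run_sum]
      refine run_congr (T := T₁) (fun _ _ => rfl) (fun rA rB b ρ hρ hb _ => ?_) T₁ _ _ _ _
        (start_posSemidef _) (by simp)
      rw [Finset.sum_eq_single (sel b)]
      · rw [hT₂ (sel b)]
        · by_cases hok : ok b = true
          · simp only [hok, if_true, and_self, mul_comm]
          · simp only [hok, false_and, if_false, mul_zero, Bool.false_eq_true]
        · have : T₂ (sel b) ≤ T₂ false + T₂ true := by cases sel b <;> omega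
          omega
      · intro c _ hc
        rw [if_neg fun h => hc h.2.symm, mul_zero]
      · simp
    · split
      · exact mul_nonneg (re_trace_nonneg hρ) (guessProb_nonneg _ _)
      · exact le_rfl

end SeqAttained

/-! ### Bounded length and interchange of parties for sequences -/

section SeqNext

variable {C M : Type} [Fintype C] [Fintype M] [DecidableEq M]
  {next₁ : List (Option C) → Option Party} {next₂ : Bool → List (Option C) → Option Party}
  {ok sel : List (Option C) → Bool}

theorem nextSeq_bounded
    (h₁ : ∃ N : ℕ, ∀ τ σ : List (Option C), σ.length = N → none ∉ σ →
      ∃ υ : List (Option C), υ <:+ σ ++ τ ∧ next₁ υ = none)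
    (h₂ : ∀ c, ∃ N : ℕ, ∀ τ σ : List (Option C), σ.length = N → none ∉ σ →
      ∃ υ : List (Option C), υ <:+ σ ++ τ ∧ next₂ c υ = none) :
    ∃ N : ℕ, ∀ τ σ : List (Option C), σ.length = N → none ∉ σ →
      ∃ υ : List (Option C), υ <:+ σ ++ τ ∧ nextSeq next₁ next₂ sel υ = none := by
  obtain ⟨N₁, h₁⟩ := h₁
  choose N₂ h₂ using h₂
  -- Lists have the latest symbol first, so `σ₁` comprises the first `N₁` turns, which end the first
  -- protocol. The earliest `N₂ (sel b)` turns of `σ₂` then end the second one, even if it had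
  -- already begun, because its bound holds from any transcript on.
  refine ⟨N₂ false + N₂ true + N₁, fun τ σ hσ hn => ?_⟩
  obtain ⟨σ₂, σ₁, rfl, hσ₁⟩ : ∃ σ₂ σ₁, σ = σ₂ ++ σ₁ ∧ σ₁.length = N₁ :=
    ⟨σ.take (N₂ false + N₂ true), σ.drop (N₂ false + N₂ true), (List.take_append_drop _ _).symm,
      by simp [hσ]⟩
  obtain ⟨υ, hυ, hυ'⟩ := h₁ τ σ₁ hσ₁ fun h => hn (by simp [h])
  rcases hc : cut next₁ (σ₁ ++ τ) with _ | ⟨a, b⟩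
  · exact absurd hυ' (cut_eq_none_iff.mp hc υ hυ)
  obtain ⟨h3, h4, h5⟩ := cut_spec hc
  have hlen : N₂ (sel b) ≤ σ₂.length := by
    simp only [List.length_append] at hσ
    cases sel b <;> omega
  obtain ⟨υ', ⟨t, ht⟩, hυ''⟩ := h₂ (sel b) a (σ₂.drop (σ₂.length - N₂ (sel b)))
    (by rw [List.length_drop]; omega) fun h => hn (by
      rw [List.mem_append]
      exact .inl (List.mem_of_mem_drop h))
  refine ⟨υ' ++ b, ⟨σ₂.take (σ₂.length - N₂ (sel b)) ++ t, ?_⟩, ?_⟩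
  · rw [List.append_assoc, ← List.append_assoc t, ht, List.append_assoc, ← h3, ← List.append_assoc,
      List.take_append_drop, List.append_assoc]
  · rw [nextSeq, h5.cut_eq_some h4]
    exact hυ''

theorem seqSecret_map {Y Z R₁ : Type} {R₂ : Bool → Type} (g : Y → Z)
    (out : ∀ c, List (R₂ c) → List (Option C) → Option Y) (r : List (SeqRecord M R₁ R₂)) (τ) :
    (seqSecret next₁ ok sel out r τ).map g =
      seqSecret next₁ ok sel (fun c r τ => (out c r τ).map g) r τ := by
  unfold seqSecret
  rcases cut next₁ τ with _ | ⟨a, b⟩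
  · rfl
  · simp only
    split <;> rfl

theorem seqSecret_swapNext {Y R₁ : Type} {R₂ : Bool → Type}
    (out : ∀ c, List (R₂ c) → List (Option C) → Option Y) :
    (seqSecret (swapNext next₁) ok sel out : List (SeqRecord M R₁ R₂) → _ → _) =
      seqSecret next₁ ok sel out := by
  funext r τ
  rw [seqSecret, cut_swapNext, seqSecret]

theorem Strategy.seqOp_swapNext (S₁ : Strategy C M) (S₂ : Bool → Strategy C M)
    (m₂ : Bool → M) : S₁.seqOp S₂ (swapNext next₁) sel m₂ = S₁.seqOp S₂ next₁ sel m₂ := by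
  funext r τ o
  rw [Strategy.seqOp, cut_swapNext, Strategy.seqOp]

end SeqNext

/-! ### Honest views and outputs in a sequence of protocols -/

section SeqViews

variable {C M : Type} [Fintype C] [Fintype M] [DecidableEq M] {A₁ B₁ : Strategy C M}
  {A₂ B₂ : Bool → Strategy C M}
  {next₁ : List (Option C) → Option Party} {next₂ : Bool → List (Option C) → Option Party}
  {ok sel : List (Option C) → Bool} {m₁ : M} {m₂ : Bool → M} {loss : LossPattern} {T : ℕ}

theorem traceOutB_tens {A B A' B' : Strategy C M} {EA EB : Type} [Fintype EA] [DecidableEq EA]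
    [Fintype EB] [DecidableEq EB] (gA : A'.Q ≃ A.Q × EA) (gB : B'.Q ≃ B.Q × EB)
    (σ : Matrix (EA × EB) (EA × EB) ℂ) (ρ : Joint A B) :
    traceOutB A' B' (tens (jointEquiv gA gB) σ ρ) = tens (slotEquiv M gA)
      (Matrix.of fun x y => ∑ z, σ (x, z) (y, z)) (traceOutB A B ρ) := by
  ext i j
  simp only [traceOutB, tens_apply, Matrix.of_apply, slotEquiv, Equiv.coe_fn_mk, jointEquiv]
  rw [← gB.symm.sum_comp, Fintype.sum_prod_type, Finset.sum_mul_sum]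
  simp only [Equiv.apply_symm_apply]

/-- Tensoring with a fixed state. -/
def tensHom {I J E : Type} [Fintype I] [Fintype J] [Fintype E] (g : I ≃ J × E)
    (σ : Matrix E E ℂ) : Matrix J J ℂ →+ Matrix I I ℂ where
  toFun := tens g σ
  map_zero' := tens_zero g σ
  map_add' ρ ρ' := by ext; simp [tens_apply, add_mul]

open Classical in
/-- If two events have the same views in the second protocols, then also in the sequence. -/
theorem viewOf_seq {Y : Type} {out : ∀ c, List (B₂ c).R → List (Option C) → Option Y}
    {P Q : Option Y → Prop} (hP : ¬ P none) (hQ : ¬ Q none)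
    {G : ∀ c, List (A₂ c).R → List (Option C) → Prop} (hne : ∀ c, next₂ c [] ≠ none)
    (h : ∀ c (loss : LossPattern) T rA a, G c rA a →
      viewOf (next₂ c) (A₂ c) (B₂ c) (m₂ c) loss T (fun rB τ => P (out c rB τ)) rA a =
      viewOf (next₂ c) (A₂ c) (B₂ c) (m₂ c) loss T (fun rB τ => Q (out c rB τ)) rA a)
    (rA : List (SeqRecord M A₁.R fun c => (A₂ c).R)) (τ : List (Option C))
    (hG : ∀ a b, cut next₁ τ = some (a, b) → ok b = true →
      G (sel b) (secondRecord (sel b) rA) a) :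
    viewOf (nextSeq next₁ next₂ sel) (A₁.seq A₂ next₁ sel m₂) (B₁.seq B₂ next₁ sel m₂) m₁ loss T
      (fun rB τ => P (seqSecret next₁ ok sel out rB τ)) rA τ =
    viewOf (nextSeq next₁ next₂ sel) (A₁.seq A₂ next₁ sel m₂) (B₁.seq B₂ next₁ sel m₂) m₁ loss T
      (fun rB τ => Q (seqSecret next₁ ok sel out rB τ)) rA τ := by
  unfold viewOf
  rw [run_seq (fun _ _ _ => by rw [traceOutB_zero, ite_self]) hne,
    run_seq (fun _ _ _ => by rw [traceOutB_zero, ite_self]) hne,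
    run_restrict _ _ _ _ _ proper_nil]
  conv_rhs => rw [run_restrict _ _ _ _ _ proper_nil]
  congr 1
  funext rA₁ rB₁ b ρ
  by_cases hb : cut next₁ b = some ([], b)
  swap
  · rw [if_neg hb, if_neg hb]
  rw [if_pos hb, if_pos hb]
  refine Finset.sum_congr rfl fun k _ => ?_
  have hφ : ∀ ρ' : Joint (A₂ (sel b)) (B₂ (sel b)),
      traceOutB (A₁.seq A₂ next₁ sel m₂) (B₁.seq B₂ next₁ sel m₂)
        (tens (jointEquiv (seqEquiv₂ A₁.Q (fun c => (A₂ c).Q) (sel b))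
          (seqEquiv₂ B₁.Q (fun c => (B₂ c).Q) (sel b))) (seqEnv A₂ B₂ (sel b) k ρ) ρ') =
      tensHom (slotEquiv M (seqEquiv₂ A₁.Q (fun c => (A₂ c).Q) (sel b)))
        (Matrix.of fun x y => ∑ z, seqEnv A₂ B₂ (sel b) k ρ (x, z) (y, z))
        (traceOutB (A₂ (sel b)) (B₂ (sel b)) ρ') := fun ρ' =>
    traceOutB_tens (A' := A₁.seq A₂ next₁ sel m₂) (B' := B₁.seq B₂ next₁ sel m₂) _ _ _ ρ'
  simp only [seqSecret_second hb, secondRecord_seqRecord, hφ]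
  by_cases hok : ok b = true
  swap
  · simp only [if_neg hok, hP, hQ, and_false]
  simp only [if_pos hok]
  -- For a fixed transcript `b`, fixed first record and fixed reset outcome, the overall record and
  -- transcript determine those of the second protocol. So equality of its views suffices.
  have := viewOf_transfer (next := next₂ (sel b)) (A := A₂ (sel b)) (B := B₂ (sel b))
    (m₀ := m₂ (sel b)) (loss := fun i => loss (i + b.length)) (T := T - b.length)
    (tensHom (slotEquiv M (seqEquiv₂ A₁.Q (fun c => (A₂ c).Q) (sel b)))
      (Matrix.of fun x y => ∑ z, seqEnv A₂ B₂ (sel b) k ρ (x, z) (y, z)))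
    (key := fun r a => seqRecord (sel b) (resetRecord (next₂ (sel b) []) .alice k) r ++
      rA₁.map .inl = rA ∧ a ++ b = τ) (P := fun rB τ => P (out (sel b) rB τ))
    (Q := fun rB τ => Q (out (sel b) rB τ)) ?_ ?_
  · simpa only [and_assoc] using this
  · rintro r a r' a' ⟨h1, h2⟩ ⟨h3, h4⟩
    refine ⟨?_, List.append_cancel_right (h2.trans h4.symm)⟩
    have := congrArg (secondRecord (R₂ := fun c => (A₂ c).R) (sel b)) (h1.trans h3.symm)
    rwa [secondRecord_seqRecord, secondRecord_seqRecord] at this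
  · rintro r a ⟨rfl, rfl⟩
    obtain ⟨-, h1, h2⟩ := cut_spec hb
    refine h _ _ _ _ _ ?_
    have := hG a b (h2.cut_eq_some h1 a) hok
    rwa [secondRecord_seqRecord] at this

-- With honest-type sequences on both sides the second protocol starts afresh, so its output
-- probabilities multiply the weight of the transcript of the first. It experiences the losses
-- shifted by the length of that transcript.
open Classical in
theorem outWeight_seq (hne : ∀ c, next₂ c [] ≠ none) {ok' : List (Option C) → Bool} {Y Z : Type}
    {outA : ∀ c, List (A₂ c).R → List (Option C) → Option Y}
    {outB : ∀ c, List (B₂ c).R → List (Option C) → Option Z} (y : Y) (z : Z) :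
    outWeight (nextSeq next₁ next₂ sel) (A₁.seq A₂ next₁ sel m₂) (B₁.seq B₂ next₁ sel m₂) m₁ loss T
      (fun rA rB τ => seqSecret next₁ ok sel outA rA τ = some y ∧
        seqSecret next₁ ok' sel outB rB τ = some z) =
    run next₁ A₁ B₁ loss (fun _ _ b ρ => if ok b = true ∧ ok' b = true then ρ.trace.re *
      outWeight (next₂ (sel b)) (A₂ (sel b)) (B₂ (sel b)) (m₂ (sel b)) (fun i => loss (i + b.length))
        (T - b.length) (fun rA rB τ => outA (sel b) rA τ = some y ∧ outB (sel b) rB τ = some z)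
      else 0) T [] [] [] (start A₁ B₁ m₁) := by
  unfold outWeight
  rw [run_seq (fun _ _ _ => by simp) hne, run_restrict _ _ _ _ _ proper_nil]
  conv_rhs => rw [run_restrict _ _ _ _ _ proper_nil]
  refine run_congr (T := T) (fun _ _ => rfl) (fun rA rB b ρ hρ _ _ => ?_) T _ _ _ _
    (start_posSemidef _) (by simp)
  by_cases hb : cut next₁ b = some ([], b)
  swap
  · rw [if_neg hb, if_neg hb]
  rw [if_pos hb, if_pos hb]
  simp only [seqSecret_second hb, secondRecord_seqRecord]
  by_cases hok : ok b = true ∧ ok' b = true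
  swap
  · rw [if_neg hok]
    refine Finset.sum_eq_zero fun k _ => ?_
    refine Eq.trans ?_ (run_zero_payoff (next := next₂ (sel b)) (A := A₂ (sel b))
      (B := B₂ (sel b)) (loss := fun i => loss (i + b.length)) (N := ℝ) (T - b.length) [] [] []
      (start (A₂ (sel b)) (B₂ (sel b)) (m₂ (sel b))))
    congr 1
    funext rA' rB' a ρ'
    refine if_neg ?_
    by_cases h1 : ok b = true <;> by_cases h2 : ok' b = true <;> simp_all
  simp only [if_pos hok, if_pos hok.1, if_pos hok.2]
  rw [← sum_trace_seqEnv (A₂ := A₂) (B₂ := B₂) (sel b) ρ, Complex.re_sum, Finset.sum_mul]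
  refine Finset.sum_congr rfl fun k _ => ?_
  rw [← run_const_mul]
  congr 1
  funext rA' rB' a ρ'
  have h5 := trace_eq_re (seqEnv_posSemidef (A₂ := A₂) (B₂ := B₂) (sel b) k hρ)
  rw [trace_tens]
  generalize (seqEnv A₂ B₂ (sel b) k ρ).trace = z at h5 ⊢
  rw [h5, mul_comm ρ'.trace, Complex.re_ofReal_mul, Complex.ofReal_re, mul_ite, mul_zero]
  congr

end SeqViews

/-! ### Random OT in a direction chosen by a coin -/

section Switch

variable {C M : Type} [Fintype C] [Fintype M] [DecidableEq M]

/-- A selector chooses one of two random oblivious transfer protocols. -/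
abbrev Selector.switch (S : Selector C M)
    (D : Bool → Duo C M (Option (Bool × Bool)) (Option (Bool × Bool))) :
    Duo C M (Option (Bool × Bool)) (Option (Bool × Bool)) where
  m₀ := S.m₀
  next := nextSeq S.next (fun c => (D c).next) S.sel
  bounded := nextSeq_bounded S.bounded fun c => (D c).bounded
  A := {
    toStrategy := S.A.seq (fun c => (D c).A.toStrategy) S.next S.sel fun c => (D c).m₀
    honest := S.honestA.seq fun c => (D c).A.honest
    out := seqSecret S.next (fun _ => true) S.sel fun c => (D c).A.out }
  B := {
    toStrategy := S.B.seq (fun c => (D c).B.toStrategy) S.next S.sel fun c => (D c).m₀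
    honest := S.honestB.seq fun c => (D c).B.honest
    out := seqSecret S.next S.ok S.sel fun c => (D c).B.out }

/-- If the protocol were over before the first turn, its outputs would be deterministic, so each
pair of outputs would have probability 0 or 1 rather than 1/8. -/
theorem Duo.IsROT.next_ne_none {D : Duo C M (Option (Bool × Bool)) (Option (Bool × Bool))}
    {a b : ℝ} (h : D.IsROT a b) : D.next [] ≠ none := fun hn => by
  obtain ⟨T, hT⟩ := h.correct noLoss ⟨0, fun _ _ => rfl⟩
  have := hT T le_rfl (false, false) false
  rw [outWeight, run_over hn, trace_start] at this
  split at this <;> norm_num at this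

variable {S : Selector C M} {D : Bool → Duo C M (Option (Bool × Bool)) (Option (Bool × Bool))}

/-- A strategy with the same operators. -/
abbrev Strategy.withOp (S : Strategy C M) (op) (h : S.op = op) : Strategy C M :=
  { S with op := op, op_complete := h ▸ S.op_complete }

/-- Interchanging the parties changes the operators of a composed strategy only by an equality
between cuts that is not definitional; transport along it is done here once. -/
theorem HasCheatingProb.withOp {next : List (Option C) → Option Party} {S : Strategy C M} {m₀ : M}
    {secret : List S.R → List (Option C) → Option Bool} {a : ℝ}
    (h : HasCheatingProb next S m₀ secret a) {op} (hop : S.op = op) :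
    HasCheatingProb next (S.withOp op hop) m₀ secret a := by
  subst hop
  exact h

theorem viewOf_withOp {next : List (Option C) → Option Party} {A B : Strategy C M} {m₀ : M}
    {loss : LossPattern} {T : ℕ} {P : List B.R → List (Option C) → Prop} {opA opB}
    (hA : A.op = opA) (hB : B.op = opB) (rA τ) :
    viewOf next (A.withOp opA hA) (B.withOp opB hB) m₀ loss T P rA τ =
      viewOf next A B m₀ loss T P rA τ := by
  subst hA hB
  rfl

/-- Weights of at least 1/8 of eight disjoint events are equal to 1/8. -/
theorem outWeight_eq_of_le {next : List (Option C) → Option Party} {A B : Strategy C M} {m₀ : M}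
    {loss : LossPattern} {T : ℕ} {outA : List A.R → List (Option C) → Option (Bool × Bool)}
    {outB : List B.R → List (Option C) → Option (Bool × Bool)}
    (h : ∀ (x : Bool × Bool) (i : Bool), 1 / 8 ≤ outWeight next A B m₀ loss T
      (fun rA rB τ => outA rA τ = some x ∧ outB rB τ = some (i, pick x i)))
    (x : Bool × Bool) (i : Bool) : outWeight next A B m₀ loss T
      (fun rA rB τ => outA rA τ = some x ∧ outB rB τ = some (i, pick x i)) = 1 / 8 := by
  classical
  have h1 : ∑ p : (Bool × Bool) × Bool, outWeight next A B m₀ loss T (fun rA rB τ =>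
      outA rA τ = some p.1 ∧ outB rB τ = some (p.2, pick p.1 p.2)) ≤ 1 := by
    refine le_trans ?_ (outWeight_le_one (P := fun _ _ _ => True) (next := next) (A := A) (B := B)
      (m₀ := m₀) (loss := loss) (T := T))
    unfold outWeight
    rw [← run_sum]
    refine run_le (T := T) (fun rA rB b ρ hρ _ _ => ?_) T _ _ _ _ (start_posSemidef _) (by simp)
    rw [if_pos trivial]
    by_cases hp : ∃ p : (Bool × Bool) × Bool,
      outA rA b = some p.1 ∧ outB rB b = some (p.2, pick p.1 p.2)
    · obtain ⟨p, h1, h2⟩ := hp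
      rw [Finset.sum_eq_single p]
      · rw [if_pos ⟨h1, h2⟩]
      · rintro q - hq
        refine if_neg fun ⟨h3, h4⟩ => hq ?_
        rw [h1, Option.some.injEq] at h3
        rw [h2, Option.some.injEq] at h4
        exact (Prod.ext h3 (congrArg Prod.fst h4)).symm
      · simp
    · push Not at hp
      refine (Finset.sum_nonpos fun p _ => ?_).trans (re_trace_nonneg hρ)
      rw [if_neg fun ⟨h1, h2⟩ => hp p h1 h2]
  have h2 : ∑ _p : (Bool × Bool) × Bool, (1 / 8 : ℝ) = 1 := by simp
  have h3 := (Finset.sum_eq_sum_iff_of_le (fun (p : (Bool × Bool) × Bool) _ => h p.1 p.2)).mp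
    (le_antisymm (Finset.sum_le_sum fun p _ => h p.1 p.2) (h1.trans h2.symm.le))
  exact (h3 (x, i) (Finset.mem_univ _)).symm

/-- Only lower bounds are needed. Coin flips finished by turn `T₁` already have total weight one and
leave time for the second protocol, which gives each of the eight consistent outputs weight at least
1/8; since these are disjoint, equality follows. -/
theorem Selector.IsWCF.switch_correct {p q : ℝ} (hS : S.IsWCF p q) {a b : Bool → ℝ}
    (hD : ∀ c, (D c).IsROT (a c) (b c)) (loss : LossPattern) (hl : loss.Finite) :
    ∃ T₀, ∀ T ≥ T₀, ∀ (x : Bool × Bool) (i : Bool),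
    outWeight (S.switch D).next (S.switch D).A.toStrategy (S.switch D).B.toStrategy S.m₀ loss T
      (fun rA rB τ => (S.switch D).A.out rA τ = some x ∧
        (S.switch D).B.out rB τ = some (i, pick x i)) = 1 / 8 := by
  classical
  obtain ⟨T₁, hT₁⟩ := hS.correct loss hl
  have hshift : ∀ s, LossPattern.Finite fun i => loss (i + s) := fun s => by
    obtain ⟨t, ht⟩ := hl
    exact ⟨t, fun i hi => ht _ (by omega)⟩
  choose T₂ hT₂ using fun (c : Bool) (s : ℕ) => (hD c).correct _ (hshift s)
  -- The shifted pattern of losses, and with it the time needed, depends on the length of the first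
  -- transcript; only the finitely many lengths up to `T₁` occur.
  obtain ⟨K, hK⟩ : ∃ K, ∀ c, ∀ s ≤ T₁, T₂ c s ≤ K := by
    refine ⟨∑ c, ∑ s ∈ Finset.range (T₁ + 1), T₂ c s, fun c s hs => ?_⟩
    exact (Finset.single_le_sum (f := T₂ c) (fun _ _ => Nat.zero_le _)
      (Finset.mem_range.mpr (Nat.lt_succ_of_le hs))).trans
      (Finset.single_le_sum (f := fun c => ∑ s ∈ Finset.range (T₁ + 1), T₂ c s)
        (fun _ _ => Nat.zero_le _) (Finset.mem_univ c))
  refine ⟨T₁ + K, fun T hT => outWeight_eq_of_le fun x i => ?_⟩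
  refine le_of_le_of_eq ?_ (outWeight_seq (m₁ := S.m₀) (m₂ := fun c => (D c).m₀) (next₁ := S.next)
    (next₂ := fun c => (D c).next) (ok := fun _ => true) (ok' := S.ok) (sel := S.sel)
    (outA := fun c => (D c).A.out) (outB := fun c => (D c).B.out)
    (fun c => (hD c).next_ne_none) x (i, pick x i)).symm
  refine le_trans (le_of_eq ?_) (run_mono_turns (n := T₁) (fun rA rB b ρ hρ => ?_) (by omega)
    _ _ _ _ (start_posSemidef _))
  · have h1 := hT₁ T₁ le_rfl
    refine Eq.trans (b := 1 / 8 * outWeight S.next S.A S.B S.m₀ loss T₁ fun _ _ τ => S.ok τ = true)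
      (by rw [h1, mul_one]) ?_
    rw [outWeight, ← run_const_mul]
    refine run_congr (T := T₁) (fun _ _ => rfl) (fun rA rB b ρ hρ hb _ => ?_) T₁ _ _ _ _
      (start_posSemidef _) (by simp)
    simp only [true_and]
    by_cases hok : S.ok b = true
    · have h2 := hT₂ (S.sel b) b.length (T - b.length)
        (by have := hK (S.sel b) b.length hb; omega) x i
      rw [if_pos hok, if_pos hok, ← h2, mul_comm]
    · rw [if_neg hok, if_neg hok, mul_zero]
  · split
    · exact mul_nonneg (re_trace_nonneg hρ) outWeight_nonneg
    · exact le_rfl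

/-- The inequalities `ha` and `hb` say that outcome 0 selects the protocol in which a dishonest
Alice does better, and outcome 1 the one in which a dishonest Bob does. Hiding holds in each
selected protocol separately, and the selection is public. -/
theorem Selector.IsWCF.switch {p q : ℝ} (hS : S.IsWCF p q) {a b : Bool → ℝ}
    (hD : ∀ c, (D c).IsROT (a c) (b c)) (ha : a true ≤ a false) (hb : b false ≤ b true) :
    (S.switch D).IsROT (a true + (a false - a true) * p) (b false + (b true - b false) * q) where
  correct := hS.switch_correct hD
  hidingA loss T rA τ :=
    viewOf_seq (P := fun y => ∃ v, y = some (false, v)) (Q := fun y => ∃ v, y = some (true, v))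
      (G := fun _ _ _ => True) (out := fun c => (D c).B.out) (by simp) (by simp)
      (fun c => (hD c).next_ne_none) (fun c loss T rA τ _ => (hD c).hidingA loss T rA τ) rA τ
      fun _ _ _ _ => trivial
  hidingB loss T rB τ i v hv := by
    have h := viewOf_seq (A₁ := S.B) (B₁ := S.A) (m₁ := S.m₀) (loss := loss) (T := T)
      (next₁ := swapNext S.next) (sel := S.sel) (ok := fun _ => true) (m₂ := fun c => (D c).m₀)
      (P := fun y => ∃ x, y = some x ∧ pick x (!i) = false)
      (Q := fun y => ∃ x, y = some x ∧ pick x (!i) = true)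
      (G := fun c rB τ => (D c).B.out rB τ = some (i, v)) (out := fun c => (D c).A.out)
      (by simp) (by simp) (next₂ := fun c => swapNext (D c).next)
      (fun c h => (hD c).next_ne_none (swapNext_eq_none.mp h))
      (fun c loss T rB τ hG => (hD c).hidingB loss T rB τ i v hG) rB τ ?_
    · simp only [← swapNext_nextSeq, seqSecret_swapNext] at h
      exact (viewOf_withOp (Strategy.seqOp_swapNext _ _ _) (Strategy.seqOp_swapNext _ _ _) _ _).trans
        (h.trans (viewOf_withOp (Strategy.seqOp_swapNext _ _ _) (Strategy.seqOp_swapNext _ _ _) _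
          _).symm)
    · intro a b hc _
      rw [cut_swapNext] at hc
      simp only [seqSecret, hc] at hv
      split at hv
      · exact hv
      · cases hv
  cheatA := by
    have := HasCheatingProb.seq (m₂ := fun c => (D c).m₀) hS.cheatA (fun c => (hD c).cheatA)
      (fun c => (hD c).next_ne_none) ha
    simp only [seqSecret_map]
    exact this
  cheatB := by
    have := HasCheatingProb.seq (m₂ := fun c => (D c).m₀) hS.cheatB (fun c => (hD c).cheatB)
      (fun c h => (hD c).next_ne_none (swapNext_eq_none.mp h)) hb
    simp only [← swapNext_nextSeq, seqSecret_swapNext] at this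
    simp only [seqSecret_map]
    exact this.withOp (Strategy.seqOp_swapNext _ _ _)

end Switch

/-! ### OT from random OT: correctness and hiding -/

section Transferred

variable {C M : Type} [Fintype C] [Fintype M] [DecidableEq M]

/-- The output of a player after the announcements. -/
def sayOut {R Y : Type} (next : List (Option C) → Option Party)
    (g : List R → List (Option C) → List (Option C) → Option Y) (r : List (Option R))
    (τ : List (Option C)) : Option Y :=
  match cut next τ with
  | none => none
  | some (a, b) => g r.reduceOption a b

theorem sayOut_say {R Y : Type} {next : List (Option C) → Option Party}
    (g : List R → List (Option C) → List (Option C) → Option Y) (r : List R) {b : List (Option C)}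
    (hb : cut next b = some ([], b)) (s s' : Option C) :
    sayOut next g (none :: r.map some) (s :: s' :: b) = g r [s, s'] b := by
  rw [sayOut, cut_cons_of_cut (cut_cons_of_cut hb), List.reduceOption_cons_of_none,
    reduceOption_map_some]

/-- Bob's announcement: whether his input differs from his random bit. -/
def bobBit (i : Bool) (y : Option (Bool × Bool)) : Bool := y.elim false fun y => xor y.1 i

/-- Alice's announcement: her inputs, masked by her random bits. -/
def aliceBits (x : Bool × Bool) (d : Bool) (y : Option (Bool × Bool)) : Bool × Bool :=
  y.elim (false, false) fun z => (xor x.1 (pick z d), xor x.2 (pick z (!d)))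

variable (D : Duo C M (Option (Bool × Bool)) (Option (Bool × Bool))) (X : BitCode C)

/-- Oblivious transfer from random oblivious transfer. -/
abbrev Duo.transfer : OTProtocol where
  C := C
  M := M
  m₀ := D.m₀
  next := nextSay D.next .bob .alice
  bounded := nextSay_bounded D.bounded
  alice x := {
    toStrategy := D.A.toStrategy.say D.next fun r a b =>
      X.wr (aliceBits x (X.last a) (D.A.out r b))
    honest := D.A.honest.say _ _
    out := sayOut D.next fun r _ b => (D.A.out r b).map fun _ => () }
  bob i := {
    toStrategy := D.B.toStrategy.say D.next fun r _ b => X.wr (bobBit i (D.B.out r b), false)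
    honest := D.B.honest.say _ _
    out := sayOut D.next fun r a b => (D.B.out r b).map fun y =>
      xor y.2 (pick (X.bits (a.headD none)) i) }

variable {D X}

theorem BitCode.last_wr (d e : Bool) (a : List (Option C)) : X.last (some (X.wr (d, e)) :: a) = d := by
  rw [BitCode.last, X.bits_wr]

theorem Duo.IsROT.outWeight_consistent {a b : ℝ} (h : D.IsROT a b) (loss : LossPattern)
    (hl : loss.Finite) : ∃ T₀, ∀ T ≥ T₀, outWeight D.next D.A.toStrategy D.B.toStrategy D.m₀ loss T
      (fun rA rB τ => Consistent (D.A.out rA τ) (D.B.out rB τ)) = 1 := by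
  classical
  obtain ⟨T₀, hT⟩ := h.correct loss hl
  refine ⟨T₀, fun T hT' => ?_⟩
  have h2 : ∑ p : (Bool × Bool) × Bool, outWeight D.next D.A.toStrategy D.B.toStrategy D.m₀ loss T
      (fun rA rB τ => D.A.out rA τ = some p.1 ∧ D.B.out rB τ = some (p.2, pick p.1 p.2)) = 1 := by
    simp only [hT T hT']
    simp
  rw [← h2]
  unfold outWeight
  rw [← run_sum]
  congr 1
  funext rA rB b ρ
  by_cases hp : Consistent (D.A.out rA b) (D.B.out rB b)
  · rw [if_pos hp]
    obtain ⟨x, i, h1, h2⟩ := hp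
    rw [Finset.sum_eq_single (x, i)]
    · rw [if_pos ⟨h1, h2⟩]
    · rintro q - hq
      refine if_neg fun ⟨h3, h4⟩ => hq ?_
      rw [h1, Option.some.injEq] at h3
      rw [h2, Option.some.injEq] at h4
      exact (Prod.ext h3 (congrArg Prod.fst h4)).symm
    · simp
  · rw [if_neg hp]
    refine (Finset.sum_eq_zero fun p _ => if_neg fun h => hp ⟨p.1, p.2, h⟩).symm

theorem xor_aliceBits (x z : Bool × Bool) (i j : Bool) :
    xor (pick z j) (pick (aliceBits x (bobBit i (some (j, pick z j))) (some z)) i) = pick x i := by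
  revert x z i j
  decide

theorem bobBit_eq_iff (i j v d : Bool) : bobBit i (some (j, v)) = d ↔ j = xor d i := by
  revert i j v d
  decide

/-- For a Bob with input `i` and random output `(j, z_j)`, a given announcement `y` of Alice amounts
to two conditions: one involves only what he may know, the other fixes the bit of `z` that is hidden
from him. That hidden bit masks the input he did not ask for. -/
theorem aliceBits_eq_iff (x y z : Bool × Bool) (i j : Bool) :
    aliceBits x (bobBit i (some (j, pick z j))) (some z) = y ↔
      pick y i = xor (pick x i) (pick z j) ∧ pick z (!j) = xor (pick x !i) (pick y !i) := by
  revert x y z i j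
  decide

/-- On consistent outputs, which have total weight one, Bob removes the mask on the requested input
with the random bit that he holds. -/
theorem Duo.IsROT.transfer_correct {a b : ℝ} (h : D.IsROT a b) (loss : LossPattern)
    (hl : loss.Finite) (x : Bool × Bool) (i : Bool) : ∃ T₀, ∀ T ≥ T₀,
    (D.transfer X).outProb x i loss T (some ()) (some (pick x i)) = 1 := by
  classical
  obtain ⟨T₀, hT⟩ := h.outWeight_consistent loss hl
  refine ⟨T₀ + 2, fun T hT' => ?_⟩
  obtain ⟨T, rfl⟩ : ∃ t, T = t + 2 := ⟨T - 2, by omega⟩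
  rw [Protocol.outProb_eq]
  refine le_antisymm outWeight_le_one ?_
  rw [← hT T (by omega)]
  refine le_trans ?_ (run_say_say (A := D.A.toStrategy) (B := D.B.toStrategy) (by simp) T
    (start _ _ D.m₀)).ge
  unfold outWeight
  rw [run_restrict _ _ _ _ _ proper_nil]
  conv_rhs => rw [run_restrict _ _ _ _ _ proper_nil]
  refine run_le (T := T) (fun rA rB b ρ hρ _ _ => ?_) T _ _ _ _ (start_posSemidef _) (by simp)
  by_cases hb : cut D.next b = some ([], b)
  swap
  · rw [if_neg hb, if_neg hb]
  rw [if_pos hb, if_pos hb]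
  beta_reduce
  rw [trace_chan, trace_chan]
  by_cases hc : Consistent (D.A.out rA b) (D.B.out rB b)
  · rw [if_pos hc]
    obtain ⟨z, j, h1, h2⟩ := hc
    rw [if_pos]
    constructor
    · refine (sayOut_say (fun r _ b => (D.A.out r b).map fun _ => ()) rA hb _ _).trans ?_
      rw [h1, Option.map_some]
    · refine (sayOut_say (fun r a b => (D.B.out r b).map fun y =>
        xor y.2 (pick (X.bits (a.headD none)) i)) rB hb _ _).trans ?_
      simp only [h1, h2, Option.map_some, X.last_wr, List.headD_cons, X.bits_wr, xor_aliceBits]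
  · rw [if_neg hc]
    split
    exacts [re_trace_nonneg hρ, le_rfl]

/-- The action of the channel on what one party holds. -/
def chanReg (Q M : Type) [Fintype M] [DecidableEq M] (l : Bool) :
    Matrix (Q × Option M) (Q × Option M) ℂ →+ Matrix (Q × Option M) (Q × Option M) ℂ where
  toFun ω := if l then Matrix.of fun i j => Matrix.single none none (1 : ℂ) i.2 j.2 *
    ∑ k : Option M, ω (i.1, k) (j.1, k) else ω
  map_zero' := by
    cases l
    · rfl
    · ext
      simp
  map_add' ω ω' := by
    cases l
    · rfl
    · ext
      simp [Finset.sum_add_distrib, mul_add]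

theorem ite_congr_of_iff {α : Type} {p q : Prop} {_ : Decidable p} {_ : Decidable q} {x y z : α}
    (h : p ↔ q) (hxy : q → x = y) : (if p then x else z) = if q then y else z := by
  by_cases hq : q
  · rw [if_pos hq, if_pos (h.mpr hq), hxy hq]
  · rw [if_neg hq, if_neg (mt h.mp hq)]

theorem traceOutB_chan {A B : Strategy C M} (l : Bool) (ρ : Joint A B) :
    traceOutB A B (chan A B l ρ) = chanReg A.Q M l (traceOutB A B ρ) := by
  cases l
  · rfl
  · ext i j
    change ∑ q, Matrix.single none none (1 : ℂ) i.2 j.2 * ∑ k : Option M, ρ (i.1, k, q) (j.1, k, q) =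
      Matrix.single none none (1 : ℂ) i.2 j.2 * ∑ k : Option M, ∑ q, ρ (i.1, k, q) (j.1, k, q)
    rw [← Finset.mul_sum, Finset.sum_comm]

theorem viewOf_transfer' {next : List (Option C) → Option Party} {A B : Strategy C M} {m₀ : M}
    {loss : LossPattern} {T : ℕ} {N : Type} [AddCommMonoid N]
    (φ : Matrix (A.Q × Option M) (A.Q × Option M) ℂ →+ N)
    {key : List A.R → List (Option C) → Prop}
    (hkey : ∀ r τ r' τ', key r τ → key r' τ' → r = r' ∧ τ = τ')
    {P Q : List B.R → List (Option C) → Prop}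
    {_ : ∀ rA rB τ, Decidable (key rA τ ∧ P rB τ)} {_ : ∀ rA rB τ, Decidable (key rA τ ∧ Q rB τ)}
    (h : ∀ rA τ, key rA τ → viewOf next A B m₀ loss T P rA τ = viewOf next A B m₀ loss T Q rA τ) :
    run next A B loss (fun rA rB τ ρ => if key rA τ ∧ P rB τ then φ (traceOutB A B ρ) else 0)
      T [] [] [] (start A B m₀) =
    run next A B loss (fun rA rB τ ρ => if key rA τ ∧ Q rB τ then φ (traceOutB A B ρ) else 0)
      T [] [] [] (start A B m₀) := by
  convert viewOf_transfer φ hkey h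

theorem Strategy.sayOp_swapNext (S : Strategy C M) (next : List (Option C) → Option Party)
    (msg : List S.R → List (Option C) → List (Option C) → C) :
    S.sayOp (swapNext next) msg = S.sayOp next msg := by
  funext r τ o
  simp only [Strategy.sayOp, cut_swapNext]

theorem map_some_injective {R : Type} {r r' : List R} {l : List (Option R)}
    (h : none :: r.map some = l) (h' : none :: r'.map some = l) : r = r' := by
  rw [← h'] at h
  exact List.map_injective_iff.mpr (Option.some_injective R) (List.cons.inj h).2

/-- The transcript fixes Bob's announcement `d`, so changing his input amounts to changing his
random choice `xor d i`, about which Alice's view in the random OT contains nothing. -/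
theorem Duo.IsROT.transfer_hidingA {a b : ℝ} (h : D.IsROT a b) (loss : LossPattern) (T : ℕ)
    (x : Bool × Bool) (r : List (Option D.A.R)) (τ : List (Option C)) :
    (D.transfer X).viewA x false loss T (fun _ => True) r τ =
      (D.transfer X).viewA x true loss T (fun _ => True) r τ := by
  classical
  rw [Protocol.viewA_eq, Protocol.viewA_eq]
  obtain hT | ⟨T, rfl⟩ : T < 2 ∨ ∃ t, T = t + 2 := by
    by_cases h : T < 2
    exacts [.inl h, .inr ⟨T - 2, by omega⟩]
  · exact (run_nextSay_eq_zero hT _ _ _).trans (run_nextSay_eq_zero hT _ _ _).symm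
  let d := X.last τ.tail
  let φ := (chanReg D.A.Q M (loss (τ.length - 1))).comp (chanReg D.A.Q M (loss (τ.length - 2)))
  let key (rA : List D.A.R) (b : List (Option C)) : Prop := none :: rA.map some = r ∧
    some (X.wr (aliceBits x d (D.A.out rA b))) :: some (X.wr (d, false)) :: b = τ
  have expand (i : Bool) : viewOf (D.transfer X).next ((D.transfer X).alice x).toStrategy
      ((D.transfer X).bob i).toStrategy D.m₀ loss (T + 2) (fun _ _ => True) r τ =
      run D.next D.A.toStrategy D.B.toStrategy loss (fun rA rB b ρ =>
        if key rA b ∧ bobBit i (D.B.out rB b) = d then φ (traceOutB _ _ ρ) else 0) T [] [] []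
        (start _ _ D.m₀) := by
    refine (run_say_say (A := D.A.toStrategy) (B := D.B.toStrategy)
      (fun _ _ _ => by rw [traceOutB_zero, ite_self]) T (start _ _ D.m₀)).trans ?_
    congr 1
    funext rA rB b ρ
    refine ite_congr_of_iff ?_ ?_
    · rw [X.last_wr]
      constructor
      · rintro ⟨h1, h2, -⟩
        have hd : d = bobBit i (D.B.out rB b) := by
          change X.last τ.tail = _
          rw [← h2, List.tail_cons, X.last_wr]
        rw [← hd] at h2
        exact ⟨⟨h1, h2⟩, hd.symm⟩
      · rintro ⟨⟨h1, h2⟩, hd⟩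
        rw [hd]
        exact ⟨h1, h2, trivial⟩
    · rintro ⟨⟨-, h2⟩, -⟩
      have hl := congrArg List.length h2
      simp only [List.length_cons] at hl
      change traceOutB D.A.toStrategy D.B.toStrategy (chan _ _ _ (chan _ _ _ ρ)) = _
      rw [traceOutB_chan, traceOutB_chan]
      change _ = chanReg _ _ (loss (τ.length - 1)) (chanReg _ _ (loss (τ.length - 2)) _)
      rw [← hl]
      rfl
  refine (expand false).trans (Eq.trans ?_ (expand true).symm)
  refine viewOf_transfer' φ (key := key) (fun rA b rA' b' hk hk' => ⟨map_some_injective hk.1 hk'.1, ?_⟩) ?_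
  · have := hk.2.trans hk'.2.symm
    exact (List.cons.inj (List.cons.inj this).2).2
  intro rA b _
  have key' (i : Bool) : viewOf D.next D.A.toStrategy D.B.toStrategy D.m₀ loss T
      (fun rB b => bobBit i (D.B.out rB b) = d) rA b =
      viewOf D.next D.A.toStrategy D.B.toStrategy D.m₀ loss T
        (fun rB b => ∃ v, D.B.out rB b = some (xor d i, v)) rA b := by
    refine viewOf_congr (h.outWeight_eq_zero loss T) fun rB hc => ?_
    obtain ⟨z, j, -, h2⟩ := not_not.mp hc
    rw [h2]
    simp only [Option.some.injEq, Prod.mk.injEq, exists_and_left, exists_eq', and_true]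
    exact bobBit_eq_iff _ _ _ _
  rw [key', key']
  cases d
  · exact h.hidingA loss T rA b
  · exact (h.hidingA loss T rA b).symm

/-- Bob's record and transcript fix his random output and Alice's announcement. Inputs that agree at
`i` then differ only in the required value of the hidden random bit, and his views for its two
values are equal. -/
theorem Duo.IsROT.transfer_hidingB {a b : ℝ} (h : D.IsROT a b) (loss : LossPattern) (T : ℕ)
    (i : Bool) (x x' : Bool × Bool) (hx : pick x i = pick x' i) (r : List (Option D.B.R))
    (τ : List (Option C)) :
    (D.transfer X).viewB x i loss T (fun _ => True) r τ =
      (D.transfer X).viewB x' i loss T (fun _ => True) r τ := by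
  classical
  rw [Protocol.viewB_eq, Protocol.viewB_eq, swapNext_nextSay]
  obtain hT | ⟨T, rfl⟩ : T < 2 ∨ ∃ t, T = t + 2 := by
    by_cases h : T < 2
    exacts [.inl h, .inr ⟨T - 2, by omega⟩]
  · exact (run_nextSay_eq_zero hT _ _ _).trans (run_nextSay_eq_zero hT _ _ _).symm
  let d := X.last τ.tail
  let y := X.bits (τ.headD none)
  let φ := (chanReg D.B.Q M (loss (τ.length - 1))).comp (chanReg D.B.Q M (loss (τ.length - 2)))
  let key (rB : List D.B.R) (b : List (Option C)) : Prop := none :: rB.map some = r ∧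
    some (X.wr y) :: some (X.wr (bobBit i (D.B.out rB b), false)) :: b = τ
  have hkey (rB b) (hk : key rB b) : d = bobBit i (D.B.out rB b) := by
    change X.last τ.tail = _
    rw [← hk.2, List.tail_cons, X.last_wr]
  have expand (x : Bool × Bool) : viewOf (nextSay (swapNext D.next) .alice .bob)
      ((D.transfer X).bob i).toStrategy ((D.transfer X).alice x).toStrategy
      D.m₀ loss (T + 2) (fun _ _ => True) r τ =
      run (swapNext D.next) D.B.toStrategy D.A.toStrategy loss (fun rB rA b ρ =>
        if key rB b ∧ aliceBits x d (D.A.out rA b) = y then φ (traceOutB _ _ ρ) else 0) T [] [] []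
        (start _ _ D.m₀) := by
    refine (viewOf_withOp (A := D.B.toStrategy.say (swapNext D.next) _)
      (B := D.A.toStrategy.say (swapNext D.next) _) (Strategy.sayOp_swapNext _ _ _)
      (Strategy.sayOp_swapNext _ _ _) _ _).trans ?_
    refine (run_say_say' (A := D.B.toStrategy) (B := D.A.toStrategy)
      (fun _ _ _ => by rw [traceOutB_zero, ite_self]) T (start _ _ D.m₀)).trans ?_
    congr 1
    funext rB rA b ρ
    refine ite_congr_of_iff ?_ ?_
    · rw [X.last_wr]
      constructor
      · rintro ⟨h1, h2, -⟩
        have hd : d = bobBit i (D.B.out rB b) := by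
          change X.last τ.tail = _
          rw [← h2, List.tail_cons, X.last_wr]
        have hy : y = aliceBits x d (D.A.out rA b) := by
          change X.bits (τ.headD none) = _
          rw [← h2, List.headD_cons, X.bits_wr, hd]
        rw [← hd, ← hy, hd] at h2
        exact ⟨⟨h1, h2⟩, hy.symm⟩
      · rintro ⟨hk, hy⟩
        rw [← hkey _ _ hk, hy, hkey _ _ hk]
        exact ⟨hk.1, hk.2, trivial⟩
    · rintro ⟨⟨-, h2⟩, -⟩
      have hl := congrArg List.length h2
      simp only [List.length_cons] at hl
      change traceOutB D.B.toStrategy D.A.toStrategy (chan _ _ _ (chan _ _ _ ρ)) = _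
      rw [traceOutB_chan, traceOutB_chan]
      change _ = chanReg _ _ (loss (τ.length - 1)) (chanReg _ _ (loss (τ.length - 2)) _)
      rw [← hl]
      rfl
  refine (expand x).trans (Eq.trans ?_ (expand x').symm)
  refine viewOf_transfer' φ (key := key) (fun rA b rA' b' hk hk' => ⟨map_some_injective hk.1 hk'.1, ?_⟩) ?_
  · have := hk.2.trans hk'.2.symm
    exact (List.cons.inj (List.cons.inj this).2).2
  intro rB b hk
  have hd := hkey _ _ hk
  have hzero := (outWeight_swap (B := D.B.toStrategy)).trans (h.outWeight_eq_zero loss T)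
  rcases ho : D.B.out rB b with _ | ⟨j, v⟩
  · refine viewOf_congr hzero fun rA hc => ?_
    obtain ⟨z, j, -, h2⟩ := not_not.mp hc
    rw [ho] at h2
    cases h2
  rw [ho] at hd
  have key' (x : Bool × Bool) : viewOf (swapNext D.next) D.B.toStrategy D.A.toStrategy D.m₀ loss T
      (fun rA b => aliceBits x d (D.A.out rA b) = y) rB b =
      viewOf (swapNext D.next) D.B.toStrategy D.A.toStrategy D.m₀ loss T
        (fun rA b => pick y i = xor (pick x i) v ∧ ∃ z, D.A.out rA b = some z ∧
          pick z (!j) = xor (pick x (!i)) (pick y (!i))) rB b := by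
    refine viewOf_congr hzero fun rA hc => ?_
    obtain ⟨z, j', h1, h2⟩ := not_not.mp hc
    rw [ho, Option.some.injEq, Prod.mk.injEq] at h2
    obtain ⟨rfl, rfl⟩ := h2
    rw [h1, hd]
    simp only [Option.some.injEq, exists_eq_left']
    exact aliceBits_eq_iff _ _ _ _ _
  rw [key', key', hx]
  -- If the announcement contradicts the bit that Bob already knows, both events are empty.
  by_cases hy : pick y i = xor (pick x' i) v
  · simp only [hy, true_and]
    have := h.hidingB loss T rB b j v ho
    generalize xor (pick x (!i)) (pick y (!i)) = u
    generalize xor (pick x' (!i)) (pick y (!i)) = u'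
    cases u <;> cases u'
    exacts [rfl, this, this.symm, rfl]
  · simp only [hy, false_and]

end Transferred

/-! ### OT from random OT: cheating probabilities -/

section TransferCheat

variable {C M : Type} [Fintype C] [Fintype M] [DecidableEq M]

/-- A dishonest player who imagines a uniformly random message `j : J`, makes one more move, and
then guesses like `E`, up to the mask `t j`. -/
abbrev Guesser.average (E : Guesser C M) (J : Type) [Fintype J] [Nonempty J]
    (ctx : J → List (Option C) → List (Option C))
    (post : J → Option C → List (Option C) → List (Option C)) (t : J → Bool) : Guesser C M where
  toStrategy := E.toStrategy
  eff r b s := (Fintype.card J : ℂ)⁻¹ • ∑ j, ∑ o, (E.op r (ctx j b) o)ᴴ *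
    E.eff (o.1 :: r) (post j o.2 b) (xor (t j) s) * E.op r (ctx j b) o
  eff_posSemidef r b s := by
    refine Matrix.PosSemidef.smul ?_ (by positivity)
    refine Matrix.posSemidef_sum _ fun j _ => Matrix.posSemidef_sum _ fun o _ => ?_
    exact (E.eff_posSemidef _ _ _).conjTranspose_mul_mul_same _
  eff_sum r b := by
    have h (t : Bool) (r τ) : E.eff r τ (xor t false) + E.eff r τ (xor t true) = 1 := by
      cases t
      · exact E.eff_sum r τ
      · exact (add_comm _ _).trans (E.eff_sum r τ)
    rw [← smul_add, ← Finset.sum_add_distrib]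
    have h2 (j : J) : ∑ o, (E.op r (ctx j b) o)ᴴ * E.eff (o.1 :: r) (post j o.2 b) (xor (t j) false) *
        E.op r (ctx j b) o + ∑ o, (E.op r (ctx j b) o)ᴴ *
          E.eff (o.1 :: r) (post j o.2 b) (xor (t j) true) * E.op r (ctx j b) o = 1 := by
      rw [← Finset.sum_add_distrib, ← E.op_complete r (ctx j b)]
      refine Finset.sum_congr rfl fun o _ => ?_
      rw [← add_mul, ← mul_add, h, mul_one]
    simp only [h2, Finset.sum_const, Finset.card_univ]
    rw [← Nat.cast_smul_eq_nsmul ℂ, smul_smul, inv_mul_cancel₀ (by simp), one_smul]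

/-- By cyclicity of the trace, the Kraus operators of the last move are absorbed into the final
measurement. In this way the cheater in the OT becomes a cheater in the random OT, which ends before
the announcements. -/
theorem guessPayoff_average {E : Guesser C M} {B : Strategy C M} {J : Type} [Fintype J] [Nonempty J]
    {ctx : J → List (Option C) → List (Option C)}
    {post : J → Option C → List (Option C) → List (Option C)} {t : J → Bool} (s : Bool) (r b)
    (ρ : Joint E.toStrategy B) :
    Fintype.card J * guessPayoff (E.average J ctx post t) B (some s) r b ρ = ∑ j, ∑ o,
      guessPayoff E B (some (xor (t j) s)) (o.1 :: r) (post j o.2 b)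
        (stepA E.toStrategy B (E.op r (ctx j b) o) ρ) := by
  have hJ : (Fintype.card J : ℂ) ≠ 0 := by simp
  have key : (Fintype.card J : ℂ) * (liftA E.toStrategy B ((E.average J ctx post t).eff r b s) * ρ).trace =
      ∑ j, ∑ o, (liftA E.toStrategy B (E.eff (o.1 :: r) (post j o.2 b) (xor (t j) s)) *
        stepA E.toStrategy B (E.op r (ctx j b) o) ρ).trace := by
    have h1 : (Fintype.card J : ℂ) • liftA E.toStrategy B ((E.average J ctx post t).eff r b s) =
        ∑ j, ∑ o, (liftA E.toStrategy B (E.op r (ctx j b) o))ᴴ *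
          liftA E.toStrategy B (E.eff (o.1 :: r) (post j o.2 b) (xor (t j) s)) *
            liftA E.toStrategy B (E.op r (ctx j b) o) := by
      have h2 (c : ℂ) (K) : c • liftA E.toStrategy B K = liftA E.toStrategy B (c • K) := by
        ext
        simp [liftA, mul_assoc]
      rw [h2, smul_smul, mul_inv_cancel₀ hJ, one_smul]
      simp only [liftA_eq_amp, amp_sum, amp_mul, amp_conjTranspose]
    rw [← smul_eq_mul, ← Matrix.trace_smul, ← smul_mul_assoc, h1, Finset.sum_mul, Matrix.trace_sum]
    refine Finset.sum_congr rfl fun j _ => ?_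
    rw [Finset.sum_mul, Matrix.trace_sum]
    refine Finset.sum_congr rfl fun o _ => ?_
    rw [stepA, mul_assoc, mul_assoc, Matrix.trace_mul_comm]
    simp only [mul_assoc]
  have := congrArg Complex.re key
  simp only [Complex.re_sum] at this
  rw [← Complex.ofReal_natCast, Complex.re_ofReal_mul] at this
  exact this

theorem guessProb_withOp {next : List (Option C) → Option Party} {S : Strategy C M} {m₀ : M}
    {secret : List S.R → List (Option C) → Option Bool} {op} (hop : S.op = op) (E : Guesser C M)
    (T : ℕ) : guessProb next (S.withOp op hop) m₀ secret E T = guessProb next S m₀ secret E T := by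
  subst hop
  rfl

/-- A dishonest player who announces `c`, and guesses like `E`, up to a mask that depends on the
announcements. -/
abbrev Guesser.say (E : Guesser C M) (next : List (Option C) → Option Party) (c : C)
    (t : List (Option C) → Bool) : Guesser C M where
  toStrategy := E.toStrategy.say next fun _ _ _ => c
  eff r τ s := match cut next τ with
    | none => E.eff r.reduceOption τ s
    | some (a, b) => E.eff r.reduceOption b (xor (t a) s)
  eff_posSemidef r τ s := by
    split <;> exact E.eff_posSemidef _ _ _
  eff_sum r τ := by
    split
    · exact E.eff_sum _ _
    · rename_i a b _
      cases t a
      · exact E.eff_sum _ _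
      · exact (add_comm _ _).trans (E.eff_sum _ _)

theorem Guesser.say_eff {E : Guesser C M} {next : List (Option C) → Option Party} {c : C}
    {t : List (Option C) → Bool} {b : List (Option C)} (hb : cut next b = some ([], b)) (r : List E.R)
    (s s' : Option C) (g : Bool) : (E.say next c t).eff (none :: r.map some) (s :: s' :: b) g =
      E.eff r b (xor (t [s, s']) g) := by
  have h := cut_cons_of_cut (s := s) (cut_cons_of_cut (s := s') hb)
  simp only [h]
  rw [List.reduceOption_cons_of_none, reduceOption_map_some]

/-- Probabilities `g i` of which some player attains the maximal average, uniformly in `i`. -/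
theorem isLTCheatingProb_of_uniform {S : Type 1} {ι : Type} [Fintype ι] [Nonempty ι]
    {lossFree : S → Prop} {g : ι → S → ℕ → ℝ} {a : ℝ}
    (hle : ∀ E T, ∑ i, g i E T ≤ Fintype.card ι * a)
    (hatt : ∃ E T, lossFree E ∧ ∀ i, g i E T = a) :
    IsLTCheatingProb lossFree (fun E T => (∑ i, g i E T) / Fintype.card ι) a ∧
      IsLTCheatingProb lossFree (fun E T => ⨅ i, g i E T) a := by
  have hpos : (0 : ℝ) < Fintype.card ι := by exact_mod_cast Fintype.card_pos
  have h1 : ∀ E T, (∑ i, g i E T) / Fintype.card ι ≤ a := fun E T => by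
    rw [div_le_iff₀ hpos, mul_comm]
    exact hle E T
  have h2 : ∀ E T, ⨅ i, g i E T ≤ a := fun E T => by
    refine le_trans ?_ (h1 E T)
    rw [le_div_iff₀ hpos, mul_comm, ← nsmul_eq_mul]
    exact Finset.card_nsmul_le_sum _ _ _ fun i _ => ciInf_le (Set.finite_range _).bddBelow i
  obtain ⟨E, T, hE, hT⟩ := hatt
  refine ⟨⟨⟨⟨E, T, hE, ?_⟩, ?_⟩, h1⟩, ⟨⟨⟨E, T, hE, ?_⟩, ?_⟩, h2⟩⟩
  · simp only [hT, Finset.sum_const, Finset.card_univ, nsmul_eq_mul]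
    field_simp
  · rintro _ ⟨E, T, -, rfl⟩
    exact h1 E T
  · simp only [hT, ciInf_const]
  · rintro _ ⟨E, T, -, rfl⟩
    exact h2 E T

variable {D : Duo C M (Option (Bool × Bool)) (Option (Bool × Bool))} {X : BitCode C}

theorem aliceBits_involutive (d : Bool) (z : Bool × Bool) :
    Function.Involutive fun x => aliceBits x d (some z) := by
  intro x
  revert x d z
  decide

theorem aliceBits_xor (x z : Bool × Bool) (d : Bool) :
    xor (xor (aliceBits x d (some z)).1 (aliceBits x d (some z)).2) (xor z.1 z.2) =
      xor x.1 x.2 := by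
  revert x d z
  decide

/-- For uniform `i`, Bob's announcement d = i ⊕ j is uniform and independent of the random OT. So
Alice can draw `d` herself in the random OT, and her guess of `i` becomes a guess of j = d ⊕ i. -/
theorem Duo.IsROT.transfer_cheatA_le {a b : ℝ} (h : D.IsROT a b) (E : Guesser C M) (T : ℕ) :
    ∑ i : Bool, (D.transfer X).learnA i (fun y => y.map fun _ => i) E T ≤ 2 * a := by
  classical
  let F := E.average Bool (fun d b => some (X.wr (d, false)) :: b)
    (fun d s b => s :: some (X.wr (d, false)) :: b) id
  have key : ∑ i : Bool, (D.transfer X).learnA i (fun y => y.map fun _ => i) E (T + 2) ≤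
      Fintype.card Bool * guessProb D.next D.B.toStrategy D.m₀ (fun r τ => (D.B.out r τ).map Prod.fst) F T := by
    simp only [Protocol.learnA_eq]
    have h1 (i : Bool) := run_cheat_say (next := D.next) (A := E.toStrategy) (B := D.B.toStrategy)
      (msg := fun r _ b => X.wr (bobBit i (D.B.out r b), false))
      (f := fun rA rB τ ρ => guessPayoff E _
        ((((D.transfer X).bob i).out rB τ).map fun _ => i) rA τ ρ)
      (fun _ _ _ => guessPayoff_zero _ _ _) T (start _ _ D.m₀)
    refine (Finset.sum_congr rfl fun i _ => h1 i).le.trans ?_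
    rw [← run_sum]
    unfold guessProb
    rw [← run_const_mul]
    rw [run_restrict _ _ _ _ _ proper_nil]
    conv_rhs => rw [run_restrict _ _ _ _ _ proper_nil]
    refine run_le (T := T) (fun rA rB b ρ hρ _ _ => ?_) T _ _ _ _ (start_posSemidef _) (by simp)
    by_cases hb : cut D.next b = some ([], b)
    swap
    · rw [if_neg hb, if_neg hb]
    rw [if_pos hb, if_pos hb]
    change _ ≤ _ * guessPayoff F _ ((D.B.out rB b).map Prod.fst) rA b ρ
    refine le_of_eq ?_
    simp only [sayOut_say _ _ hb]
    rcases ho : D.B.out rB b with _ | ⟨j, v⟩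
    · exact Eq.trans (Finset.sum_eq_zero fun i _ => Finset.sum_eq_zero fun o _ => rfl)
        (mul_zero _).symm
    · simp only [Option.map_some]
      rw [guessPayoff_average]
      -- Summing over Bob's inputs is the same as summing over his announcements, for fixed `j`.
      have hsum (g : Bool → ℝ) : ∑ i, g i = ∑ d, g (xor d j) := by
        cases j <;> simp [add_comm]
      rw [hsum]
      refine Finset.sum_congr rfl fun d _ => Finset.sum_congr rfl fun o _ => ?_
      have hd : bobBit (xor d j) (some (j, v)) = d := by
        cases d <;> cases j <;> rfl
      rw [hd]
      rfl
  refine le_trans (Finset.sum_le_sum fun i _ => ?_) (key.trans ?_)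
  · rw [Protocol.learnA_eq]
    exact guessProb_mono E (by omega)
  · have := h.cheatA.2 F T
    rw [Fintype.card_bool, Nat.cast_ofNat]
    linarith

/-- An optimal cheater learns Bob's random choice `j`, announces something fixed, and guesses `d ⊕
j`. This is right exactly when the guess of `j` is, for either input. -/
theorem Duo.IsROT.transfer_cheatA_attained {a b : ℝ} (h : D.IsROT a b) :
    ∃ (E : Guesser C M) (T : ℕ), E.LossFree ∧
      ∀ i : Bool, (D.transfer X).learnA i (fun y => y.map fun _ => i) E T = a := by
  classical
  obtain ⟨E, T, hE, hT⟩ := h.cheatA.attained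
  refine ⟨E.say D.next (X.wr (false, false)) fun a => X.last a.tail, T + 2, hE.say _ _, fun i => ?_⟩
  rw [Protocol.learnA_eq, ← hT T le_rfl]
  refine (run_say_say (next := D.next) (A := E.toStrategy) (B := D.B.toStrategy)
    (msgA := fun _ _ _ => X.wr (false, false))
    (msgB := fun r _ b => X.wr (bobBit i (D.B.out r b), false))
    (f := fun rA rB τ ρ => guessPayoff (E.say D.next _ _) _
      ((((D.transfer X).bob i).out rB τ).map fun _ => i) rA τ ρ)
    (fun _ _ _ => guessPayoff_zero _ _ _) T (start _ _ D.m₀)).trans ?_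
  unfold guessProb
  rw [run_restrict _ _ _ _ _ proper_nil]
  conv_rhs => rw [run_restrict _ _ _ _ _ proper_nil]
  congr 1
  funext rA rB b ρ
  by_cases hb : cut D.next b = some ([], b)
  swap
  · rw [if_neg hb, if_neg hb]
  rw [if_pos hb, if_pos hb]
  have hout (s s' : Option C) : ((D.transfer X).bob i).out (none :: rB.map some)
      (s :: s' :: b) = (D.B.out rB b).map fun y => xor y.2 (pick (X.bits s) i) :=
    sayOut_say (fun r a b => (D.B.out r b).map fun y =>
      xor y.2 (pick (X.bits (a.headD none)) i)) rB hb s s'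
  rw [hout]
  beta_reduce
  rcases ho : D.B.out rB b with _ | ⟨j, v⟩
  · rfl
  · change (liftA E.toStrategy D.B.toStrategy ((E.say D.next _ _).eff _ _ i) * ρ).trace.re = _
    rw [Guesser.say_eff hb, List.tail_cons, X.last_wr]
    have hj : xor (bobBit i (some (j, v))) i = j := by
      cases i <;> cases j <;> rfl
    rw [hj]
    rfl

/-- For uniform inputs Alice's announcement is uniform and independent of her random pair, whatever
Bob has announced. So Bob can draw it himself; its XOR masks x_0 ⊕ x_1 with the XOR of the random
pair. -/
theorem Duo.IsROT.transfer_cheatB_le {a b : ℝ} (h : D.IsROT a b) (E : Guesser C M) (T : ℕ) :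
    ∑ x : Bool × Bool, (D.transfer X).learnB x (fun y => y.map fun _ => xor x.1 x.2) E T ≤
      4 * b := by
  classical
  let F := E.average (Bool × Bool) (fun _ b => b) (fun y s b => some (X.wr y) :: s :: b)
    fun y => xor y.1 y.2
  have key : ∑ x : Bool × Bool,
      (D.transfer X).learnB x (fun y => y.map fun _ => xor x.1 x.2) E (T + 2) ≤
      Fintype.card (Bool × Bool) * guessProb (swapNext D.next) D.A.toStrategy D.m₀
        (fun r τ => (D.A.out r τ).map fun x => xor x.1 x.2) F T := by
    simp only [Protocol.learnB_eq, swapNext_nextSay]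
    have h1 (x : Bool × Bool) := run_cheat_say' (next := swapNext D.next) (A := E.toStrategy)
      (B := D.A.toStrategy)
      (msg := fun r a b => X.wr (aliceBits x (X.last a) (D.A.out r b)))
      (f := fun rA rB τ ρ => guessPayoff E _
        ((((D.transfer X).alice x).out rB τ).map fun _ => xor x.1 x.2) rA τ ρ)
      (fun _ _ _ => guessPayoff_zero _ _ _) T (start _ _ D.m₀)
    refine (Finset.sum_congr rfl fun x _ => (guessProb_withOp
      (S := D.A.toStrategy.say (swapNext D.next) _) (Strategy.sayOp_swapNext _ _ _) _ _).trans
      (h1 x)).le.trans ?_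
    rw [← run_sum]
    unfold guessProb
    rw [← run_const_mul]
    rw [run_restrict _ _ _ _ _ proper_nil]
    conv_rhs => rw [run_restrict _ _ _ _ _ proper_nil]
    refine run_le (T := T) (fun rA rB b ρ hρ _ _ => ?_) T _ _ _ _ (start_posSemidef _) (by simp)
    by_cases hb : cut (swapNext D.next) b = some ([], b)
    swap
    · rw [if_neg hb, if_neg hb]
    rw [if_pos hb, if_pos hb]
    have hb' : cut D.next b = some ([], b) := cut_swapNext D.next ▸ hb
    change _ ≤ _ * guessPayoff F _ ((D.A.out rB b).map fun x => xor x.1 x.2) rA b ρ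
    refine le_of_eq ?_
    simp only [sayOut_say _ _ hb']
    rcases ho : D.A.out rB b with _ | z
    · exact Eq.trans (Finset.sum_eq_zero fun i _ => Finset.sum_eq_zero fun o _ => rfl)
        (mul_zero _).symm
    · rw [Option.map_some, Option.map_some, guessPayoff_average, Finset.sum_comm]
      conv_rhs => rw [Finset.sum_comm]
      refine Finset.sum_congr rfl fun o _ => ?_
      -- For fixed random pair and fixed announcement of Bob, the masking of the inputs is an
      -- involution; so the sum over inputs is a sum over Alice's announcements.
      refine Fintype.sum_bijective (fun x => aliceBits x (X.last [o.2]) (some z))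
        (Function.Involutive.bijective (aliceBits_involutive _ _)) _ _ fun x => ?_
      rw [aliceBits_xor]
      rfl
  refine le_trans (Finset.sum_le_sum fun i _ => ?_) (key.trans ?_)
  · rw [Protocol.learnB_eq]
    exact guessProb_mono E (by omega)
  · have := h.cheatB.2 F T
    rw [Fintype.card_prod, Fintype.card_bool]
    norm_num
    linarith

/-- Alice's announcement shows x_0 ⊕ x_1 masked by the XOR of her random pair, whichever bit Bob has
announced. An optimal guess of that XOR thus yields the same success for all inputs. -/
theorem Duo.IsROT.transfer_cheatB_attained {a b : ℝ} (h : D.IsROT a b) :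
    ∃ (E : Guesser C M) (T : ℕ), E.LossFree ∧ ∀ x : Bool × Bool,
      (D.transfer X).learnB x (fun y => y.map fun _ => xor x.1 x.2) E T = b := by
  classical
  obtain ⟨E, T, hE, hT⟩ := h.cheatB.attained
  refine ⟨E.say (swapNext D.next) (X.wr (false, false)) fun a =>
    xor (X.bits (a.headD none)).1 (X.bits (a.headD none)).2, T + 2, hE.say _ _, fun x => ?_⟩
  rw [Protocol.learnB_eq, swapNext_nextSay, ← hT T le_rfl]
  refine (guessProb_withOp (S := D.A.toStrategy.say (swapNext D.next) _)
    (Strategy.sayOp_swapNext _ _ _) _ _).trans ?_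
  refine (run_say_say' (next := swapNext D.next) (A := E.toStrategy) (B := D.A.toStrategy)
    (msgA := fun _ _ _ => X.wr (false, false))
    (msgB := fun r a b => X.wr (aliceBits x (X.last a) (D.A.out r b)))
    (f := fun rA rB τ ρ => guessPayoff (E.say (swapNext D.next) _ _) _
      ((((D.transfer X).alice x).out rB τ).map fun _ => xor x.1 x.2) rA τ ρ)
    (fun _ _ _ => guessPayoff_zero _ _ _) T (start _ _ D.m₀)).trans ?_
  unfold guessProb
  rw [run_restrict _ _ _ _ _ proper_nil]
  conv_rhs => rw [run_restrict _ _ _ _ _ proper_nil]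
  congr 1
  funext rA rB b ρ
  by_cases hb : cut (swapNext D.next) b = some ([], b)
  swap
  · rw [if_neg hb, if_neg hb]
  rw [if_pos hb, if_pos hb]
  have hout (s s' : Option C) : ((D.transfer X).alice x).out
      (none :: rB.map some) (s :: s' :: b) = (D.A.out rB b).map fun _ => () :=
    sayOut_say (fun r a b => (D.A.out r b).map fun _ => ()) rB (cut_swapNext D.next ▸ hb) s s'
  rw [hout]
  beta_reduce
  rcases ho : D.A.out rB b with _ | z
  · rfl
  · change (liftA E.toStrategy D.A.toStrategy
      ((E.say (swapNext D.next) _ _).eff _ _ (xor x.1 x.2)) * ρ).trace.re = _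
    rw [Guesser.say_eff hb, List.headD_cons, X.last_wr, X.bits_wr]
    have hz : xor (xor (aliceBits x false (some z)).1 (aliceBits x false (some z)).2)
        (xor x.1 x.2) = xor z.1 z.2 := by
      rw [← aliceBits_xor x z false, ← Bool.xor_assoc, Bool.xor_self, Bool.false_xor]
    rw [hz]
    rfl

/-- Oblivious transfer from random oblivious transfer, with the same cheating probabilities. -/
theorem Duo.IsROT.transfer {a b : ℝ} (h : D.IsROT a b) : IsLTOT (D.transfer X) a b where
  correct := h.transfer_correct
  hidingA := h.transfer_hidingA
  hidingB loss T i x x' hx := h.transfer_hidingB loss T i x x' hx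
  cheatA := by
    simpa using (isLTCheatingProb_of_uniform (fun E T => by simpa using h.transfer_cheatA_le E T)
      h.transfer_cheatA_attained).1
  cheatA_worst := by
    simpa using (isLTCheatingProb_of_uniform (fun E T => by simpa using h.transfer_cheatA_le E T)
      h.transfer_cheatA_attained).2
  cheatB := by
    simpa using (isLTCheatingProb_of_uniform (fun E T => by simpa using h.transfer_cheatB_le E T)
      h.transfer_cheatB_attained).1
  cheatB_worst := by
    simpa using (isLTCheatingProb_of_uniform (fun E T => by simpa using h.transfer_cheatB_le E T)
      h.transfer_cheatB_attained).2

end TransferCheat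

/-! ### Common alphabets and the final construction -/

/-- A player who never exploits losses needs public symbols other than the declaration of a loss. -/
theorem Strategy.LossFree.nonempty {C M : Type} [Fintype C] [Fintype M] [DecidableEq M]
    {S : Strategy C M} (hS : S.LossFree) (m₀ : M) : Nonempty C := by
  by_contra hC
  rw [not_nonempty_iff] at hC
  have hQ : Nonempty S.Q := by
    by_contra hQ
    rw [not_nonempty_iff] at hQ
    have := S.init_trace
    simp [Matrix.trace] at this
  obtain ⟨q⟩ := hQ
  have h := congrFun (congrFun (S.op_complete [] []) (q, some m₀)) (q, some m₀)
  rw [Matrix.one_apply_eq, Matrix.sum_apply, Finset.sum_eq_zero fun o _ => ?_] at h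
  · exact zero_ne_one h
  · rw [Matrix.mul_apply]
    refine Finset.sum_eq_zero fun i _ => ?_
    rw [(hS [] [] o q i.1 m₀).1 (by rcases o.2 with _ | c; exacts [rfl, hC.elim c]) i.2, mul_zero]

/-- Oblivious transfer from weak coin flipping and random oblivious transfer with common alphabets. -/
theorem exists_isLTOT {C M : Type} [Fintype C] [Fintype M] [DecidableEq M] (X : BitCode C)
    {W : Duo C M Bool Bool} {R : Duo C M (Option (Bool × Bool)) (Option (Bool × Bool))}
    {aW bW aR bR : ℝ} (hW : W.IsWCF aW bW) (hR : R.IsROT aR bR) : ∃ O : OTProtocol,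
      IsLTOT O (aW * |aR - bR| + min aR bR) (bW * |aR - bR| + min aR bR) := by
  -- Up to reversal, the given random OT favours a dishonest Alice.
  obtain ⟨R₀, h₀⟩ : ∃ R₀ : Duo C M (Option (Bool × Bool)) (Option (Bool × Bool)),
      R₀.IsROT (max aR bR) (min aR bR) := by
    rcases le_total aR bR with h | h
    · rw [max_eq_right h, min_eq_left h]
      exact ⟨_, hR.reverse⟩
    · rw [max_eq_left h, min_eq_right h]
      exact ⟨_, hR⟩
  -- Outcome 0, Alice's aim, selects the orientation that favours her; outcome 1, Bob's aim, the
  -- reversed one.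
  let D : Bool → Duo C M (Option (Bool × Bool)) (Option (Bool × Bool)) := fun c =>
    if c then R₀.reverse else R₀
  have hD : ∀ c, (D c).IsROT (if c then min aR bR else max aR bR)
      (if c then max aR bR else min aR bR) := by
    rintro (_ | _)
    exacts [h₀, h₀.reverse]
  have h := ((hW.selector X).switch hD (by simp) (by simp)).transfer (X := X)
  refine ⟨((Duo.selector X W).switch D).transfer X, ?_⟩
  convert h using 1
  all_goals
    simp only [if_true, Bool.false_eq_true, if_false, max_sub_min_eq_abs']
    ring

/-- Common alphabets for two protocols without inputs. -/
theorem exists_isLTOT_of_isLT {W : WCFProtocol} {R : ROTProtocol} {aW bW aR bR : ℝ}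
    (hW : IsLTWCF W aW bW) (hR : IsLTROT R aR bR) : ∃ O : OTProtocol,
      IsLTOT O (aW * |aR - bR| + min aR bR) (bW * |aR - bR| + min aR bR) := by
  obtain ⟨cW⟩ := (W.alice ()).honest.nonempty W.m₀
  obtain ⟨cR⟩ := (R.alice ()).honest.nonempty R.m₀
  -- The common symbols are triples: a symbol of each protocol, and a pair of bits for the
  -- announcements. The fixed symbols `cW`, `cR` fill the components not in use. A common message is
  -- a pair of messages, one component serving as the label.
  let XW : Extension W.C W.M (W.C × R.C × Bool × Bool) (W.M × R.M) := {
    F := R.M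
    f₀ := R.m₀
    fib := Equiv.refl _
    dec := Prod.fst
    enc := fun c => (c, cR, false, false)
    dec_enc := fun _ => rfl }
  let XR : Extension R.C R.M (W.C × R.C × Bool × Bool) (W.M × R.M) := {
    F := W.M
    f₀ := W.m₀
    fib := Equiv.prodComm _ _
    dec := fun c => c.2.1
    enc := fun c => (cW, c, false, false)
    dec_enc := fun _ => rfl }
  exact exists_isLTOT ⟨fun y => (cW, cR, y), fun c => c.2.2, fun _ => rfl⟩ (hW.isWCF.lift XW)
    (hR.isROT.lift XR)

end QProto

end

theorem theorem1 (W : QProto.WCFProtocol) (R : QProto.ROTProtocol) (aW bW aR bR : ℝ)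
    (hW : QProto.IsLTWCF W aW bW) (hR : QProto.IsLTROT R aR bR) :
    ∃ (O : QProto.OTProtocol) (aO bO : ℝ),
      QProto.IsLTOT O aO bO ∧
      aO = aW * |aR - bR| + min aR bR ∧
      bO = bW * |aR - bR| + min aR bR ∧
      QProto.bias aO bO ≤ |aR - bR| + min aR bR - 1 / 2 ∧
      |aR - bR| + min aR bR - 1 / 2 = QProto.bias aR bR ∧
      (QProto.bias aW bW < 1 / 2 → aR ≠ bR → QProto.bias aO bO < QProto.bias aR bR) ∧
      (aW = bW → aO = bO) := by
  obtain ⟨O, hO⟩ := QProto.exists_isLTOT_of_isLT hW hR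
  -- The comparison of biases rests on `aW, bW ≤ 1`; a coin-flipping bias below 1/2 makes both
  -- strictly less than 1.
  have ha := hW.isWCF.cheatA.le_one
  have hb := hW.isWCF.cheatB.le_one
  have hR' : |aR - bR| + min aR bR = max aR bR := by
    rw [← max_sub_min_eq_abs']
    ring
  refine ⟨O, _, _, hO, rfl, rfl, ?_, ?_, fun hlt hne => ?_, fun h => by rw [h]⟩
  · unfold QProto.bias
    have := abs_nonneg (aR - bR)
    have h : max (aW * |aR - bR| + min aR bR) (bW * |aR - bR| + min aR bR) ≤
      |aR - bR| + min aR bR := max_le (by nlinarith) (by nlinarith)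
    linarith
  · rw [hR', QProto.bias]
  · unfold QProto.bias at *
    have hpos : 0 < |aR - bR| := abs_pos.mpr (sub_ne_zero.mpr hne)
    have h1 : aW < 1 := by linarith [le_max_left aW bW]
    have h2 : bW < 1 := by linarith [le_max_right aW bW]
    have h : max (aW * |aR - bR| + min aR bR) (bW * |aR - bR| + min aR bR) <
      |aR - bR| + min aR bR := max_lt (by nlinarith) (by nlinarith)
    linarith
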